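/- Let $d\in\{2,3\}$, $N\in\mathbb N$, let $B_s$ be the ball of radius $s$ about $0$ in $\mathbb R^d$. **Coated structure.** Let $2=r_1>r_2>\dots>r_{L+1}=1$, $\sigma_1,\dots,\sigma_L>0$, and let $\sigma$ be the radial conductivity equal to $1$ for $|x|\ge 2$, to $\sigma_j$ for $r_{j+1}\le |x|<r_j$, with an insulating core $B_1$. Assume that $\sigma$ is GPT-vanishing of order $N$: whenever $H$ is a harmonic polynomial of degree at most $N$ and $u$ solves $\nabla\cdot\sigma\nabla u=0$ in $\mathbb R^d\setminus\overline{B_1}$, $\partial u/\partial n=0$ on $\partial B_1$, $u-H=O(|x|^{-1})$ at infinity, then the multipole expansion of $u-H$ contains no multipole of order at most $N$, i.e. $u-H=O(|x|^{-(N+d-1)})$. Put $\kappa=\max\{\max_j\sigma_j,(\min_j\sigma_j)^{-1}\}$. **Cloak.** For $\rho\in(0,1/2)$ let $\tau=\rho^{d/(d+2N)}$ and assume $2\tau\le 3/4$. Let $\alpha(\tau)=\ln\frac32/(\ln\frac34-\ln\tau)$ and, for $\frac12\le s<\frac34$, $h(s)=\tau(2s)^{1/\alpha(\tau)}$, $$\sigma_1^*(s)=\sigma\big(h(s)/\tau\big)\Big(\frac{h(s)}{s}\Big)^{d-2}\alpha(\tau),\qquad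 \sigma_2^*(s)=\sigma\big(h(s)/\tau\big)\Big(\frac{h(s)}{s}\Big)^{d-2}\frac1{\alpha(\tau)};$$ these are the radial and tangential eigenvalues of the push-forward of $x\mapsto\sigma(x/\tau)$ by the radial map that blows $B_\tau$ up to $B_{1/2}$ and is the identity outside $B_{3/4}$. **Laminate.** Let $0<\varepsilon\le 1/8$, $s_k=\frac12+k\varepsilon$, $I_k=[s_k,s_{k+1})$. For each $k\ge0$ with $s_k<3/4$ let $0<\alpha_k<\gamma_k$ be two materials and $l_0,l_1\ge0$, $l_0+l_1\le 1$ (depending on $k$) be volume fractions with $$\alpha_kl_0+l_1+\gamma_k(1-l_0-l_1)=\sigma_2^*(s_k),\qquad \frac{l_0}{\alpha_k}+l_1+\frac{1-l_0-l_1}{\gamma_k}=\frac1{\sigma_1^*(s_k)}.$$ Let $a_k$ be the $1$-periodic function equal to $\alpha_k$ on $[0,l_0)$, to $1$ on $[l_0,l_0+l_1)$ and to $\gamma_k$ on $[l_0+l_1,1)$; for $s_k\ge 3/4$ let $a_k=1$. Let $A_\varepsilon(y)=a_k(|y|/\varepsilon)$ for $|y|\in I_k$, $\frac12\le|y|\le1$.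 (This includes one low material $\alpha_k=\alpha=s(\kappa|\ln\rho|)^{-1}\tau^{d-2}$ with $0<s<1$ and high materials $\gamma_k=t_k\kappa|\ln\rho|$ with $t_k>1$, whenever $\alpha<\gamma_k$ and such volume fractions exist.) **Claim.** For every $K>0$ there is a constant $C>0$, depending only on $d,N,\sigma,K$, such that for all $\rho$, $\varepsilon$, $A_\varepsilon$ as above with $$\varepsilon\le K\kappa^{-3}\rho^2|\ln\rho|^{-3}\ \ (d=2),\qquad \varepsilon\le K\kappa^{-3}\rho^{3+\frac{3}{2N+3}}|\ln\rho|^{-1}\ \ (d=3),$$ the Dirichlet-to-Neumann maps $\Lambda_{B_1,B_{1/2}}[A_\varepsilon]$ and $\Lambda_{B_1}[1]$ are well-defined bounded operators from $H^{1/2}(\partial B_1)$ to $H^{-1/2}(\partial B_1)$ and $$\big\|\Lambda_{B_1,B_{1/2}}[A_\varepsilon]-\Lambda_{B_1}[1]\big\|_{\mathcal L(H^{1/2}(\partial B_1),H^{-1/2}(\partial B_1))}\le C\rho^d .$$ Here $\Lambda_{B_1,B_{1/2}}[A_\varepsilon]\varphi=A_\varepsilon\,\partial u/\partial\nu|_{\partial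 B_1}$, where $u\in H^1(B_1\setminus\overline{B_{1/2}})$ is the weak solution of $\nabla\cdot A_\varepsilon\nabla u=0$ in $B_1\setminus\overline{B_{1/2}}$, $A_\varepsilon\,\partial u/\partial\nu=0$ on $\partial B_{1/2}$, $u=\varphi$ on $\partial B_1$; $\Lambda_{B_1}[1]$ is the Dirichlet-to-Neumann map of the Laplacian on $B_1$; and $\|\varphi\|_{H^{1/2}(\partial B_1)}^2=\|\varphi\|_{L^2(\partial B_1)}^2+\inf\{\|\nabla v\|_{L^2(B_1)}^2: v\in H^1(B_1),\ v=\varphi\text{ on }\partial B_1\}$, with the dual norm on $H^{-1/2}(\partial B_1)$. -/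

import Mathlib

open MeasureTheory Metric Set
open scoped ENNReal ContDiff InnerProductSpace

noncomputable section

namespace Cloak

/-! ### Sobolev functions and traces -/

/-- Euclidean space `ℝ^d`. -/
abbrev Sp (d : ℕ) : Type := EuclideanSpace ℝ (Fin d)

/-- The unit ball `B_1`. -/
def unitBall (d : ℕ) : Set (Sp d) := ball 0 1

/-- The shell `B_1 \ closure B_{1/2}`. -/
def shell (d : ℕ) : Set (Sp d) := {x | 1 / 2 < ‖x‖ ∧ ‖x‖ < 1}

/-- Surface measure on the unit sphere `∂B_1`. -/
def surf (d : ℕ) : Measure (sphere (0 : Sp d) 1) := (volume : Measure (Sp d)).toSphere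

instance instIsFiniteMeasureSurf (d : ℕ) : IsFiniteMeasure (surf d) := by
  unfold surf; infer_instance

/-- `L²(D)`. -/
abbrev L2 {d : ℕ} (D : Set (Sp d)) : Type := Lp ℝ 2 ((volume : Measure (Sp d)).restrict D)

/-- `L²(D; ℝ^d)`. -/
abbrev L2Vec {d : ℕ} (D : Set (Sp d)) : Type :=
  Lp (Sp d) 2 ((volume : Measure (Sp d)).restrict D)

/-- `L²(∂B_1)`. -/
abbrev L2Sphere (d : ℕ) : Type := Lp ℝ 2 (surf d)

/-- For `D = B_1` or `D` the shell: `u ∈ H¹(D)`, its weak gradient is `G`, and its trace on the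
outer boundary `∂B_1` is `φ`. This is Green's formula against all smooth `ψ` which vanish near the
rest of the boundary of `D` (if any); the unit normal at `θ ∈ ∂B_1` is `θ`. -/
def IsH1 {d : ℕ} (D : Set (Sp d)) (u : L2 D) (G : L2Vec D) (φ : L2Sphere d) : Prop :=
  ∀ ψ : Sp d → ℝ, ContDiff ℝ ∞ ψ → HasCompactSupport ψ → tsupport ψ ⊆ D ∪ (unitBall d)ᶜ →
    ∀ i : Fin d,
      (∫ x in D, u x * fderiv ℝ ψ x (EuclideanSpace.single i 1)) + (∫ x in D, G x i * ψ x)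
        = ∫ θ, φ θ * (ψ θ * (θ : Sp d) i) ∂(surf d)

/-- The integrals in Green's formula converge. -/
theorem integrable_aux {d : ℕ} {D : Set (Sp d)} (u : L2 D) {f : Sp d → ℝ} (hf : Continuous f)
    (hc : HasCompactSupport f) :
    Integrable (fun x => u x * f x) ((volume : Measure (Sp d)).restrict D) :=
  (Lp.memLp u).integrable_mul (q := 2) (hf.memLp_of_hasCompactSupport hc)

theorem integrable_aux_vec {d : ℕ} {D : Set (Sp d)} (G : L2Vec D) (i : Fin d) {f : Sp d → ℝ}
    (hf : Continuous f) (hc : HasCompactSupport f) :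
    Integrable (fun x => G x i * f x) ((volume : Measure (Sp d)).restrict D) := by
  have h : MemLp (fun x => G x i) 2 ((volume : Measure (Sp d)).restrict D) :=
    (EuclideanSpace.proj (𝕜 := ℝ) i).comp_memLp' (Lp.memLp G)
  exact h.integrable_mul (q := 2) (hf.memLp_of_hasCompactSupport hc)

theorem integrable_aux_sphere {d : ℕ} (φ : L2Sphere d) {f : sphere (0 : Sp d) 1 → ℝ}
    (hf : Continuous f) : Integrable (fun θ => φ θ * f θ) (surf d) :=
  (Lp.memLp φ).integrable_mul (q := 2)
    (hf.memLp_of_hasCompactSupport (HasCompactSupport.of_compactSpace f))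

theorem continuous_aux {d : ℕ} {ψ : Sp d → ℝ} (hψ : ContDiff ℝ ∞ ψ) (i : Fin d) :
    Continuous fun x => fderiv ℝ ψ x (EuclideanSpace.single i 1) :=
  (hψ.continuous_fderiv (by simp)).clm_apply continuous_const

theorem compactSupport_aux {d : ℕ} {ψ : Sp d → ℝ} (hc : HasCompactSupport ψ) (i : Fin d) :
    HasCompactSupport fun x => fderiv ℝ ψ x (EuclideanSpace.single i 1) :=
  hc.fderiv_apply (𝕜 := ℝ) _

theorem continuous_aux_sphere {d : ℕ} {ψ : Sp d → ℝ} (hψ : ContDiff ℝ ∞ ψ) (i : Fin d) :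
    Continuous fun θ : sphere (0 : Sp d) 1 => ψ θ * (θ : Sp d) i := by
  have := hψ.continuous
  fun_prop

theorem IsH1.add {d : ℕ} {D : Set (Sp d)} {u v : L2 D} {G F : L2Vec D} {φ χ : L2Sphere d}
    (hu : IsH1 D u G φ) (hv : IsH1 D v F χ) : IsH1 D (u + v) (G + F) (φ + χ) := by
  intro ψ hψ hc hs i
  have h1 : (∫ x in D, (u + v) x * fderiv ℝ ψ x (EuclideanSpace.single i 1)) =
      (∫ x in D, u x * fderiv ℝ ψ x (EuclideanSpace.single i 1)) +
        ∫ x in D, v x * fderiv ℝ ψ x (EuclideanSpace.single i 1) := by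
    rw [← integral_add (integrable_aux u (continuous_aux hψ i) (compactSupport_aux hc i))
      (integrable_aux v (continuous_aux hψ i) (compactSupport_aux hc i))]
    refine integral_congr_ae ?_
    filter_upwards [Lp.coeFn_add u v] with x hx
    rw [hx, Pi.add_apply, add_mul]
  have h2 : (∫ x in D, (G + F) x i * ψ x) =
      (∫ x in D, G x i * ψ x) + ∫ x in D, F x i * ψ x := by
    rw [← integral_add (integrable_aux_vec G i hψ.continuous hc)
      (integrable_aux_vec F i hψ.continuous hc)]
    refine integral_congr_ae ?_
    filter_upwards [Lp.coeFn_add G F] with x hx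
    rw [hx, Pi.add_apply, PiLp.add_apply, add_mul]
  have h3 : (∫ θ, (φ + χ) θ * (ψ θ * (θ : Sp d) i) ∂(surf d)) =
      (∫ θ, φ θ * (ψ θ * (θ : Sp d) i) ∂(surf d)) +
        ∫ θ, χ θ * (ψ θ * (θ : Sp d) i) ∂(surf d) := by
    rw [← integral_add (integrable_aux_sphere φ (continuous_aux_sphere hψ i))
      (integrable_aux_sphere χ (continuous_aux_sphere hψ i))]
    refine integral_congr_ae ?_
    filter_upwards [Lp.coeFn_add φ χ] with x hx
    rw [hx, Pi.add_apply, add_mul]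
  rw [h1, h2, h3, ← hu ψ hψ hc hs i, ← hv ψ hψ hc hs i]
  ring

theorem IsH1.smul {d : ℕ} {D : Set (Sp d)} {u : L2 D} {G : L2Vec D} {φ : L2Sphere d}
    (c : ℝ) (hu : IsH1 D u G φ) : IsH1 D (c • u) (c • G) (c • φ) := by
  intro ψ hψ hc hs i
  have h1 : (∫ x in D, (c • u) x * fderiv ℝ ψ x (EuclideanSpace.single i 1)) =
      c * ∫ x in D, u x * fderiv ℝ ψ x (EuclideanSpace.single i 1) := by
    rw [← integral_const_mul]
    refine integral_congr_ae ?_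
    filter_upwards [Lp.coeFn_smul c u] with x hx
    rw [hx, Pi.smul_apply, smul_eq_mul, mul_assoc]
  have h2 : (∫ x in D, (c • G) x i * ψ x) = c * ∫ x in D, G x i * ψ x := by
    rw [← integral_const_mul]
    refine integral_congr_ae ?_
    filter_upwards [Lp.coeFn_smul c G] with x hx
    rw [hx, Pi.smul_apply, PiLp.smul_apply, smul_eq_mul, mul_assoc]
  have h3 : (∫ θ, (c • φ) θ * (ψ θ * (θ : Sp d) i) ∂(surf d)) =
      c * ∫ θ, φ θ * (ψ θ * (θ : Sp d) i) ∂(surf d) := by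
    rw [← integral_const_mul]
    refine integral_congr_ae ?_
    filter_upwards [Lp.coeFn_smul c φ] with x hx
    rw [hx, Pi.smul_apply, smul_eq_mul, mul_assoc]
  rw [h1, h2, h3, ← hu ψ hψ hc hs i]
  ring

theorem IsH1.zero {d : ℕ} {D : Set (Sp d)} : IsH1 D (0 : L2 D) 0 0 := by
  intro ψ hψ hc hs i
  have h1 : (∫ x in D, (0 : L2 D) x * fderiv ℝ ψ x (EuclideanSpace.single i 1)) = 0 := by
    refine integral_eq_zero_of_ae ?_
    filter_upwards [Lp.coeFn_zero ℝ 2 ((volume : Measure (Sp d)).restrict D)] with x hx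
    rw [hx]; simp
  have h2 : (∫ x in D, (0 : L2Vec D) x i * ψ x) = 0 := by
    refine integral_eq_zero_of_ae ?_
    filter_upwards [Lp.coeFn_zero (Sp d) 2 ((volume : Measure (Sp d)).restrict D)] with x hx
    rw [hx]; simp
  have h3 : (∫ θ, (0 : L2Sphere d) θ * (ψ θ * (θ : Sp d) i) ∂(surf d)) = 0 := by
    refine integral_eq_zero_of_ae ?_
    filter_upwards [Lp.coeFn_zero ℝ 2 (surf d)] with x hx
    rw [hx]; simp
  rw [h1, h2, h3, add_zero]

/-! ### The spaces `H^{1/2}(∂B_1)` and `H^{-1/2}(∂B_1)` -/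

/-- Pairs (trace of `v`, gradient of `v`) for `v ∈ H¹(B_1)`, with the Hilbert norm
`(‖v‖²_{L²(∂B_1)} + ‖∇v‖²_{L²(B_1)})^{1/2}`. -/
def traceGrad (d : ℕ) : Submodule ℝ (WithLp 2 (L2Sphere d × L2Vec (unitBall d))) where
  carrier := {p | ∃ u : L2 (unitBall d), IsH1 (unitBall d) u p.snd p.fst}
  add_mem' := by
    rintro p q ⟨u, hu⟩ ⟨v, hv⟩
    exact ⟨u + v, hu.add hv⟩
  zero_mem' := ⟨0, IsH1.zero⟩
  smul_mem' := by
    rintro c p ⟨u, hu⟩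
    exact ⟨c • u, hu.smul c⟩

/-- The trace, as a linear map. -/
def traceMap (d : ℕ) : traceGrad d →ₗ[ℝ] L2Sphere d :=
  (WithLp.fstₗ 2 ℝ (L2Sphere d) (L2Vec (unitBall d))).comp (traceGrad d).subtype

/-- `H^{1/2}(∂B_1)`: the traces `φ` of functions in `H¹(B_1)`, with the quotient norm
`‖φ‖² = ‖φ‖²_{L²(∂B_1)} + inf {‖∇v‖²_{L²(B_1)} : v ∈ H¹(B_1), v = φ on ∂B_1}`. -/
def HHalf (d : ℕ) : Type := traceGrad d ⧸ LinearMap.ker (traceMap d)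

instance instIsClosedKerTrace (d : ℕ) :
    IsClosed (LinearMap.ker (traceMap d) : Set (traceGrad d)) := by
  have h : Continuous (traceMap d) :=
    (WithLp.fstL 2 ℝ (L2Sphere d) (L2Vec (unitBall d))).continuous.comp continuous_subtype_val
  exact isClosed_singleton.preimage h

instance instNormedAddCommGroupHHalf (d : ℕ) : NormedAddCommGroup (HHalf d) :=
  Submodule.Quotient.normedAddCommGroup (LinearMap.ker (traceMap d))

instance instNormedSpaceHHalf (d : ℕ) : NormedSpace ℝ (HHalf d) :=
  Submodule.Quotient.normedSpace (LinearMap.ker (traceMap d)) ℝ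

/-- The embedding of `H^{1/2}(∂B_1)` into `L²(∂B_1)`. -/
def HHalf.toL2 (d : ℕ) : HHalf d →ₗ[ℝ] L2Sphere d :=
  (LinearMap.ker (traceMap d)).liftQ (traceMap d) le_rfl

/-- `H^{-1/2}(∂B_1)`, the dual of `H^{1/2}(∂B_1)` with the dual norm. -/
abbrev HMinusHalf (d : ℕ) : Type := StrongDual ℝ (HHalf d)

/-! ### Dirichlet-to-Neumann maps -/

/-- `u ∈ H¹(D)` (with gradient `G`) is the weak solution of `∇·A∇u = 0` in `D`, `u = φ` on `∂B_1`,
and `A ∂u/∂ν = 0` on the rest of the boundary of `D` (if any): test functions vanish on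
`∂B_1` only. -/
def IsWeakSolution {d : ℕ} (D : Set (Sp d)) (A : Sp d → ℝ) (φ : L2Sphere d)
    (u : L2 D) (G : L2Vec D) : Prop :=
  IsH1 D u G φ ∧
    ∀ (v : L2 D) (F : L2Vec D), IsH1 D v F 0 → ∫ x in D, A x * ⟪G x, F x⟫_ℝ = 0

/-- `Λ : H^{1/2}(∂B_1) → H^{-1/2}(∂B_1)` is the Dirichlet-to-Neumann map
`φ ↦ A ∂u/∂ν` on `∂B_1` of the problem above: the problem is solvable for every `φ`, and the
conormal derivative of the solution is the functional `v|_{∂B_1} ↦ ∫_D A ∇u·∇v`. -/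
def IsDtN {d : ℕ} (D : Set (Sp d)) (A : Sp d → ℝ) (Λ : HHalf d →L[ℝ] HMinusHalf d) : Prop :=
  ∀ φ : HHalf d,
    (∃ (u : L2 D) (G : L2Vec D), IsWeakSolution D A (HHalf.toL2 d φ) u G) ∧
    ∀ (u : L2 D) (G : L2Vec D), IsWeakSolution D A (HHalf.toL2 d φ) u G →
      ∀ (η : HHalf d) (v : L2 D) (F : L2Vec D), IsH1 D v F (HHalf.toL2 d η) →
        Λ φ η = ∫ x in D, A x * ⟪G x, F x⟫_ℝ

/-! ### Multi-coated balls and the GPT-vanishing property -/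

/-- A radial multi-coated structure with insulating core `B_1` and coating layers filling
`B_2 \ B_1`: radii `2 = r 0 > r 1 > ⋯ > r L = 1`; layer `i` lies between the radii `r (i+1)` and
`r i` and has the constant conductivity `cond i > 0`. The background conductivity is `1`. -/
structure Coating where
  L : ℕ
  r : Fin (L + 1) → ℝ
  cond : Fin L → ℝ
  strictAnti : StrictAnti r
  outer : r 0 = 2
  inner : r (Fin.last L) = 1
  cond_pos : ∀ i, 0 < cond i

namespace Coating

variable (σ : Coating)

/-- The conductivity just outside layer `i`. -/
def condAbove (i : Fin σ.L) : ℝ := (Fin.cons 1 σ.cond : Fin (σ.L + 1) → ℝ) i.castSucc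

/-- The conductivity at distance `t` from the origin. At an interface the value of the outer side
is taken. -/
def profile (t : ℝ) : ℝ :=
  if 2 ≤ t then 1
  else ∑ i : Fin σ.L, if σ.r i.succ ≤ t ∧ t < σ.r i.castSucc then σ.cond i else 0

/-- The contrast `κ = max {max σ, (min σ)⁻¹}`, over the coating layers. -/
def kappa : ℝ := max (⨆ i, σ.cond i) (⨅ i, σ.cond i)⁻¹

/-- `u` solves `∇·σ∇u = 0` in `ℝ^d` outside the insulating core, with
`u - H = O(|x|⁻¹)` at infinity: it is continuous, harmonic off the interfaces, the flux is
continuous across the interfaces, and it vanishes on the boundary of the core. -/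
structure Solves (d : ℕ) (H u : Sp d → ℝ) : Prop where
  cont : ContinuousOn u {x | 1 ≤ ‖x‖}
  harm_background : InnerProductSpace.HarmonicOnNhd u {x | 2 < ‖x‖}
  harm_layer : ∀ i : Fin σ.L,
    InnerProductSpace.HarmonicOnNhd u {x | σ.r i.succ < ‖x‖ ∧ ‖x‖ < σ.r i.castSucc}
  transmission : ∀ (i : Fin σ.L) (θ : Sp d), ‖θ‖ = 1 → ∃ q₁ q₂ : ℝ,
    HasDerivWithinAt (fun t : ℝ => u (t • θ)) q₁ (Ici (σ.r i.castSucc)) (σ.r i.castSucc) ∧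
    HasDerivWithinAt (fun t : ℝ => u (t • θ)) q₂ (Iic (σ.r i.castSucc)) (σ.r i.castSucc) ∧
    σ.condAbove i * q₁ = σ.cond i * q₂
  insulated : ∀ θ : Sp d, ‖θ‖ = 1 → HasDerivWithinAt (fun t : ℝ => u (t • θ)) 0 (Ici 1) 1
  far : (fun x => u x - H x) =O[Bornology.cobounded (Sp d)] fun x => ‖x‖⁻¹

/-- The GPT-vanishing property of order `N`: the contracted generalized polarization tensors
`M_{mk}`, `m, k ≤ N`, vanish. These are the coefficients of the multipoles of order `m` (decaying
like `|x|^{-(m+d-2)}`) in the far field `u - H` caused by background fields `H` that are harmonic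
polynomials of degree `k`; so for `H` of degree at most `N` no multipole of order at most `N`
is left in the far field. -/
def GPTVanishing (d N : ℕ) : Prop :=
  ∀ P : MvPolynomial (Fin d) ℝ, P.totalDegree ≤ N →
    InnerProductSpace.HarmonicOnNhd (fun x : Sp d => MvPolynomial.eval (fun i => x i) P) univ →
    ∀ u : Sp d → ℝ, σ.Solves d (fun x => MvPolynomial.eval (fun i => x i) P) u →
      (fun x => u x - MvPolynomial.eval (fun i => x i) P)
        =O[Bornology.cobounded (Sp d)] fun x => (‖x‖ ^ (N + (d - 1)))⁻¹

end Coating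

/-! ### The blow-up transformation and the anisotropic cloak -/

/-- The radius `ρ^{d/(d+2N)}` of the inclusion before the blow-up. -/
def rhoEC (d N : ℕ) (ρ : ℝ) : ℝ := ρ ^ ((d : ℝ) / (d + 2 * N))

/-- The exponent `α(τ)` in `g(t) = (t/τ)^{α(τ)} / 2`, `τ ≤ t ≤ 3/4`. -/
def blowExp (τ : ℝ) : ℝ := Real.log (3 / 2) / (Real.log (3 / 4) - Real.log τ)

/-- `g⁻¹`, where `F(x) = g(|x|) x/|x|` blows `B_τ` up to `B_{1/2}`. -/
def gInv (τ s : ℝ) : ℝ :=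
  if s ≤ 1 / 2 then 2 * s * τ else if s ≤ 3 / 4 then τ * (2 * s) ^ (1 / blowExp τ) else s

/-- `λ(s) = s (g⁻¹)'(s) / g⁻¹(s)` (one-sided derivative from the right). -/
def lam (τ s : ℝ) : ℝ := if s < 1 / 2 then 1 else if s < 3 / 4 then 1 / blowExp τ else 1

/-- Radial eigenvalue `σ₁*` of the push-forward by `F` of the conductivity `x ↦ σ(x/τ)`. -/
def sigmaRad (d : ℕ) (σ : Coating) (τ s : ℝ) : ℝ :=
  σ.profile (gInv τ s / τ) * ((gInv τ s / s) ^ (d - 2) * (1 / lam τ s))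

/-- Tangential eigenvalue `σ₂*` of the same push-forward. -/
def sigmaTan (d : ℕ) (σ : Coating) (τ s : ℝ) : ℝ :=
  σ.profile (gInv τ s / τ) * ((gInv τ s / s) ^ (d - 2) * lam τ s)

/-! ### Laminates -/

/-- The left end point `s_k` of the cell `I_k = [1/2 + kε, 1/2 + (k+1)ε)`. -/
def node (ε : ℝ) (k : ℕ) : ℝ := 1 / 2 + k * ε

/-- Materials and volume fractions of a laminate: in cell `k` the material `low k` has the volume
fraction `l₀ k`, the material `1` has `l₁ k`, and `high k` has the remaining one. -/
structure Laminate where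
  low : ℕ → ℝ
  high : ℕ → ℝ
  l₀ : ℕ → ℝ
  l₁ : ℕ → ℝ

namespace Laminate

variable (M : Laminate)

/-- The `1`-periodic function `a_k`. -/
def cell (k : ℕ) (t : ℝ) : ℝ :=
  if Int.fract t < M.l₀ k then M.low k
  else if Int.fract t < M.l₀ k + M.l₁ k then 1
  else M.high k

/-- The laminate `A_ε(y) = a_k(|y|/ε)` for `|y| ∈ I_k`; cells within `[3/4, 1]` hold the
background material `1`. -/
def conductivity {d : ℕ} (ε : ℝ) (y : Sp d) : ℝ :=
  if node ε ⌊(‖y‖ - 1 / 2) / ε⌋₊ < 3 / 4 then M.cell ⌊(‖y‖ - 1 / 2) / ε⌋₊ (‖y‖ / ε) else 1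

/-- In each laminated cell the materials are positive, the volume fractions are nonnegative, the
arithmetic mean of the laminate is `σ₂*(s_k)` and its harmonic mean is `σ₁*(s_k)`. -/
def Realizes (d : ℕ) (σ : Coating) (τ ε : ℝ) : Prop :=
  ∀ k : ℕ, node ε k < 3 / 4 →
    0 < M.low k ∧ M.low k < M.high k ∧
    0 ≤ M.l₀ k ∧ 0 ≤ M.l₁ k ∧ M.l₀ k + M.l₁ k ≤ 1 ∧
    M.low k * M.l₀ k + M.l₁ k + M.high k * (1 - M.l₀ k - M.l₁ k)
      = sigmaTan d σ τ (node ε k) ∧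
    1 / M.low k * M.l₀ k + M.l₁ k + 1 / M.high k * (1 - M.l₀ k - M.l₁ k)
      = 1 / sigmaRad d σ τ (node ε k)

end Laminate

/-- The order of magnitude of the lamination scale, for `d = 2` and `d = 3`. -/
def scaleOrder (d N : ℕ) (κ ρ : ℝ) : ℝ :=
  if d = 2 then (κ ^ 3)⁻¹ * ρ ^ 2 * (|Real.log ρ| ^ 3)⁻¹
  else (κ ^ 3)⁻¹ * ρ ^ (3 + 3 / (2 * (N : ℝ) + 3)) * |Real.log ρ|⁻¹

end Cloak

end

open MeasureTheory Metric Set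
open scoped ENNReal ContDiff InnerProductSpace

noncomputable section

namespace Cloak

section

/-! ### Absolutely continuous functions on an interval -/

/-! Everything is radial, so both Dirichlet-to-Neumann maps are diagonal in spherical harmonics and
the theorem reduces to ordinary differential equations with a bound uniform in the degree `n`. Write
`d = e + 2`. For a harmonic `P` of degree `n`, the coefficient `V` of the solution along `P` and its
flux `p = A r^(d-1) V'` solve the `RadialSystem` `V' = b p`, `p' = c V` with `b = 1/(r^(d-1) A)`, `c
= n(n+d-2) r^(d-3) A` and `p(1/2) = 0`. For the Laplacian `p(1) = n V(1)`, so what has to be bounded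
is the defect `p(1) - n V(1)`, by `C ρ^d (1+n) |V(1)|`. Since the `H^{1/2}` norm dominates `∑ (1+n)
‖P_n‖²` and harmonics are dense, such bounds give the operator norm (`norm_le_of_forall_harm`).

Homogenization. Replacing `A` in `c` by `σ₂*` and `1/A` in `b` by `1/σ₁*` gives a system solved
explicitly: its solution is the mode of the coating composed with the inverse blow-up
(`Mode.radialSystem_blowup`). The laminate has the right arithmetic and harmonic means in each cell,
so the primitives of the coefficient differences are `O(ε)` (`abs_integral_sub_le_of_cell_means`).
The Wronskian of the two systems has derivative `(c-c') U V + (b'-b) p q`; the products `U V` and `p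
q` are nonnegative and increasing, so an integration by parts needs only those primitives
(`RadialSystem.compare`). No bound on the materials of the laminate enters, only their means.

Far field. In the background a mode is `α t^n + β t^-(n+e)`, and its defect is a multiple of `β`.
For `1 ≤ n ≤ N` the vanishing of the polarization tensors gives `β = 0` (`Mode.beta_eq_zero`). For
`n > N` the defect at `t = R/τ` has relative size `(τ/R)^(2n)` up to a polynomial factor in `n` and
a power of a constant (`Mode.far_bound`), which together with the flux factor `τ^e` yields `τ^(d+2N)
= ρ^d`.

Uniformity in `n`. Since `ε ≤ 1/8`, the medium is homogeneous beyond `R = 7/8`, and there the defect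
is transported with the factor `R^n` (`RadialSystem.defect_eq`). This factor absorbs all polynomial
growth in `n` and leaves a homogenization error of order `S + T (G+S) G`, where `S ~ ε |ln ρ|`, `T ~
ε τ^-e |ln ρ|` and `G` bounds the integral of `r^(d-3) σ₂*`. In the plane `G ~ |ln ρ|`; in space `G`
is bounded because `σ₂*` is comparable to the derivative of the inverse blow-up. The assumed sizes
of `ε` make the error `O(ρ^d)` in both cases.

Solvability and boundedness come from a Poincaré inequality (`IsH1.norm_le`) and the Lax–Milgram
theorem (`exists_isDtN`). -/

/-- `F` is a primitive on `[x, y]` of the integrable function `f`. -/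
def IsPrim (F f : ℝ → ℝ) (x y : ℝ) : Prop :=
  IntervalIntegrable f volume x y ∧ ∀ r ∈ Icc x y, F r = F x + ∫ t in x..r, f t

namespace IsPrim

variable {F f G g k : ℝ → ℝ} {x y : ℝ}

/-- Values of `F` outside `[x, y]` are arbitrary, so `F` is traded for the global primitive `F₀`,
for which integration by parts and almost everywhere differentiation are available. -/
theorem absCont (h : IsPrim F f x y) :
    ∃ F₀ : ℝ → ℝ, AbsolutelyContinuousOnInterval F₀ x y ∧ EqOn F F₀ (Icc x y) ∧
      ∀ᵐ t, t ∈ uIcc x y → HasDerivAt F₀ (f t) t := by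
  refine ⟨fun r => F x + ∫ t in x..r, f t, ?_, fun r hr => h.2 r hr, ?_⟩
  · have h1 := h.1.absolutelyContinuousOnInterval_intervalIntegral (c := x) left_mem_uIcc
    have h2 : AbsolutelyContinuousOnInterval (fun _ : ℝ => F x) x y :=
      (LipschitzWith.const (F x)).lipschitzOnWith.absolutelyContinuousOnInterval
    exact h2.add h1
  · filter_upwards [h.1.ae_hasDerivAt_integral] with t ht hty
    exact (ht hty x left_mem_uIcc).const_add _

theorem continuousOn (h : IsPrim F f x y) (hxy : x ≤ y) : ContinuousOn F (Icc x y) := by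
  obtain ⟨F₀, h1, h2, -⟩ := h.absCont
  have := h1.continuousOn
  rw [uIcc_of_le hxy] at this
  exact this.congr h2

theorem mono (h : IsPrim F f x y) {x' y' : ℝ} (h1 : x ≤ x') (h2 : x' ≤ y') (h3 : y' ≤ y) :
    IsPrim F f x' y' := by
  have hi : ∀ r ∈ Icc x y, IntervalIntegrable f volume x r := fun r hr =>
    h.1.mono_set (by
      rw [uIcc_of_le hr.1, uIcc_of_le (hr.1.trans hr.2)]
      exact Icc_subset_Icc_right hr.2)
  have hx' : x' ∈ Icc x y := ⟨h1, h2.trans h3⟩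
  have hy' : y' ∈ Icc x y := ⟨h1.trans h2, h3⟩
  refine ⟨(hi x' hx').symm.trans (hi y' hy'), fun r hr => ?_⟩
  have hr' : r ∈ Icc x y := ⟨h1.trans hr.1, hr.2.trans h3⟩
  rw [h.2 r hr', h.2 x' hx', add_assoc,
    intervalIntegral.integral_add_adjacent_intervals (hi x' hx') ((hi x' hx').symm.trans (hi r hr'))]

theorem congr_ae (h : IsPrim F f x y) (hxy : x ≤ y) (hfg : ∀ᵐ t, t ∈ Ioo x y → f t = g t) :
    IsPrim F g x y := by
  have hfg' : ∀ᵐ t, t ∈ Ioc x y → f t = g t := by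
    have : ∀ᵐ t : ℝ, t ≠ y := by simp [ae_iff]
    filter_upwards [hfg, this] with t h1 h2 h3
    exact h1 ⟨h3.1, lt_of_le_of_ne h3.2 h2⟩
  refine ⟨h.1.congr_ae ?_, fun r hr => ?_⟩
  · rw [uIoc_of_le hxy]
    exact (ae_restrict_iff' measurableSet_Ioc).2 hfg'
  · rw [h.2 r hr]
    congr 1
    refine intervalIntegral.integral_congr_ae ?_
    rw [uIoc_of_le hr.1]
    filter_upwards [hfg'] with t ht hty
    exact ht ⟨hty.1, hty.2.trans hr.2⟩

theorem add (h1 : IsPrim F f x y) (h2 : IsPrim G g x y) :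
    IsPrim (fun t => F t + G t) (fun t => f t + g t) x y := by
  refine ⟨h1.1.add h2.1, fun r hr => ?_⟩
  have hs : uIcc x r ⊆ uIcc x y := by
    rw [uIcc_of_le hr.1, uIcc_of_le (hr.1.trans hr.2)]
    exact Icc_subset_Icc_right hr.2
  rw [intervalIntegral.integral_add (h1.1.mono_set hs) (h2.1.mono_set hs)]
  simp only [h1.2 r hr, h2.2 r hr]
  ring

theorem const_mul (h1 : IsPrim F f x y) (c : ℝ) :
    IsPrim (fun t => c * F t) (fun t => c * f t) x y := by
  refine ⟨h1.1.const_mul c, fun r hr => ?_⟩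
  rw [intervalIntegral.integral_const_mul]
  simp only [h1.2 r hr]
  ring

theorem mul (h1 : IsPrim F f x y) (h2 : IsPrim G g x y) (hxy : x ≤ y) :
    IsPrim (fun t => F t * G t) (fun t => f t * G t + F t * g t) x y := by
  have hcF := h1.continuousOn hxy
  have hcG := h2.continuousOn hxy
  refine ⟨?_, fun r hr => ?_⟩
  · rw [← uIcc_of_le hxy] at hcF hcG
    exact (h1.1.mul_continuousOn hcG).add (h2.1.continuousOn_mul hcF)
  · obtain ⟨F₀, a1, e1, d1⟩ := (h1.mono le_rfl hr.1 hr.2).absCont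
    obtain ⟨G₀, a2, e2, d2⟩ := (h2.mono le_rfl hr.1 hr.2).absCont
    have := a1.integral_deriv_mul_eq_sub a2
    simp only
    rw [e1 (right_mem_Icc.2 hr.1), e2 (right_mem_Icc.2 hr.1), e1 (left_mem_Icc.2 hr.1),
      e2 (left_mem_Icc.2 hr.1)]
    rw [← sub_eq_iff_eq_add', ← this]
    refine intervalIntegral.integral_congr_ae ?_
    filter_upwards [d1, d2] with t ht1 ht2 ht
    have ht' := uIoc_subset_uIcc ht
    rw [(ht1 ht').deriv, (ht2 ht').deriv]
    rw [uIcc_of_le hr.1] at ht'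
    rw [e1 ht', e2 ht']

theorem monotoneOn (h : IsPrim F f x y) (hf : ∀ᵐ t, t ∈ Ioo x y → 0 ≤ f t) :
    MonotoneOn F (Icc x y) := by
  intro r hr s hs hrs
  have h1 := (h.mono hr.1 hrs hs.2).2 s ⟨hrs, le_rfl⟩
  rw [h1, le_add_iff_nonneg_right]
  refine intervalIntegral.integral_nonneg_of_ae_restrict hrs ?_
  rw [← restrict_Ioo_eq_restrict_Icc]
  refine (ae_restrict_iff' measurableSet_Ioo).2 ?_
  filter_upwards [hf] with t ht hty
  exact ht ⟨hr.1.trans_lt hty.1, hty.2.trans_le hs.2⟩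

/-- The countable exceptional set absorbs the interfaces of the coating and the kink of the blow-up
map. -/
theorem of_hasDerivAt {s : Set ℝ} (hs : s.Countable) (hxy : x ≤ y) (hc : ContinuousOn F (Icc x y))
    (hd : ∀ t ∈ Ioo x y \ s, HasDerivAt F (f t) t) (hi : IntervalIntegrable f volume x y) :
    IsPrim F f x y := by
  refine ⟨hi, fun r hr => ?_⟩
  have h1 : ContinuousOn F (Icc x r) := hc.mono (Icc_subset_Icc_right hr.2)
  have := integral_eq_of_hasDerivAt_off_countable_of_le F f hr.1 hs h1
    (fun t ht => hd t ⟨⟨ht.1.1, ht.1.2.trans_le hr.2⟩, ht.2⟩)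
    (hi.mono_set (by
      rw [uIcc_of_le hr.1, uIcc_of_le hxy]
      exact Icc_subset_Icc_right hr.2))
  rw [this]; ring

/-- Integration against a nonnegative increasing function is controlled by the primitive. -/
theorem abs_integral_mul_le (h : IsPrim F f x y) (hxy : x ≤ y)
    (hf : ∀ᵐ t, t ∈ Ioo x y → 0 ≤ f t) (hx : 0 ≤ F x) (hk : IntervalIntegrable k volume x y)
    {S : ℝ} (hS : ∀ r ∈ Icc x y, |∫ t in x..r, k t| ≤ S) :
    |∫ t in x..y, k t * F t| ≤ 2 * S * F y := by
  have hK : IsPrim (fun r => ∫ t in x..r, k t) k x y := ⟨hk, fun r _ => by simp⟩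
  -- With `K` the primitive of `k` that vanishes at `x`, `∫ k F = K(y) F(y) - ∫ K f`. Both terms are
  -- at most `S F(y)`, because `|K| ≤ S` and `∫ f = F(y) - F(x) ≤ F(y)`.
  have hm := (hK.mul h hxy).2 y (right_mem_Icc.2 hxy)
  have hcF := h.continuousOn hxy
  have hcK := hK.continuousOn hxy
  rw [← uIcc_of_le hxy] at hcF hcK
  rw [intervalIntegral.integral_add (hk.mul_continuousOn hcF) (h.1.continuousOn_mul hcK)] at hm
  simp only [intervalIntegral.integral_same, zero_mul, zero_add] at hm
  have hb : |∫ t in x..y, (∫ s in x..t, k s) * f t| ≤ S * (F y - F x) := by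
    have h2 : F y - F x = ∫ t in x..y, f t := by
      rw [h.2 y (right_mem_Icc.2 hxy)]; ring
    rw [h2, ← intervalIntegral.integral_const_mul, ← Real.norm_eq_abs]
    refine intervalIntegral.norm_integral_le_of_norm_le hxy ?_ (h.1.const_mul S)
    have : ∀ᵐ t : ℝ, t ≠ y := by simp [ae_iff]
    filter_upwards [hf, this] with t ht hty htt
    have h0 := ht ⟨htt.1, lt_of_le_of_ne htt.2 hty⟩
    rw [norm_mul, Real.norm_eq_abs, Real.norm_eq_abs, abs_of_nonneg h0]
    exact mul_le_mul_of_nonneg_right (hS t ⟨htt.1.le, htt.2⟩) h0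
  have hFy : F x ≤ F y :=
    h.monotoneOn hf (left_mem_Icc.2 hxy) (right_mem_Icc.2 hxy) hxy
  have hSy := hS y (right_mem_Icc.2 hxy)
  have hS0 : 0 ≤ S := (abs_nonneg _).trans hSy
  have e : ∫ t in x..y, k t * F t
      = (∫ t in x..y, k t) * F y - ∫ t in x..y, (∫ s in x..t, k s) * f t := by linarith
  rw [e]
  refine (abs_sub _ _).trans ?_
  rw [abs_mul, abs_of_nonneg (hx.trans hFy)]
  nlinarith [mul_le_mul_of_nonneg_right hSy (hx.trans hFy), mul_nonneg hS0 hx]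

end IsPrim

/-! ### Radial systems -/

/-- `V' = b p` and `p' = c V` on `[x, y]`. -/
structure RadialSystem (b c V p : ℝ → ℝ) (x y : ℝ) : Prop where
  val : IsPrim V (fun t => b t * p t) x y
  flux : IsPrim p (fun t => c t * V t) x y

namespace RadialSystem

variable {b c b' c' V p U q : ℝ → ℝ} {x y : ℝ}

theorem mono (h : RadialSystem b c V p x y) {x' y' : ℝ} (h1 : x ≤ x') (h2 : x' ≤ y')
    (h3 : y' ≤ y) : RadialSystem b c V p x' y' :=
  ⟨h.val.mono h1 h2 h3, h.flux.mono h1 h2 h3⟩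

theorem const_mul (h : RadialSystem b c V p x y) (s : ℝ) :
    RadialSystem b c (fun t => s * V t) (fun t => s * p t) x y := by
  constructor
  · convert h.val.const_mul s using 2; ring
  · convert h.flux.const_mul s using 2; ring

/-- The derivative of `p U - q V` is `c V U + p b' q - c' U V - q b p`, so only the differences of
the coefficients survive. -/
theorem wronskian (h : RadialSystem b c V p x y) (h' : RadialSystem b' c' U q x y) (hxy : x ≤ y) :
    p y * U y - q y * V y = p x * U x - q x * V x
      + ∫ t in x..y, ((c t - c' t) * (U t * V t) + (b' t - b t) * (p t * q t)) := by
  have h1 := (h.flux.mul h'.val hxy).add ((h'.flux.mul h.val hxy).const_mul (-1))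
  have := h1.2 y (right_mem_Icc.2 hxy)
  simp only at this
  rw [show p y * U y - q y * V y = p y * U y + -1 * (q y * V y) by ring, this]
  congr 1
  · ring
  · refine intervalIntegral.integral_congr fun t _ => ?_
    ring

/-- Energy argument: `(p V)' = c V² + b p² ≥ 0` and `p V` vanishes at `x`, hence `(V²)' = 2 b p V ≥
0`. -/
theorem sq_monotoneOn (h : RadialSystem b c V p x y) (hxy : x ≤ y) (hp : p x = 0)
    (hb : ∀ t ∈ Ioo x y, 0 ≤ b t) (hc : ∀ t ∈ Ioo x y, 0 ≤ c t) :
    MonotoneOn (fun t => V t * V t) (Icc x y) := by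
  have h1 : MonotoneOn (fun t => p t * V t) (Icc x y) := by
    refine (h.flux.mul h.val hxy).monotoneOn (Filter.Eventually.of_forall fun t ht => ?_)
    nlinarith [mul_nonneg (hc t ht) (mul_self_nonneg (V t)),
      mul_nonneg (hb t ht) (mul_self_nonneg (p t))]
  refine (h.val.mul h.val hxy).monotoneOn (Filter.Eventually.of_forall fun t ht => ?_)
  have h2 := h1 (left_mem_Icc.2 hxy) (Ioo_subset_Icc_self ht) ht.1.le
  simp only [hp, zero_mul] at h2
  nlinarith [mul_nonneg (hb t ht) h2]

/-- A solution without flux at the left end point does not change its sign. -/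
theorem nonneg (h : RadialSystem b c V p x y) (hxy : x ≤ y) (hp : p x = 0)
    (hb : ∀ t ∈ Ioo x y, 0 ≤ b t) (hc : ∀ t ∈ Ioo x y, 0 ≤ c t) (hV : 0 ≤ V y) :
    (∀ t ∈ Icc x y, 0 ≤ V t) ∧ ∀ t ∈ Icc x y, 0 ≤ p t := by
  have hsq := h.sq_monotoneOn hxy hp hb hc
  have h1 : ∀ t ∈ Icc x y, 0 ≤ V t := by
    intro t ht
    by_contra! hneg
    have hcont : ContinuousOn V (Icc t y) :=
      (h.val.continuousOn hxy).mono (Icc_subset_Icc_left ht.1)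
    -- A negative value followed by `V y ≥ 0` forces a later zero of `V`, which contradicts the
    -- growth of `V²`.
    obtain ⟨z, hz, hz0⟩ := intermediate_value_Icc ht.2 hcont ⟨hneg.le, hV⟩
    have := hsq ht ⟨ht.1.trans hz.1, hz.2⟩ hz.1
    simp only [hz0] at this
    nlinarith
  refine ⟨h1, fun t ht => ?_⟩
  have hm : MonotoneOn p (Icc x y) :=
    h.flux.monotoneOn (Filter.Eventually.of_forall fun s hs =>
      mul_nonneg (hc s hs) (h1 s (Ioo_subset_Icc_self hs)))
  have := hm (left_mem_Icc.2 hxy) ht ht.1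
  rwa [hp] at this

theorem val_monotoneOn (h : RadialSystem b c V p x y)
    (hb : ∀ t ∈ Ioo x y, 0 ≤ b t) (hp : ∀ t ∈ Icc x y, 0 ≤ p t) : MonotoneOn V (Icc x y) :=
  h.val.monotoneOn (Filter.Eventually.of_forall fun t ht =>
    mul_nonneg (hb t ht) (hp t (Ioo_subset_Icc_self ht)))

/-- The flux is `∫ c V` and `V` increases. The bound involves the integral of `c` only, so a highly
conducting thin layer does no harm. -/
theorem flux_le (h : RadialSystem b c V p x y) (hxy : x ≤ y) (hpx : p x = 0)
    (hb : ∀ t ∈ Ioo x y, 0 ≤ b t) (hc : ∀ t ∈ Ioo x y, 0 ≤ c t)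
    (hp : ∀ t ∈ Icc x y, 0 ≤ p t)
    (hci : IntervalIntegrable c volume x y) : p y ≤ (∫ t in x..y, c t) * V y := by
  rw [h.flux.2 y (right_mem_Icc.2 hxy), hpx, zero_add, ← intervalIntegral.integral_mul_const]
  refine intervalIntegral.integral_mono_on_of_le_Ioo hxy h.flux.1 (hci.mul_const _) fun t ht => ?_
  exact mul_le_mul_of_nonneg_left (h.val_monotoneOn hb hp (Ioo_subset_Icc_self ht)
    (right_mem_Icc.2 hxy) ht.2.le) (hc t ht)

/-- Comparison of two radial systems whose coefficients have close primitives. -/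
theorem compare (h : RadialSystem b c V p x y) (h' : RadialSystem b' c' U q x y) (hxy : x ≤ y)
    (hpx : p x = 0) (hqx : q x = 0)
    (hb : ∀ t ∈ Ioo x y, 0 ≤ b t) (hc : ∀ t ∈ Ioo x y, 0 ≤ c t)
    (hb' : ∀ t ∈ Ioo x y, 0 ≤ b' t) (hc' : ∀ t ∈ Ioo x y, 0 ≤ c' t)
    (hbi : IntervalIntegrable b volume x y) (hci : IntervalIntegrable c volume x y)
    (hbi' : IntervalIntegrable b' volume x y) (hci' : IntervalIntegrable c' volume x y)
    (hV : 0 ≤ V y) (hU : 0 ≤ U y) {S T : ℝ}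
    (hS : ∀ r ∈ Icc x y, |∫ t in x..r, (c t - c' t)| ≤ S)
    (hT : ∀ r ∈ Icc x y, |∫ t in x..r, (b' t - b t)| ≤ T) :
    |p y * U y - q y * V y| ≤
      (2 * S + 2 * T * ((∫ t in x..y, c t) * ∫ t in x..y, c' t)) * (U y * V y) := by
  obtain ⟨hV0, hp0⟩ := h.nonneg hxy hpx hb hc hV
  obtain ⟨hU0, hq0⟩ := h'.nonneg hxy hqx hb' hc' hU
  have e := h.wronskian h' hxy
  have hUV := h'.val.mul h.val hxy
  have hpq := h.flux.mul h'.flux hxy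
  have cUV := hUV.continuousOn hxy
  have cpq := hpq.continuousOn hxy
  rw [← uIcc_of_le hxy] at cUV cpq
  rw [hpx, hqx, zero_mul, zero_mul, sub_zero, zero_add,
    intervalIntegral.integral_add ((hci.sub hci').mul_continuousOn cUV)
      ((hbi'.sub hbi).mul_continuousOn cpq)] at e
  rw [e]
  -- `U V` and `p q` have nonnegative derivatives because all four functions are nonnegative. Hence
  -- the oscillating coefficient differences enter through their primitives, with bounds `S` and
  -- `T`.
  have i1 := hUV.abs_integral_mul_le hxy (Filter.Eventually.of_forall fun t ht => by
    have ht' := Ioo_subset_Icc_self ht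
    have := mul_nonneg (mul_nonneg (hb' t ht) (hq0 t ht')) (hV0 t ht')
    have := mul_nonneg (hU0 t ht') (mul_nonneg (hb t ht) (hp0 t ht'))
    linarith) (mul_nonneg (hU0 x (left_mem_Icc.2 hxy)) (hV0 x (left_mem_Icc.2 hxy)))
    (hci.sub hci') hS
  have i2 := hpq.abs_integral_mul_le hxy (Filter.Eventually.of_forall fun t ht => by
    have ht' := Ioo_subset_Icc_self ht
    have := mul_nonneg (mul_nonneg (hc t ht) (hV0 t ht')) (hq0 t ht')
    have := mul_nonneg (hp0 t ht') (mul_nonneg (hc' t ht) (hU0 t ht'))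
    linarith) (by simp [hpx]) (hbi'.sub hbi) hT
  have f1 := h.flux_le hxy hpx hb hc hp0 hci
  have f2 := h'.flux_le hxy hqx hb' hc' hq0 hci'
  have hy := right_mem_Icc.2 hxy
  have hT0 : 0 ≤ T := (abs_nonneg _).trans (hT y hy)
  -- The product of the fluxes at `y` is turned into a multiple of `U y * V y`, so that the final
  -- estimate is relative.
  have f3 := mul_le_mul f1 f2 (hq0 y hy) ((hp0 y hy).trans f1)
  refine (abs_add_le _ _).trans ((add_le_add i1 i2).trans ?_)
  nlinarith [mul_le_mul_of_nonneg_left f3 hT0]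

end RadialSystem

end

section

/-! ### Polar coordinates -/

/-- The measure `r^(d-1) dr` on `(0, ∞)`. -/
def radialMeasure (d : ℕ) : Measure ℝ :=
  (volume.restrict (Ioi (0 : ℝ))).withDensity fun r => ENNReal.ofReal (r ^ (d - 1))

theorem map_volumeIoiPow (d : ℕ) :
    (Measure.volumeIoiPow (d - 1)).map ((↑) : Ioi (0 : ℝ) → ℝ) = radialMeasure d := by
  have he : MeasurableEmbedding ((↑) : Ioi (0 : ℝ) → ℝ) :=
    MeasurableEmbedding.subtype_coe measurableSet_Ioi
  ext s hs
  rw [he.map_apply, Measure.volumeIoiPow, radialMeasure,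
    withDensity_apply _ (he.measurable hs), withDensity_apply _ hs,
    setLIntegral_subtype measurableSet_Ioi _ fun a : ℝ ↦ ENNReal.ofReal (a ^ (d - 1)),
    Measure.restrict_restrict hs, Subtype.image_preimage_coe, inter_comm]

/-- Transfers `homeomorphUnitSphereProd` from subtypes to the ambient spaces. The origin is a null
set because `d > 0`. -/
theorem measurePreserving_polar (d : ℕ) (hd : 0 < d) :
    MeasurePreserving (fun z : sphere (0 : Sp d) 1 × ℝ => z.2 • (z.1 : Sp d))
      ((surf d).prod (radialMeasure d)) volume := by
  have hnt : Nontrivial (Sp d) := by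
    have : Nonempty (Fin d) := ⟨⟨0, hd⟩⟩
    infer_instance
  have h1 : MeasurePreserving (fun z : sphere (0 : Sp d) 1 × Ioi (0 : ℝ) => (z.1, (z.2 : ℝ)))
      ((surf d).prod (Measure.volumeIoiPow (d - 1))) ((surf d).prod (radialMeasure d)) :=
    (MeasurePreserving.id (surf d)).prod
      ⟨measurable_subtype_coe, map_volumeIoiPow d⟩
  have h2 := (volume : Measure (Sp d)).measurePreserving_homeomorphUnitSphereProd
  rw [show Module.finrank ℝ (Sp d) = d by simp] at h2
  have h3 : MeasurePreserving ((↑) : ({0}ᶜ : Set (Sp d)) → Sp d)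
      ((volume : Measure (Sp d)).comap (↑)) volume := by
    refine ⟨measurable_subtype_coe, ?_⟩
    rw [map_comap_subtype_coe (measurableSet_singleton _).compl, restrict_compl_singleton]
  have h4 : MeasurePreserving (homeomorphUnitSphereProd (Sp d)).symm
      ((surf d).prod (Measure.volumeIoiPow (d - 1))) ((volume : Measure (Sp d)).comap (↑)) :=
    MeasurePreserving.symm (homeomorphUnitSphereProd (Sp d)).toMeasurableEquiv h2
  have h5 := h3.comp h4
  have hm : Measurable (fun z : sphere (0 : Sp d) 1 × ℝ => z.2 • (z.1 : Sp d)) := by fun_prop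
  refine ⟨hm, ?_⟩
  rw [← h1.map_eq, Measure.map_map hm h1.measurable, ← h5.map_eq]
  rfl

variable {d : ℕ}

theorem prod_radialMeasure (d : ℕ) :
    (surf d).prod (radialMeasure d) =
      ((surf d).prod (volume.restrict (Ioi (0 : ℝ)))).withDensity
        fun z => ENNReal.ofReal (z.2 ^ (d - 1)) := by
  rw [radialMeasure, prod_withDensity_right (by fun_prop)]

theorem integrable_polar {f : Sp d → ℝ} (hd : 0 < d) (hf : Integrable f) :
    Integrable (fun z : sphere (0 : Sp d) 1 × ℝ => z.2 ^ (d - 1) * f (z.2 • (z.1 : Sp d)))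
      ((surf d).prod (volume.restrict (Ioi (0 : ℝ)))) := by
  have h := (measurePreserving_polar d hd).integrable_comp_of_integrable hf
  rw [prod_radialMeasure, integrable_withDensity_iff_integrable_smul' (by fun_prop) (by simp)] at h
  refine h.congr ?_
  have : ∀ᵐ z ∂((surf d).prod (volume.restrict (Ioi (0 : ℝ)))), z.2 ∈ Ioi (0 : ℝ) :=
    Measure.quasiMeasurePreserving_snd.ae (ae_restrict_mem measurableSet_Ioi)
  filter_upwards [this] with z hz
  simp only [Function.comp, smul_eq_mul]
  rw [ENNReal.toReal_ofReal (pow_nonneg hz.out.le _)]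

theorem integral_polar_prod {f : Sp d → ℝ} (hd : 0 < d) (hf : AEStronglyMeasurable f) :
    ∫ x, f x = ∫ z, z.2 ^ (d - 1) * f (z.2 • (z.1 : Sp d))
      ∂((surf d).prod (volume.restrict (Ioi (0 : ℝ)))) := by
  have hp := measurePreserving_polar d hd
  rw [← hp.map_eq] at hf
  conv_lhs => rw [← hp.map_eq]
  rw [integral_map hp.measurable.aemeasurable hf, prod_radialMeasure,
    integral_withDensity_eq_integral_toReal_smul (by fun_prop) (by simp)]
  refine integral_congr_ae ?_
  have : ∀ᵐ z ∂((surf d).prod (volume.restrict (Ioi (0 : ℝ)))), z.2 ∈ Ioi (0 : ℝ) :=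
    Measure.quasiMeasurePreserving_snd.ae (ae_restrict_mem measurableSet_Ioi)
  filter_upwards [this] with z hz
  simp only [smul_eq_mul]
  rw [ENNReal.toReal_ofReal (pow_nonneg hz.out.le _)]

theorem abs_integral_mul_le {α : Type*} [MeasurableSpace α] {μ : Measure α} {f g : α → ℝ}
    (hf : MemLp f 2 μ) (hg : MemLp g 2 μ) :
    |∫ x, f x * g x ∂μ| ≤ √(∫ x, f x ^ 2 ∂μ) * √(∫ x, g x ^ 2 ∂μ) := by
  have key : ∀ {h : α → ℝ} (hh : MemLp h 2 μ), ‖hh.toLp h‖ = √(∫ x, h x ^ 2 ∂μ) := by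
    intro h hh
    rw [norm_eq_sqrt_real_inner, L2.inner_def]
    congr 1
    refine integral_congr_ae ?_
    filter_upwards [hh.coeFn_toLp] with x hx
    rw [hx, real_inner_self_eq_norm_sq, Real.norm_eq_abs, sq_abs]
  have h1 := abs_real_inner_le_norm (hf.toLp f) (hg.toLp g)
  rw [key, key, L2.inner_def] at h1
  convert h1 using 2
  refine integral_congr_ae ?_
  filter_upwards [hf.coeFn_toLp, hg.coeFn_toLp] with x hx hy
  rw [hx, hy, real_inner_eq_re_inner]
  simp [mul_comm]

theorem norm_lp_eq_sqrt {α : Type*} [MeasurableSpace α] {μ : Measure α} (f : Lp ℝ 2 μ) :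
    ‖f‖ = √(∫ x, f x ^ 2 ∂μ) := by
  rw [norm_eq_sqrt_real_inner, L2.inner_def]
  congr 1
  refine integral_congr_ae (Filter.Eventually.of_forall fun x => ?_)
  simp only
  rw [real_inner_self_eq_norm_sq, Real.norm_eq_abs, sq_abs]

end

section

/-! ### Green's formula and the Poincaré inequality -/

variable {d : ℕ} {D : Set (Sp d)}

/-- The properties of the shell and the ball that are used: `D` is an open subset of the ball, and
dilations move points of `D` within `D` or out of the ball. -/
structure Admissible (D : Set (Sp d)) : Prop where
  isOpen : IsOpen D
  subset : D ⊆ unitBall d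
  dilate : ∀ x ∈ D, ∀ t : ℝ, 1 ≤ t → t • x ∈ D ∪ (unitBall d)ᶜ

theorem mem_unitBall {x : Sp d} : x ∈ unitBall d ↔ ‖x‖ < 1 := by simp [unitBall]

theorem admissible_unitBall : Admissible (unitBall d) where
  isOpen := isOpen_ball
  subset := le_rfl
  dilate x _ t _ := by rw [union_compl_self]; trivial

theorem admissible_shell : Admissible (shell d) where
  isOpen := (isOpen_lt continuous_const continuous_norm).inter
    (isOpen_lt continuous_norm continuous_const)
  subset x hx := mem_unitBall.2 hx.2
  dilate x hx t ht := by
    by_cases h : ‖t • x‖ < 1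
    · refine Or.inl ⟨hx.1.trans_le ?_, h⟩
      rw [norm_smul, Real.norm_eq_abs, abs_of_nonneg (by linarith)]
      exact le_mul_of_one_le_left (norm_nonneg _) ht
    · exact Or.inr fun h' => h (mem_unitBall.1 h')

theorem Admissible.measurableSet (hD : Admissible D) : MeasurableSet D := hD.isOpen.measurableSet

theorem Admissible.norm_lt (hD : Admissible D) {x : Sp d} (hx : x ∈ D) : ‖x‖ < 1 :=
  mem_unitBall.1 (hD.subset hx)

theorem Admissible.isFiniteMeasure (hD : Admissible D) :
    IsFiniteMeasure ((volume : Measure (Sp d)).restrict D) :=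
  ⟨by
    rw [Measure.restrict_apply_univ]
    exact (measure_mono hD.subset).trans_lt measure_ball_lt_top⟩

/-- A smooth cutoff function that is `1` on `B_2`. -/
theorem exists_cutoff (d : ℕ) : ∃ χ : Sp d → ℝ, ContDiff ℝ ∞ χ ∧ HasCompactSupport χ ∧
    ∀ x, ‖x‖ < 2 → χ =ᶠ[nhds x] 1 := by
  let χ : ContDiffBump (0 : Sp d) := ⟨2, 3, by norm_num, by norm_num⟩
  refine ⟨χ, χ.contDiff, χ.hasCompactSupport, fun x hx => ?_⟩
  have : ball (0 : Sp d) 2 ∈ nhds x := isOpen_ball.mem_nhds (by simpa using hx)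
  filter_upwards [this] with y hy
  exact χ.one_of_mem_closedBall (ball_subset_closedBall hy)

/-- A cutoff equal to `1` on `B_2` gives the continuous factor compact support without changing it
on `D`, which lies in the unit ball. -/
theorem integrable_lp_mul (hD : Admissible D) (u : L2 D) {f : Sp d → ℝ} (hf : Continuous f) :
    Integrable (fun x => u x * f x) ((volume : Measure (Sp d)).restrict D) := by
  obtain ⟨χ, h1, h2, h3⟩ := exists_cutoff d
  have := integrable_aux u (f := fun x => χ x * f x) (h1.continuous.mul hf) h2.mul_right
  refine this.congr ?_
  filter_upwards [ae_restrict_mem hD.measurableSet] with x hx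
  rw [(h3 x (by linarith [hD.norm_lt hx])).eq_of_nhds]
  simp

theorem integrable_lpVec_mul (hD : Admissible D) (G : L2Vec D) (i : Fin d) {f : Sp d → ℝ}
    (hf : Continuous f) :
    Integrable (fun x => G x i * f x) ((volume : Measure (Sp d)).restrict D) := by
  obtain ⟨χ, h1, h2, h3⟩ := exists_cutoff d
  have := integrable_aux_vec G i (f := fun x => χ x * f x) (h1.continuous.mul hf) h2.mul_right
  refine this.congr ?_
  filter_upwards [ae_restrict_mem hD.measurableSet] with x hx
  rw [(h3 x (by linarith [hD.norm_lt hx])).eq_of_nhds]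
  simp

/-- Green's formula holds without compact support of the test function. -/
theorem IsH1.green_single (hD : Admissible D) {u : L2 D} {G : L2Vec D} {φ : L2Sphere d}
    (h : IsH1 D u G φ) {ψ : Sp d → ℝ} (hψ : ContDiff ℝ ∞ ψ)
    (hs : tsupport ψ ⊆ D ∪ (unitBall d)ᶜ) (i : Fin d) :
    (∫ x in D, u x * fderiv ℝ ψ x (EuclideanSpace.single i 1)) + (∫ x in D, G x i * ψ x)
        = ∫ θ, φ θ * (ψ θ * (θ : Sp d) i) ∂(surf d) := by
  obtain ⟨χ, h1, h2, h3⟩ := exists_cutoff d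
  have := h (fun x => χ x * ψ x) (h1.mul hψ) h2.mul_right
    ((tsupport_mul_subset_right).trans hs) i
  convert this using 1
  · congr 1
    · refine setIntegral_congr_fun hD.measurableSet fun x hx => ?_
      beta_reduce
      congr 2
      refine Filter.EventuallyEq.fderiv_eq ?_
      filter_upwards [h3 x (by linarith [hD.norm_lt hx])] with y hy
      simp [hy]
    · refine setIntegral_congr_fun hD.measurableSet fun x hx => ?_
      beta_reduce
      rw [(h3 x (by linarith [hD.norm_lt hx])).eq_of_nhds]
      simp
  · refine integral_congr_ae (Filter.Eventually.of_forall fun θ => ?_)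
    beta_reduce
    rw [(h3 θ (by simp)).eq_of_nhds]
    simp

/-- Green's formula for vector fields. -/
theorem IsH1.green (hD : Admissible D) {u : L2 D} {G : L2Vec D} {φ : L2Sphere d}
    (h : IsH1 D u G φ) {Ψ : Fin d → Sp d → ℝ} (hΨ : ∀ i, ContDiff ℝ ∞ (Ψ i))
    (hs : ∀ i, tsupport (Ψ i) ⊆ D ∪ (unitBall d)ᶜ) :
    (∫ x in D, u x * ∑ i, fderiv ℝ (Ψ i) x (EuclideanSpace.single i 1))
      + (∫ x in D, ∑ i, G x i * Ψ i x)
        = ∫ θ, φ θ * ∑ i, Ψ i θ * (θ : Sp d) i ∂(surf d) := by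
  simp_rw [Finset.mul_sum]
  rw [integral_finsetSum _ fun i _ => integrable_lp_mul hD u (continuous_aux (hΨ i) i),
    integral_finsetSum _ fun i _ => integrable_lpVec_mul hD G i (hΨ i).continuous,
    integral_finsetSum _ fun i _ => integrable_aux_sphere φ (continuous_aux_sphere (hΨ i) i),
    ← Finset.sum_add_distrib]
  exact Finset.sum_congr rfl fun i _ => h.green_single hD (hΨ i) (hs i) i

theorem sum_smul_single (x : Sp d) :
    ∑ i, x i • (EuclideanSpace.single i (1 : ℝ) : Sp d) = x := by
  have := (EuclideanSpace.basisFun (Fin d) ℝ).sum_repr x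
  simpa using this

theorem fderiv_sum_single (f : Sp d →L[ℝ] ℝ) (x : Sp d) :
    ∑ i, x i * f (EuclideanSpace.single i 1) = f x := by
  conv_rhs => rw [← sum_smul_single x]
  simp [map_sum]

/-- The divergence of `g(tx) x`. -/
theorem divergence_dilation {g : Sp d → ℝ} (hg : ContDiff ℝ ∞ g) (t : ℝ) (x : Sp d) :
    ∑ i, fderiv ℝ (fun y : Sp d => y i * g (t • y)) x (EuclideanSpace.single i 1)
      = d * g (t • x) + t * fderiv ℝ g (t • x) x := by
  have hgd : Differentiable ℝ g := hg.differentiable (by simp)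
  have h1 : ∀ i : Fin d, fderiv ℝ (fun y : Sp d => y i * g (t • y)) x (EuclideanSpace.single i 1)
      = g (t • x) + t * (x i * fderiv ℝ g (t • x) (EuclideanSpace.single i 1)) := by
    intro i
    have e1 : HasFDerivAt (fun y : Sp d => y i) (EuclideanSpace.proj (𝕜 := ℝ) i) x :=
      (EuclideanSpace.proj (𝕜 := ℝ) i : Sp d →L[ℝ] ℝ).hasFDerivAt
    have e2 : HasFDerivAt (fun y : Sp d => t • y) (t • ContinuousLinearMap.id ℝ (Sp d)) x :=
      (hasFDerivAt_id x).const_smul t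
    have e3 := (hgd (t • x)).hasFDerivAt.comp x e2
    have e4 : HasFDerivAt (fun y : Sp d => y i * g (t • y)) _ x := e1.fun_mul e3
    rw [e4.fderiv]
    simp
    ring
  simp_rw [h1]
  rw [Finset.sum_add_distrib, ← Finset.mul_sum, fderiv_sum_single]
  simp

/-- The bracket is the divergence of `y ↦ g(ty) y` from `divergence_dilation`. Integrating over `t ∈
(0, 1]` therefore writes `g` as a superposition of divergences, to each of which Green's formula
applies. -/
theorem hasDerivAt_dilation {g : Sp d → ℝ} (hg : ContDiff ℝ ∞ g) (x : Sp d) (t : ℝ) :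
    HasDerivAt (fun s : ℝ => s ^ d * g (s • x))
      (t ^ (d - 1) * (d * g (t • x) + t * fderiv ℝ g (t • x) x)) t := by
  have hgd : Differentiable ℝ g := hg.differentiable (by simp)
  have h1 : HasDerivAt (fun s : ℝ => s • x) x t := by
    simpa using (hasDerivAt_id t).smul_const x
  have h2 := (hgd (t • x)).hasFDerivAt.comp_hasDerivAt t h1
  have h3 : HasDerivAt (fun s : ℝ => s ^ d * g (s • x)) _ t := (hasDerivAt_pow d t).fun_mul h2
  convert! h3 using 1
  rcases d with _ | d
  · have : x = 0 := Subsingleton.elim _ _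
    simp [this]
  · simp only [Nat.add_sub_cancel]
    ring

/-- The dilation costs `t^(-d)`, and the weight gains `t^(2(d-1))`; since `2(d-1) ≥ d` for `d ≥ 2`,
the gain wins. -/
theorem integral_smul_sq_le (hd : 2 ≤ d) {g : Sp d → ℝ} {t : ℝ} (ht : 0 < t) (ht1 : t ≤ 1) :
    ∫ x, (t ^ (d - 1) * g (t • x)) ^ 2 ≤ ∫ x, g x ^ 2 := by
  have h := Measure.integral_comp_smul (volume : Measure (Sp d)) (fun x => g x ^ 2) t
  simp_rw [mul_pow]
  rw [integral_const_mul, h, smul_eq_mul, ← mul_assoc]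
  refine mul_le_of_le_one_left (integral_nonneg fun x => sq_nonneg _) ?_
  rw [finrank_euclideanSpace_fin, abs_of_pos (by positivity), ← pow_mul]
  rw [← div_eq_mul_inv, div_le_one (by positivity)]
  exact pow_le_pow_of_le_one ht.le ht1 (by omega)

theorem integral_inner_id_sq_le (hD : Admissible D) (F : L2Vec D) :
    MemLp (fun x => ⟪F x, x⟫_ℝ) 2 ((volume : Measure (Sp d)).restrict D) ∧
    √(∫ x in D, ⟪F x, x⟫_ℝ ^ 2) ≤ ‖F‖ := by
  have hb : ∀ᵐ x ∂((volume : Measure (Sp d)).restrict D), ‖⟪F x, x⟫_ℝ‖ ≤ ‖F x‖ := by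
    filter_upwards [ae_restrict_mem hD.measurableSet] with x hx
    refine (norm_inner_le_norm _ _).trans ?_
    exact mul_le_of_le_one_right (norm_nonneg _) (hD.norm_lt hx).le
  have hm : MemLp (fun x => ⟪F x, x⟫_ℝ) 2 ((volume : Measure (Sp d)).restrict D) :=
    (Lp.memLp F).mono ((Lp.aestronglyMeasurable F).inner aestronglyMeasurable_id) hb
  refine ⟨hm, ?_⟩
  rw [norm_eq_sqrt_real_inner F, L2.inner_def]
  refine Real.sqrt_le_sqrt (integral_mono_ae hm.integrable_sq ?_ ?_)
  · exact L2.integrable_inner F F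
  · filter_upwards [hb] with x hx
    rw [real_inner_self_eq_norm_sq, ← sq_abs, ← Real.norm_eq_abs]
    exact pow_le_pow_left₀ (norm_nonneg _) hx 2

/-- Cauchy–Schwarz on sphere times `(0, 1]`. The squared weight `t^(2(d-1))` is at most `t^(d-1)`,
the density of polar coordinates, so the second factor is bounded by the volume integral of `g²`. -/
theorem abs_integral_sphere_le (hd : 2 ≤ d) (φ : L2Sphere d) {g : Sp d → ℝ} (hg : Continuous g)
    (hc : HasCompactSupport g) :
    |∫ t in Ioc (0 : ℝ) 1, ∫ θ, φ θ * (t ^ (d - 1) * g (t • (θ : Sp d))) ∂(surf d)|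
      ≤ ‖φ‖ * √(∫ x, g x ^ 2) := by
  set ν : Measure ℝ := volume.restrict (Ioc (0 : ℝ) 1)
  have hd0 : 0 < d := by omega
  have hg2 : Integrable (fun x => g x ^ 2) :=
    (hg.pow 2).integrable_of_hasCompactSupport (by
      simpa only [sq] using hc.mul_right)
  have hφ : MemLp (fun z : sphere (0 : Sp d) 1 × ℝ => φ z.1) 2 ((surf d).prod ν) :=
    (Lp.memLp φ).comp_fst ν
  obtain ⟨B, hB⟩ := hc.exists_bound_of_continuous hg
  have hν : ∀ᵐ z ∂((surf d).prod ν), z.2 ∈ Ioc (0 : ℝ) 1 :=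
    Measure.quasiMeasurePreserving_snd.ae (ae_restrict_mem measurableSet_Ioc)
  have hgm : MemLp (fun z : sphere (0 : Sp d) 1 × ℝ => z.2 ^ (d - 1) * g (z.2 • (z.1 : Sp d))) 2
      ((surf d).prod ν) := by
    refine MemLp.of_bound (C := B) (by fun_prop) ?_
    filter_upwards [hν] with z hz
    rw [norm_mul, norm_pow, Real.norm_eq_abs, abs_of_pos hz.1]
    calc z.2 ^ (d - 1) * ‖g (z.2 • (z.1 : Sp d))‖ ≤ 1 * B := by
          refine mul_le_mul (pow_le_one₀ hz.1.le hz.2) (hB _) (norm_nonneg _) zero_le_one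
      _ = B := one_mul _
  have h1 := abs_integral_mul_le hφ hgm
  rw [integral_prod_symm (fun z : sphere (0 : Sp d) 1 × ℝ =>
    φ z.1 * (z.2 ^ (d - 1) * g (z.2 • (z.1 : Sp d)))) (hφ.integrable_mul hgm)] at h1
  refine h1.trans (mul_le_mul ?_ (Real.sqrt_le_sqrt ?_) (Real.sqrt_nonneg _) (norm_nonneg _))
  · rw [norm_lp_eq_sqrt, integral_fun_fst (fun θ => φ θ ^ 2)]
    simp [ν]
  · rw [integral_polar_prod hd0 hg2.aestronglyMeasurable]
    have hle : (surf d).prod ν ≤ (surf d).prod (volume.restrict (Ioi (0 : ℝ))) :=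
      Measure.prod_mono le_rfl (Measure.restrict_mono Ioc_subset_Ioi_self le_rfl)
    have hi := integrable_polar hd0 hg2
    have hnn : 0 ≤ᵐ[(surf d).prod (volume.restrict (Ioi (0 : ℝ)))]
        fun z : sphere (0 : Sp d) 1 × ℝ => z.2 ^ (d - 1) * g (z.2 • (z.1 : Sp d)) ^ 2 := by
      have : ∀ᵐ z ∂((surf d).prod (volume.restrict (Ioi (0 : ℝ)))), z.2 ∈ Ioi (0 : ℝ) :=
        Measure.quasiMeasurePreserving_snd.ae (ae_restrict_mem measurableSet_Ioi)
      filter_upwards [this] with z hz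
      exact mul_nonneg (pow_nonneg hz.out.le _) (sq_nonneg _)
    refine le_trans ?_ (integral_mono_measure hle hnn hi)
    refine integral_mono_ae hgm.integrable_sq (hi.mono_measure hle) ?_
    filter_upwards [hν] with z hz
    rw [mul_pow]
    refine mul_le_mul_of_nonneg_right ?_ (sq_nonneg _)
    rw [sq]
    exact mul_le_of_le_one_left (pow_nonneg hz.1.le _) (pow_le_one₀ hz.1.le hz.2)

end

/-! ### The Poincaré inequality by testing with dilated fields -/

section

variable {d : ℕ} {D : Set (Sp d)}

theorem integral_dilation {g : Sp d → ℝ} (hd : 0 < d) (hg : ContDiff ℝ ∞ g) (x : Sp d) :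
    ∫ t in Ioc (0 : ℝ) 1, t ^ (d - 1) * (d * g (t • x) + t * fderiv ℝ g (t • x) x) = g x := by
  have hc : Continuous fun t : ℝ => t ^ (d - 1) * (d * g (t • x) + t * fderiv ℝ g (t • x) x) := by
    have h1 := hg.continuous
    have h2 : Continuous fun t : ℝ => fderiv ℝ g (t • x) :=
      (hg.continuous_fderiv (by simp)).comp (by fun_prop)
    have h3 := h2.clm_apply (continuous_const (y := x))
    fun_prop
  rw [← intervalIntegral.integral_of_le zero_le_one,
    intervalIntegral.integral_eq_sub_of_hasDerivAt (fun t _ => hasDerivAt_dilation hg x t)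
      (hc.intervalIntegrable _ _)]
  simp [hd.ne']

/-- For `t ≤ 1` the support of `g(t ·)` is pushed outwards. It can leave `D` only through the outer
boundary, so the field is admissible in Green's formula on the shell too. -/
theorem tsupport_dilation (hD : Admissible D) {g : Sp d → ℝ}
    (hs : tsupport g ⊆ D) {t : ℝ} (ht : 0 < t) (ht1 : t ≤ 1) (i : Fin d) :
    tsupport (fun y : Sp d => y i * g (t • y)) ⊆ D ∪ (unitBall d)ᶜ := by
  have h1 : tsupport (fun y : Sp d => y i * g (t • y)) ⊆ (fun y : Sp d => t • y) ⁻¹' tsupport g := by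
    refine closure_minimal ?_ ((isClosed_tsupport g).preimage (by fun_prop))
    intro y hy
    refine subset_tsupport g ?_
    simp only [Function.mem_support] at hy ⊢
    exact right_ne_zero_of_mul hy
  intro y hy
  have := hD.dilate _ (hs (h1 hy)) t⁻¹ ((one_le_inv₀ ht).2 ht1)
  simpa [smul_smul, ht.ne'] using this

/-- Testing an `H¹` function against a smooth function that is compactly supported in `D`. -/
theorem IsH1.abs_integral_le (hd : 2 ≤ d) (hD : Admissible D) {u : L2 D} {G : L2Vec D}
    {φ : L2Sphere d} (h : IsH1 D u G φ) {g : Sp d → ℝ} (hg : ContDiff ℝ ∞ g)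
    (hc : HasCompactSupport g) (hs : tsupport g ⊆ D) :
    |∫ x in D, u x * g x| ≤ (‖G‖ + ‖φ‖) * √(∫ x, g x ^ 2) := by
  have hd0 : 0 < d := by omega
  have := hD.isFiniteMeasure
  have hgc := hg.continuous
  set k : ℝ → Sp d → ℝ := fun t x => t ^ (d - 1) * (d * g (t • x) + t * fderiv ℝ g (t • x) x)
  have hkc : Continuous fun z : Sp d × ℝ => k z.2 z.1 := by
    have h2 : Continuous fun z : Sp d × ℝ => fderiv ℝ g (z.2 • z.1) :=
      (hg.continuous_fderiv (by simp)).comp (by fun_prop)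
    have h3 := h2.clm_apply continuous_fst
    simp only [k]
    fun_prop
  obtain ⟨B, hB⟩ := ((isCompact_closedBall (0 : Sp d) 1).prod
    (isCompact_Icc (a := (0 : ℝ)) (b := 1))).exists_bound_of_continuousOn hkc.continuousOn
  set μ : Measure (Sp d) := (volume : Measure (Sp d)).restrict D with hμ
  set ν : Measure ℝ := volume.restrict (Ioc (0 : ℝ) 1) with hν
  have hu : Integrable u μ := (Lp.memLp u).integrable (by norm_num)
  have hkint : Integrable (fun z : Sp d × ℝ => u z.1 * k z.2 z.1) (μ.prod ν) := by
    refine (hu.comp_fst ν).mul_bdd (c := B) hkc.aestronglyMeasurable ?_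
    have e1 : ∀ᵐ z ∂(μ.prod ν), z.2 ∈ Ioc (0 : ℝ) 1 :=
      Measure.quasiMeasurePreserving_snd.ae (ae_restrict_mem measurableSet_Ioc)
    have e2 : ∀ᵐ z ∂(μ.prod ν), z.1 ∈ D :=
      Measure.quasiMeasurePreserving_fst.ae (ae_restrict_mem hD.measurableSet)
    filter_upwards [e1, e2] with z h1 h2
    exact hB z ⟨by simpa using (hD.norm_lt h2).le, Ioc_subset_Icc_self h1⟩
  -- Green's formula for the field `y g(ty)`. On the unit sphere its normal component is `g(tθ)`, as
  -- `∑ θ_i² = 1`.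
  have hgreen : ∀ t ∈ Ioc (0 : ℝ) 1, (∫ x, u x * k t x ∂μ) =
      (∫ θ, φ θ * (t ^ (d - 1) * g (t • (θ : Sp d))) ∂(surf d))
        - ∫ x, ⟪G x, x⟫_ℝ * (t ^ (d - 1) * g (t • x)) ∂μ := by
    intro t ht
    have hsm : ∀ i : Fin d, ContDiff ℝ ∞ fun y : Sp d => y i * g (t • y) := by
      intro i
      exact (EuclideanSpace.proj (𝕜 := ℝ) i : Sp d →L[ℝ] ℝ).contDiff.mul
        (hg.comp (contDiff_const_smul t))
    have := h.green hD (Ψ := fun i y => y i * g (t • y)) hsm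
      (tsupport_dilation hD hs ht.1 ht.2)
    simp_rw [divergence_dilation hg] at this
    have e1 : (∫ x, u x * k t x ∂μ)
        = t ^ (d - 1) * ∫ x, u x * (d * g (t • x) + t * fderiv ℝ g (t • x) x) ∂μ := by
      rw [← integral_const_mul]
      refine integral_congr_ae (Filter.Eventually.of_forall fun x => ?_)
      simp only [k]; ring
    have e2 : (∫ x, ⟪G x, x⟫_ℝ * (t ^ (d - 1) * g (t • x)) ∂μ)
        = t ^ (d - 1) * ∫ x, ∑ i, G x i * (x i * g (t • x)) ∂μ := by
      rw [← integral_const_mul]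
      refine integral_congr_ae (Filter.Eventually.of_forall fun x => ?_)
      simp only [PiLp.inner_apply, RCLike.inner_apply, conj_trivial, Finset.sum_mul,
        Finset.mul_sum]
      exact Finset.sum_congr rfl fun i _ => by ring
    have e3 : (∫ θ, φ θ * (t ^ (d - 1) * g (t • (θ : Sp d))) ∂(surf d))
        = t ^ (d - 1) * ∫ θ, φ θ * ∑ i, (θ : Sp d) i * g (t • (θ : Sp d)) * (θ : Sp d) i
            ∂(surf d) := by
      rw [← integral_const_mul]
      refine integral_congr_ae (Filter.Eventually.of_forall fun θ => ?_)
      have hθ : ∑ i, (θ : Sp d) i * g (t • (θ : Sp d)) * (θ : Sp d) i = g (t • (θ : Sp d)) := by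
        have h1 : ∑ i, (θ : Sp d) i ^ 2 = 1 := by
          rw [← EuclideanSpace.real_norm_sq_eq]; simp
        calc _ = (∑ i, (θ : Sp d) i ^ 2) * g (t • (θ : Sp d)) := by
              rw [Finset.sum_mul]
              exact Finset.sum_congr rfl fun i _ => by ring
          _ = _ := by rw [h1, one_mul]
      beta_reduce
      rw [hθ]; ring
    rw [e1, e2, e3, ← this]
    ring
  have hswap : ∫ x, u x * g x ∂μ = ∫ t, (∫ x, u x * k t x ∂μ) ∂ν := by
    rw [← integral_prod_symm _ hkint, integral_prod _ hkint]
    refine integral_congr_ae (Filter.Eventually.of_forall fun x => ?_)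
    have := integral_dilation hd0 hg x
    simp only [k]
    rw [integral_const_mul, this]
  have hsphere := abs_integral_sphere_le hd φ hgc hc
  obtain ⟨hm, hGle⟩ := integral_inner_id_sq_le hD G
  have hg2 : ∀ t ∈ Ioc (0 : ℝ) 1,
      |∫ x, ⟪G x, x⟫_ℝ * (t ^ (d - 1) * g (t • x)) ∂μ| ≤ ‖G‖ * √(∫ x, g x ^ 2) := by
    intro t ht
    have hcs : HasCompactSupport fun x => t ^ (d - 1) * g (t • x) :=
      HasCompactSupport.mul_left (hc.comp_homeomorph (Homeomorph.smulOfNeZero t ht.1.ne'))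
    have hcc : Continuous fun x : Sp d => t ^ (d - 1) * g (t • x) := by fun_prop
    have hml : MemLp (fun x => t ^ (d - 1) * g (t • x)) 2 (volume : Measure (Sp d)) :=
      hcc.memLp_of_hasCompactSupport hcs
    refine (abs_integral_mul_le hm (hml.restrict D)).trans
      (mul_le_mul hGle (Real.sqrt_le_sqrt ?_) (Real.sqrt_nonneg _) (norm_nonneg _))
    refine le_trans ?_ (integral_smul_sq_le hd (g := g) ht.1 ht.2)
    exact setIntegral_le_integral hml.integrable_sq
      (Filter.Eventually.of_forall fun x => sq_nonneg _)
  have hi1 : Integrable (fun t => ∫ x, u x * k t x ∂μ) ν := hkint.integral_prod_right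
  have hi2 : Integrable (fun t => ∫ θ, φ θ * (t ^ (d - 1) * g (t • (θ : Sp d))) ∂(surf d)) ν := by
    obtain ⟨B', hB'⟩ := hc.exists_bound_of_continuous hgc
    have hφ : Integrable φ (surf d) := (Lp.memLp φ).integrable (by norm_num)
    have : Integrable (fun z : sphere (0 : Sp d) 1 × ℝ =>
        φ z.1 * (z.2 ^ (d - 1) * g (z.2 • (z.1 : Sp d)))) ((surf d).prod ν) := by
      refine (hφ.comp_fst ν).mul_bdd (c := B') (by fun_prop) ?_
      have e1 : ∀ᵐ z ∂((surf d).prod ν), z.2 ∈ Ioc (0 : ℝ) 1 :=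
        Measure.quasiMeasurePreserving_snd.ae (ae_restrict_mem measurableSet_Ioc)
      filter_upwards [e1] with z hz
      rw [norm_mul, norm_pow, Real.norm_eq_abs, abs_of_pos hz.1]
      calc _ ≤ 1 * B' := by
            refine mul_le_mul (pow_le_one₀ hz.1.le hz.2) (hB' _) (norm_nonneg _) zero_le_one
        _ = B' := one_mul _
    exact this.integral_prod_right
  -- The gradient term is written as a difference of the two integrals already under control.
  -- `hgreen` then bounds it pointwise in `t`.
  have hsub : ∫ t, (∫ x, u x * k t x ∂μ) ∂ν =
      (∫ t, (∫ θ, φ θ * (t ^ (d - 1) * g (t • (θ : Sp d))) ∂(surf d)) ∂ν)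
        - ∫ t, ((∫ θ, φ θ * (t ^ (d - 1) * g (t • (θ : Sp d))) ∂(surf d))
          - ∫ x, u x * k t x ∂μ) ∂ν := by
    rw [integral_sub hi2 hi1]; ring
  rw [hswap, hsub]
  refine (abs_sub _ _).trans ?_
  rw [add_mul, add_comm (‖G‖ * _)]
  refine add_le_add hsphere ?_
  rw [← Real.norm_eq_abs, hν]
  refine (norm_setIntegral_le_of_norm_le_const (C := ‖G‖ * √(∫ x, g x ^ 2)) (by simp)
    fun t ht => ?_).trans ?_
  · rw [hgreen t ht, sub_sub_cancel, Real.norm_eq_abs]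
    exact hg2 t ht
  · simp

/-- Smooth functions with compact support in `D`, as a subspace of `L²(D)`. -/
def testSpace (D : Set (Sp d)) : Submodule ℝ (L2 D) where
  carrier := {w | ∃ g : Sp d → ℝ, ContDiff ℝ ∞ g ∧ HasCompactSupport g ∧ tsupport g ⊆ D ∧
    w =ᵐ[(volume : Measure (Sp d)).restrict D] g}
  add_mem' := by
    rintro v w ⟨f, f1, f2, f3, f4⟩ ⟨g, g1, g2, g3, g4⟩
    refine ⟨fun x => f x + g x, f1.add g1, f2.add g2,
      (tsupport_add f g).trans (union_subset f3 g3), ?_⟩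
    filter_upwards [Lp.coeFn_add v w, f4, g4] with x h1 h2 h3
    rw [h1, Pi.add_apply, h2, h3]
  zero_mem' := by
    refine ⟨fun _ => 0, contDiff_const, HasCompactSupport.zero, by simp [tsupport], ?_⟩
    exact Lp.coeFn_zero _ _ _
  smul_mem' := by
    rintro c w ⟨g, g1, g2, g3, g4⟩
    refine ⟨fun x => c * g x, contDiff_const.mul g1, g2.mul_left,
      (tsupport_mul_subset_right).trans g3, ?_⟩
    filter_upwards [Lp.coeFn_smul c w, g4] with x h1 h2
    rw [h1, Pi.smul_apply, h2, smul_eq_mul]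

/-- A function orthogonal to all test functions vanishes almost everywhere by the fundamental lemma
of the calculus of variations. -/
theorem dense_testSpace (hD : Admissible D) : (testSpace D).topologicalClosure = ⊤ := by
  rw [Submodule.topologicalClosure_eq_top_iff, Submodule.eq_bot_iff]
  intro v hv
  have := hD.isFiniteMeasure
  have hvi : IntegrableOn v D := (Lp.memLp v).integrable (by norm_num)
  have := hD.isOpen.ae_eq_zero_of_integral_contDiff_smul_eq_zero hvi.locallyIntegrableOn
    (fun g g1 g2 g3 => ?_)
  · rw [Lp.eq_zero_iff_ae_eq_zero]
    exact (ae_restrict_iff' hD.measurableSet).2 this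
  · have hgm : MemLp g 2 ((volume : Measure (Sp d)).restrict D) :=
      (g1.continuous.memLp_of_hasCompactSupport g2)
    have hw : hgm.toLp g ∈ testSpace D := ⟨g, g1, g2, g3, hgm.coeFn_toLp⟩
    have h0 := hv _ hw
    rw [L2.inner_def] at h0
    rw [← h0, ← setIntegral_eq_integral_of_forall_compl_eq_zero (s := D)]
    · refine integral_congr_ae ?_
      filter_upwards [hgm.coeFn_toLp] with x hx
      rw [hx]
      simp [mul_comm]
    · intro x hx
      rw [image_eq_zero_of_notMem_tsupport (fun h => hx (g3 h)), zero_smul]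

/-- The Poincaré inequality. -/
theorem IsH1.norm_le (hd : 2 ≤ d) (hD : Admissible D) {u : L2 D} {G : L2Vec D}
    {φ : L2Sphere d} (h : IsH1 D u G φ) : ‖u‖ ≤ ‖G‖ + ‖φ‖ := by
  have key : ∀ w : L2 D, |⟪u, w⟫_ℝ| ≤ (‖G‖ + ‖φ‖) * ‖w‖ := by
    intro w
    have hw : w ∈ closure (testSpace D : Set (L2 D)) := by
      have : w ∈ (testSpace D).topologicalClosure := by rw [dense_testSpace hD]; trivial
      exact this
    refine closure_minimal (s := (testSpace D : Set (L2 D)))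
      (t := {w | |⟪u, w⟫_ℝ| ≤ (‖G‖ + ‖φ‖) * ‖w‖}) ?_ (isClosed_le (by fun_prop) (by fun_prop)) hw
    rintro w ⟨g, g1, g2, g3, g4⟩
    have h1 := h.abs_integral_le hd hD g1 g2 g3
    have e1 : ⟪u, w⟫_ℝ = ∫ x in D, u x * g x := by
      rw [L2.inner_def]
      refine integral_congr_ae ?_
      filter_upwards [g4] with x hx
      rw [hx]; simp [mul_comm]
    have e2 : ‖w‖ = √(∫ x, g x ^ 2) := by
      rw [norm_lp_eq_sqrt,
        ← setIntegral_eq_integral_of_forall_compl_eq_zero (s := D) (f := fun x => g x ^ 2)]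
      · congr 1
        refine integral_congr_ae ?_
        filter_upwards [g4] with x hx
        rw [hx]
      · intro x hx
        rw [image_eq_zero_of_notMem_tsupport (fun h => hx (g3 h))]; simp
    simp only [mem_ofPred_eq]
    rw [e1, e2]
    exact h1
  -- The bound by duality, extended to all of `L²(D)` by density, is used with `w = u`.
  have := key u
  rw [real_inner_self_eq_norm_sq, abs_of_nonneg (sq_nonneg _), sq] at this
  by_cases h0 : ‖u‖ = 0
  · rw [h0]; positivity
  · exact le_of_mul_le_mul_right this (lt_of_le_of_ne (norm_nonneg _) (Ne.symm h0))

end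

section

variable {d : ℕ} {D : Set (Sp d)}

/-! ### Closedness of the spaces of gradients -/

theorem continuous_integral_mul {α : Type*} [MeasurableSpace α] {μ : Measure α} {f : α → ℝ}
    (hf : MemLp f 2 μ) : Continuous fun u : Lp ℝ 2 μ => ∫ x, u x * f x ∂μ := by
  have : (fun u : Lp ℝ 2 μ => ∫ x, u x * f x ∂μ) = fun u => ⟪u, hf.toLp f⟫_ℝ := by
    ext u
    rw [L2.inner_def]
    refine integral_congr_ae ?_
    filter_upwards [hf.coeFn_toLp] with x hx
    rw [hx]; simp [mul_comm]
  rw [this]; fun_prop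

theorem continuous_integral_coord_mul {μ : Measure (Sp d)} {f : Sp d → ℝ}
    (hf : MemLp f 2 μ) (i : Fin d) :
    Continuous fun G : Lp (Sp d) 2 μ => ∫ x, G x i * f x ∂μ := by
  have hm : MemLp (fun x => f x • (EuclideanSpace.single i 1 : Sp d)) 2 μ :=
    ((ContinuousLinearMap.id ℝ ℝ).smulRight (EuclideanSpace.single i 1 : Sp d)).comp_memLp' hf
  have : (fun G : Lp (Sp d) 2 μ => ∫ x, G x i * f x ∂μ) = fun G => ⟪G, hm.toLp _⟫_ℝ := by
    ext G
    rw [L2.inner_def]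
    refine integral_congr_ae ?_
    filter_upwards [hm.coeFn_toLp] with x hx
    rw [hx, real_inner_smul_right, EuclideanSpace.inner_single_right]
    simp [mul_comm]
  rw [this]; fun_prop

/-- The graph of `(trace, gradient)` in `L²` is closed. -/
theorem IsH1.of_tendsto {u : ℕ → L2 D} {G : ℕ → L2Vec D} {φ : ℕ → L2Sphere d}
    {u₀ : L2 D} {G₀ : L2Vec D} {φ₀ : L2Sphere d}
    (h : ∀ n, IsH1 D (u n) (G n) (φ n)) (hu : Filter.Tendsto u Filter.atTop (nhds u₀))
    (hG : Filter.Tendsto G Filter.atTop (nhds G₀))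
    (hφ : Filter.Tendsto φ Filter.atTop (nhds φ₀)) : IsH1 D u₀ G₀ φ₀ := by
  intro ψ hψ hc hs i
  have h1 := (((continuous_integral_mul
    (((continuous_aux hψ i).memLp_of_hasCompactSupport (compactSupport_aux hc i) :
      MemLp _ 2 ((volume : Measure (Sp d)).restrict D)))).tendsto u₀).comp hu)
  have h2 := ((continuous_integral_coord_mul
    ((hψ.continuous.memLp_of_hasCompactSupport hc :
      MemLp _ 2 ((volume : Measure (Sp d)).restrict D))) i).tendsto G₀).comp hG
  have h3 := ((continuous_integral_mul
    (((continuous_aux_sphere hψ i).memLp_of_hasCompactSupport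
      (HasCompactSupport.of_compactSpace _) : MemLp _ 2 (surf d)))).tendsto φ₀).comp hφ
  refine tendsto_nhds_unique (h1.add h2) (h3.congr fun n => ?_)
  exact (h n ψ hψ hc hs i).symm

theorem IsH1.sub {u v : L2 D} {G F : L2Vec D} {φ χ : L2Sphere d}
    (hu : IsH1 D u G φ) (hv : IsH1 D v F χ) : IsH1 D (u - v) (G - F) (φ - χ) := by
  have := hu.add (hv.smul (-1))
  simpa [sub_eq_add_neg] using this

/-- By the Poincaré inequality, convergence of gradients and traces makes the functions themselves
Cauchy. This is what makes the spaces of gradients and of trace–gradient pairs complete. -/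
theorem exists_isH1_of_tendsto (hd : 2 ≤ d) (hD : Admissible D) {G : ℕ → L2Vec D}
    {φ : ℕ → L2Sphere d} {G₀ : L2Vec D} {φ₀ : L2Sphere d} (h : ∀ n, ∃ u, IsH1 D u (G n) (φ n))
    (hG : Filter.Tendsto G Filter.atTop (nhds G₀))
    (hφ : Filter.Tendsto φ Filter.atTop (nhds φ₀)) : ∃ u, IsH1 D u G₀ φ₀ := by
  choose u hu using h
  have hc : CauchySeq u := by
    have h1 := Metric.cauchySeq_iff.1 hG.cauchySeq
    have h2 := Metric.cauchySeq_iff.1 hφ.cauchySeq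
    refine Metric.cauchySeq_iff.2 fun ε hε => ?_
    obtain ⟨n1, hn1⟩ := h1 (ε / 2) (by positivity)
    obtain ⟨n2, hn2⟩ := h2 (ε / 2) (by positivity)
    refine ⟨max n1 n2, fun m hm n hn => ?_⟩
    have e1 := hn1 m (le_of_max_le_left hm) n (le_of_max_le_left hn)
    have e2 := hn2 m (le_of_max_le_right hm) n (le_of_max_le_right hn)
    have e3 := ((hu m).sub (hu n)).norm_le hd hD
    rw [dist_eq_norm] at e1 e2 ⊢
    linarith
  obtain ⟨u₀, hu₀⟩ := cauchySeq_tendsto_of_complete hc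
  exact ⟨u₀, IsH1.of_tendsto hu hu₀ hG hφ⟩

/-- Gradients of `H¹` functions with zero trace. -/
def zeroTraceGrad (D : Set (Sp d)) : Submodule ℝ (L2Vec D) where
  carrier := {F | ∃ v : L2 D, IsH1 D v F 0}
  add_mem' := by
    rintro F G ⟨u, hu⟩ ⟨v, hv⟩
    exact ⟨u + v, by simpa using hu.add hv⟩
  zero_mem' := ⟨0, IsH1.zero⟩
  smul_mem' := by
    rintro c F ⟨u, hu⟩
    exact ⟨c • u, by simpa using hu.smul c⟩

theorem isClosed_zeroTraceGrad (hd : 2 ≤ d) (hD : Admissible D) :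
    IsClosed (zeroTraceGrad D : Set (L2Vec D)) := by
  refine IsSeqClosed.isClosed fun G G₀ hG hlim => ?_
  exact exists_isH1_of_tendsto hd hD (φ := fun _ => 0) hG hlim tendsto_const_nhds

theorem isClosed_traceGrad (hd : 2 ≤ d) :
    IsClosed (traceGrad d : Set (WithLp 2 (L2Sphere d × L2Vec (unitBall d)))) := by
  refine IsSeqClosed.isClosed fun p p₀ hp hlim => ?_
  exact exists_isH1_of_tendsto hd admissible_unitBall (G := fun n => (p n).snd)
    (φ := fun n => (p n).fst) hp
    (((WithLp.sndL 2 ℝ (L2Sphere d) (L2Vec (unitBall d))).continuous.tendsto p₀).comp hlim)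
    (((WithLp.fstL 2 ℝ (L2Sphere d) (L2Vec (unitBall d))).continuous.tendsto p₀).comp hlim)

/-! ### Multiplication and restriction operators -/

section operators

variable {A : Sp d → ℝ} {m M : ℝ}

theorem memLp_smul (hD : Admissible D) (hA : Measurable A) (hM : ∀ x ∈ D, |A x| ≤ M)
    (F : L2Vec D) : MemLp (fun x => A x • F x) 2 ((volume : Measure (Sp d)).restrict D) := by
  refine (Lp.memLp F).of_le_mul (c := M)
    (hA.aestronglyMeasurable.smul (Lp.aestronglyMeasurable F)) ?_
  filter_upwards [ae_restrict_mem hD.measurableSet] with x hx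
  rw [norm_smul]
  exact mul_le_mul_of_nonneg_right (hM x hx) (norm_nonneg _)

/-- Multiplication by a bounded function. -/
def mulOp (hD : Admissible D) (hA : Measurable A) (hM : ∀ x ∈ D, |A x| ≤ M) :
    L2Vec D →L[ℝ] L2Vec D :=
  LinearMap.mkContinuous
    { toFun := fun F => (memLp_smul hD hA hM F).toLp _
      map_add' := fun F G => by
        ext1
        filter_upwards [(memLp_smul hD hA hM F).coeFn_toLp, (memLp_smul hD hA hM G).coeFn_toLp,
          (memLp_smul hD hA hM (F + G)).coeFn_toLp, Lp.coeFn_add F G,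
          Lp.coeFn_add ((memLp_smul hD hA hM F).toLp _) ((memLp_smul hD hA hM G).toLp _)]
          with x h1 h2 h3 h4 h5
        rw [h3, h5, Pi.add_apply, h1, h2, h4, Pi.add_apply, smul_add]
      map_smul' := fun c F => by
        ext1
        filter_upwards [(memLp_smul hD hA hM F).coeFn_toLp,
          (memLp_smul hD hA hM (c • F)).coeFn_toLp, Lp.coeFn_smul c F,
          Lp.coeFn_smul c ((memLp_smul hD hA hM F).toLp _)] with x h1 h2 h3 h4
        rw [h2, h3, RingHom.id_apply, h4, Pi.smul_apply, Pi.smul_apply, h1, smul_comm] }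
    M fun F => by
      refine Lp.norm_le_mul_norm_of_ae_le_mul ?_
      filter_upwards [(memLp_smul hD hA hM F).coeFn_toLp,
        ae_restrict_mem hD.measurableSet] with x h1 hx
      simp only [LinearMap.coe_mk, AddHom.coe_mk]
      rw [h1, norm_smul]
      exact mul_le_mul_of_nonneg_right (hM x hx) (norm_nonneg _)

theorem inner_mulOp (hD : Admissible D) (hA : Measurable A) (hM : ∀ x ∈ D, |A x| ≤ M)
    (F G : L2Vec D) : ⟪mulOp hD hA hM F, G⟫_ℝ = ∫ x in D, A x * ⟪F x, G x⟫_ℝ := by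
  rw [L2.inner_def]
  refine integral_congr_ae ?_
  filter_upwards [(memLp_smul hD hA hM F).coeFn_toLp] with x h1
  have : (mulOp hD hA hM F) x = A x • F x := h1
  rw [this, real_inner_smul_left]

theorem volume_restrict_le (hD : Admissible D) :
    (volume : Measure (Sp d)).restrict D ≤ volume.restrict (unitBall d) :=
  Measure.restrict_mono hD.subset le_rfl

/-- Restriction of functions on the ball to `D`. -/
def restrictLp {E : Type*} [NormedAddCommGroup E] [NormedSpace ℝ E] (hD : Admissible D)
    (u : Lp E 2 ((volume : Measure (Sp d)).restrict (unitBall d))) :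
    Lp E 2 ((volume : Measure (Sp d)).restrict D) :=
  ((Lp.memLp u).mono_measure (volume_restrict_le hD)).toLp u

theorem restrictLp_ae {E : Type*} [NormedAddCommGroup E] [NormedSpace ℝ E] (hD : Admissible D)
    (u : Lp E 2 ((volume : Measure (Sp d)).restrict (unitBall d))) :
    restrictLp hD u =ᵐ[(volume : Measure (Sp d)).restrict D] u :=
  MemLp.coeFn_toLp _

theorem norm_restrictLp_le {E : Type*} [NormedAddCommGroup E] [NormedSpace ℝ E]
    (hD : Admissible D) (u : Lp E 2 ((volume : Measure (Sp d)).restrict (unitBall d))) :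
    ‖restrictLp hD u‖ ≤ ‖u‖ := by
  rw [restrictLp, Lp.norm_toLp, Lp.norm_def]
  exact ENNReal.toReal_mono (Lp.eLpNorm_ne_top u) (eLpNorm_mono_measure _ (volume_restrict_le hD))

/-- Restriction of vector fields, as an operator. -/
def restrictOp (hD : Admissible D) : L2Vec (unitBall d) →L[ℝ] L2Vec D :=
  LinearMap.mkContinuous
    { toFun := restrictLp hD
      map_add' := fun F G => by
        ext1
        have h := (volume_restrict_le hD).absolutelyContinuous.ae_le (Lp.coeFn_add F G)
        filter_upwards [restrictLp_ae hD F, restrictLp_ae hD G, restrictLp_ae hD (F + G), h,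
          Lp.coeFn_add (restrictLp hD F) (restrictLp hD G)] with x h1 h2 h3 h4 h5
        rw [h3, h5, Pi.add_apply, h1, h2, h4, Pi.add_apply]
      map_smul' := fun c F => by
        ext1
        have h := (volume_restrict_le hD).absolutelyContinuous.ae_le (Lp.coeFn_smul c F)
        filter_upwards [restrictLp_ae hD F, restrictLp_ae hD (c • F), h,
          Lp.coeFn_smul c (restrictLp hD F)] with x h1 h2 h3 h4
        rw [h2, h3, RingHom.id_apply, h4, Pi.smul_apply, Pi.smul_apply, h1] }
    1 fun F => by
      rw [one_mul]
      exact norm_restrictLp_le hD F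

theorem restrictOp_ae (hD : Admissible D) (F : L2Vec (unitBall d)) :
    restrictOp hD F =ᵐ[(volume : Measure (Sp d)).restrict D] F := restrictLp_ae hD F

theorem setIntegral_ball_eq (hD : Admissible D) {f : Sp d → ℝ}
    (hf : ∀ x ∈ unitBall d \ D, f x = 0) : ∫ x in unitBall d, f x = ∫ x in D, f x :=
  setIntegral_eq_of_subset_of_forall_sdiff_eq_zero isOpen_ball.measurableSet hD.subset hf

/-- The restriction to `D` of an `H¹` function on the ball. -/
theorem IsH1.restrict (hD : Admissible D) {u : L2 (unitBall d)} {G : L2Vec (unitBall d)}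
    {φ : L2Sphere d} (h : IsH1 (unitBall d) u G φ) :
    IsH1 D (restrictLp hD u) (restrictOp hD G) φ := by
  intro ψ hψ hc hs i
  have h0 : ∀ x ∈ unitBall d \ D, x ∉ tsupport ψ := by
    intro x hx hx'
    rcases hs hx' with h1 | h1
    · exact hx.2 h1
    · exact h1 hx.1
  rw [← h ψ hψ hc (by rw [union_compl_self]; exact subset_univ _) i,
    setIntegral_ball_eq hD (f := fun x => u x * fderiv ℝ ψ x (EuclideanSpace.single i 1)),
    setIntegral_ball_eq hD (f := fun x => G x i * ψ x)]
  · congr 1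
    · refine integral_congr_ae ?_
      filter_upwards [restrictLp_ae hD u] with x hx
      rw [hx]
    · refine integral_congr_ae ?_
      filter_upwards [restrictOp_ae hD G] with x hx
      rw [hx]
  · intro x hx
    rw [image_eq_zero_of_notMem_tsupport (h0 x hx), mul_zero]
  · intro x hx
    have : fderiv ℝ ψ x = 0 := by
      by_contra h'
      exact h0 x hx (support_fderiv_subset ℝ h')
    rw [this]; simp

end operators

/-! ### Existence of Dirichlet-to-Neumann maps -/

/-- A bounded bilinear form that vanishes on a subspace descends to the quotient. -/
theorem exists_quotient_form {X : Type*} [NormedAddCommGroup X] [NormedSpace ℝ X]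
    (S : Submodule ℝ X) [IsClosed (S : Set X)] (β : X →L[ℝ] X →L[ℝ] ℝ)
    (h1 : ∀ x ∈ S, β x = 0) (h2 : ∀ x, ∀ y ∈ S, β x y = 0) :
    ∃ Λ : (X ⧸ S) →L[ℝ] StrongDual ℝ (X ⧸ S),
      ∀ x y, Λ (Submodule.Quotient.mk x) (Submodule.Quotient.mk y) = β x y := by
  let φ : X →ₗ[ℝ] (X ⧸ S) →ₗ[ℝ] ℝ :=
    { toFun := fun x => S.liftQ (β x : X →ₗ[ℝ] ℝ) fun y hy => by simpa using h2 x y hy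
      map_add' := fun x y => by ext z; simp
      map_smul' := fun c x => by ext z; simp }
  let f : (X ⧸ S) →ₗ[ℝ] (X ⧸ S) →ₗ[ℝ] ℝ :=
    S.liftQ φ fun x hx => by
      rw [LinearMap.mem_ker]
      ext z
      simp [φ, h1 x hx]
  have hf : ∀ x y, f (Submodule.Quotient.mk x) (Submodule.Quotient.mk y) = β x y := fun x y => by
    simp [f, φ]
  refine ⟨LinearMap.mkContinuous₂ f ‖β‖ fun x y => ?_, fun x y => by
    rw [LinearMap.mkContinuous₂_apply, hf]⟩
  -- The quotient norm is an infimum that need not be attained, so representatives within `ε` are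
  -- used and `ε` tends to `0`.
  have key : ∀ ε : ℝ, 0 < ε → ‖f x y‖ ≤ ‖β‖ * (‖x‖ + ε) * (‖y‖ + ε) := by
    intro ε hε
    obtain ⟨x', hx', hx⟩ := Submodule.Quotient.norm_mk_lt x hε
    obtain ⟨y', hy', hy⟩ := Submodule.Quotient.norm_mk_lt y hε
    rw [← hx', ← hy', hf]
    rw [← hx'] at hx
    rw [← hy'] at hy
    refine (β.le_opNorm₂ x' y').trans ?_
    gcongr
  have hlim : Filter.Tendsto (fun ε : ℝ => ‖β‖ * (‖x‖ + ε) * (‖y‖ + ε)) (nhdsWithin 0 (Ioi 0))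
      (nhds (‖β‖ * (‖x‖ + 0) * (‖y‖ + 0))) :=
    Filter.Tendsto.mono_left (Continuous.tendsto (by fun_prop) 0) nhdsWithin_le_nhds
  rw [add_zero, add_zero] at hlim
  exact ge_of_tendsto hlim (Filter.eventually_of_mem self_mem_nhdsWithin fun ε hε => key ε hε)

/-- The class in `H^{1/2}` of the trace of an `H¹` function on the ball. -/
def HHalf.mk {d : ℕ} (x : traceGrad d) : HHalf d := Submodule.Quotient.mk x

theorem HHalf.exists_mk {d : ℕ} (φ : HHalf d) : ∃ x, HHalf.mk x = φ :=
  Submodule.Quotient.mk_surjective _ φ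

theorem HHalf.toL2_mk {d : ℕ} (x : traceGrad d) : HHalf.toL2 d (HHalf.mk x) = x.1.fst := rfl

/-- Solvability of the weak Dirichlet problem and existence of the Dirichlet-to-Neumann map. -/
theorem exists_isDtN (hd : 2 ≤ d) (hD : Admissible D) {A : Sp d → ℝ} (hA : Measurable A)
    {m M : ℝ} (hm : 0 < m) (hmA : ∀ x ∈ D, m ≤ A x) (hM : ∀ x ∈ D, A x ≤ M) :
    ∃ Λ : HHalf d →L[ℝ] HMinusHalf d, IsDtN D A Λ := by
  have hM' : ∀ x ∈ D, |A x| ≤ M := fun x hx => by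
    rw [abs_of_nonneg (hm.le.trans (hmA x hx))]; exact hM x hx
  set T := mulOp hD hA hM' with hT
  set K := zeroTraceGrad D with hK
  have : CompleteSpace K := (isClosed_zeroTraceGrad hd hD).completeSpace_coe
  let B : K →L[ℝ] K →L[ℝ] ℝ := (innerSL ℝ).bilinearComp (T.comp K.subtypeL) K.subtypeL
  have hB : ∀ F G : K, B F G = ⟪T F, (G : L2Vec D)⟫_ℝ := fun F G => rfl
  have hTpos : ∀ F : L2Vec D, m * ‖F‖ * ‖F‖ ≤ ⟪T F, F⟫_ℝ := by
    intro F
    rw [hT, inner_mulOp, mul_assoc, ← real_inner_self_eq_norm_mul_norm, L2.inner_def,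
      ← integral_const_mul]
    have hi : Integrable (fun x => A x * ⟪F x, F x⟫_ℝ) ((volume : Measure (Sp d)).restrict D) := by
      refine (L2.integrable_inner (T F) F (𝕜 := ℝ)).congr ?_
      filter_upwards [(memLp_smul hD hA hM' F).coeFn_toLp] with x h1
      have : (T F) x = A x • F x := h1
      rw [this, real_inner_smul_left]
    refine integral_mono_ae ((L2.integrable_inner F F).const_mul m) hi ?_
    filter_upwards [ae_restrict_mem hD.measurableSet] with x hx
    exact mul_le_mul_of_nonneg_right (hmA x hx) real_inner_self_nonneg
  have hcoer : IsCoercive B := ⟨m, hm, fun F => by rw [hB]; exact hTpos F⟩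
  -- The projection onto `K` that is orthogonal for the form weighted by `A`, obtained from the
  -- Lax–Milgram isomorphism.
  let Pr : L2Vec D →L[ℝ] K :=
    (hcoer.continuousLinearEquivOfBilin.symm : K →L[ℝ] K).comp
      (K.orthogonalProjectionOnto.comp T)
  have hPr : ∀ (G : L2Vec D) (F : K), ⟪T (Pr G : L2Vec D), (F : L2Vec D)⟫_ℝ
      = ⟪T G, (F : L2Vec D)⟫_ℝ := by
    intro G F
    have h1 := hcoer.continuousLinearEquivOfBilin_apply (Pr G) F
    rw [← hB, ← h1]
    simp only [Pr, ContinuousLinearMap.comp_apply, ContinuousLinearEquiv.coe_coe,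
      ContinuousLinearEquiv.apply_symm_apply]
    rw [Submodule.inner_orthogonalProjectionOnto_eq_of_mem_right]
  let R : traceGrad d →L[ℝ] L2Vec D :=
    (restrictOp hD).comp ((WithLp.sndL 2 ℝ (L2Sphere d) (L2Vec (unitBall d))).comp
      (traceGrad d).subtypeL)
  have hR : ∀ x : traceGrad d, ∃ u, IsH1 D u (R x) x.1.fst := by
    rintro ⟨x, u, hu⟩
    exact ⟨_, hu.restrict hD⟩
  have hRker : ∀ x ∈ LinearMap.ker (traceMap d), R x ∈ K := by
    intro x hx
    obtain ⟨u, hu⟩ := hR x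
    have : x.1.fst = 0 := hx
    rw [this] at hu
    exact ⟨u, hu⟩
  -- The gradient of the weak solution: any extension of the boundary value, minus the part that is
  -- a gradient with zero trace.
  let Sol : traceGrad d →L[ℝ] L2Vec D := R - (K.subtypeL.comp Pr).comp R
  have hSol : ∀ x, ∀ F ∈ K, ⟪T (Sol x), F⟫_ℝ = 0 := by
    intro x F hF
    have := hPr (R x) ⟨F, hF⟩
    simp only [Sol, sub_apply, ContinuousLinearMap.comp_apply, map_sub,
      inner_sub_left, Submodule.subtypeL_apply]
    rw [this, sub_self]
  have hSolH : ∀ x, ∃ u, IsH1 D u (Sol x) x.1.fst := by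
    intro x
    obtain ⟨u, hu⟩ := hR x
    obtain ⟨v, hv⟩ := (Pr (R x)).2
    refine ⟨u - v, ?_⟩
    have := hu.sub hv
    rwa [sub_zero] at this
  have huniq : ∀ F ∈ K, (∀ F' ∈ K, ⟪T F, F'⟫_ℝ = 0) → F = 0 := by
    intro F hF h
    have h1 := hTpos F
    rw [h F hF, mul_assoc] at h1
    have h2 : ‖F‖ * ‖F‖ ≤ 0 := by
      by_contra! h3
      have := mul_pos hm h3
      linarith
    have h4 : ‖F‖ = 0 := by nlinarith [norm_nonneg F]
    exact norm_eq_zero.1 h4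
  -- In the second slot any extension may be used, since `T (Sol x)` is orthogonal to `K`. For the
  -- same reason `β` depends on `x` and `y` through their traces alone and descends to `H^{1/2}`.
  let β : traceGrad d →L[ℝ] traceGrad d →L[ℝ] ℝ := (innerSL ℝ).bilinearComp (T.comp Sol) R
  have hβ : ∀ x y, β x y = ⟪T (Sol x), R y⟫_ℝ := fun x y => rfl
  have := instIsClosedKerTrace d
  obtain ⟨Λ, hΛ⟩ := exists_quotient_form (LinearMap.ker (traceMap d)) β
    (fun x hx => by
      have h0 : Sol x = 0 := by
        refine huniq _ ?_ (hSol x)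
        simp only [Sol, sub_apply, ContinuousLinearMap.comp_apply,
          Submodule.subtypeL_apply]
        exact K.sub_mem (hRker x hx) (Pr (R x)).2
      ext y
      rw [hβ, h0]; simp)
    (fun x y hy => by rw [hβ, hSol x _ (hRker y hy)])
  refine ⟨Λ, fun φ => ?_⟩
  obtain ⟨x, rfl⟩ := HHalf.exists_mk φ
  rw [HHalf.toL2_mk]
  obtain ⟨u₀, hu₀⟩ := hSolH x
  refine ⟨⟨u₀, Sol x, hu₀, fun v F hF => ?_⟩, fun u G hG η v F hF => ?_⟩
  · rw [← inner_mulOp hD hA hM']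
    exact hSol x F ⟨v, hF⟩
  · obtain ⟨y, rfl⟩ := HHalf.exists_mk η
    rw [HHalf.toL2_mk] at hF
    obtain ⟨v', hv'⟩ := hR y
    -- `IsDtN` quantifies over all weak solutions, so uniqueness of the gradient is needed.
    have hGS : G = Sol x := by
      refine sub_eq_zero.1 (huniq _ ⟨u - u₀, by simpa using hG.1.sub hu₀⟩ fun F' hF' => ?_)
      obtain ⟨w, hw⟩ := hF'
      rw [map_sub, inner_sub_left, hSol x F' ⟨w, hw⟩, sub_zero, hT, inner_mulOp]
      exact hG.2 w F' hw
    have h1 : ⟪T G, F - R y⟫_ℝ = 0 := by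
      have := hF.sub hv'
      rw [sub_self] at this
      rw [hT, inner_mulOp]
      exact hG.2 _ _ this
    rw [inner_sub_right, sub_eq_zero] at h1
    rw [← inner_mulOp hD hA hM', ← hT, h1, hGS, ← hβ]
    exact hΛ x y

end

section

variable {d : ℕ} {D : Set (Sp d)}

/-! ### Polar coordinates in annuli -/

theorem integrable_polar_on (hd : 0 < d) {I : Set ℝ} (hI : MeasurableSet I) (hI0 : I ⊆ Ioi 0)
    {f : Sp d → ℝ} (hf : IntegrableOn f {x | ‖x‖ ∈ I}) :
    Integrable (fun z : sphere (0 : Sp d) 1 × ℝ => z.2 ^ (d - 1) * f (z.2 • (z.1 : Sp d)))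
      ((surf d).prod (volume.restrict I)) := by
  have hm : MeasurableSet {x : Sp d | ‖x‖ ∈ I} := measurable_norm hI
  have h1 := integrable_polar hd ((integrable_indicator_iff hm).2 hf)
  have hle : (surf d).prod (volume.restrict I) ≤ (surf d).prod (volume.restrict (Ioi (0 : ℝ))) :=
    Measure.prod_mono le_rfl (Measure.restrict_mono hI0 le_rfl)
  refine (h1.mono_measure hle).congr ?_
  have e1 : ∀ᵐ z ∂((surf d).prod (volume.restrict I)), z.2 ∈ I :=
    Measure.quasiMeasurePreserving_snd.ae (ae_restrict_mem hI)
  filter_upwards [e1] with z hz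
  rw [indicator_of_mem]
  have : 0 < z.2 := hI0 hz
  simpa [norm_smul, abs_of_pos this] using hz

theorem integral_polar_on (hd : 0 < d) {I : Set ℝ} (hI : MeasurableSet I) (hI0 : I ⊆ Ioi 0)
    {f : Sp d → ℝ} (hf : IntegrableOn f {x | ‖x‖ ∈ I}) :
    ∫ x in {x | ‖x‖ ∈ I}, f x = ∫ z, z.2 ^ (d - 1) * f (z.2 • (z.1 : Sp d))
      ∂((surf d).prod (volume.restrict I)) := by
  have hm : MeasurableSet {x : Sp d | ‖x‖ ∈ I} := measurable_norm hI
  have hi := (integrable_indicator_iff hm).2 hf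
  rw [← integral_indicator hm, integral_polar_prod hd hi.aestronglyMeasurable]
  have hm2 : MeasurableSet {z : sphere (0 : Sp d) 1 × ℝ | z.2 ∈ I} := measurable_snd hI
  have hr : (surf d).prod (volume.restrict I)
      = ((surf d).prod (volume.restrict (Ioi (0 : ℝ)))).restrict {z | z.2 ∈ I} := by
    have : {z : sphere (0 : Sp d) 1 × ℝ | z.2 ∈ I} = univ ×ˢ I := by ext; simp
    rw [this, ← Measure.prod_restrict, Measure.restrict_univ, Measure.restrict_restrict hI,
      inter_eq_left.2 hI0]
  rw [hr, ← integral_indicator hm2]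
  refine integral_congr_ae ?_
  have : ∀ᵐ z ∂((surf d).prod (volume.restrict (Ioi (0 : ℝ)))), z.2 ∈ Ioi (0 : ℝ) :=
    Measure.quasiMeasurePreserving_snd.ae (ae_restrict_mem measurableSet_Ioi)
  filter_upwards [this] with z hz
  have hz' : (0 : ℝ) < z.2 := hz
  have hn : ‖z.2 • (z.1 : Sp d)‖ = z.2 := by simp [norm_smul, abs_of_pos hz']
  by_cases h : z.2 ∈ I
  · rw [indicator_of_mem (by simpa only [mem_ofPred_eq, hn] using h),
      indicator_of_mem (show z ∈ {z : sphere (0 : Sp d) 1 × ℝ | z.2 ∈ I} from h)]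
  · rw [indicator_of_notMem (by simpa only [mem_ofPred_eq, hn] using h),
      indicator_of_notMem (show z ∉ {z : sphere (0 : Sp d) 1 × ℝ | z.2 ∈ I} from h), mul_zero]

theorem unitBall_ae_eq (hd : 0 < d) :
    ({x : Sp d | ‖x‖ ∈ Ioo (0 : ℝ) 1} : Set (Sp d)) =ᵐ[volume] unitBall d := by
  have hnt : Nontrivial (Sp d) := by
    have : Nonempty (Fin d) := ⟨⟨0, hd⟩⟩
    infer_instance
  have : ∀ᵐ x : Sp d, x ≠ 0 := by simp [ae_iff]
  refine Filter.eventuallyEq_set.2 ?_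
  filter_upwards [this] with x hx
  simp [unitBall, hx]

/-! ### The divergence theorem in the ball -/

/-- The divergence theorem for the field `g(x) x`, which is the fundamental theorem of calculus
along each ray. The general case is reduced to this one. -/
theorem integral_radial_ball (hd : 0 < d) {g : Sp d → ℝ} (hg : ContDiff ℝ ∞ g) :
    ∫ x in unitBall d, (d * g x + fderiv ℝ g x x) = ∫ θ, g (θ : Sp d) ∂(surf d) := by
  have hc : Continuous fun x => d * g x + fderiv ℝ g x x := by
    have h1 := hg.continuous
    have h3 := (hg.continuous_fderiv (by simp)).clm_apply continuous_id
    simp only [id] at h3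
    fun_prop
  have hi : IntegrableOn (fun x => d * g x + fderiv ℝ g x x) {x | ‖x‖ ∈ Ioo (0 : ℝ) 1} := by
    refine (hc.continuousOn.integrableOn_compact (isCompact_closedBall (0 : Sp d) 1)).mono_set ?_
    intro x hx
    simpa using hx.2.le
  rw [← setIntegral_congr_set (unitBall_ae_eq hd),
    integral_polar_on hd measurableSet_Ioo (fun r hr => hr.1) hi,
    integral_prod _ (integrable_polar_on hd measurableSet_Ioo (fun r hr => hr.1) hi)]
  refine integral_congr_ae (Filter.Eventually.of_forall fun θ => ?_)
  have := integral_dilation hd hg (θ : Sp d)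
  rw [integral_Ioc_eq_integral_Ioo] at this
  beta_reduce
  rw [← this]
  refine integral_congr_ae (Filter.Eventually.of_forall fun t => ?_)
  simp

theorem integral_mul_radial {g η : Sp d → ℝ} (hg : ContDiff ℝ ∞ g) (hη : ContDiff ℝ ∞ η)
    (hc : HasCompactSupport η) :
    ∫ x, η x * (d * g x + fderiv ℝ g x x) = -∫ x, fderiv ℝ η x x * g x := by
  have hdiv : ∀ x, ∑ i, fderiv ℝ (fun y : Sp d => y i * g y) x (EuclideanSpace.single i 1)
      = d * g x + fderiv ℝ g x x := by
    intro x
    simpa using divergence_dilation hg 1 x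
  have hsm : ∀ i : Fin d, ContDiff ℝ ∞ fun y : Sp d => y i * g y := fun i =>
    (EuclideanSpace.proj (𝕜 := ℝ) i : Sp d →L[ℝ] ℝ).contDiff.mul hg
  have hi1 : ∀ i : Fin d, Integrable fun x =>
      η x * fderiv ℝ (fun y : Sp d => y i * g y) x (EuclideanSpace.single i 1) := fun i =>
    (hη.continuous.mul (continuous_aux (hsm i) i)).integrable_of_hasCompactSupport hc.mul_right
  have hi2 : ∀ i : Fin d, Integrable fun x : Sp d =>
      fderiv ℝ η x (EuclideanSpace.single i 1) * (x i * g x) := fun i =>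
    ((continuous_aux hη i).mul (hsm i).continuous).integrable_of_hasCompactSupport
      (compactSupport_aux hc i).mul_right
  have hparts : ∀ i : Fin d,
      ∫ x, η x * fderiv ℝ (fun y : Sp d => y i * g y) x (EuclideanSpace.single i 1)
        = -∫ x, fderiv ℝ η x (EuclideanSpace.single i 1) * (x i * g x) := fun i =>
    integral_mul_fderiv_eq_neg_fderiv_mul_of_integrable (hi2 i) (hi1 i)
      ((hη.continuous.mul (hsm i).continuous).integrable_of_hasCompactSupport hc.mul_right)
      (fun x _ => hη.differentiable (by simp) x) (fun x _ => (hsm i).differentiable (by simp) x)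
  simp_rw [← hdiv, Finset.mul_sum]
  rw [integral_finsetSum _ fun i _ => hi1 i]
  simp_rw [hparts]
  rw [Finset.sum_neg_distrib, ← integral_finsetSum _ fun i _ => hi2 i]
  congr 1
  refine integral_congr_ae (Filter.Eventually.of_forall fun x => ?_)
  beta_reduce
  rw [← fderiv_sum_single (fderiv ℝ η x) x, Finset.sum_mul]
  exact Finset.sum_congr rfl fun i _ => by ring

/-- Provides the dominating function for the boundary layer of `radialCutoff`: its derivative is of
order `k`, but it will appear multiplied by `1 - |x|²`. -/
theorem exists_bound_mul_deriv_smoothTransition :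
    ∃ C : ℝ, ∀ y : ℝ, |y * deriv Real.smoothTransition y| ≤ C := by
  have hcd : Continuous (deriv Real.smoothTransition) :=
    (Real.smoothTransition.contDiff (n := 1)).continuous_deriv (by simp)
  have hc : Continuous fun y : ℝ => y * deriv Real.smoothTransition y := continuous_id.mul hcd
  obtain ⟨C, hC⟩ := (isCompact_Icc (a := (0 : ℝ)) (b := 1)).exists_bound_of_continuousOn
    hc.continuousOn
  have hC0 : 0 ≤ C := (norm_nonneg _).trans (hC 0 (by simp))
  refine ⟨C, fun y => ?_⟩
  rcases lt_or_ge y 0 with h | h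
  · have : deriv Real.smoothTransition y = 0 := by
      have : Real.smoothTransition =ᶠ[nhds y] fun _ => 0 := by
        filter_upwards [gt_mem_nhds h] with z hz
        exact Real.smoothTransition.zero_of_nonpos hz.le
      rw [this.deriv_eq]; simp
    simpa [this] using hC0
  · rcases le_or_gt y 1 with h1 | h1
    · exact hC y ⟨h, h1⟩
    · have : deriv Real.smoothTransition y = 0 := by
        have : Real.smoothTransition =ᶠ[nhds y] fun _ => 1 := by
          filter_upwards [lt_mem_nhds h1] with z hz
          exact Real.smoothTransition.one_of_one_le hz.le
        rw [this.deriv_eq]; simp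
      simpa [this] using hC0

/-- Radial cutoff functions that increase to the indicator function of the unit ball. -/
def radialCutoff (d k : ℕ) (x : Sp d) : ℝ := Real.smoothTransition (k * (1 - ‖x‖ ^ 2))

theorem contDiff_radialCutoff (d k : ℕ) : ContDiff ℝ ∞ (radialCutoff d k) :=
  Real.smoothTransition.contDiff.comp
    (contDiff_const.mul (contDiff_const.sub (contDiff_norm_sq ℝ)))

theorem hasCompactSupport_radialCutoff (d k : ℕ) : HasCompactSupport (radialCutoff d k) := by
  refine HasCompactSupport.intro (isCompact_closedBall (0 : Sp d) 1) fun x hx => ?_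
  have : 1 < ‖x‖ := by simpa using hx
  refine Real.smoothTransition.zero_of_nonpos (mul_nonpos_of_nonneg_of_nonpos (by positivity) ?_)
  nlinarith

theorem fderiv_radialCutoff (k : ℕ) (x v : Sp d) :
    fderiv ℝ (radialCutoff d k) x v
      = deriv Real.smoothTransition (k * (1 - ‖x‖ ^ 2)) * (k * (-2 * ⟪x, v⟫_ℝ)) := by
  have h1 : HasFDerivAt (fun x : Sp d => k * (1 - ‖x‖ ^ 2))
      ((k : ℝ) • -((2 : ℝ) • innerSL ℝ x)) x := by
    have := (((hasStrictFDerivAt_norm_sq x).hasFDerivAt.const_sub 1).const_mul (k : ℝ))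
    convert! this using 2
    simp [two_smul]
  have h2 : HasDerivAt Real.smoothTransition
      (deriv Real.smoothTransition (k * (1 - ‖x‖ ^ 2))) (k * (1 - ‖x‖ ^ 2)) :=
    ((Real.smoothTransition.contDiff (n := 1)).differentiable (by simp) _).hasDerivAt
  have h3 := h2.comp_hasFDerivAt x h1
  have h4 : fderiv ℝ (radialCutoff d k) x = _ := h3.fderiv
  rw [h4]
  simp

theorem tendsto_radialCutoff (x : Sp d) (hx : ‖x‖ < 1) :
    ∀ᶠ k : ℕ in Filter.atTop, 1 < (k : ℝ) * (1 - ‖x‖ ^ 2) := by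
  have h0 : 0 < 1 - ‖x‖ ^ 2 := by nlinarith [norm_nonneg x]
  exact (tendsto_natCast_atTop_atTop.atTop_mul_const h0).eventually_gt_atTop 1

/-- The divergence theorem in the unit ball. -/
theorem integral_fderiv_ball (hd : 0 < d) {f : Sp d → ℝ} (hf : ContDiff ℝ ∞ f)
    (hfc : HasCompactSupport f) (i : Fin d) :
    ∫ x in unitBall d, fderiv ℝ f x (EuclideanSpace.single i 1)
      = ∫ θ, f (θ : Sp d) * (θ : Sp d) i ∂(surf d) := by
  -- On the unit sphere `f e_i` and `f x_i x` have the same normal component. The divergence `w` of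
  -- their difference, a field tangent to the sphere, must integrate to zero over the ball.
  set g : Sp d → ℝ := fun x => f x * x i with hgdef
  have hg : ContDiff ℝ ∞ g := hf.mul (EuclideanSpace.proj (𝕜 := ℝ) i : Sp d →L[ℝ] ℝ).contDiff
  have hgc : HasCompactSupport g := hfc.mul_right
  have hrc : Continuous fun x => d * g x + fderiv ℝ g x x := by
    have h1 := hg.continuous
    have h3 := (hg.continuous_fderiv (by simp)).clm_apply continuous_id
    simp only [id] at h3
    fun_prop
  have hrcs : HasCompactSupport fun x => d * g x + fderiv ℝ g x x := by
    have h1 : HasCompactSupport fun x => fderiv ℝ g x x := by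
      have := hgc.fderiv (𝕜 := ℝ)
      refine this.mono fun x hx => ?_
      intro h0
      apply hx
      simp only [h0]; simp
    exact hgc.mul_left.add h1
  have hfcd := continuous_aux hf i
  have hfcs := compactSupport_aux hfc i
  rw [← integral_radial_ball hd hg, ← sub_eq_zero,
    ← integral_sub (hfcd.integrable_of_hasCompactSupport hfcs).integrableOn
      (hrc.integrable_of_hasCompactSupport hrcs).integrableOn]
  set w : Sp d → ℝ := fun x =>
    fderiv ℝ f x (EuclideanSpace.single i 1) - (d * g x + fderiv ℝ g x x) with hw
  have hwi : Integrable w := (hfcd.integrable_of_hasCompactSupport hfcs).sub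
    (hrc.integrable_of_hasCompactSupport hrcs)
  have hwc : Continuous w := hfcd.sub hrc
  -- The scalar product of `f e_i - f x_i x` with `x` is `g (1 - |x|²)`, so the derivative of the
  -- cutoff comes with the compensating factor `1 - |x|²`.
  have hid : ∀ k : ℕ, ∫ x, radialCutoff d k x * w x =
      ∫ x, (2 * g x) * ((k * (1 - ‖x‖ ^ 2)) *
        deriv Real.smoothTransition (k * (1 - ‖x‖ ^ 2))) := by
    intro k
    have hη := contDiff_radialCutoff d k
    have hηc := hasCompactSupport_radialCutoff d k
    have p1 : ∫ x, radialCutoff d k x * fderiv ℝ f x (EuclideanSpace.single i 1)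
        = -∫ x, fderiv ℝ (radialCutoff d k) x (EuclideanSpace.single i 1) * f x :=
      integral_mul_fderiv_eq_neg_fderiv_mul_of_integrable
        (((continuous_aux hη i).mul hf.continuous).integrable_of_hasCompactSupport
          (compactSupport_aux hηc i).mul_right)
        ((hη.continuous.mul hfcd).integrable_of_hasCompactSupport hηc.mul_right)
        ((hη.continuous.mul hf.continuous).integrable_of_hasCompactSupport hηc.mul_right)
        (fun x _ => hη.differentiable (by simp) x) (fun x _ => hf.differentiable (by simp) x)
    have p2 := integral_mul_radial hg hη hηc
    have hi2 : Integrable fun x : Sp d => fderiv ℝ (radialCutoff d k) x x * g x := by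
      have h3 := (hη.continuous_fderiv (by simp)).clm_apply continuous_id
      simp only [id] at h3
      exact (h3.mul hg.continuous).integrable_of_hasCompactSupport hgc.mul_left
    have hi3 : Integrable fun x : Sp d =>
        fderiv ℝ (radialCutoff d k) x (EuclideanSpace.single i 1) * f x :=
      ((continuous_aux hη i).mul hf.continuous).integrable_of_hasCompactSupport
        (compactSupport_aux hηc i).mul_right
    have hi4 : Integrable fun x : Sp d =>
        radialCutoff d k x * fderiv ℝ f x (EuclideanSpace.single i 1) :=
      (hη.continuous.mul hfcd).integrable_of_hasCompactSupport hηc.mul_right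
    have hi5 : Integrable fun x : Sp d => radialCutoff d k x * (d * g x + fderiv ℝ g x x) :=
      (hη.continuous.mul hrc).integrable_of_hasCompactSupport hηc.mul_right
    have hsplit : ∀ x, radialCutoff d k x * w x
        = radialCutoff d k x * fderiv ℝ f x (EuclideanSpace.single i 1)
          - radialCutoff d k x * (d * g x + fderiv ℝ g x x) := fun x => mul_sub _ _ _
    simp_rw [hsplit]
    rw [integral_sub hi4 hi5, p1, p2, sub_neg_eq_add, neg_add_eq_sub, ← integral_sub hi2 hi3]
    refine integral_congr_ae (Filter.Eventually.of_forall fun x => ?_)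
    simp only [fderiv_radialCutoff, real_inner_self_eq_norm_sq, hgdef,
      EuclideanSpace.inner_single_right]
    simp
    ring
  obtain ⟨C, hC⟩ := exists_bound_mul_deriv_smoothTransition
  have lim1 : Filter.Tendsto (fun k : ℕ => ∫ x, radialCutoff d k x * w x) Filter.atTop
      (nhds (∫ x in unitBall d, w x)) := by
    have hbm : MeasurableSet (unitBall d) := isOpen_ball.measurableSet
    rw [← integral_indicator hbm]
    refine tendsto_integral_of_dominated_convergence (fun x => ‖w x‖)
      (fun k => ((contDiff_radialCutoff d k).continuous.mul hwc).aestronglyMeasurable)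
      hwi.norm (fun k => Filter.Eventually.of_forall fun x => ?_)
      (Filter.Eventually.of_forall fun x => ?_)
    · rw [norm_mul]
      refine mul_le_of_le_one_left (norm_nonneg _) ?_
      rw [Real.norm_eq_abs, radialCutoff, abs_of_nonneg (Real.smoothTransition.nonneg _)]
      exact Real.smoothTransition.le_one _
    · by_cases hx : x ∈ unitBall d
      · rw [indicator_of_mem hx]
        refine tendsto_const_nhds.congr' ?_
        filter_upwards [tendsto_radialCutoff x (mem_unitBall.1 hx)] with k hk
        rw [radialCutoff, Real.smoothTransition.one_of_one_le hk.le, one_mul]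
      · rw [indicator_of_notMem hx]
        refine tendsto_const_nhds.congr fun k => ?_
        have : 1 ≤ ‖x‖ := not_lt.1 fun h => hx (mem_unitBall.2 h)
        rw [radialCutoff, Real.smoothTransition.zero_of_nonpos, zero_mul]
        exact mul_nonpos_of_nonneg_of_nonpos (by positivity) (by nlinarith)
  -- Dominated convergence: the integrand is bounded by a multiple of `|g|`. At each point it is
  -- eventually zero, because the transition is locally constant inside and outside the ball and the
  -- factor `k (1 - |x|²)` vanishes on the sphere.
  have lim2 : Filter.Tendsto (fun k : ℕ => ∫ x, radialCutoff d k x * w x) Filter.atTop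
      (nhds (∫ _ : Sp d, (0 : ℝ))) := by
    simp_rw [hid]
    have hcd : Continuous (deriv Real.smoothTransition) :=
      (Real.smoothTransition.contDiff (n := 1)).continuous_deriv (by simp)
    refine tendsto_integral_of_dominated_convergence (fun x => ‖2 * g x‖ * C)
      (fun k => Continuous.aestronglyMeasurable ?_)
      ((((continuous_const.mul hg.continuous).integrable_of_hasCompactSupport
        hgc.mul_left).norm).mul_const C) (fun k => Filter.Eventually.of_forall fun x => ?_)
      (Filter.Eventually.of_forall fun x => ?_)
    · have := hg.continuous
      fun_prop
    · rw [norm_mul]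
      exact mul_le_mul_of_nonneg_left (hC _) (norm_nonneg _)
    · refine tendsto_const_nhds.congr' ?_
      rcases lt_or_ge ‖x‖ 1 with hx | hx
      · filter_upwards [tendsto_radialCutoff x hx] with k hk
        have : Real.smoothTransition =ᶠ[nhds ((k : ℝ) * (1 - ‖x‖ ^ 2))] fun _ => 1 := by
          filter_upwards [lt_mem_nhds hk] with z hz
          exact Real.smoothTransition.one_of_one_le hz.le
        rw [this.deriv_eq]; simp
      · refine Filter.Eventually.of_forall fun k => ?_
        beta_reduce
        rcases (mul_nonpos_of_nonneg_of_nonpos (Nat.cast_nonneg k)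
          (by nlinarith : 1 - ‖x‖ ^ 2 ≤ 0)).lt_or_eq with h | h
        · have : Real.smoothTransition =ᶠ[nhds ((k : ℝ) * (1 - ‖x‖ ^ 2))] fun _ => 0 := by
            filter_upwards [gt_mem_nhds h] with z hz
            exact Real.smoothTransition.zero_of_nonpos hz.le
          rw [this.deriv_eq]; simp
        · rw [h]; simp
  rw [integral_zero] at lim2
  exact tendsto_nhds_unique lim1 lim2

end

section

variable {d : ℕ}

/-! ### Harmonic polynomials -/

/-- The polynomial function on `ℝ^d`. -/
def ev (P : MvPolynomial (Fin d) ℝ) (x : Sp d) : ℝ := MvPolynomial.eval (fun i => x i) P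

/-- The Laplacian of a polynomial. -/
def lap (d : ℕ) : MvPolynomial (Fin d) ℝ →ₗ[ℝ] MvPolynomial (Fin d) ℝ :=
  ∑ i, (MvPolynomial.pderiv (R := ℝ) i).toLinearMap ∘ₗ (MvPolynomial.pderiv (R := ℝ) i).toLinearMap

theorem lap_apply (P : MvPolynomial (Fin d) ℝ) :
    lap d P = ∑ i, MvPolynomial.pderiv i (MvPolynomial.pderiv i P) := by
  simp [lap]

/-- The homogeneous harmonic polynomials of degree `n`. -/
def Harm (d n : ℕ) : Submodule ℝ (MvPolynomial (Fin d) ℝ) :=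
  MvPolynomial.homogeneousSubmodule (Fin d) ℝ n ⊓ LinearMap.ker (lap d)

theorem mem_Harm {n : ℕ} {P : MvPolynomial (Fin d) ℝ} :
    P ∈ Harm d n ↔ P.IsHomogeneous n ∧ lap d P = 0 := by
  simp [Harm, MvPolynomial.mem_homogeneousSubmodule]

@[simp] theorem ev_add (P Q : MvPolynomial (Fin d) ℝ) (x : Sp d) :
    ev (P + Q) x = ev P x + ev Q x := by simp [ev]

@[simp] theorem ev_sub (P Q : MvPolynomial (Fin d) ℝ) (x : Sp d) :
    ev (P - Q) x = ev P x - ev Q x := by simp [ev]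

@[simp] theorem ev_mul (P Q : MvPolynomial (Fin d) ℝ) (x : Sp d) :
    ev (P * Q) x = ev P x * ev Q x := by simp [ev]

@[simp] theorem ev_smul (c : ℝ) (P : MvPolynomial (Fin d) ℝ) (x : Sp d) :
    ev (c • P) x = c * ev P x := by simp [ev]

@[simp] theorem ev_zero (x : Sp d) : ev (0 : MvPolynomial (Fin d) ℝ) x = 0 := by simp [ev]

@[simp] theorem ev_X (i : Fin d) (x : Sp d) : ev (MvPolynomial.X i) x = x i := by simp [ev]

@[simp] theorem ev_C (c : ℝ) (x : Sp d) : ev (MvPolynomial.C c) x = c := by simp [ev]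

theorem ev_sum {ι : Type*} (s : Finset ι) (P : ι → MvPolynomial (Fin d) ℝ) (x : Sp d) :
    ev (∑ i ∈ s, P i) x = ∑ i ∈ s, ev (P i) x := by simp [ev]

theorem contDiff_ev (P : MvPolynomial (Fin d) ℝ) {n : WithTop ℕ∞} : ContDiff ℝ n (ev P) := by
  induction P using MvPolynomial.induction_on with
  | C a => simpa [funext (ev_C a)] using contDiff_const
  | add p q hp hq =>
    rw [show ev (p + q) = fun x => ev p x + ev q x from funext (ev_add p q)]
    exact hp.add hq
  | mul_X p i hp =>
    rw [show ev (p * MvPolynomial.X i) = fun x => ev p x * x i from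
      funext fun x => by rw [ev_mul, ev_X]]
    exact hp.mul (EuclideanSpace.proj (𝕜 := ℝ) i : Sp d →L[ℝ] ℝ).contDiff

theorem fderiv_ev (P : MvPolynomial (Fin d) ℝ) (x : Sp d) (i : Fin d) :
    fderiv ℝ (ev P) x (EuclideanSpace.single i 1) = ev (MvPolynomial.pderiv i P) x := by
  induction P using MvPolynomial.induction_on with
  | C a =>
    rw [show ev (MvPolynomial.C a) = fun _ : Sp d => a from funext (ev_C a)]
    simp
  | add p q hp hq =>
    rw [show ev (p + q) = fun x => ev p x + ev q x from funext (ev_add p q),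
      fderiv_fun_add ((contDiff_ev p (n := 1)).differentiable (by simp) x)
        ((contDiff_ev q (n := 1)).differentiable (by simp) x)]
    simp [hp, hq]
  | mul_X p j hp =>
    have e1 : HasFDerivAt (fun y : Sp d => y j) (EuclideanSpace.proj (𝕜 := ℝ) j) x :=
      (EuclideanSpace.proj (𝕜 := ℝ) j : Sp d →L[ℝ] ℝ).hasFDerivAt
    have e2 := ((contDiff_ev p (n := 1)).differentiable (by simp) x).hasFDerivAt
    have e3 : HasFDerivAt (fun y : Sp d => ev p y * y j) _ x := e2.fun_mul e1
    rw [show ev (p * MvPolynomial.X j) = fun x => ev p x * x j from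
      funext fun x => by rw [ev_mul, ev_X], e3.fderiv]
    simp only [_root_.add_apply, _root_.smul_apply, smul_eq_mul, hp,
      Derivation.leibniz, ev_add, ev_mul, ev_X, MvPolynomial.pderiv_X]
    by_cases hij : i = j
    · subst hij
      simp [ev]
    · simp [ev, Ne.symm hij]

/-- The gradient of a polynomial. -/
def gradV (P : MvPolynomial (Fin d) ℝ) (x : Sp d) : Sp d :=
  WithLp.toLp 2 fun i => ev (MvPolynomial.pderiv i P) x

@[simp] theorem gradV_apply (P : MvPolynomial (Fin d) ℝ) (x : Sp d) (i : Fin d) :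
    gradV P x i = ev (MvPolynomial.pderiv i P) x := rfl

theorem continuous_gradV (P : MvPolynomial (Fin d) ℝ) : Continuous (gradV P) := by
  refine (PiLp.continuous_toLp 2 _).comp (continuous_pi fun i => ?_)
  exact (contDiff_ev _ (n := 0)).continuous

theorem inner_gradV (P : MvPolynomial (Fin d) ℝ) (x v : Sp d) :
    ⟪v, gradV P x⟫_ℝ = ∑ i, v i * ev (MvPolynomial.pderiv i P) x := by
  simp [PiLp.inner_apply, mul_comm]

theorem ev_smul_point {n : ℕ} {P : MvPolynomial (Fin d) ℝ} (hP : P.IsHomogeneous n) (t : ℝ)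
    (x : Sp d) : ev P (t • x) = t ^ n * ev P x := by
  simp only [ev, MvPolynomial.eval_eq, Finset.mul_sum]
  refine Finset.sum_congr rfl fun m hm => ?_
  have h1 := hP (MvPolynomial.mem_support_iff.1 hm)
  rw [Finsupp.weight_apply, Finsupp.sum] at h1
  simp only [Pi.one_apply, smul_eq_mul, mul_one] at h1
  simp only [PiLp.smul_apply, smul_eq_mul, mul_pow, Finset.prod_mul_distrib,
    Finset.prod_pow_eq_pow_sum, h1]
  ring

theorem euler {n : ℕ} {P : MvPolynomial (Fin d) ℝ} (hP : P.IsHomogeneous n) (x : Sp d) :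
    ∑ i, x i * ev (MvPolynomial.pderiv i P) x = n * ev P x := by
  have := congrArg (fun Q => ev Q x) hP.sum_X_mul_pderiv
  simp only [ev_sum, ev_mul, ev_X] at this
  rw [this]
  simp [ev]

/-! ### Polynomials as Sobolev functions on the ball -/

theorem memLp_ball_of_continuous {E : Type*} [NormedAddCommGroup E] {f : Sp d → E}
    [SecondCountableTopologyEither (Sp d) E] (hf : Continuous f) :
    MemLp f 2 ((volume : Measure (Sp d)).restrict (unitBall d)) := by
  have := (admissible_unitBall (d := d)).isFiniteMeasure
  obtain ⟨C, hC⟩ := (isCompact_closedBall (0 : Sp d) 1).exists_bound_of_continuousOn hf.continuousOn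
  refine MemLp.of_bound (C := C) hf.aestronglyMeasurable ?_
  filter_upwards [ae_restrict_mem (isOpen_ball.measurableSet : MeasurableSet (ball (0 : Sp d) 1))]
    with x hx
  exact hC x (ball_subset_closedBall hx)

theorem memLp_sphere_of_continuous {f : Sp d → ℝ} (hf : Continuous f) :
    MemLp (fun θ : sphere (0 : Sp d) 1 => f θ) 2 (surf d) :=
  (hf.comp continuous_subtype_val).memLp_of_hasCompactSupport (HasCompactSupport.of_compactSpace _)

theorem continuous_ev (P : MvPolynomial (Fin d) ℝ) : Continuous (ev P) :=
  (contDiff_ev P (n := 0)).continuous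

/-- The restriction of a polynomial to the ball. -/
def polyL2 (P : MvPolynomial (Fin d) ℝ) : L2 (unitBall d) :=
  (memLp_ball_of_continuous (continuous_ev P)).toLp (ev P)

/-- The gradient of a polynomial on the ball. -/
def polyGrad (P : MvPolynomial (Fin d) ℝ) : L2Vec (unitBall d) :=
  (memLp_ball_of_continuous (continuous_gradV P)).toLp (gradV P)

/-- The restriction of a polynomial to the sphere. -/
def polyTrace (P : MvPolynomial (Fin d) ℝ) : L2Sphere d :=
  (memLp_sphere_of_continuous (continuous_ev P)).toLp fun θ : sphere (0 : Sp d) 1 => ev P θ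

theorem polyL2_ae (P : MvPolynomial (Fin d) ℝ) :
    polyL2 P =ᵐ[(volume : Measure (Sp d)).restrict (unitBall d)] ev P := MemLp.coeFn_toLp _

theorem polyGrad_ae (P : MvPolynomial (Fin d) ℝ) :
    polyGrad P =ᵐ[(volume : Measure (Sp d)).restrict (unitBall d)] gradV P := MemLp.coeFn_toLp _

theorem polyTrace_ae (P : MvPolynomial (Fin d) ℝ) :
    polyTrace P =ᵐ[surf d] fun θ : sphere (0 : Sp d) 1 => ev P θ := MemLp.coeFn_toLp _

theorem inner_polyTrace (φ : L2Sphere d) (P : MvPolynomial (Fin d) ℝ) :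
    ⟪φ, polyTrace P⟫_ℝ = ∫ θ, φ θ * ev P (θ : Sp d) ∂(surf d) := by
  rw [L2.inner_def]
  refine integral_congr_ae ?_
  filter_upwards [polyTrace_ae P] with x hx
  rw [hx]; simp [mul_comm]

theorem inner_polyGrad (G : L2Vec (unitBall d)) (P : MvPolynomial (Fin d) ℝ) :
    ⟪G, polyGrad P⟫_ℝ = ∫ x in unitBall d, ∑ i, G x i * ev (MvPolynomial.pderiv i P) x := by
  rw [L2.inner_def]
  refine integral_congr_ae ?_
  filter_upwards [polyGrad_ae P] with x hx
  rw [hx, inner_gradV]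

theorem isH1_poly (hd : 0 < d) (P : MvPolynomial (Fin d) ℝ) :
    IsH1 (unitBall d) (polyL2 P) (polyGrad P) (polyTrace P) := by
  intro ψ hψ hc hs i
  have h := integral_fderiv_ball hd (f := fun x => ψ x * ev P x) (hψ.mul (contDiff_ev P))
    hc.mul_right i
  have e0 : ∀ x, fderiv ℝ (fun x => ψ x * ev P x) x (EuclideanSpace.single i 1)
      = ev P x * fderiv ℝ ψ x (EuclideanSpace.single i 1)
        + ev (MvPolynomial.pderiv i P) x * ψ x := by
    intro x
    rw [fderiv_fun_mul (hψ.differentiable (by simp) x)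
      ((contDiff_ev P (n := 1)).differentiable (by simp) x)]
    simp only [_root_.add_apply, _root_.smul_apply, smul_eq_mul, fderiv_ev]
    ring
  simp_rw [e0] at h
  have hi1 : Integrable (fun x => ev P x * fderiv ℝ ψ x (EuclideanSpace.single i 1)) :=
    ((continuous_ev P).mul (continuous_aux hψ i)).integrable_of_hasCompactSupport
      (compactSupport_aux hc i).mul_left
  have hi2 : Integrable (fun x => ev (MvPolynomial.pderiv i P) x * ψ x) :=
    ((continuous_ev _).mul hψ.continuous).integrable_of_hasCompactSupport hc.mul_left
  rw [integral_add hi1.integrableOn hi2.integrableOn] at h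
  convert h using 1
  · congr 1
    · refine integral_congr_ae ?_
      filter_upwards [polyL2_ae P] with x hx
      rw [hx]
    · refine integral_congr_ae ?_
      filter_upwards [polyGrad_ae P] with x hx
      rw [hx, gradV_apply]
  · refine integral_congr_ae ?_
    filter_upwards [polyTrace_ae P] with x hx
    rw [hx]; ring

/-- Green's formula against a homogeneous harmonic polynomial. -/
theorem IsH1.inner_grad_harm {n : ℕ} {P : MvPolynomial (Fin d) ℝ} (hP : P ∈ Harm d n)
    {u : L2 (unitBall d)} {G : L2Vec (unitBall d)} {φ : L2Sphere d}
    (h : IsH1 (unitBall d) u G φ) : ⟪G, polyGrad P⟫_ℝ = n * ⟪φ, polyTrace P⟫_ℝ := by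
  obtain ⟨hhom, hlap⟩ := mem_Harm.1 hP
  have := h.green admissible_unitBall (Ψ := fun i => ev (MvPolynomial.pderiv i P))
    (fun i => contDiff_ev _) (fun i => by rw [union_compl_self]; exact subset_univ _)
  rw [inner_polyGrad, inner_polyTrace]
  have e1 : ∀ x : Sp d, ∑ i, fderiv ℝ (ev (MvPolynomial.pderiv i P)) x (EuclideanSpace.single i 1)
      = 0 := by
    intro x
    simp_rw [fderiv_ev, ← ev_sum, ← lap_apply, hlap, ev_zero]
  simp_rw [e1, mul_zero, integral_zero, zero_add] at this
  rw [this, ← integral_const_mul]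
  refine integral_congr_ae (Filter.Eventually.of_forall fun θ => ?_)
  have := euler hhom (θ : Sp d)
  beta_reduce
  rw [mul_left_comm, ← this]
  simp_rw [mul_comm]

/-- Spherical harmonics of different degrees are orthogonal. -/
theorem inner_polyTrace_eq_zero (hd : 0 < d) {m n : ℕ} (hmn : m ≠ n)
    {P Q : MvPolynomial (Fin d) ℝ} (hP : P ∈ Harm d m) (hQ : Q ∈ Harm d n) :
    ⟪polyTrace P, polyTrace Q⟫_ℝ = 0 := by
  -- Green's formula with the roles of `P` and `Q` exchanged evaluates the same Dirichlet integral
  -- as `n` times and as `m` times the boundary pairing.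
  have h1 := (isH1_poly hd P).inner_grad_harm hQ
  have h2 := (isH1_poly hd Q).inner_grad_harm hP
  rw [real_inner_comm, h1, real_inner_comm] at h2
  have h3 : ((n : ℝ) - m) * ⟪polyTrace Q, polyTrace P⟫_ℝ = 0 := by linarith
  rcases mul_eq_zero.1 h3 with h | h
  · exact absurd (by exact_mod_cast (sub_eq_zero.1 h).symm) hmn
  · rw [real_inner_comm]; exact h

theorem polyTrace_add (P Q : MvPolynomial (Fin d) ℝ) :
    polyTrace (P + Q) = polyTrace P + polyTrace Q := by
  ext1
  filter_upwards [polyTrace_ae (P + Q), polyTrace_ae P, polyTrace_ae Q,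
    Lp.coeFn_add (polyTrace P) (polyTrace Q)] with x h1 h2 h3 h4
  rw [h1, h4, Pi.add_apply, h2, h3, ev_add]

theorem polyTrace_smul (c : ℝ) (P : MvPolynomial (Fin d) ℝ) :
    polyTrace (c • P) = c • polyTrace P := by
  ext1
  filter_upwards [polyTrace_ae (c • P), polyTrace_ae P,
    Lp.coeFn_smul c (polyTrace P)] with x h1 h2 h4
  rw [h1, h4, Pi.smul_apply, h2, ev_smul, smul_eq_mul]

theorem polyGrad_add (P Q : MvPolynomial (Fin d) ℝ) :
    polyGrad (P + Q) = polyGrad P + polyGrad Q := by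
  ext1
  filter_upwards [polyGrad_ae (P + Q), polyGrad_ae P, polyGrad_ae Q,
    Lp.coeFn_add (polyGrad P) (polyGrad Q)] with x h1 h2 h3 h4
  rw [h1, h4, Pi.add_apply, h2, h3]
  ext i
  simp

theorem polyGrad_smul (c : ℝ) (P : MvPolynomial (Fin d) ℝ) :
    polyGrad (c • P) = c • polyGrad P := by
  ext1
  filter_upwards [polyGrad_ae (c • P), polyGrad_ae P,
    Lp.coeFn_smul c (polyGrad P)] with x h1 h2 h4
  rw [h1, h4, Pi.smul_apply, h2]
  ext i
  simp

theorem polyTrace_congr {P Q : MvPolynomial (Fin d) ℝ}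
    (h : ∀ x : Sp d, ‖x‖ = 1 → ev P x = ev Q x) : polyTrace P = polyTrace Q := by
  ext1
  filter_upwards [polyTrace_ae P, polyTrace_ae Q] with x h1 h2
  rw [h1, h2, h _ (by simp)]

theorem eq_zero_of_polyTrace_eq_zero (hd : 0 < d) {n : ℕ} {P : MvPolynomial (Fin d) ℝ}
    (hP : P.IsHomogeneous n) (h : polyTrace P = 0) : P = 0 := by
  have h0 : ∀ᵐ θ : sphere (0 : Sp d) 1 ∂(surf d), ev P θ = 0 := by
    have h1 := polyTrace_ae P
    rw [h] at h1
    filter_upwards [h1, Lp.coeFn_zero ℝ 2 (surf d)] with θ h2 h3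
    rw [← h2, h3]; rfl
  have hop : (surf d).IsOpenPosMeasure := by unfold surf; infer_instance
  have h1 : (fun θ : sphere (0 : Sp d) 1 => ev P θ) = fun _ => 0 := by
    have hc : Continuous fun θ : sphere (0 : Sp d) 1 => ev P θ :=
      (continuous_ev P).comp continuous_subtype_val
    exact Measure.eq_of_ae_eq (μ := surf d) h0 hc continuous_const
  refine MvPolynomial.funext fun y => ?_
  rw [map_zero]
  set x : Sp d := WithLp.toLp 2 y
  have hy : MvPolynomial.eval y P = ev P x := rfl
  have key : ∀ z : Sp d, z ≠ 0 → ev P z = 0 := by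
    intro z hz
    have hz' : z = ‖z‖ • (‖z‖⁻¹ • z) := by rw [smul_smul, mul_inv_cancel₀ (by simpa), one_smul]
    have h2 := congrFun h1 ⟨‖z‖⁻¹ • z, by simp [norm_smul, hz]⟩
    rw [hz', ev_smul_point hP]
    simp only at h2
    rw [h2, mul_zero]
  rw [hy]
  by_cases hx : x = 0
  · have hnt : Nontrivial (Sp d) := by
      have : Nonempty (Fin d) := ⟨⟨0, hd⟩⟩
      infer_instance
    have hclosed : IsClosed {z : Sp d | ev P z = 0} :=
      isClosed_eq (continuous_ev P) continuous_const
    have hdense : Dense ({0}ᶜ : Set (Sp d)) := dense_compl_singleton 0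
    have : {z : Sp d | ev P z = 0} = univ :=
      (hdense.mono (fun z hz => key z hz)).closure_eq ▸ hclosed.closure_eq.symm
    have hx : x ∈ {z : Sp d | ev P z = 0} := by rw [this]; trivial
    exact hx
  · exact key x hx

end

section

variable {d : ℕ}

/-! ### Completeness of the spherical harmonics -/

/-- The polynomial `|x|²`. -/
def normSqPoly (d : ℕ) : MvPolynomial (Fin d) ℝ := ∑ i, MvPolynomial.X i ^ 2

theorem ev_normSqPoly (x : Sp d) : ev (normSqPoly d) x = ‖x‖ ^ 2 := by
  rw [normSqPoly, ev_sum, EuclideanSpace.real_norm_sq_eq]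
  simp [pow_two]

theorem isHomogeneous_normSqPoly : (normSqPoly d).IsHomogeneous 2 :=
  MvPolynomial.IsHomogeneous.sum _ _ _ fun i _ => by
    simpa using (MvPolynomial.isHomogeneous_X ℝ i).pow 2

theorem lap_isHomogeneous {n : ℕ} {P : MvPolynomial (Fin d) ℝ} (hP : P.IsHomogeneous (n + 2)) :
    (lap d P).IsHomogeneous n := by
  rw [lap_apply]
  exact MvPolynomial.IsHomogeneous.sum _ _ _ fun i _ => hP.pderiv.pderiv

theorem lap_eq_zero_of_lt_two {n : ℕ} (hn : n < 2) {P : MvPolynomial (Fin d) ℝ}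
    (hP : P.IsHomogeneous n) : lap d P = 0 := by
  rw [lap_apply]
  refine Finset.sum_eq_zero fun i _ => ?_
  have h1 : (MvPolynomial.pderiv i P).IsHomogeneous 0 := by
    have := hP.pderiv (i := i)
    rwa [show n - 1 = 0 by omega] at this
  rw [← MvPolynomial.totalDegree_zero_iff_isHomogeneous,
    MvPolynomial.totalDegree_eq_zero_iff_eq_C] at h1
  rw [h1, MvPolynomial.pderiv_C]

instance instFiniteHomogeneous (n : ℕ) :
    Module.Finite ℝ (MvPolynomial.homogeneousSubmodule (Fin d) ℝ n) := by
  have hle : MvPolynomial.homogeneousSubmodule (Fin d) ℝ n ≤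
      MvPolynomial.restrictTotalDegree (Fin d) ℝ n := by
    intro P hP
    rw [MvPolynomial.mem_restrictTotalDegree]
    exact ((MvPolynomial.mem_homogeneousSubmodule _ _).1 hP).totalDegree_le
  exact Submodule.finiteDimensional_of_le hle

/-- Sums of homogeneous harmonic polynomials. -/
def HarmSum (d : ℕ) : Submodule ℝ (MvPolynomial (Fin d) ℝ) := ⨆ n, Harm d n

theorem Harm_le_HarmSum (n : ℕ) : Harm d n ≤ HarmSum d := le_iSup (Harm d) n

/-- On the sphere, every homogeneous polynomial is a sum of harmonic ones, of no larger degree. -/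
theorem exists_harmSum_of_homogeneous (hd : 0 < d) (n : ℕ) : ∀ Q : MvPolynomial (Fin d) ℝ,
    Q.IsHomogeneous n → (∃ H ∈ HarmSum d, ∀ x : Sp d, ‖x‖ = 1 → ev Q x = ev H x) ∧
      ∀ k, n < k → ∀ G ∈ Harm d k, ⟪polyTrace Q, polyTrace G⟫_ℝ = 0 := by
  induction n using Nat.strong_induction_on with
  | _ n ih =>
    intro Q hQ
    rcases lt_or_ge n 2 with hn | hn
    · have hQH : Q ∈ Harm d n := mem_Harm.2 ⟨hQ, lap_eq_zero_of_lt_two hn hQ⟩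
      exact ⟨⟨Q, Harm_le_HarmSum n hQH, fun _ _ => rfl⟩,
        fun k hk G hG => inner_polyTrace_eq_zero hd hk.ne hQH hG⟩
    obtain ⟨m, rfl⟩ : ∃ m, n = m + 2 := ⟨n - 2, by omega⟩
    have hmul : ∀ R : MvPolynomial (Fin d) ℝ, R.IsHomogeneous m →
        (normSqPoly d * R).IsHomogeneous (m + 2) := by
      intro R hR
      have := isHomogeneous_normSqPoly.mul hR
      rwa [add_comm] at this
    have htr : ∀ R : MvPolynomial (Fin d) ℝ, polyTrace (normSqPoly d * R) = polyTrace R := by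
      intro R
      refine polyTrace_congr fun x hx => ?_
      rw [ev_mul, ev_normSqPoly, hx]; ring
    let L : MvPolynomial.homogeneousSubmodule (Fin d) ℝ m →ₗ[ℝ]
        MvPolynomial.homogeneousSubmodule (Fin d) ℝ m :=
      (((lap d).comp (LinearMap.mulLeft ℝ (normSqPoly d))).comp
        (Submodule.subtype _)).codRestrict _ fun R => by
          rw [MvPolynomial.mem_homogeneousSubmodule]
          exact lap_isHomogeneous (hmul R.1 ((MvPolynomial.mem_homogeneousSubmodule _ _).1 R.2))
    have hL : ∀ R, (L R : MvPolynomial (Fin d) ℝ) = lap d (normSqPoly d * R) := fun R => rfl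
    -- If `|x|² R` were harmonic of degree `m + 2`, the induction hypothesis would make it
    -- orthogonal on the sphere to `R`, with which it coincides there; so `R = 0`. In finite
    -- dimension `L` is then onto, and solving `Δ(|x|² R) = ΔQ` makes `Q - |x|² R` harmonic. On the
    -- sphere this reduces `Q` to the polynomial `R` of lower degree.
    have hinj : Function.Injective L := by
      rw [← LinearMap.ker_eq_bot, LinearMap.ker_eq_bot']
      rintro ⟨R, hR⟩ h0
      have hR' := (MvPolynomial.mem_homogeneousSubmodule _ _).1 hR
      have hH : normSqPoly d * R ∈ Harm d (m + 2) :=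
        mem_Harm.2 ⟨hmul R hR', by simpa [hL] using congrArg Subtype.val h0⟩
      have h1 := (ih m (by omega) R hR').2 (m + 2) (by omega) _ hH
      rw [htr, inner_self_eq_zero] at h1
      exact Subtype.ext (eq_zero_of_polyTrace_eq_zero hd hR' h1)
    obtain ⟨⟨R, hR⟩, hRL⟩ := (LinearMap.injective_iff_surjective.1 hinj)
      ⟨lap d Q, (MvPolynomial.mem_homogeneousSubmodule _ _).2 (lap_isHomogeneous hQ)⟩
    have hR' := (MvPolynomial.mem_homogeneousSubmodule _ _).1 hR
    have hlap : lap d (normSqPoly d * R) = lap d Q := by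
      simpa [hL] using congrArg Subtype.val hRL
    have hT : Q - normSqPoly d * R ∈ Harm d (m + 2) :=
      mem_Harm.2 ⟨hQ.sub (hmul R hR'), by rw [map_sub, hlap, sub_self]⟩
    obtain ⟨⟨H, hH, hHe⟩, hort⟩ := ih m (by omega) R hR'
    refine ⟨⟨(Q - normSqPoly d * R) + H, add_mem (Harm_le_HarmSum _ hT) hH, fun x hx => ?_⟩,
      fun k hk G hG => ?_⟩
    · rw [ev_add, ev_sub, ev_mul, ev_normSqPoly, hx, ← hHe x hx]; ring
    · have e : polyTrace Q = polyTrace (Q - normSqPoly d * R) + polyTrace R := by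
        rw [← htr R, ← polyTrace_add, sub_add_cancel]
      rw [e, inner_add_left, hort k (by omega) G hG,
        inner_polyTrace_eq_zero hd hk.ne hT hG, add_zero]

theorem exists_harmSum (hd : 0 < d) (Q : MvPolynomial (Fin d) ℝ) :
    ∃ H ∈ HarmSum d, polyTrace Q = polyTrace H := by
  have h := fun n => (exists_harmSum_of_homogeneous hd n (MvPolynomial.homogeneousComponent n Q)
    (MvPolynomial.homogeneousComponent_isHomogeneous n Q)).1
  choose H hH hHe using h
  refine ⟨∑ n ∈ Finset.range (Q.totalDegree + 1), H n,
    Submodule.sum_mem _ fun n _ => hH n, polyTrace_congr fun x hx => ?_⟩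
  conv_lhs => rw [← MvPolynomial.sum_homogeneousComponent Q]
  rw [ev_sum, ev_sum]
  exact Finset.sum_congr rfl fun n _ => hHe n x hx

/-- Polynomials as continuous functions on the sphere. -/
def polyAlg (d : ℕ) : MvPolynomial (Fin d) ℝ →ₐ[ℝ] C(sphere (0 : Sp d) 1, ℝ) :=
  MvPolynomial.aeval fun i => ⟨fun θ => (θ : Sp d) i, by fun_prop⟩

theorem polyAlg_apply (P : MvPolynomial (Fin d) ℝ) (θ : sphere (0 : Sp d) 1) :
    polyAlg d P θ = ev P θ := by
  induction P using MvPolynomial.induction_on with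
  | C a => simp [polyAlg, ev]
  | add p q hp hq => rw [map_add, ContinuousMap.add_apply, hp, hq, ev_add]
  | mul_X p i hp =>
    rw [map_mul, ContinuousMap.mul_apply, hp, ev_mul, ev_X]
    simp [polyAlg]

theorem dense_range_polyAlg (d : ℕ) : (polyAlg d).range.topologicalClosure = ⊤ := by
  refine ContinuousMap.subalgebra_topologicalClosure_eq_top_of_separatesPoints _ ?_
  intro x y hxy
  have : ∃ i, (x : Sp d) i ≠ (y : Sp d) i := by
    by_contra! h
    exact hxy (Subtype.ext (PiLp.ext h))
  obtain ⟨i, hi⟩ := this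
  refine ⟨_, ⟨polyAlg d (MvPolynomial.X i), ⟨MvPolynomial.X i, rfl⟩, rfl⟩, ?_⟩
  change polyAlg d (MvPolynomial.X i) x ≠ polyAlg d (MvPolynomial.X i) y
  rwa [polyAlg_apply, polyAlg_apply, ev_X, ev_X]

/-- A function on the sphere that is orthogonal to all spherical harmonics vanishes. -/
theorem eq_zero_of_forall_inner_harm (hd : 0 < d) (φ : L2Sphere d)
    (h : ∀ n, ∀ P ∈ Harm d n, ⟪φ, polyTrace P⟫_ℝ = 0) : φ = 0 := by
  have h1 : ∀ H ∈ HarmSum d, ⟪φ, polyTrace H⟫_ℝ = 0 := by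
    intro H hH
    refine Submodule.iSup_induction (Harm d) (motive := fun H => ⟪φ, polyTrace H⟫_ℝ = 0) hH
      (fun n P hP => h n P hP) ?_ fun P Q hP hQ => ?_
    · have : polyTrace (0 : MvPolynomial (Fin d) ℝ) = 0 := by
        simpa using polyTrace_smul 0 (0 : MvPolynomial (Fin d) ℝ)
      rw [this, inner_zero_right]
    · rw [polyTrace_add, inner_add_right, hP, hQ, add_zero]
  have h2 : ∀ P : MvPolynomial (Fin d) ℝ, ⟪φ, polyTrace P⟫_ℝ = 0 := by
    intro P
    obtain ⟨H, hH, e⟩ := exists_harmSum hd P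
    rw [e]
    exact h1 H hH
  have h3 : ∀ f : C(sphere (0 : Sp d) 1, ℝ),
      ⟪φ, ContinuousMap.toLp 2 (surf d) ℝ f⟫_ℝ = 0 := by
    intro f
    have hf : f ∈ closure ((polyAlg d).range : Set C(sphere (0 : Sp d) 1, ℝ)) := by
      have : f ∈ (polyAlg d).range.topologicalClosure := by rw [dense_range_polyAlg]; trivial
      exact this
    refine closure_minimal (s := ((polyAlg d).range : Set C(sphere (0 : Sp d) 1, ℝ)))
      (t := {f | ⟪φ, ContinuousMap.toLp 2 (surf d) ℝ f⟫_ℝ = 0}) ?_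
      (isClosed_eq (continuous_const.inner (ContinuousMap.toLp 2 (surf d) ℝ).continuous)
        continuous_const) hf
    rintro _ ⟨P, rfl⟩
    have : ContinuousMap.toLp 2 (surf d) ℝ (polyAlg d P) = polyTrace P := by
      ext1
      filter_upwards [ContinuousMap.coeFn_toLp (p := 2) (𝕜 := ℝ) (surf d) (polyAlg d P),
        polyTrace_ae P] with x e1 e2
      rw [e1, e2, polyAlg_apply]
    change ⟪φ, ContinuousMap.toLp 2 (surf d) ℝ (polyAlg d P)⟫_ℝ = 0
    rw [this]; exact h2 P
  have hden : DenseRange (ContinuousMap.toLp 2 (surf d) ℝ :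
      C(sphere (0 : Sp d) 1, ℝ) → L2Sphere d) :=
    ContinuousMap.toLp_denseRange ℝ (surf d) ℝ (by norm_num)
  have h4 : ∀ ψ : L2Sphere d, ⟪φ, ψ⟫_ℝ = 0 := by
    intro ψ
    refine hden.induction_on (p := fun ψ => ⟪φ, ψ⟫_ℝ = 0) ψ ?_ h3
    exact isClosed_eq (by fun_prop) continuous_const
  exact inner_self_eq_zero.1 (h4 φ)

/-! ### Spherical harmonics in `H^{1/2}` -/

/-- Polynomials on the ball as elements of `traceGrad`. -/
def polyTG (hd : 0 < d) : MvPolynomial (Fin d) ℝ →ₗ[ℝ] traceGrad d where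
  toFun P := ⟨WithLp.toLp 2 (polyTrace P, polyGrad P), polyL2 P, isH1_poly hd P⟩
  map_add' P Q := by
    refine Subtype.ext ?_
    simp only [polyTrace_add, polyGrad_add]
    rfl
  map_smul' c P := by
    refine Subtype.ext ?_
    simp only [polyTrace_smul, polyGrad_smul]
    rfl

/-- Polynomials on the ball as elements of `H^{1/2}`. -/
def polyHalf (hd : 0 < d) : MvPolynomial (Fin d) ℝ →ₗ[ℝ] HHalf d :=
  (LinearMap.ker (traceMap d)).mkQ.comp (polyTG hd)

theorem toL2_polyHalf (hd : 0 < d) (P : MvPolynomial (Fin d) ℝ) :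
    HHalf.toL2 d (polyHalf hd P) = polyTrace P := rfl

/-- Sums of spherical harmonics are dense in `H^{1/2}`. -/
theorem dense_polyHalf (hd : 2 ≤ d) :
    Dense ((HarmSum d).map (polyHalf (by omega : 0 < d)) : Set (HHalf d)) := by
  have hd0 : 0 < d := by omega
  by_contra hnd
  set S : Submodule ℝ (HHalf d) := (HarmSum d).map (polyHalf hd0)
  have hne : S.topologicalClosure ≠ ⊤ := fun h => hnd (Submodule.dense_iff_topologicalClosure_eq_top.2 h)
  obtain ⟨y, hy⟩ : ∃ y, y ∉ S.topologicalClosure := by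
    by_contra! h
    exact hne (eq_top_iff.2 fun y _ => h y)
  obtain ⟨f, hf0, hfy⟩ : ∃ f : StrongDual ℝ (HHalf d), (∀ s ∈ S.topologicalClosure, f s = 0) ∧
      f y ≠ 0 := by
    obtain ⟨f, u, hlt, hgt⟩ := geometric_hahn_banach_closed_point (E := HHalf d)
      S.topologicalClosure.convex S.isClosed_topologicalClosure hy
    have h0 : ∀ s ∈ S.topologicalClosure, f s = 0 := by
      intro s hs
      by_contra hne
      have h1 := hlt ((u / f s) • s) (S.topologicalClosure.smul_mem _ hs)
      rw [map_smul, smul_eq_mul, div_mul_cancel₀ _ hne] at h1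
      exact lt_irrefl _ h1
    refine ⟨f, h0, fun h => ?_⟩
    have := hlt 0 (zero_mem _)
    rw [map_zero] at this
    linarith
  have hcomp : CompleteSpace (traceGrad d) := (isClosed_traceGrad hd).completeSpace_coe
  let g : StrongDual ℝ (traceGrad d) := f.comp (LinearMap.ker (traceMap d)).mkQL
  obtain ⟨p, hp⟩ : ∃ p : traceGrad d, ∀ q, ⟪p, q⟫_ℝ = g q :=
    ⟨(InnerProductSpace.toDual ℝ (traceGrad d)).symm g, fun q =>
      InnerProductSpace.toDual_symm_apply⟩
  obtain ⟨u, hu⟩ := p.2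
  -- `p` represents the functional lifted to the Hilbert space `traceGrad d`. Green's formula turns
  -- its pairing with a harmonic of degree `n` into `1 + n` times the boundary pairing, so `p` has
  -- zero trace. But the functional vanishes on elements of zero trace, whence `⟪p, p⟫ = 0`.
  have hφ : (p : WithLp 2 (L2Sphere d × L2Vec (unitBall d))).fst = 0 := by
    refine eq_zero_of_forall_inner_harm hd0 _ fun n P hP => ?_
    have h1 : g (polyTG hd0 P) = 0 :=
      hf0 _ (S.le_topologicalClosure ⟨P, Harm_le_HarmSum n hP, rfl⟩)
    rw [← hp, Submodule.coe_inner, WithLp.prod_inner_apply] at h1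
    have h2 := hu.inner_grad_harm hP
    have h3 : ⟪(p : WithLp 2 (L2Sphere d × L2Vec (unitBall d))).fst, polyTrace P⟫_ℝ
        + ⟪(p : WithLp 2 (L2Sphere d × L2Vec (unitBall d))).snd, polyGrad P⟫_ℝ = 0 := h1
    rw [h2] at h3
    have h4 : (1 + (n : ℝ)) *
        ⟪(p : WithLp 2 (L2Sphere d × L2Vec (unitBall d))).fst, polyTrace P⟫_ℝ = 0 := by linarith
    rcases mul_eq_zero.1 h4 with h | h
    · exact absurd h (by positivity)
    · exact h
  have hker : p ∈ LinearMap.ker (traceMap d) := hφ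
  have hp0 : p = 0 := by
    have h1 : g p = 0 := by
      have : (LinearMap.ker (traceMap d)).mkQL p = 0 := by
        rw [Submodule.mkQL_apply]
        exact (Submodule.Quotient.mk_eq_zero _).2 hker
      change f ((LinearMap.ker (traceMap d)).mkQL p) = 0
      exact (congrArg f this).trans (map_zero f)
    rw [← hp] at h1
    exact inner_self_eq_zero.1 h1
  obtain ⟨q, rfl⟩ := HHalf.exists_mk y
  apply hfy
  have := hp q
  rw [hp0, inner_zero_left] at this
  exact this.symm

/-- The norm of a sum of spherical harmonics. -/
theorem le_norm_polyHalf_sq (hd : 0 < d) (s : Finset ℕ) (P : ℕ → MvPolynomial (Fin d) ℝ)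
    (hP : ∀ n, P n ∈ Harm d n) :
    ∑ n ∈ s, (1 + (n : ℝ)) * ‖polyTrace (P n)‖ ^ 2 ≤ ‖polyHalf hd (∑ n ∈ s, P n)‖ ^ 2 := by
  set E := ∑ n ∈ s, (n : ℝ) * ‖polyTrace (P n)‖ ^ 2 with hE
  have hE0 : 0 ≤ E := Finset.sum_nonneg fun n _ => by positivity
  have hlin : ∀ Q : ℕ → MvPolynomial (Fin d) ℝ,
      polyTrace (∑ n ∈ s, Q n) = ∑ n ∈ s, polyTrace (Q n) := fun Q => by
    let f : MvPolynomial (Fin d) ℝ →ₗ[ℝ] L2Sphere d := ⟨⟨polyTrace, polyTrace_add⟩, polyTrace_smul⟩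
    exact map_sum f Q s
  have hlinG : polyGrad (∑ n ∈ s, P n) = ∑ n ∈ s, polyGrad (P n) := by
    let f : MvPolynomial (Fin d) ℝ →ₗ[ℝ] L2Vec (unitBall d) :=
      ⟨⟨polyGrad, polyGrad_add⟩, polyGrad_smul⟩
    exact map_sum f P s
  have hin : ∀ n ∈ s, ⟪polyTrace (∑ n ∈ s, P n), polyTrace (P n)⟫_ℝ = ‖polyTrace (P n)‖ ^ 2 := by
    intro n hn
    rw [hlin, sum_inner, Finset.sum_eq_single n]
    · exact real_inner_self_eq_norm_sq _
    · intro m _ hmn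
      exact inner_polyTrace_eq_zero hd hmn (hP m) (hP n)
    · exact fun h => absurd hn h
  -- Dirichlet's principle: every extension has the same inner product `E` with the harmonic
  -- extension, whose energy is `E`. By Cauchy–Schwarz no extension has less energy.
  have key : ∀ (u : L2 (unitBall d)) (G : L2Vec (unitBall d)),
      IsH1 (unitBall d) u G (polyTrace (∑ n ∈ s, P n)) →
      ⟪G, polyGrad (∑ n ∈ s, P n)⟫_ℝ = E := by
    intro u G h
    rw [hlinG, inner_sum]
    refine Finset.sum_congr rfl fun n hn => ?_
    rw [h.inner_grad_harm (hP n), hin n hn]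
  have hself := key _ _ (isH1_poly hd (∑ n ∈ s, P n))
  rw [real_inner_self_eq_norm_sq] at hself
  have htr : ‖polyTrace (∑ n ∈ s, P n)‖ ^ 2 = ∑ n ∈ s, ‖polyTrace (P n)‖ ^ 2 := by
    rw [← real_inner_self_eq_norm_sq]
    nth_rewrite 2 [hlin]
    rw [inner_sum]
    exact Finset.sum_congr rfl hin
  have hmain : ∀ x : traceGrad d, HHalf.mk x = polyHalf hd (∑ n ∈ s, P n) →
      ∑ n ∈ s, (1 + (n : ℝ)) * ‖polyTrace (P n)‖ ^ 2 ≤ ‖x‖ ^ 2 := by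
    intro x hx
    have h1 : (x : WithLp 2 (L2Sphere d × L2Vec (unitBall d))).fst
        = polyTrace (∑ n ∈ s, P n) := by
      rw [← toL2_polyHalf hd, ← hx, HHalf.toL2_mk]
    obtain ⟨u, hu⟩ := x.2
    rw [h1] at hu
    have h2 := key _ _ hu
    set G := (x : WithLp 2 (L2Sphere d × L2Vec (unitBall d))).snd
    have h3 := real_inner_le_norm G (polyGrad (∑ n ∈ s, P n))
    rw [h2] at h3
    have h4 : E ≤ ‖G‖ ^ 2 := by
      by_contra! hlt
      have h5 : ‖G‖ * ‖polyGrad (∑ n ∈ s, P n)‖ < E := by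
        by_cases hG : ‖G‖ = 0
        · rw [hG, zero_mul]
          rw [hG] at hlt
          simpa using hlt
        · have : ‖G‖ < ‖polyGrad (∑ n ∈ s, P n)‖ := by
            refine lt_of_pow_lt_pow_left₀ 2 (norm_nonneg _) ?_
            rw [hself]; exact hlt
          rw [← hself, sq]
          exact mul_lt_mul_of_pos_right this (lt_of_le_of_lt (norm_nonneg _) this)
      linarith
    rw [Submodule.coe_norm, WithLp.prod_norm_sq_eq_of_L2, h1, htr]
    simp_rw [add_mul, one_mul]
    rw [Finset.sum_add_distrib]
    linarith
  have hle : √(∑ n ∈ s, (1 + (n : ℝ)) * ‖polyTrace (P n)‖ ^ 2)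
      ≤ ‖polyHalf hd (∑ n ∈ s, P n)‖ := by
    refine le_of_forall_pos_lt_add fun ε hε => ?_
    obtain ⟨x, hx, hlt⟩ := Submodule.Quotient.norm_mk_lt
      (S := LinearMap.ker (traceMap d)) (polyHalf hd (∑ n ∈ s, P n)) hε
    refine lt_of_le_of_lt (Real.sqrt_le_left (norm_nonneg _) |>.2 (hmain x hx)) hlt
  have h0 : 0 ≤ ∑ n ∈ s, (1 + (n : ℝ)) * ‖polyTrace (P n)‖ ^ 2 :=
    Finset.sum_nonneg fun n _ => by positivity
  calc _ = √(∑ n ∈ s, (1 + (n : ℝ)) * ‖polyTrace (P n)‖ ^ 2) ^ 2 := (Real.sq_sqrt h0).symm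
    _ ≤ _ := pow_le_pow_left₀ (Real.sqrt_nonneg _) hle 2

end

section

variable {d : ℕ}

/-! ### Radial functions -/

/-- A primitive is determined by its weak formulation. -/
theorem IsPrim.ae_eq_of_weak {Y F f : ℝ → ℝ} {x y : ℝ} (hxy : x < y)
    (hY : IntervalIntegrable Y volume x y) (h : IsPrim F f x y)
    (hw : ∀ g : ℝ → ℝ, ContDiff ℝ ∞ g → HasCompactSupport g → tsupport g ⊆ Ioo x y →
      ∃ k : ℝ → ℝ, (∀ r, HasDerivAt k (g r) r) ∧
        ∫ r in x..y, (g r * Y r + k r * f r) = k y * F y - k x * F x) :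
    ∀ᵐ r, r ∈ Ioo x y → Y r = F r := by
  have hF : IntervalIntegrable F volume x y :=
    (h.continuousOn hxy.le).intervalIntegrable_of_Icc hxy.le
  have hi : IntegrableOn (fun r => Y r - F r) (Ioo x y) := by
    have := (intervalIntegrable_iff_integrableOn_Ioo_of_le hxy.le).1 (hY.sub hF)
    exact this
  have h0 := isOpen_Ioo.ae_eq_zero_of_integral_contDiff_smul_eq_zero
    (μ := (volume : Measure ℝ)) (f := fun r => Y r - F r) (U := Ioo x y) hi.locallyIntegrableOn ?_
  · filter_upwards [h0] with r hr hr'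
    linarith [hr hr']
  intro g hg hc hs
  -- The primitive `k` of `g` may be chosen by the caller, because its integration constant has to
  -- fit the boundary condition. Integration by parts gives `F` the same identity as `Y`, so `Y - F`
  -- is orthogonal to `g`.
  obtain ⟨k, hk, hkY⟩ := hw g hg hc hs
  have hgc : Continuous g := hg.continuous
  have hkc : Continuous k := continuous_iff_continuousAt.2 fun r => (hk r).continuousAt
  have hkp : IsPrim k g x y := IsPrim.of_hasDerivAt countable_empty hxy.le hkc.continuousOn
    (fun t _ => hk t) (hgc.intervalIntegrable _ _)
  have h1 := (hkp.mul h hxy.le).2 y (right_mem_Icc.2 hxy.le)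
  have e1 : ∫ r in x..y, (g r * Y r + k r * f r) = ∫ r in x..y, (g r * F r + k r * f r) := by
    rw [hkY]; linarith
  have i1 : IntervalIntegrable (fun r => g r * Y r) volume x y :=
    hY.continuousOn_mul hgc.continuousOn
  have i2 : IntervalIntegrable (fun r => g r * F r) volume x y :=
    hF.continuousOn_mul hgc.continuousOn
  have i3 : IntervalIntegrable (fun r => k r * f r) volume x y :=
    h.1.continuousOn_mul hkc.continuousOn
  rw [intervalIntegral.integral_add i1 i3, intervalIntegral.integral_add i2 i3,
    add_left_inj] at e1
  have e2 : ∫ r, g r • (Y r - F r) = ∫ r in Ioo x y, g r • (Y r - F r) := by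
    refine (setIntegral_eq_integral_of_forall_compl_eq_zero fun r hr => ?_).symm
    have : g r = 0 := by
      by_contra hne
      exact hr (hs (subset_tsupport g hne))
    rw [this, zero_smul]
  rw [e2, ← integral_Ioc_eq_integral_Ioo, ← intervalIntegral.integral_of_le hxy.le]
  simp_rw [smul_eq_mul, mul_sub]
  rw [intervalIntegral.integral_sub i1 i2, e1, sub_self]

theorem hasFDerivAt_norm {x : Sp d} (hx : x ≠ 0) :
    HasFDerivAt (fun y : Sp d => ‖y‖) (‖x‖⁻¹ • innerSL ℝ x) x := by
  have h1 : HasFDerivAt (fun y : Sp d => ‖y‖ ^ 2) ((2 : ℝ) • innerSL ℝ x) x := by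
    have := (hasStrictFDerivAt_norm_sq x).hasFDerivAt
    convert! this using 1
    simp [two_smul]
  have hx' : ‖x‖ ≠ 0 := norm_ne_zero_iff.2 hx
  have h2 := h1.sqrt (pow_ne_zero 2 hx')
  simp_rw [Real.sqrt_sq (norm_nonneg _)] at h2
  convert! h2 using 1
  rw [smul_smul]
  congr 1
  field_simp

theorem hasFDerivAt_comp_norm {k : ℝ → ℝ} {k' : ℝ} {x : Sp d} (hk : HasDerivAt k k' ‖x‖)
    (hx : x ≠ 0) : HasFDerivAt (fun y : Sp d => k ‖y‖) ((k' / ‖x‖) • innerSL ℝ x) x := by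
  have := hk.comp_hasFDerivAt x (hasFDerivAt_norm hx)
  rwa [smul_smul, ← div_eq_mul_inv] at this

theorem contDiff_comp_norm {k : ℝ → ℝ} (hk : ContDiff ℝ ∞ k) {c : ℝ}
    (h0 : ∀ᶠ r in nhds 0, k r = c) : ContDiff ℝ ∞ fun x : Sp d => k ‖x‖ := by
  rw [contDiff_iff_contDiffAt]
  intro x
  by_cases hx : x = 0
  · subst hx
    have : (fun x : Sp d => k ‖x‖) =ᶠ[nhds 0] fun _ => c := by
      have := (continuous_norm (E := Sp d)).tendsto 0
      rw [norm_zero] at this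
      exact this.eventually h0
    exact contDiffAt_const.congr_of_eventuallyEq this
  · exact hk.contDiffAt.comp x (contDiffAt_norm ℝ hx)

/-! ### Spherical means -/

/-- `r^{d-1}` times the integral of `f(rθ)` over the unit sphere. -/
def sphMean (f : Sp d → ℝ) (r : ℝ) : ℝ := r ^ (d - 1) * ∫ θ, f (r • (θ : Sp d)) ∂(surf d)

theorem integrableOn_sphMean (hd : 0 < d) {f : Sp d → ℝ} (hf : IntegrableOn f (shell d)) :
    IntegrableOn (sphMean f) (Ioo (1 / 2) 1) := by
  have h := integrable_polar_on hd (measurableSet_Ioo (a := (1 / 2 : ℝ)) (b := 1))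
    (fun r hr => lt_trans (by norm_num) hr.1) hf
  have := h.swap.integral_prod_left
  refine this.congr (Filter.Eventually.of_forall fun r => ?_)
  simp [sphMean, integral_const_mul]

theorem integral_mul_sphMean (hd : 0 < d) {f : Sp d → ℝ} {κ : ℝ → ℝ}
    (hf : IntegrableOn (fun x => κ ‖x‖ * f x) (shell d)) :
    ∫ x in shell d, κ ‖x‖ * f x = ∫ r in (1 / 2 : ℝ)..1, κ r * sphMean f r := by
  have h0 : Ioo (1 / 2 : ℝ) 1 ⊆ Ioi 0 := fun r hr => lt_trans (by norm_num) hr.1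
  have h := integrable_polar_on hd measurableSet_Ioo h0 hf
  have e := integral_polar_on hd measurableSet_Ioo h0 hf
  change ∫ x in {x : Sp d | ‖x‖ ∈ Ioo (1 / 2 : ℝ) 1}, κ ‖x‖ * f x = _
  rw [e, integral_prod_symm _ h, intervalIntegral.integral_of_le (by norm_num),
    integral_Ioc_eq_integral_Ioo]
  refine setIntegral_congr_fun measurableSet_Ioo fun r hr => ?_
  have hr0 : 0 < r := h0 hr
  have hn : ∀ θ : sphere (0 : Sp d) 1, ‖r • (θ : Sp d)‖ = r := by
    intro θ; simp [norm_smul, abs_of_pos hr0]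
  simp only [hn, sphMean]
  rw [integral_const_mul, integral_const_mul]
  ring

theorem integrableOn_radial_mul {f : Sp d → ℝ} {κ : ℝ → ℝ} {C : ℝ} (hκ : Measurable κ)
    (hC : ∀ r ∈ Ioo (1 / 2 : ℝ) 1, |κ r| ≤ C) (hf : IntegrableOn f (shell d)) :
    IntegrableOn (fun x => κ ‖x‖ * f x) (shell d) := by
  refine Integrable.bdd_mul (c := C) hf (hκ.comp measurable_norm).aestronglyMeasurable ?_
  filter_upwards [ae_restrict_mem admissible_shell.measurableSet] with x hx
  exact hC _ hx

theorem exists_bound_Ioo {κ : ℝ → ℝ} (hκ : ContinuousOn κ (Icc (1 / 2) 1)) :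
    ∃ C, ∀ r ∈ Ioo (1 / 2 : ℝ) 1, |κ r| ≤ C := by
  obtain ⟨C, hC⟩ := isCompact_Icc.exists_bound_of_continuousOn hκ
  exact ⟨C, fun r hr => hC r (Ioo_subset_Icc_self hr)⟩

/-! ### Green's formula with radial factors -/

/-- Green's formula on the shell, for the vector field `k(|x|) Q(x)`. -/
theorem IsH1.green_radial {u : L2 (shell d)} {G : L2Vec (shell d)} {φ : L2Sphere d}
    (h : IsH1 (shell d) u G φ) {k : ℝ → ℝ} (hk : ContDiff ℝ ∞ k) (hs : tsupport k ⊆ Ioi (1 / 2))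
    (Q : Fin d → MvPolynomial (Fin d) ℝ) :
    (∫ x in shell d, u x * (k ‖x‖ * ev (∑ i, MvPolynomial.pderiv i (Q i)) x
        + deriv k ‖x‖ / ‖x‖ * ev (∑ i, MvPolynomial.X i * Q i) x))
      + (∫ x in shell d, k ‖x‖ * ∑ i, G x i * ev (Q i) x)
      = k 1 * ∫ θ, φ θ * ev (∑ i, MvPolynomial.X i * Q i) (θ : Sp d) ∂(surf d) := by
  have h0 : ∀ᶠ r in nhds (0 : ℝ), k r = 0 := by
    filter_upwards [Iio_mem_nhds (show (0 : ℝ) < 1 / 2 by norm_num)] with r hr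
    by_contra hne
    have h1 : 1 / 2 < r := hs (subset_tsupport k hne)
    have h2 : r < 1 / 2 := hr
    linarith
  have hkn := contDiff_comp_norm (d := d) hk h0
  have hsupp : ∀ i, tsupport (fun x : Sp d => k ‖x‖ * ev (Q i) x) ⊆ shell d ∪ (unitBall d)ᶜ := by
    intro i x hx
    have h1 : x ∈ tsupport fun x : Sp d => k ‖x‖ := tsupport_mul_subset_left hx
    have h2 : ‖x‖ ∈ tsupport k := tsupport_comp_subset_preimage k continuous_norm h1
    have h3 : 1 / 2 < ‖x‖ := hs h2
    by_cases hx1 : ‖x‖ < 1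
    · exact Or.inl ⟨h3, hx1⟩
    · exact Or.inr fun h' => hx1 (mem_unitBall.1 h')
  have := h.green admissible_shell (Ψ := fun i x => k ‖x‖ * ev (Q i) x)
    (fun i => hkn.mul (contDiff_ev _)) hsupp
  convert this using 1
  · congr 1
    · refine setIntegral_congr_fun admissible_shell.measurableSet fun x hx => ?_
      have hx0 : x ≠ 0 := by
        rintro rfl
        have := hx.1
        rw [norm_zero] at this
        linarith
      have hd1 := hasFDerivAt_comp_norm ((hk.differentiable (by simp)).differentiableAt.hasDerivAt
        (x := ‖x‖)) hx0
      have e : ∀ i, fderiv ℝ (fun x : Sp d => k ‖x‖ * ev (Q i) x) x (EuclideanSpace.single i 1)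
          = k ‖x‖ * ev (MvPolynomial.pderiv i (Q i)) x
            + deriv k ‖x‖ / ‖x‖ * (x i * ev (Q i) x) := by
        intro i
        rw [fderiv_fun_mul hd1.differentiableAt
          ((contDiff_ev (Q i) (n := 1)).differentiable (by simp) x), hd1.fderiv]
        simp only [_root_.add_apply, _root_.smul_apply, smul_eq_mul, fderiv_ev, innerSL_apply_apply,
          EuclideanSpace.inner_single_right]
        simp
        ring
      beta_reduce
      simp_rw [e, Finset.sum_add_distrib, ← Finset.mul_sum, ev_sum, ev_mul, ev_X]
    · refine setIntegral_congr_fun admissible_shell.measurableSet fun x hx => ?_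
      beta_reduce
      rw [Finset.mul_sum]
      exact Finset.sum_congr rfl fun i _ => by ring
  · rw [← integral_const_mul]
    refine integral_congr_ae (Filter.Eventually.of_forall fun θ => ?_)
    have hθ : ‖(θ : Sp d)‖ = 1 := by simp
    simp only [hθ, ev_sum, ev_mul, ev_X, Finset.mul_sum]
    exact Finset.sum_congr rfl fun i _ => by ring

/-- Smooth functions are `H¹` functions. -/
theorem isH1_smooth (hd : 0 < d) {f : Sp d → ℝ} (hf : ContDiff ℝ ∞ f) {u : L2 (unitBall d)}
    {G : L2Vec (unitBall d)} {φ : L2Sphere d}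
    (hu : u =ᵐ[(volume : Measure (Sp d)).restrict (unitBall d)] f)
    (hG : ∀ᵐ x ∂((volume : Measure (Sp d)).restrict (unitBall d)), ∀ i,
      G x i = fderiv ℝ f x (EuclideanSpace.single i 1))
    (hφ : φ =ᵐ[surf d] fun θ : sphere (0 : Sp d) 1 => f θ) : IsH1 (unitBall d) u G φ := by
  intro ψ hψ hc hs i
  have h := integral_fderiv_ball hd (f := fun x => ψ x * f x) (hψ.mul hf) hc.mul_right i
  have e0 : ∀ x, fderiv ℝ (fun x => ψ x * f x) x (EuclideanSpace.single i 1)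
      = f x * fderiv ℝ ψ x (EuclideanSpace.single i 1)
        + fderiv ℝ f x (EuclideanSpace.single i 1) * ψ x := by
    intro x
    rw [fderiv_fun_mul (hψ.differentiable (by simp) x) (hf.differentiable (by simp) x)]
    simp only [_root_.add_apply, _root_.smul_apply, smul_eq_mul]
    ring
  simp_rw [e0] at h
  have hi1 : Integrable (fun x => f x * fderiv ℝ ψ x (EuclideanSpace.single i 1)) :=
    (hf.continuous.mul (continuous_aux hψ i)).integrable_of_hasCompactSupport
      (compactSupport_aux hc i).mul_left
  have hi2 : Integrable (fun x => fderiv ℝ f x (EuclideanSpace.single i 1) * ψ x) :=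
    ((continuous_aux hf i).mul hψ.continuous).integrable_of_hasCompactSupport hc.mul_left
  rw [integral_add hi1.integrableOn hi2.integrableOn] at h
  convert h using 1
  · congr 1
    · refine integral_congr_ae ?_
      filter_upwards [hu] with x hx
      rw [hx]
    · refine integral_congr_ae ?_
      filter_upwards [hG] with x hx
      rw [hx]
  · refine integral_congr_ae ?_
    filter_upwards [hφ] with x hx
    rw [hx]; ring

end

section

variable {d : ℕ}

/-! ### Projection of weak solutions onto spherical harmonics -/

/-- The primitive vanishes near the inner radius, which Green's formula on the shell requires.
Shifted by its value at the outer radius, it vanishes there and is constant near the inner one,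
which is right for the weak equation with a natural inner boundary condition. -/
theorem exists_primitive {g : ℝ → ℝ} {x y : ℝ} (hxy : x < y) (hg : ContDiff ℝ ∞ g)
    (hc : HasCompactSupport g) (hs : tsupport g ⊆ Ioo x y) :
    ∃ k : ℝ → ℝ, ContDiff ℝ ∞ k ∧ (∀ r, HasDerivAt k (g r) r) ∧ ∃ a b, x < a ∧ b < y ∧
      (∀ r ≤ a, k r = 0) ∧ ∀ r, b ≤ r → k r = k y := by
  have hgc := hg.continuous
  obtain ⟨a, b, hxa, hby, ha, hb⟩ : ∃ a b, x < a ∧ b < y ∧ (∀ r < a, g r = 0) ∧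
      ∀ r, b < r → g r = 0 := by
    rcases (tsupport g).eq_empty_or_nonempty with h | h
    · have : g = 0 := by rwa [tsupport_eq_empty_iff] at h
      -- For `g = 0` there is no support to bound and any `a`, `b` beyond the end points will do.
      exact ⟨y, x, hxy, hxy, by simp [this], by simp [this]⟩
    · have hcK : IsCompact (tsupport g) := hc
      refine ⟨sInf (tsupport g), sSup (tsupport g), (hs (hcK.sInf_mem h)).1,
        (hs (hcK.sSup_mem h)).2, fun r hr => ?_, fun r hr => ?_⟩
      · by_contra hne
        exact absurd (csInf_le hcK.bddBelow (subset_tsupport g hne)) (not_le.2 hr)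
      · by_contra hne
        exact absurd (le_csSup hcK.bddAbove (subset_tsupport g hne)) (not_le.2 hr)
  have hder : ∀ r, HasDerivAt (fun r => ∫ t in x..r, g t) (g r) r := fun r =>
    intervalIntegral.integral_hasDerivAt_right (hgc.intervalIntegrable _ _)
      hgc.stronglyMeasurable.stronglyMeasurableAtFilter hgc.continuousAt
  have hzero : ∀ s t : ℝ, (∀ r, min s t < r → r < max s t → g r = 0) → ∫ r in s..t, g r = 0 := by
    intro s t hst
    rw [intervalIntegral.integral_congr_ae (g := fun _ => 0)]
    · simp
    · have : ∀ᵐ r : ℝ, r ≠ max s t := by simp [ae_iff]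
      filter_upwards [this] with r hr hr'
      exact hst r hr'.1 (lt_of_le_of_ne hr'.2 hr)
  refine ⟨fun r => ∫ t in x..r, g t, ?_, hder, a, b, hxa, hby, fun r hr => ?_, fun r hr => ?_⟩
  · rw [contDiff_infty_iff_deriv]
    refine ⟨fun r => (hder r).differentiableAt, ?_⟩
    rwa [show deriv (fun r => ∫ t in x..r, g t) = g from funext fun r => (hder r).deriv]
  · exact hzero x r fun t _ ht => ha t (ht.trans_le (max_le hxa.le hr))
  · beta_reduce
    rw [← intervalIntegral.integral_add_adjacent_intervals (hgc.intervalIntegrable x r)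
      (hgc.intervalIntegrable r y), hzero r y fun t ht _ => hb t ((le_min hr hby.le).trans_lt ht),
      add_zero]

theorem isPrim_integral {f : ℝ → ℝ} {x y : ℝ} (hf : IntervalIntegrable f volume x y) (c : ℝ) :
    IsPrim (fun r => c + ∫ t in x..r, f t) f x y :=
  ⟨hf, fun r _ => by simp⟩

theorem hasDerivAt_inv_pow (m : ℕ) {t : ℝ} (ht : t ≠ 0) :
    HasDerivAt (fun t : ℝ => (t ^ m)⁻¹) (-m * (t ^ m * t)⁻¹) t := by
  convert! (hasDerivAt_pow m t).inv (pow_ne_zero m ht) using 1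
  rcases m with _ | m
  · simp
  · rw [Nat.add_sub_cancel]
    field_simp
    ring

theorem isPrim_inv_pow (m : ℕ) {x y : ℝ} (hx : 0 < x) (hxy : x ≤ y) :
    IsPrim (fun r : ℝ => (r ^ m)⁻¹) (fun r => -m * (r ^ m * r)⁻¹) x y := by
  have h0 : ∀ r ∈ Icc x y, r ≠ 0 := fun r hr => (hx.trans_le hr.1).ne'
  refine IsPrim.of_hasDerivAt countable_empty hxy ?_ (fun r hr => ?_) ?_
  · exact ContinuousOn.inv₀ (by fun_prop) fun r hr => pow_ne_zero _ (h0 r hr)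
  · have hr0 := h0 r (Ioo_subset_Icc_self hr.1)
    exact hasDerivAt_inv_pow m hr0
  · refine ContinuousOn.intervalIntegrable_of_Icc hxy (continuousOn_const.mul ?_)
    exact ContinuousOn.inv₀ (by fun_prop) fun r hr => mul_ne_zero (pow_ne_zero _ (h0 r hr)) (h0 r hr)

theorem shell_ne_zero {x : Sp d} (hx : x ∈ shell d) : ‖x‖ ≠ 0 := by
  have := hx.1
  linarith

section

variable {u : L2 (shell d)} {G : L2Vec (shell d)} {φ : L2Sphere d}

theorem integrableOn_mul_ev (u : L2 (shell d)) (P : MvPolynomial (Fin d) ℝ) :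
    IntegrableOn (fun x => u x * ev P x) (shell d) :=
  integrable_lp_mul admissible_shell u (continuous_ev P)

theorem integrableOn_sum_mul_ev (G : L2Vec (shell d)) (Q : Fin d → MvPolynomial (Fin d) ℝ) :
    IntegrableOn (fun x => ∑ i, G x i * ev (Q i) x) (shell d) :=
  integrable_finsetSum _ fun i _ => integrable_lpVec_mul admissible_shell G i (continuous_ev (Q i))

/-- Green's formula for `k(|x|) P(x) x`. -/
theorem IsH1.weak_radial (hd : 0 < d) (h : IsH1 (shell d) u G φ) {n : ℕ}
    {P : MvPolynomial (Fin d) ℝ} (hP : P.IsHomogeneous n) {k : ℝ → ℝ} (hk : ContDiff ℝ ∞ k)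
    (hs : tsupport k ⊆ Ioi (1 / 2)) :
    ∫ r in (1 / 2 : ℝ)..1, (deriv k r * (r * sphMean (fun x => u x * ev P x) r)
      + k r * ((d + n) * sphMean (fun x => u x * ev P x) r
        + sphMean (fun x => ∑ i, G x i * ev (MvPolynomial.X i * P) x) r))
      = k 1 * ⟪φ, polyTrace P⟫_ℝ := by
  have hg := h.green_radial hk hs fun i => MvPolynomial.X i * P
  have e1 : ∀ x : Sp d, ev (∑ i, MvPolynomial.pderiv i (MvPolynomial.X i * P)) x
      = (d + n) * ev P x := by
    intro x
    have := euler hP x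
    simp only [Derivation.leibniz, MvPolynomial.pderiv_X_self, smul_eq_mul, ev_sum, ev_add, ev_mul,
      mul_one, Finset.sum_add_distrib, ev_X]
    rw [this]
    simp
    ring
  have e2 : ∀ x : Sp d, ev (∑ i, MvPolynomial.X i * (MvPolynomial.X i * P)) x
      = ‖x‖ ^ 2 * ev P x := by
    intro x
    rw [← ev_normSqPoly, ← ev_mul, normSqPoly, Finset.sum_mul]
    congr 1
    exact Finset.sum_congr rfl fun i _ => by ring
  have e3 : ∀ θ : sphere (0 : Sp d) 1, ‖(θ : Sp d)‖ = 1 := fun θ => by simp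
  simp_rw [e1, e2, e3] at hg
  rw [inner_polyTrace]
  simp only [one_pow, one_mul] at hg
  rw [← hg]
  have hkc := hk.continuous
  have hkd : Continuous (deriv k) := hk.continuous_deriv (by simp)
  have hκc : Continuous fun r => deriv k r * r + k r * (d + n) := by fun_prop
  obtain ⟨C, hC⟩ := exists_bound_Ioo hκc.continuousOn
  obtain ⟨C', hC'⟩ := exists_bound_Ioo hkc.continuousOn
  have i1 := integrableOn_mul_ev u P
  have i2 := integrableOn_sum_mul_ev G fun i => MvPolynomial.X i * P
  have j1 := integral_mul_sphMean hd (integrableOn_radial_mul hκc.measurable hC i1)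
  have j2 := integral_mul_sphMean hd (integrableOn_radial_mul hkc.measurable hC' i2)
  have s1 := (intervalIntegrable_iff_integrableOn_Ioo_of_le (by norm_num)).2
    (integrableOn_sphMean hd i1)
  have s2 := (intervalIntegrable_iff_integrableOn_Ioo_of_le (by norm_num)).2
    (integrableOn_sphMean hd i2)
  rw [j2]
  have e4 : ∫ x in shell d, u x * (k ‖x‖ * ((d + n) * ev P x)
      + deriv k ‖x‖ / ‖x‖ * (‖x‖ ^ 2 * ev P x))
      = ∫ x in shell d, (deriv k ‖x‖ * ‖x‖ + k ‖x‖ * (d + n)) * (u x * ev P x) := by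
    refine setIntegral_congr_fun admissible_shell.measurableSet fun x hx => ?_
    have := shell_ne_zero hx
    beta_reduce
    field_simp
    ring
  rw [e4, j1, ← intervalIntegral.integral_add (s1.continuousOn_mul hκc.continuousOn)
    (s2.continuousOn_mul hkc.continuousOn)]
  exact intervalIntegral.integral_congr fun r _ => by ring

/-- Green's formula for the tangential field `k(|x|) (|x|² ∇P - n P x)`. -/
theorem IsH1.weak_tangential (hd : 0 < d) (h : IsH1 (shell d) u G φ) {n : ℕ}
    {P : MvPolynomial (Fin d) ℝ} (hP : P ∈ Harm d n) :
    ∀ᵐ r, r ∈ Ioo (1 / 2 : ℝ) 1 →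
      r ^ 2 * sphMean (fun x => ∑ i, G x i * ev (MvPolynomial.pderiv i P) x) r
        = n * sphMean (fun x => ∑ i, G x i * ev (MvPolynomial.X i * P) x) r
          + n * (n + d - 2) * sphMean (fun x => u x * ev P x) r := by
  obtain ⟨hhom, hlap⟩ := mem_Harm.1 hP
  have i1 := integrableOn_mul_ev u P
  have i2 := integrableOn_sum_mul_ev G fun i => MvPolynomial.X i * P
  have i3 := integrableOn_sum_mul_ev G fun i => MvPolynomial.pderiv i P
  set Z1 := sphMean fun x => u x * ev P x
  set Z2 := sphMean fun x => ∑ i, G x i * ev (MvPolynomial.X i * P) x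
  set Z3 := sphMean fun x => ∑ i, G x i * ev (MvPolynomial.pderiv i P) x
  have s1 : IntegrableOn Z1 (Ioo (1 / 2) 1) := integrableOn_sphMean hd i1
  have s2 : IntegrableOn Z2 (Ioo (1 / 2) 1) := integrableOn_sphMean hd i2
  have s3 : IntegrableOn Z3 (Ioo (1 / 2) 1) := integrableOn_sphMean hd i3
  have v1 := (intervalIntegrable_iff_integrableOn_Ioo_of_le (by norm_num)).2 s1
  have v2 := (intervalIntegrable_iff_integrableOn_Ioo_of_le (by norm_num)).2 s2
  have v3 := (intervalIntegrable_iff_integrableOn_Ioo_of_le (by norm_num)).2 s3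
  have v3' : IntervalIntegrable (fun r => r ^ 2 * Z3 r) volume (1 / 2) 1 :=
    v3.continuousOn_mul (by fun_prop)
  have v : IntervalIntegrable (fun r => r ^ 2 * Z3 r - n * Z2 r - n * (n + d - 2) * Z1 r)
      volume (1 / 2) 1 := (v3'.sub (v2.const_mul n)).sub (v1.const_mul _)
  have vi := (intervalIntegrable_iff_integrableOn_Ioo_of_le (by norm_num)).1 v
  have h0 := isOpen_Ioo.ae_eq_zero_of_integral_contDiff_smul_eq_zero
    (μ := (volume : Measure ℝ)) (f := fun r => r ^ 2 * Z3 r - n * Z2 r - n * (n + d - 2) * Z1 r)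
    (U := Ioo (1 / 2) 1) vi.locallyIntegrableOn ?_
  · filter_upwards [h0] with r hr hr'
    linarith [hr hr']
  intro k hk hc hs
  have hg := h.green_radial hk (hs.trans fun r hr => hr.1)
    fun i => normSqPoly d * MvPolynomial.pderiv i P - (n : ℝ) • (MvPolynomial.X i * P)
  have eu : ∀ x : Sp d, ∑ i, x i * ev (MvPolynomial.pderiv i P) x = n * ev P x := fun x =>
    euler hhom x
  -- The field `|x|² ∇P - n P x` is tangent to spheres by Euler's identity. Its divergence
  -- `-n(n+d-2) P` shows the eigenvalue of the spherical Laplacian.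
  have e1 : ∀ x : Sp d, ev (∑ i, MvPolynomial.pderiv i (normSqPoly d * MvPolynomial.pderiv i P
      - (n : ℝ) • (MvPolynomial.X i * P))) x = -(n * (n + d - 2)) * ev P x := by
    intro x
    have hpn : ∀ i, MvPolynomial.pderiv i (normSqPoly d) = 2 * MvPolynomial.X i := by
      intro i
      rw [normSqPoly, map_sum, Finset.sum_eq_single i]
      · rw [Derivation.leibniz_pow, MvPolynomial.pderiv_X_self]; simp
      · intro j _ hj
        rw [Derivation.leibniz_pow, MvPolynomial.pderiv_X_of_ne hj]; simp
      · simp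
    have hl : ∑ i, ev (MvPolynomial.pderiv i (MvPolynomial.pderiv i P)) x = 0 := by
      rw [← ev_sum, ← lap_apply, hlap, ev_zero]
    have h2 : ev (2 : MvPolynomial (Fin d) ℝ) x = 2 := by simp [ev]
    simp only [map_sub, Derivation.map_smul, Derivation.leibniz, MvPolynomial.pderiv_X_self, hpn,
      smul_eq_mul, ev_sum, ev_add, ev_sub, ev_mul, ev_smul, mul_one, Finset.sum_add_distrib, ev_X,
      Finset.sum_sub_distrib, ← Finset.mul_sum, hl, eu, h2]
    have : ∑ i, ev (MvPolynomial.pderiv i P) x * (2 * x i) = 2 * (n * ev P x) := by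
      rw [← eu, Finset.mul_sum]
      exact Finset.sum_congr rfl fun i _ => by ring
    rw [this]
    simp
    ring
  have e2 : ∀ x : Sp d, ev (∑ i, MvPolynomial.X i * (normSqPoly d * MvPolynomial.pderiv i P
      - (n : ℝ) • (MvPolynomial.X i * P))) x = 0 := by
    intro x
    simp only [ev_sum, ev_mul, ev_sub, ev_smul, ev_X, ev_normSqPoly]
    have : ∀ i, x i * (‖x‖ ^ 2 * ev (MvPolynomial.pderiv i P) x - n * (x i * ev P x))
        = ‖x‖ ^ 2 * (x i * ev (MvPolynomial.pderiv i P) x) - n * ev P x * x i ^ 2 := fun i => by ring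
    simp_rw [this, Finset.sum_sub_distrib, ← Finset.mul_sum, eu, ← EuclideanSpace.real_norm_sq_eq]
    ring
  have e3 : ∀ x : Sp d, ∑ i, G x i * ev (normSqPoly d * MvPolynomial.pderiv i P
      - (n : ℝ) • (MvPolynomial.X i * P)) x
      = ‖x‖ ^ 2 * (∑ i, G x i * ev (MvPolynomial.pderiv i P) x)
        - n * ∑ i, G x i * ev (MvPolynomial.X i * P) x := by
    intro x
    rw [Finset.mul_sum, Finset.mul_sum, ← Finset.sum_sub_distrib]
    refine Finset.sum_congr rfl fun i _ => ?_
    simp only [ev_sub, ev_mul, ev_smul, ev_normSqPoly]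
    ring
  simp_rw [e1, e2, e3] at hg
  simp only [mul_zero, add_zero, integral_zero] at hg
  have hkc := hk.continuous
  have hκc : Continuous fun r : ℝ => k r * r ^ 2 := by fun_prop
  obtain ⟨C, hC⟩ := exists_bound_Ioo hκc.continuousOn
  obtain ⟨C', hC'⟩ := exists_bound_Ioo hkc.continuousOn
  have j1 := integral_mul_sphMean hd (integrableOn_radial_mul hkc.measurable hC' i1)
  have r2 := integrableOn_radial_mul hkc.measurable hC' i2
  have r3 := integrableOn_radial_mul hκc.measurable hC i3
  have j2 := integral_mul_sphMean hd r2
  have j3 := integral_mul_sphMean hd (κ := fun r => k r * r ^ 2) r3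
  have e4 : ∫ x in shell d, k ‖x‖ * (‖x‖ ^ 2 * (∑ i, G x i * ev (MvPolynomial.pderiv i P) x)
        - n * ∑ i, G x i * ev (MvPolynomial.X i * P) x)
      = (∫ r in (1 / 2 : ℝ)..1, k r * r ^ 2 * Z3 r) - n * ∫ r in (1 / 2 : ℝ)..1, k r * Z2 r := by
    rw [← j2, ← j3, ← integral_const_mul, ← integral_sub r3 (r2.const_mul _)]
    refine integral_congr_ae (Filter.Eventually.of_forall fun x => ?_)
    beta_reduce
    ring
  have e5 : ∫ x in shell d, u x * (k ‖x‖ * (-(n * (n + d - 2)) * ev P x))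
      = -(n * (n + d - 2)) * ∫ r in (1 / 2 : ℝ)..1, k r * Z1 r := by
    rw [← j1, ← integral_const_mul]
    refine integral_congr_ae (Filter.Eventually.of_forall fun x => ?_)
    beta_reduce
    ring
  rw [e4, e5] at hg
  have e6 : ∫ r, k r • (r ^ 2 * Z3 r - n * Z2 r - n * (n + d - 2) * Z1 r)
      = ∫ r in Ioo (1 / 2 : ℝ) 1, k r • (r ^ 2 * Z3 r - n * Z2 r - n * (n + d - 2) * Z1 r) := by
    refine (setIntegral_eq_integral_of_forall_compl_eq_zero fun r hr => ?_).symm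
    have : k r = 0 := by
      by_contra hne
      exact hr (hs (subset_tsupport k hne))
    rw [this, zero_smul]
  have w1 := v1.continuousOn_mul hkc.continuousOn
  have w2 := v2.continuousOn_mul hkc.continuousOn
  have w3 := v3.continuousOn_mul hκc.continuousOn
  rw [e6, ← integral_Ioc_eq_integral_Ioo, ← intervalIntegral.integral_of_le (by norm_num)]
  rw [← intervalIntegral.integral_const_mul, ← intervalIntegral.integral_const_mul,
    ← intervalIntegral.integral_sub w3 (w2.const_mul _),
    ← intervalIntegral.integral_add (w1.const_mul _) (w3.sub (w2.const_mul _))] at hg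
  rw [← hg]
  exact intervalIntegral.integral_congr fun r _ => by simp only [smul_eq_mul]; ring

/-- The weak equation tested with `k(|x|) P(x)`. -/
theorem IsWeakSolution.weak_radial (hd : 0 < d) {A : ℝ → ℝ} (hA : Measurable A) {M : ℝ}
    (hM : ∀ r ∈ Ioo (1 / 2 : ℝ) 1, |A r| ≤ M)
    (h : IsWeakSolution (shell d) (fun x => A ‖x‖) φ u G)
    {P : MvPolynomial (Fin d) ℝ} {k : ℝ → ℝ} (hk : ContDiff ℝ ∞ k)
    {c : ℝ} (h0 : ∀ᶠ r in nhds 0, k r = c) (h1 : k 1 = 0) :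
    ∫ r in (1 / 2 : ℝ)..1,
      (deriv k r * (A r / r * sphMean (fun x => ∑ i, G x i * ev (MvPolynomial.X i * P) x) r)
      + k r * (A r * sphMean (fun x => ∑ i, G x i * ev (MvPolynomial.pderiv i P) x) r)) = 0 := by
  have hkn := contDiff_comp_norm (d := d) hk h0
  set f : Sp d → ℝ := fun x => k ‖x‖ * ev P x with hf
  have hfs : ContDiff ℝ ∞ f := hkn.mul (contDiff_ev P)
  set gr : Sp d → Sp d := fun x => WithLp.toLp 2 fun i => fderiv ℝ f x (EuclideanSpace.single i 1)
    with hgr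
  have hgrc : Continuous gr := by
    refine (PiLp.continuous_toLp 2 _).comp (continuous_pi fun i => continuous_aux hfs i)
  have hH := isH1_smooth hd hfs (u := (memLp_ball_of_continuous hfs.continuous).toLp f)
    (G := (memLp_ball_of_continuous hgrc).toLp gr) (φ := 0) (MemLp.coeFn_toLp _)
    (by
      filter_upwards [MemLp.coeFn_toLp (memLp_ball_of_continuous hgrc)] with x hx i
      rw [hx])
    (by
      filter_upwards [Lp.coeFn_zero ℝ 2 (surf d)] with θ hθ
      have : ‖(θ : Sp d)‖ = 1 := by simp
      rw [hθ, hf]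
      simp [this, h1])
  have hw := h.2 _ _ (hH.restrict admissible_shell)
  have hsub : (volume : Measure (Sp d)).restrict (shell d)
      ≤ (volume : Measure (Sp d)).restrict (unitBall d) :=
    Measure.restrict_mono admissible_shell.subset le_rfl
  have i2 := integrableOn_sum_mul_ev G fun i => MvPolynomial.X i * P
  have i3 := integrableOn_sum_mul_ev G fun i => MvPolynomial.pderiv i P
  have hkc := hk.continuous
  have hkd : Continuous (deriv k) := hk.continuous_deriv (by simp)
  obtain ⟨C3, hC3⟩ := exists_bound_Ioo hkc.continuousOn
  obtain ⟨C2, hC2⟩ := exists_bound_Ioo (κ := fun r => deriv k r / r)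
    (hkd.continuousOn.div continuousOn_id fun r hr =>
      (lt_of_lt_of_le (by norm_num) hr.1 : (0 : ℝ) < r).ne')
  have b3 : ∀ r ∈ Ioo (1 / 2 : ℝ) 1, |k r * A r| ≤ C3 * M := fun r hr => by
    rw [abs_mul]
    exact mul_le_mul (hC3 r hr) (hM r hr) (abs_nonneg _) ((abs_nonneg _).trans (hC3 r hr))
  have b2 : ∀ r ∈ Ioo (1 / 2 : ℝ) 1, |deriv k r / r * A r| ≤ C2 * M := fun r hr => by
    rw [abs_mul]
    exact mul_le_mul (hC2 r hr) (hM r hr) (abs_nonneg _) ((abs_nonneg _).trans (hC2 r hr))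
  have m3 : Measurable fun r => k r * A r := hkc.measurable.mul hA
  have m2 : Measurable fun r => deriv k r / r * A r := (hkd.measurable.div measurable_id).mul hA
  have r2 := integrableOn_radial_mul m2 b2 i2
  have r3 := integrableOn_radial_mul m3 b3 i3
  have j2 := integral_mul_sphMean hd (κ := fun r => deriv k r / r * A r) r2
  have j3 := integral_mul_sphMean hd (κ := fun r => k r * A r) r3
  have e : ∫ x in shell d, A ‖x‖ * ⟪G x, restrictOp admissible_shell
        ((memLp_ball_of_continuous hgrc).toLp gr) x⟫_ℝ
      = (∫ x in shell d, deriv k ‖x‖ / ‖x‖ * A ‖x‖ * ∑ i, G x i * ev (MvPolynomial.X i * P) x)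
        + ∫ x in shell d, k ‖x‖ * A ‖x‖ * ∑ i, G x i * ev (MvPolynomial.pderiv i P) x := by
    rw [← integral_add r2 r3]
    refine integral_congr_ae ?_
    filter_upwards [restrictOp_ae admissible_shell ((memLp_ball_of_continuous hgrc).toLp gr),
      ae_mono hsub (MemLp.coeFn_toLp (memLp_ball_of_continuous hgrc)),
      ae_restrict_mem admissible_shell.measurableSet] with x hx1 hx2 hx3
    have hx0 : x ≠ 0 := norm_ne_zero_iff.1 (shell_ne_zero hx3)
    have hd1 := hasFDerivAt_comp_norm ((hk.differentiable (by simp)).differentiableAt.hasDerivAt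
        (x := ‖x‖)) hx0
    have e : ∀ i, gr x i = deriv k ‖x‖ / ‖x‖ * ev (MvPolynomial.X i * P) x
        + k ‖x‖ * ev (MvPolynomial.pderiv i P) x := by
      intro i
      simp only [hgr, hf]
      rw [fderiv_fun_mul hd1.differentiableAt
        ((contDiff_ev P (n := 1)).differentiable (by simp) x), hd1.fderiv]
      simp only [_root_.add_apply, _root_.smul_apply, smul_eq_mul, fderiv_ev, innerSL_apply_apply,
        EuclideanSpace.inner_single_right, ev_mul, ev_X]
      simp
      ring
    rw [hx1, hx2, PiLp.inner_apply]
    simp only [e, Finset.mul_sum, ← Finset.sum_add_distrib]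
    refine Finset.sum_congr rfl fun i _ => ?_
    simp
    ring
  rw [e, j2, j3] at hw
  have q2 : IntervalIntegrable (fun r => deriv k r / r * A r
      * sphMean (fun x => ∑ i, G x i * ev (MvPolynomial.X i * P) x) r) volume (1 / 2) 1 := by
    refine (intervalIntegrable_iff_integrableOn_Ioo_of_le (by norm_num)).2 ?_
    refine Integrable.bdd_mul (c := C2 * M) (integrableOn_sphMean hd i2) m2.aestronglyMeasurable ?_
    filter_upwards [ae_restrict_mem measurableSet_Ioo] with r hr
    exact b2 r hr
  have q3 : IntervalIntegrable (fun r => k r * A r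
      * sphMean (fun x => ∑ i, G x i * ev (MvPolynomial.pderiv i P) x) r) volume (1 / 2) 1 := by
    refine (intervalIntegrable_iff_integrableOn_Ioo_of_le (by norm_num)).2 ?_
    refine Integrable.bdd_mul (c := C3 * M) (integrableOn_sphMean hd i3) m3.aestronglyMeasurable ?_
    filter_upwards [ae_restrict_mem measurableSet_Ioo] with r hr
    exact b3 r hr
  rw [← intervalIntegral.integral_add q2 q3] at hw
  rw [← hw]
  exact intervalIntegral.integral_congr fun r _ => by ring

/-- The component of a weak solution along a spherical harmonic solves a radial system. -/
theorem IsWeakSolution.exists_radialSystem (hd : 0 < d) {A : ℝ → ℝ} (hA : Measurable A) {m M : ℝ}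
    (hm : 0 < m) (hmA : ∀ r ∈ Ioo (1 / 2 : ℝ) 1, m ≤ A r) (hM : ∀ r ∈ Ioo (1 / 2 : ℝ) 1, A r ≤ M)
    (h : IsWeakSolution (shell d) (fun x => A ‖x‖) φ u G) {n : ℕ}
    {P : MvPolynomial (Fin d) ℝ} (hP : P ∈ Harm d n) :
    ∃ V p : ℝ → ℝ, RadialSystem (fun r => 1 / (r ^ (d - 1) * A r))
        (fun r => n * (n + d - 2) * (r ^ (d - 1) / r ^ 2 * A r)) V p (1 / 2) 1 ∧
      p (1 / 2) = 0 ∧ V 1 = ⟪φ, polyTrace P⟫_ℝ ∧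
      p 1 = ∫ x in shell d, A ‖x‖ * ⟪G x, gradV P x⟫_ℝ := by
  obtain ⟨hhom, hlap⟩ := mem_Harm.1 hP
  have hlt : (1 / 2 : ℝ) < 1 := by norm_num
  have hMA : ∀ r ∈ Ioo (1 / 2 : ℝ) 1, |A r| ≤ M := fun r hr => by
    rw [abs_of_pos (hm.trans_le (hmA r hr))]
    exact hM r hr
  have i1 := integrableOn_mul_ev u P
  have i2 := integrableOn_sum_mul_ev G fun i => MvPolynomial.X i * P
  have i3 := integrableOn_sum_mul_ev G fun i => MvPolynomial.pderiv i P
  have htan := h.1.weak_tangential hd hP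
  have hrad := fun k hk hs => h.1.weak_radial hd hhom (k := k) hk hs
  have hweak := fun k hk c h0 h1 => h.weak_radial (P := P) hd hA hMA (k := k) hk (c := c) h0 h1
  have hp1 := integral_mul_sphMean hd (integrableOn_radial_mul hA hMA i3)
  set Z1 := sphMean fun x => u x * ev P x
  set Z2 := sphMean fun x => ∑ i, G x i * ev (MvPolynomial.X i * P) x
  set Z3 := sphMean fun x => ∑ i, G x i * ev (MvPolynomial.pderiv i P) x
  have s1 : IntegrableOn Z1 (Ioo (1 / 2) 1) := integrableOn_sphMean hd i1
  have s2 : IntegrableOn Z2 (Ioo (1 / 2) 1) := integrableOn_sphMean hd i2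
  have s3 : IntegrableOn Z3 (Ioo (1 / 2) 1) := integrableOn_sphMean hd i3
  have v1 := (intervalIntegrable_iff_integrableOn_Ioo_of_le hlt.le).2 s1
  have v2 := (intervalIntegrable_iff_integrableOn_Ioo_of_le hlt.le).2 s2
  have bdd : ∀ Z : ℝ → ℝ, IntegrableOn Z (Ioo (1 / 2) 1) →
      IntervalIntegrable (fun r => A r * Z r) volume (1 / 2) 1 := fun Z hZ => by
    refine (intervalIntegrable_iff_integrableOn_Ioo_of_le hlt.le).2 ?_
    refine Integrable.bdd_mul (c := M) hZ hA.aestronglyMeasurable ?_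
    filter_upwards [ae_restrict_mem measurableSet_Ioo] with r hr
    exact hMA r hr
  have q3 := bdd Z3 s3
  have hc0 : ContinuousOn (fun r : ℝ => r⁻¹) (uIcc (1 / 2) 1) := by
    rw [uIcc_of_le hlt.le]
    exact continuousOn_id.inv₀ fun r hr => (lt_of_lt_of_le (by norm_num) hr.1 : (0 : ℝ) < r).ne'
  have q2 : IntervalIntegrable (fun r => A r / r * Z2 r) volume (1 / 2) 1 := by
    refine ((bdd Z2 s2).continuousOn_mul hc0).congr ?_
    exact fun r _ => by ring
  have w1 : IntervalIntegrable (fun r => (d + n) * Z1 r + Z2 r) volume (1 / 2) 1 :=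
    (v1.const_mul _).add v2
  set c : ℝ := ⟪φ, polyTrace P⟫_ℝ
  -- The constant is fixed at `r = 1` by the trace of `u`. The primitive `F2` of the flux instead
  -- starts from `0` at `1/2`, which is the insulation condition.
  set F1 : ℝ → ℝ := fun r => (c - ∫ t in (1 / 2 : ℝ)..1, ((d + n) * Z1 t + Z2 t))
    + ∫ t in (1 / 2 : ℝ)..r, ((d + n) * Z1 t + Z2 t) with hF1
  set F2 : ℝ → ℝ := fun r => 0 + ∫ t in (1 / 2 : ℝ)..r, A t * Z3 t with hF2
  have pF1 : IsPrim F1 (fun r => (d + n) * Z1 r + Z2 r) (1 / 2) 1 := isPrim_integral w1 _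
  have pF2 : IsPrim F2 (fun r => A r * Z3 r) (1 / 2) 1 := isPrim_integral q3 _
  have hF11 : F1 1 = c := by simp [hF1]
  have hF20 : F2 (1 / 2) = 0 := by simp [hF2]
  have ae1 : ∀ᵐ r, r ∈ Ioo (1 / 2 : ℝ) 1 → r * Z1 r = F1 r := by
    refine pF1.ae_eq_of_weak hlt (v1.continuousOn_mul (by fun_prop)) fun g hg hc hs => ?_
    obtain ⟨k, hk, hkd, a, b, ha, hb, h0, h1⟩ := exists_primitive hlt hg hc hs
    refine ⟨k, hkd, ?_⟩
    have hts : tsupport k ⊆ Ioi (1 / 2) := by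
      have : tsupport k ⊆ Ici a := by
        refine closure_minimal (fun r hr => ?_) isClosed_Ici
        by_contra hne
        exact hr (h0 r (le_of_lt (not_le.1 hne)))
      exact this.trans fun r hr => ha.trans_le hr
    rw [h0 (1 / 2) ha.le, hF11, zero_mul, sub_zero, ← hrad k hk hts]
    exact intervalIntegral.integral_congr fun r _ => by simp only [(hkd r).deriv]
  have ae2 : ∀ᵐ r, r ∈ Ioo (1 / 2 : ℝ) 1 → A r / r * Z2 r = F2 r := by
    refine pF2.ae_eq_of_weak hlt q2 fun g hg hc hs => ?_
    obtain ⟨k, hk, hkd, a, b, ha, hb, h0, h1⟩ := exists_primitive hlt hg hc hs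
    have hkd' : ∀ r, HasDerivAt (fun r => k r - k 1) (g r) r := fun r => (hkd r).sub_const _
    refine ⟨fun r => k r - k 1, hkd', ?_⟩
    have := hweak (fun r => k r - k 1) (hk.sub contDiff_const) (-k 1) (by
      filter_upwards [Iio_mem_nhds (show (0 : ℝ) < a by linarith)] with r hr
      rw [h0 r (le_of_lt hr), zero_sub]) (sub_self _)
    beta_reduce
    rw [hF20, sub_self, mul_zero, zero_mul, sub_zero, ← this]
    exact intervalIntegral.integral_congr fun r _ => by simp only [(hkd' r).deriv]
  have hkey : ∀ᵐ r, r ∈ Ioo (1 / 2 : ℝ) 1 → 0 < r ∧ 0 < A r ∧ r * Z1 r = F1 r ∧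
      A r * Z2 r = r * F2 r ∧ r ^ 2 * Z3 r = n * Z2 r + n * (n + d - 2) * Z1 r := by
    filter_upwards [ae1, ae2, htan] with r h1 h2 h3 hr
    have hr0 : 0 < r := lt_trans (by norm_num) hr.1
    refine ⟨hr0, hm.trans_le (hmA r hr), h1 hr, ?_, h3 hr⟩
    rw [← h2 hr]
    field_simp
  have half : (0 : ℝ) < 1 / 2 := by norm_num
  obtain ⟨e, rfl⟩ : ∃ e, d = e + 1 := ⟨d - 1, by omega⟩
  -- `F1 = r Z1`, and homogeneity of `P` gives `Z1(r) = r^(d-1+n) ∫ u(rθ) P(θ)`. Dividing out the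
  -- powers of `r` leaves the coefficient of `u(r ·)` along `P`; likewise `p` becomes `A r^(d-1)`
  -- times its derivative.
  refine ⟨fun r => (r ^ (e + 1 + n))⁻¹ * F1 r, fun r => (r ^ n)⁻¹ * F2 r, ⟨?_, ?_⟩, ?_, ?_, ?_⟩
  · refine ((isPrim_inv_pow (e + 1 + n) half hlt.le).mul pF1 hlt.le).congr_ae hlt.le ?_
    filter_upwards [hkey] with r hr hr'
    obtain ⟨hr0, hA0, h1, h2, h3⟩ := hr hr'
    have h2' : Z2 r = r * F2 r / A r := by rw [← h2]; field_simp
    rw [← h1, h2', Nat.add_sub_cancel]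
    push_cast
    field_simp
    ring
  · refine ((isPrim_inv_pow n half hlt.le).mul pF2 hlt.le).congr_ae hlt.le ?_
    filter_upwards [hkey] with r hr hr'
    obtain ⟨hr0, hA0, h1, h2, h3⟩ := hr hr'
    have h3' : Z3 r = (n * Z2 r + n * (n + (e + 1 : ℕ) - 2) * Z1 r) / r ^ 2 := by
      rw [← h3]; field_simp
    have h2' : F2 r = A r * Z2 r / r := by rw [h2]; field_simp
    rw [← h1, h3', h2', Nat.add_sub_cancel]
    push_cast
    field_simp
    ring
  · beta_reduce
    rw [hF20, mul_zero]
  · simp [hF11]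
  · simp only [one_pow, inv_one, one_mul, hF2, zero_add]
    rw [← hp1]
    simp_rw [inner_gradV]

end

theorem IsDtN.exists_radialSystem (hd : 0 < d) {A : ℝ → ℝ} (hA : Measurable A) {m M : ℝ}
    (hm : 0 < m) (hmA : ∀ r ∈ Ioo (1 / 2 : ℝ) 1, m ≤ A r) (hM : ∀ r ∈ Ioo (1 / 2 : ℝ) 1, A r ≤ M)
    {Λ : HHalf d →L[ℝ] HMinusHalf d} (h : IsDtN (shell d) (fun x => A ‖x‖) Λ) (φ : HHalf d) {n : ℕ}
    {P : MvPolynomial (Fin d) ℝ} (hP : P ∈ Harm d n) :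
    ∃ V p : ℝ → ℝ, RadialSystem (fun r => 1 / (r ^ (d - 1) * A r))
        (fun r => n * (n + d - 2) * (r ^ (d - 1) / r ^ 2 * A r)) V p (1 / 2) 1 ∧
      p (1 / 2) = 0 ∧ V 1 = ⟪HHalf.toL2 d φ, polyTrace P⟫_ℝ ∧ p 1 = Λ φ (polyHalf hd P) := by
  obtain ⟨⟨u, G, hu⟩, hΛ⟩ := h φ
  obtain ⟨V, p, h1, h2, h3, h4⟩ := hu.exists_radialSystem hd hA hm hmA hM hP
  refine ⟨V, p, h1, h2, h3, ?_⟩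
  rw [h4, hΛ u G hu (polyHalf hd P) _ _
    (by rw [toL2_polyHalf]; exact (isH1_poly hd P).restrict admissible_shell)]
  refine integral_congr_ae ?_
  have hsub : (volume : Measure (Sp d)).restrict (shell d)
      ≤ (volume : Measure (Sp d)).restrict (unitBall d) :=
    Measure.restrict_mono admissible_shell.subset le_rfl
  filter_upwards [restrictOp_ae admissible_shell (polyGrad P), ae_mono hsub (polyGrad_ae P)]
    with x h1 h2
  rw [h1, h2]

/-- The Dirichlet-to-Neumann map of the Laplacian multiplies harmonics of degree `n` by `n`. -/
theorem IsDtN.apply_polyHalf_of_laplacian (hd : 0 < d) {Λ : HHalf d →L[ℝ] HMinusHalf d}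
    (h : IsDtN (unitBall d) (fun _ => 1) Λ) (φ : HHalf d) {n : ℕ}
    {P : MvPolynomial (Fin d) ℝ} (hP : P ∈ Harm d n) :
    Λ φ (polyHalf hd P) = n * ⟪HHalf.toL2 d φ, polyTrace P⟫_ℝ := by
  obtain ⟨⟨u, G, hu⟩, hΛ⟩ := h φ
  rw [hΛ u G hu (polyHalf hd P) _ _ (by rw [toL2_polyHalf]; exact isH1_poly hd P),
    ← hu.1.inner_grad_harm hP, L2.inner_def]
  simp_rw [one_mul]

end

section

variable {d : ℕ}

/-! ### Norms of operators that are bounded on each spherical harmonic -/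

/-- Decomposition of a sum of harmonic polynomials into homogeneous parts. -/
theorem exists_sum_of_mem_harmSum {H : MvPolynomial (Fin d) ℝ} (hH : H ∈ HarmSum d) :
    ∃ (s : Finset ℕ) (P : ℕ → MvPolynomial (Fin d) ℝ), (∀ n, P n ∈ Harm d n) ∧
      (∀ n ∉ s, P n = 0) ∧ H = ∑ n ∈ s, P n := by
  obtain ⟨f, hf, hsum⟩ := (Submodule.mem_iSup_iff_exists_finsupp _ _).1 hH
  exact ⟨f.support, f, hf, fun n hn => by simpa using hn, hsum.symm⟩

/-- Split the weight as `√(1+n) √(1+n)` and apply Cauchy–Schwarz over the degrees: both factors are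
`H^{1/2}` norms by `le_norm_polyHalf_sq`. Density of the harmonics extends the bound to the whole
space. -/
theorem norm_le_of_forall_harm (hd : 2 ≤ d) {T : HHalf d →L[ℝ] HMinusHalf d} {C : ℝ} (hC : 0 ≤ C)
    (h : ∀ (φ : HHalf d) (n : ℕ), ∀ P ∈ Harm d n,
      |T φ (polyHalf (by omega) P)| ≤ C * ((1 + n) * |⟪HHalf.toL2 d φ, polyTrace P⟫_ℝ|)) :
    ‖T‖ ≤ C := by
  have hd0 : 0 < d := by omega
  have hdense := dense_polyHalf hd
  have key : ∀ φ ∈ (HarmSum d).map (polyHalf hd0), ∀ η ∈ (HarmSum d).map (polyHalf hd0),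
      |T φ η| ≤ C * ‖φ‖ * ‖η‖ := by
    rintro _ ⟨H, hH, rfl⟩ _ ⟨K, hK, rfl⟩
    obtain ⟨s, Q, hQ, hQ0, rfl⟩ := exists_sum_of_mem_harmSum hH
    obtain ⟨t, P, hP, hP0, rfl⟩ := exists_sum_of_mem_harmSum hK
    let f : MvPolynomial (Fin d) ℝ →ₗ[ℝ] L2Sphere d := ⟨⟨polyTrace, polyTrace_add⟩, polyTrace_smul⟩
    have hinner : ∀ n, ⟪polyTrace (∑ m ∈ s, Q m), polyTrace (P n)⟫_ℝ
        = ⟪polyTrace (Q n), polyTrace (P n)⟫_ℝ := by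
      intro n
      have : polyTrace (∑ m ∈ s, Q m) = ∑ m ∈ s, polyTrace (Q m) := map_sum f Q s
      rw [this, sum_inner, Finset.sum_eq_single n]
      · exact fun m _ hm => inner_polyTrace_eq_zero hd0 hm (hQ m) (hP n)
      · intro hn
        rw [hQ0 n hn, show polyTrace (0 : MvPolynomial (Fin d) ℝ) = 0 from map_zero f, inner_zero_left]
    have h1 := le_norm_polyHalf_sq hd0 s Q hQ
    have h2 := le_norm_polyHalf_sq hd0 t P hP
    have hx : ∑ n ∈ t, (1 + (n : ℝ)) * ‖polyTrace (Q n)‖ ^ 2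
        ≤ ∑ n ∈ s, (1 + (n : ℝ)) * ‖polyTrace (Q n)‖ ^ 2 := by
      refine (Finset.sum_le_sum_of_subset_of_nonneg (Finset.subset_union_right (s₁ := s))
        fun n _ _ => by positivity).trans_eq ?_
      refine (Finset.sum_subset Finset.subset_union_left fun n _ hn => ?_).symm
      rw [hQ0 n hn, show polyTrace (0 : MvPolynomial (Fin d) ℝ) = 0 from map_zero f]
      simp
    calc |T (polyHalf hd0 (∑ n ∈ s, Q n)) (polyHalf hd0 (∑ n ∈ t, P n))|
        = |∑ n ∈ t, T (polyHalf hd0 (∑ n ∈ s, Q n)) (polyHalf hd0 (P n))| := by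
          rw [map_sum (polyHalf hd0) P t, map_sum (T _)]
      _ ≤ ∑ n ∈ t, |T (polyHalf hd0 (∑ n ∈ s, Q n)) (polyHalf hd0 (P n))| :=
          Finset.abs_sum_le_sum_abs _ _
      _ ≤ ∑ n ∈ t, C * ((√(1 + n) * ‖polyTrace (Q n)‖) * (√(1 + n) * ‖polyTrace (P n)‖)) := by
          refine Finset.sum_le_sum fun n _ => (h _ n (P n) (hP n)).trans ?_
          rw [toL2_polyHalf, hinner]
          refine mul_le_mul_of_nonneg_left ?_ hC
          have hn : (0 : ℝ) ≤ 1 + n := by positivity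
          calc (1 + (n : ℝ)) * |⟪polyTrace (Q n), polyTrace (P n)⟫_ℝ|
              ≤ (1 + n) * (‖polyTrace (Q n)‖ * ‖polyTrace (P n)‖) :=
                mul_le_mul_of_nonneg_left (abs_real_inner_le_norm _ _) hn
            _ = _ := by
                nth_rewrite 1 [← Real.mul_self_sqrt hn]
                ring
      _ = C * ∑ n ∈ t, (√(1 + n) * ‖polyTrace (Q n)‖) * (√(1 + n) * ‖polyTrace (P n)‖) := by
          rw [Finset.mul_sum]
      _ ≤ C * (√(∑ n ∈ t, (√(1 + n) * ‖polyTrace (Q n)‖) ^ 2)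
            * √(∑ n ∈ t, (√(1 + n) * ‖polyTrace (P n)‖) ^ 2)) :=
          mul_le_mul_of_nonneg_left (Real.sum_mul_le_sqrt_mul_sqrt _ _ _) hC
      _ ≤ C * (‖polyHalf hd0 (∑ n ∈ s, Q n)‖ * ‖polyHalf hd0 (∑ n ∈ t, P n)‖) := by
          have hsq : ∀ (n : ℕ) (x : ℝ), (√(1 + n) * x) ^ 2 = (1 + n) * x ^ 2 := fun n x => by
            rw [mul_pow, Real.sq_sqrt (by positivity)]
          simp_rw [hsq]
          refine mul_le_mul_of_nonneg_left ?_ hC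
          refine mul_le_mul ?_ ?_ (Real.sqrt_nonneg _) (norm_nonneg _)
          · exact (Real.sqrt_le_left (norm_nonneg _)).2 (hx.trans h1)
          · exact (Real.sqrt_le_left (norm_nonneg _)).2 h2
      _ = _ := by ring
  have hall : ∀ φ η : HHalf d, |T φ η| ≤ C * ‖φ‖ * ‖η‖ := by
    intro φ η
    have hcl : IsClosed {z : HHalf d × HHalf d | |T z.1 z.2| ≤ C * ‖z.1‖ * ‖z.2‖} := by
      refine isClosed_le ?_ ?_
      · exact ((T.continuous.comp continuous_fst).clm_apply continuous_snd).abs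
      · fun_prop
    have := (hdense.prod hdense).closure_eq
    have hsub := closure_minimal (s := ((HarmSum d).map (polyHalf hd0) : Set (HHalf d)) ×ˢ
      ((HarmSum d).map (polyHalf hd0) : Set (HHalf d)))
      (fun z hz => key z.1 hz.1 z.2 hz.2) hcl
    rw [this] at hsub
    exact hsub (mem_univ (φ, η))
  refine T.opNorm_le_bound hC fun φ => ?_
  refine (T φ).opNorm_le_bound (by positivity) fun η => ?_
  exact hall φ η

end

section

/-! ### The profile of a coating -/

namespace Coating

variable (σ : Coating)

theorem one_le_r (i : Fin (σ.L + 1)) : 1 ≤ σ.r i := by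
  rw [← σ.inner]
  exact σ.strictAnti.antitone (Fin.le_last i)

theorem r_le_two (i : Fin (σ.L + 1)) : σ.r i ≤ 2 := by
  rw [← σ.outer]
  exact σ.strictAnti.antitone (Fin.zero_le i)

theorem L_pos : 0 < σ.L := by
  by_contra h
  have h0 : σ.L = 0 := by omega
  have : Fin.last σ.L = 0 := Fin.ext (by simp [h0])
  have h1 := σ.inner
  rw [this, σ.outer] at h1
  norm_num at h1

theorem exists_layer {t : ℝ} (h1 : 1 ≤ t) (h2 : t < 2) :
    ∃ i : Fin σ.L, σ.r i.succ ≤ t ∧ t < σ.r i.castSucc := by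
  have key : ∀ j : Fin (σ.L + 1), t < σ.r j →
      ∃ i : Fin σ.L, σ.r i.succ ≤ t ∧ t < σ.r i.castSucc := by
    intro j
    induction j using Fin.reverseInduction with
    | last =>
      intro h
      rw [σ.inner] at h
      exact absurd h1 (not_le.2 h)
    | cast i ih =>
      intro h
      by_cases h' : t < σ.r i.succ
      · exact ih h'
      · exact ⟨i, not_lt.1 h', h⟩
  exact key 0 (by rw [σ.outer]; exact h2)

theorem profile_of_two_le {t : ℝ} (ht : 2 ≤ t) : σ.profile t = 1 := if_pos ht

theorem profile_of_mem {t : ℝ} {i : Fin σ.L} (h1 : σ.r i.succ ≤ t) (h2 : t < σ.r i.castSucc) :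
    σ.profile t = σ.cond i := by
  rw [profile, if_neg (not_le.2 (h2.trans_le (σ.r_le_two _))), Finset.sum_eq_single i]
  · rw [if_pos ⟨h1, h2⟩]
  · intro j _ hj
    refine if_neg fun h => hj ?_
    have a1 : σ.r i.succ < σ.r j.castSucc := h1.trans_lt h.2
    have a2 : σ.r j.succ < σ.r i.castSucc := h.1.trans_lt h2
    rw [σ.strictAnti.lt_iff_gt, Fin.lt_def] at a1 a2
    simp only [Fin.val_castSucc, Fin.val_succ] at a1 a2
    exact Fin.ext (by omega)
  · simp

theorem exists_profile_bounds : ∃ B : ℝ, 1 ≤ B ∧ ∀ t, 1 ≤ t →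
    0 < σ.profile t ∧ σ.profile t ≤ B ∧ (σ.profile t)⁻¹ ≤ B := by
  refine ⟨1 + ∑ i, (σ.cond i + (σ.cond i)⁻¹), ?_, fun t ht => ?_⟩
  · rw [le_add_iff_nonneg_right]
    exact Finset.sum_nonneg fun i _ => add_nonneg (σ.cond_pos i).le (inv_nonneg.2 (σ.cond_pos i).le)
  have hs : ∀ i, σ.cond i + (σ.cond i)⁻¹ ≤ ∑ i, (σ.cond i + (σ.cond i)⁻¹) := fun i =>
    Finset.single_le_sum (f := fun i => σ.cond i + (σ.cond i)⁻¹)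
      (fun i _ => add_nonneg (σ.cond_pos i).le (inv_nonneg.2 (σ.cond_pos i).le)) (Finset.mem_univ i)
  have hp : ∀ i, 0 < (σ.cond i)⁻¹ := fun i => inv_pos.2 (σ.cond_pos i)
  by_cases h2 : 2 ≤ t
  · have h0 : 0 ≤ ∑ i, (σ.cond i + (σ.cond i)⁻¹) :=
      Finset.sum_nonneg fun i _ => add_nonneg (σ.cond_pos i).le (hp i).le
    rw [σ.profile_of_two_le h2, inv_one]
    refine ⟨one_pos, ?_, ?_⟩ <;> linarith
  · obtain ⟨i, hi1, hi2⟩ := σ.exists_layer ht (not_le.1 h2)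
    rw [σ.profile_of_mem hi1 hi2]
    refine ⟨σ.cond_pos i, ?_, ?_⟩ <;> linarith [hs i, hp i, σ.cond_pos i]

theorem measurable_profile : Measurable σ.profile := by
  refine Measurable.ite measurableSet_Ici measurable_const ?_
  refine Finset.measurable_fun_sum _ fun i _ => ?_
  exact Measurable.ite (measurableSet_Ici.inter measurableSet_Iio) measurable_const measurable_const

end Coating

/-! ### Radial modes of a coating -/

section

/-- The radial part of a solution in a homogeneous layer, in dimension `e + 2`. -/
def locF (n e : ℕ) (α β t : ℝ) : ℝ := α * t ^ n + β * (t ^ (n + e))⁻¹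

/-- Its flux, in a layer of conductivity `s`. -/
def locG (n e : ℕ) (s α β t : ℝ) : ℝ := s * (n * α * t ^ (n + e) - (n + e) * β * (t ^ n)⁻¹)

variable {n e : ℕ} {s α β t : ℝ}

theorem hasDerivAt_pow_div (m : ℕ) (ht : t ≠ 0) :
    HasDerivAt (fun t : ℝ => t ^ m) (m * t ^ m / t) t := by
  convert! hasDerivAt_pow m t using 1
  rcases m with _ | m
  · simp
  · rw [Nat.add_sub_cancel]
    field_simp
    ring

theorem hasDerivAt_locF (hs : 0 < s) (ht : 0 < t) :
    HasDerivAt (locF n e α β) (1 / (t ^ (e + 1) * s) * locG n e s α β t) t := by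
  have h1 := (hasDerivAt_pow_div n ht.ne').const_mul α
  have h2 := (hasDerivAt_inv_pow (n + e) ht.ne').const_mul β
  convert! h1.add h2 using 1
  simp only [locG]
  push_cast
  field_simp
  ring

theorem hasDerivAt_locG (ht : 0 < t) :
    HasDerivAt (locG n e s α β) (n * (n + e) * (t ^ (e + 1) / t ^ 2 * s) * locF n e α β t) t := by
  have h1 := (hasDerivAt_pow_div (n + e) ht.ne').const_mul (n * α)
  have h2 := (hasDerivAt_inv_pow n ht.ne').const_mul ((n + e) * β)
  convert! (h1.sub h2).const_mul s using 1
  simp only [locF]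
  push_cast
  field_simp
  ring

/-- Value and flux at one radius determine the two coefficients, since the determinant is a multiple
of `2n + e`, nonzero for `n > 0`. This continues a solution across an interface. -/
theorem exists_loc (hn : 0 < n) (hs : 0 < s) (ht : 0 < t) (F G : ℝ) :
    ∃ α β, locF n e α β t = F ∧ locG n e s α β t = G := by
  have h0 : (2 * n + e : ℝ) ≠ 0 := by positivity
  refine ⟨(G / (s * t ^ e) + (n + e) * F) / ((2 * n + e) * t ^ n),
    (n * F - G / (s * t ^ e)) / (2 * n + e) * t ^ (n + e), ?_, ?_⟩
  · simp only [locF]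
    field_simp
    ring
  · simp only [locG]
    field_simp
    ring

/-- `f` is the radial part and `g` the flux of a solution of degree `n` outside the insulated core
of a coating; `α`, `β` are its coefficients in the background. -/
structure Mode (σ : Coating) (n e : ℕ) (f g : ℝ → ℝ) (α β : ℝ) : Prop where
  val_one : f 1 = 1
  flux_one : g 1 = 0
  layer : ∀ i : Fin σ.L, ∃ a b : ℝ, ∀ t ∈ Icc (σ.r i.succ) (σ.r i.castSucc),
    f t = locF n e a b t ∧ g t = locG n e (σ.cond i) a b t
  outer : ∀ t, 2 ≤ t → f t = locF n e α β t ∧ g t = locG n e 1 α β t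

/-- Layers are numbered from outside inwards, and the solution is continued outwards from the core.
After `m` steps the `m` innermost layers, those of index at least `L - m`, are done. -/
theorem exists_mode_layers (σ : Coating) (hn : 0 < n) (m : ℕ) (hm : m ≤ σ.L) :
    ∃ f g : ℝ → ℝ, f 1 = 1 ∧ g 1 = 0 ∧ ∀ i : Fin σ.L, σ.L - m ≤ i →
      ∃ a b : ℝ, ∀ t ∈ Icc (σ.r i.succ) (σ.r i.castSucc),
        f t = locF n e a b t ∧ g t = locG n e (σ.cond i) a b t := by
  induction m with
  | zero => exact ⟨fun _ => 1, fun _ => 0, rfl, rfl, fun i hi => absurd i.2 (by omega)⟩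
  | succ m ih =>
    obtain ⟨f, g, hf1, hg1, hfg⟩ := ih (by omega)
    let j : Fin σ.L := ⟨σ.L - (m + 1), by omega⟩
    have hr1 := σ.one_le_r j.succ
    obtain ⟨a, b, hF, hG⟩ := exists_loc (n := n) (e := e) hn (σ.cond_pos j)
      (lt_of_lt_of_le one_pos hr1) (f (σ.r j.succ)) (g (σ.r j.succ))
    refine ⟨fun t => if t ≤ σ.r j.succ then f t else locF n e a b t,
      fun t => if t ≤ σ.r j.succ then g t else locG n e (σ.cond j) a b t,
      by simp [hr1, hf1], by simp [hr1, hg1], fun i hi => ?_⟩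
    by_cases hij : i = j
    · subst hij
      refine ⟨a, b, fun t ht => ?_⟩
      rcases ht.1.eq_or_lt with h | h
      · rw [← h]
        simp [hF, hG]
      · simp [not_le.2 h]
    · have hlt : (j : ℕ) < i := lt_of_le_of_ne hi fun h => hij (Fin.ext h.symm)
      obtain ⟨a', b', hab⟩ := hfg i (by have : (j : ℕ) = σ.L - (m + 1) := rfl; omega)
      refine ⟨a', b', fun t ht => ?_⟩
      have hle : σ.r i.castSucc ≤ σ.r j.succ := σ.strictAnti.antitone (by
        rw [Fin.le_def]; simp only [Fin.val_succ, Fin.val_castSucc]; omega)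
      simp only [if_pos (ht.2.trans hle)]
      exact hab t ht

theorem exists_mode (σ : Coating) (hn : 0 < n) (e : ℕ) :
    ∃ (f g : ℝ → ℝ) (α β : ℝ), Mode σ n e f g α β := by
  obtain ⟨f, g, hf1, hg1, hfg⟩ := exists_mode_layers (e := e) σ hn σ.L le_rfl
  obtain ⟨α, β, hF, hG⟩ := exists_loc (n := n) (e := e) hn one_pos two_pos (f 2) (g 2)
  refine ⟨fun t => if t ≤ 2 then f t else locF n e α β t,
    fun t => if t ≤ 2 then g t else locG n e 1 α β t, α, β, ?_, ?_, fun i => ?_, fun t ht => ?_⟩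
  · simp [hf1]
  · simp [hg1]
  · obtain ⟨a, b, hab⟩ := hfg i (by omega)
    refine ⟨a, b, fun t ht => ?_⟩
    simp only [if_pos (ht.2.trans (σ.r_le_two _))]
    exact hab t ht
  · rcases ht.eq_or_lt with h | h
    · rw [← h]
      simp [hF, hG]
    · simp [not_le.2 h]

end

namespace Mode

variable {σ : Coating} {n e : ℕ} {f g : ℝ → ℝ} {α β : ℝ}

theorem hasDerivAt (h : Mode σ n e f g α β) {t : ℝ} (ht : 1 < t) (hr : t ∉ range σ.r) :
    HasDerivAt f (1 / (t ^ (e + 1) * σ.profile t) * g t) t ∧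
      HasDerivAt g (n * (n + e) * (t ^ (e + 1) / t ^ 2 * σ.profile t) * f t) t := by
  have ht0 : 0 < t := one_pos.trans ht
  rcases lt_trichotomy t 2 with h2 | h2 | h2
  · obtain ⟨i, h3, h4⟩ := σ.exists_layer ht.le h2
    have h3' : σ.r i.succ < t := lt_of_le_of_ne h3 fun h => hr ⟨_, h⟩
    obtain ⟨a, b, hab⟩ := h.layer i
    have hmem : Icc (σ.r i.succ) (σ.r i.castSucc) ∈ nhds t := Icc_mem_nhds h3' h4
    have e1 : f =ᶠ[nhds t] locF n e a b := by
      filter_upwards [hmem] with x hx using (hab x hx).1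
    have e2 : g =ᶠ[nhds t] locG n e (σ.cond i) a b := by
      filter_upwards [hmem] with x hx using (hab x hx).2
    rw [σ.profile_of_mem h3 h4, e1.eq_of_nhds, e2.eq_of_nhds]
    exact ⟨(hasDerivAt_locF (σ.cond_pos i) ht0).congr_of_eventuallyEq e1,
      (hasDerivAt_locG ht0).congr_of_eventuallyEq e2⟩
  · exact absurd ⟨0, by rw [σ.outer, h2]⟩ hr
  · have hmem : Ici (2 : ℝ) ∈ nhds t := Ici_mem_nhds h2
    have e1 : f =ᶠ[nhds t] locF n e α β := by
      filter_upwards [hmem] with x hx using (h.outer x hx).1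
    have e2 : g =ᶠ[nhds t] locG n e 1 α β := by
      filter_upwards [hmem] with x hx using (h.outer x hx).2
    rw [σ.profile_of_two_le h2.le, e1.eq_of_nhds, e2.eq_of_nhds]
    exact ⟨(hasDerivAt_locF one_pos ht0).congr_of_eventuallyEq e1,
      (hasDerivAt_locG ht0).congr_of_eventuallyEq e2⟩

/-- The formulas hold on closed layers, which overlap at the interfaces, so continuity can be glued
along a finite closed cover. -/
theorem continuousOn (h : Mode σ n e f g α β) :
    ContinuousOn f (Ici 1) ∧ ContinuousOn g (Ici 1) := by
  have hcov : Ici (1 : ℝ) ⊆ (⋃ i : Fin σ.L, Icc (σ.r i.succ) (σ.r i.castSucc)) ∪ Ici 2 := by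
    intro t ht
    by_cases h2 : 2 ≤ t
    · exact Or.inr h2
    · obtain ⟨i, h3, h4⟩ := σ.exists_layer ht (not_le.1 h2)
      exact Or.inl (mem_iUnion.2 ⟨i, h3, h4.le⟩)
  have key : ∀ F : ℝ → ℝ, (∀ i : Fin σ.L, ContinuousOn F (Icc (σ.r i.succ) (σ.r i.castSucc))) →
      ContinuousOn F (Ici 2) → ContinuousOn F (Ici 1) := by
    intro F h1 h2
    refine ContinuousOn.mono ?_ hcov
    refine ContinuousOn.union_of_isClosed ?_ h2 (isClosed_iUnion_of_finite fun i => isClosed_Icc)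
      isClosed_Ici
    exact (locallyFinite_of_finite _).continuousOn_iUnion (fun i => isClosed_Icc) h1
  have hpos : ∀ i : Fin σ.L, ∀ t ∈ Icc (σ.r i.succ) (σ.r i.castSucc), 0 < t := fun i t ht =>
    lt_of_lt_of_le one_pos ((σ.one_le_r _).trans ht.1)
  constructor
  · refine key f (fun i => ?_) ?_
    · obtain ⟨a, b, hab⟩ := h.layer i
      refine ContinuousOn.congr (f := locF n e a b) (fun t ht => ?_) fun t ht => (hab t ht).1
      exact (hasDerivAt_locF one_pos (hpos i t ht)).continuousAt.continuousWithinAt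
    · refine ContinuousOn.congr (f := locF n e α β) (fun t ht => ?_) fun t ht => (h.outer t ht).1
      exact (hasDerivAt_locF one_pos (lt_of_lt_of_le two_pos ht)).continuousAt.continuousWithinAt
  · refine key g (fun i => ?_) ?_
    · obtain ⟨a, b, hab⟩ := h.layer i
      refine ContinuousOn.congr (f := locG n e (σ.cond i) a b) (fun t ht => ?_)
        fun t ht => (hab t ht).2
      exact (hasDerivAt_locG (hpos i t ht)).continuousAt.continuousWithinAt
    · refine ContinuousOn.congr (f := locG n e 1 α β) (fun t ht => ?_) fun t ht => (h.outer t ht).2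
      exact (hasDerivAt_locG (lt_of_lt_of_le two_pos ht)).continuousAt.continuousWithinAt

end Mode

end

/-! ### Growth and far field of the modes -/

section

theorem intervalIntegrable_of_bound {k : ℝ → ℝ} {x y C : ℝ} (hxy : x ≤ y) (hk : Measurable k)
    (hC : ∀ t ∈ Ioo x y, |k t| ≤ C) : IntervalIntegrable k volume x y := by
  refine (intervalIntegrable_iff_integrableOn_Ioo_of_le hxy).2 ?_
  refine Measure.integrableOn_of_bounded (M := C) measure_Ioo_lt_top.ne hk.aestronglyMeasurable ?_
  filter_upwards [ae_restrict_mem measurableSet_Ioo] with t ht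
  exact hC t ht

/-- If `V y` were negative, `-V` would be nonnegative throughout by `nonneg`, against `V x > 0`. -/
theorem RadialSystem.nonneg_of_left {b c V p : ℝ → ℝ} {x y : ℝ} (h : RadialSystem b c V p x y)
    (hxy : x ≤ y) (hp : p x = 0) (hb : ∀ t ∈ Ioo x y, 0 ≤ b t) (hc : ∀ t ∈ Ioo x y, 0 ≤ c t)
    (hV : 0 < V x) : (∀ t ∈ Icc x y, V x ≤ V t) ∧ ∀ t ∈ Icc x y, 0 ≤ p t := by
  have hy : 0 ≤ V y := by
    by_contra! hneg
    have := ((h.const_mul (-1)).nonneg hxy (by rw [hp, mul_zero]) hb hc (by linarith)).1 x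
      (left_mem_Icc.2 hxy)
    linarith
  obtain ⟨h1, h2⟩ := h.nonneg hxy hp hb hc hy
  exact ⟨fun t ht => h.val_monotoneOn hb h2 (left_mem_Icc.2 hxy) ht ht.1, h2⟩

namespace Mode

variable {σ : Coating} {n e : ℕ} {f g : ℝ → ℝ} {α β : ℝ}

theorem radialSystem (h : Mode σ n e f g α β) {T : ℝ} (hT : 1 ≤ T) :
    RadialSystem (fun t => 1 / (t ^ (e + 1) * σ.profile t))
      (fun t => n * (n + e) * (t ^ (e + 1) / t ^ 2 * σ.profile t)) f g 1 T := by
  obtain ⟨B, hB1, hB⟩ := σ.exists_profile_bounds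
  obtain ⟨hf, hg⟩ := h.continuousOn
  have hsub : Icc 1 T ⊆ Ici (1 : ℝ) := fun t ht => ht.1
  have hfin : (range σ.r).Countable := (finite_range σ.r).countable
  have m1 : Measurable fun t => 1 / (t ^ (e + 1) * σ.profile t) :=
    measurable_const.div ((measurable_id.pow_const _).mul σ.measurable_profile)
  have m2 : Measurable fun t => n * (n + e) * (t ^ (e + 1) / t ^ 2 * σ.profile t) :=
    measurable_const.mul (((measurable_id.pow_const _).div
      (measurable_id.pow_const _)).mul σ.measurable_profile)
  have b1 : ∀ t ∈ Ioo 1 T, |1 / (t ^ (e + 1) * σ.profile t)| ≤ B := by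
    intro t ht
    obtain ⟨h1, h2, h3⟩ := hB t ht.1.le
    have ht1 : 1 ≤ t ^ (e + 1) := one_le_pow₀ ht.1.le
    have ht0 : 0 < t := one_pos.trans ht.1
    rw [abs_of_pos (by positivity), one_div, mul_inv]
    exact (mul_le_of_le_one_left (inv_nonneg.2 h1.le) (inv_le_one_of_one_le₀ ht1)).trans h3
  have b2 : ∀ t ∈ Ioo 1 T, |n * (n + e) * (t ^ (e + 1) / t ^ 2 * σ.profile t)|
      ≤ n * (n + e) * (T ^ (e + 1) * B) := by
    intro t ht
    obtain ⟨h1, h2, h3⟩ := hB t ht.1.le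
    have ht0 : 0 < t := one_pos.trans ht.1
    rw [abs_of_nonneg (by positivity)]
    have h4 : t ^ (e + 1) / t ^ 2 ≤ T ^ (e + 1) :=
      (div_le_self (by positivity) (one_le_pow₀ ht.1.le)).trans
        (pow_le_pow_left₀ ht0.le ht.2.le _)
    gcongr
  have i1 := intervalIntegrable_of_bound hT m1 b1
  have i2 := intervalIntegrable_of_bound hT m2 b2
  constructor
  · refine IsPrim.of_hasDerivAt hfin hT (hf.mono hsub)
      (fun t ht => (h.hasDerivAt ht.1.1 ht.2).1) (i1.mul_continuousOn ?_)
    rw [uIcc_of_le hT]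
    exact hg.mono hsub
  · refine IsPrim.of_hasDerivAt hfin hT (hg.mono hsub)
      (fun t ht => (h.hasDerivAt ht.1.1 ht.2).2) (i2.mul_continuousOn ?_)
    rw [uIcc_of_le hT]
    exact hf.mono hsub

theorem coeff_nonneg {t : ℝ} (ht : 1 ≤ t) : 0 ≤ 1 / (t ^ (e + 1) * σ.profile t) ∧
    0 ≤ n * (n + e) * (t ^ (e + 1) / t ^ 2 * σ.profile t) := by
  obtain ⟨B, hB1, hB⟩ := σ.exists_profile_bounds
  have h1 := (hB t ht).1
  have ht0 : 0 < t := one_pos.trans_le ht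
  constructor <;> positivity

theorem bounds (h : Mode σ n e f g α β) {T : ℝ} (hT : 1 ≤ T) : 1 ≤ f T ∧ 0 ≤ g T := by
  have := (h.radialSystem hT).nonneg_of_left hT h.flux_one
    (fun t ht => (coeff_nonneg (n := n) ht.1.le).1) (fun t ht => (coeff_nonneg ht.1.le).2)
    (by rw [h.val_one]; exact one_pos)
  rw [h.val_one] at this
  exact ⟨this.1 T (right_mem_Icc.2 hT), this.2 T (right_mem_Icc.2 hT)⟩

theorem flux_two_le (h : Mode σ n e f g α β) {B : ℝ} (hB : ∀ t, 1 ≤ t → σ.profile t ≤ B) :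
    g 2 ≤ n * (n + e) * (2 ^ (e + 1) * B) * f 2 := by
  have hB1 : ∀ t ∈ Ioo (1 : ℝ) 2, 0 ≤ σ.profile t := fun t ht => by
    obtain ⟨_, _, hB⟩ := σ.exists_profile_bounds
    exact (hB t ht.1.le).1.le
  have m2 : Measurable fun t => n * (n + e) * (t ^ (e + 1) / t ^ 2 * σ.profile t) :=
    measurable_const.mul (((measurable_id.pow_const _).div
      (measurable_id.pow_const _)).mul σ.measurable_profile)
  have b2 : ∀ t ∈ Ioo (1 : ℝ) 2, n * (n + e) * (t ^ (e + 1) / t ^ 2 * σ.profile t)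
      ≤ n * (n + e) * (2 ^ (e + 1) * B) := by
    intro t ht
    have ht0 : 0 < t := one_pos.trans ht.1
    have h4 : t ^ (e + 1) / t ^ 2 ≤ 2 ^ (e + 1) :=
      (div_le_self (by positivity) (one_le_pow₀ ht.1.le)).trans
        (pow_le_pow_left₀ ht0.le ht.2.le _)
    have h5 := hB t ht.1.le
    have h6 := hB1 t ht
    gcongr
  have i2 := intervalIntegrable_of_bound one_le_two m2 (C := n * (n + e) * (2 ^ (e + 1) * B))
    fun t ht => by
      rw [abs_of_nonneg (coeff_nonneg ht.1.le).2]
      exact b2 t ht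
  have h1 := (h.radialSystem one_le_two).flux_le one_le_two h.flux_one
    (fun t ht => (coeff_nonneg (n := n) ht.1.le).1) (fun t ht => (coeff_nonneg ht.1.le).2)
    (fun t ht => (h.bounds ht.1).2) i2
  refine h1.trans (mul_le_mul_of_nonneg_right ?_ (zero_le_one.trans (h.bounds one_le_two).1))
  refine (intervalIntegral.integral_mono_on_of_le_Ioo one_le_two i2
    (intervalIntegrable_const (c := n * (n + e) * (2 ^ (e + 1) * B))) b2).trans_eq ?_
  rw [intervalIntegral.integral_const]
  norm_num

/-- The growing part `α t^n` has zero defect, so the defect in the background isolates the multipole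
coefficient `β`. -/
theorem outer_coeff (h : Mode σ n e f g α β) {T : ℝ} (hT : 2 ≤ T) :
    n * T ^ e * f T - g T = (2 * n + e) * β * (T ^ n)⁻¹ := by
  have hT0 : 0 < T := two_pos.trans_le hT
  rw [(h.outer T hT).1, (h.outer T hT).2, locF, locG]
  field_simp
  ring

/-- Solving for `α` from the data at `2` gives `(2n+e) α 2^n = g(2)/2^e + (n+e) f(2)`. The flux is
nonnegative and `n + e` is at least half of `2n + e`. -/
theorem alpha_bound (h : Mode σ n e f g α β) (hn : 0 < n) : f 2 / 2 ≤ α * 2 ^ n := by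
  have h1 := (h.outer 2 le_rfl).1
  have h2 := (h.outer 2 le_rfl).2
  obtain ⟨h3, h4⟩ := h.bounds one_le_two
  have h5 : (2 * n + e) * (α * 2 ^ n) = g 2 / 2 ^ e + (n + e) * f 2 := by
    rw [h1, h2, locF, locG]
    field_simp
    ring
  have hn' : (1 : ℝ) ≤ n := by exact_mod_cast hn
  have h6 : 0 ≤ g 2 / 2 ^ e := by positivity
  have he : (0 : ℝ) ≤ e := by positivity
  have h7 : (2 * n + e) * (f 2 / 2) ≤ (2 * n + e) * (α * 2 ^ n) := by
    rw [h5]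
    nlinarith
  exact le_of_mul_le_mul_left h7 (by positivity)

theorem alpha_pos (h : Mode σ n e f g α β) (hn : 0 < n) : 0 < α := by
  have h1 := h.alpha_bound hn
  have h2 := (h.bounds one_le_two).1
  by_contra! hneg
  have : α * 2 ^ n ≤ 0 := mul_nonpos_of_nonpos_of_nonneg hneg (by positivity)
  linarith

/-- For `β ≥ 0` drop the multipole. For `β < 0` the multipole decays while `(T/2)^n` grows, so `f(T)
≥ (T/2)^n f(2)`. -/
theorem growth (h : Mode σ n e f g α β) (hn : 0 < n) {T : ℝ} (hT : 2 ≤ T) :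
    (T / 2) ^ n * (f 2 / 2) ≤ f T := by
  have hα := h.alpha_bound hn
  have h2 := (h.bounds one_le_two).1
  have hT0 : 0 < T := two_pos.trans_le hT
  have hq : 1 ≤ T / 2 := by linarith
  have hqn : 0 < (T / 2) ^ n := by positivity
  have e1 : α * T ^ n = (T / 2) ^ n * (α * 2 ^ n) := by
    rw [div_pow]; field_simp
  rw [(h.outer T hT).1, locF, e1]
  rcases le_or_gt 0 β with hb | hb
  · have : 0 ≤ β * (T ^ (n + e))⁻¹ := by positivity
    nlinarith
  · have h3 := (h.outer 2 le_rfl).1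
    rw [locF] at h3
    have e2 : (T / 2) ^ n * (β * (2 ^ (n + e))⁻¹) ≤ β * (T ^ (n + e))⁻¹ := by
      have h4 : (T ^ (n + e))⁻¹ ≤ (2 ^ (n + e))⁻¹ :=
        inv_anti₀ (by positivity) (pow_le_pow_left₀ two_pos.le hT _)
      have h5 : (1 : ℝ) ≤ (T / 2) ^ n := one_le_pow₀ hq
      have h6 : (T ^ (n + e))⁻¹ ≤ (T / 2) ^ n * (2 ^ (n + e))⁻¹ :=
        h4.trans (le_mul_of_one_le_left (by positivity) h5)
      nlinarith [mul_le_mul_of_nonpos_left h6 hb.le]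
    nlinarith

/-- The far field of a mode, at a distance. -/
theorem far_bound (h : Mode σ n e f g α β) (hn : 0 < n) {B : ℝ}
    (hB1 : 1 ≤ B) (hB : ∀ t, 1 ≤ t → σ.profile t ≤ B) {T : ℝ} (hT : 2 ≤ T) :
    |n * T ^ e * f T - g T| ≤ n * (n + e) * (2 ^ (e + 3) * B) * (2 / T) ^ (2 * n) * f T := by
  have h0 := h.outer_coeff (le_refl (2 : ℝ))
  have hg2 := h.flux_two_le hB
  obtain ⟨hf2, hg0⟩ := h.bounds one_le_two
  have hT0 : 0 < T := two_pos.trans_le hT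
  have hn' : (1 : ℝ) ≤ n := by exact_mod_cast hn
  have he : (0 : ℝ) ≤ e := by positivity
  -- Evaluated at `t = 2`, the defect bounds `β` by the value and the flux there, and the flux by `f
  -- 2` through `flux_two_le`.
  have h1 : |(2 * n + e) * β * (2 ^ n)⁻¹| ≤ n * (n + e) * (2 ^ (e + 2) * B) * f 2 := by
    rw [← h0]
    have a1 : (n : ℝ) * 2 ^ e * f 2 ≤ n * (n + e) * (2 ^ (e + 1) * B) * f 2 := by
      have c1 : (n : ℝ) ≤ n * (n + e) := le_mul_of_one_le_right (by positivity) (by linarith)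
      have c2 : (2 : ℝ) ^ e ≤ 2 ^ (e + 1) * B :=
        (pow_le_pow_right₀ one_le_two (Nat.le_succ e)).trans
          (le_mul_of_one_le_right (by positivity) hB1)
      exact mul_le_mul_of_nonneg_right (mul_le_mul c1 c2 (by positivity) (by positivity))
        (by linarith)
    have a2 : (n : ℝ) * (n + e) * (2 ^ (e + 2) * B) * f 2
        = 2 * (n * (n + e) * (2 ^ (e + 1) * B) * f 2) := by ring
    rw [a2, abs_le]
    have a3 : 0 ≤ (n : ℝ) * 2 ^ e * f 2 := by positivity
    have a4 : 0 ≤ (n : ℝ) * (n + e) * (2 ^ (e + 1) * B) * f 2 := by positivity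
    constructor <;> linarith
  have e1 : (2 * n + e) * β * (T ^ n)⁻¹ = (2 * n + e) * β * (2 ^ n)⁻¹ * (2 / T) ^ n := by
    rw [div_pow]; field_simp
  rw [h.outer_coeff hT, e1, abs_mul, abs_of_pos (by positivity : 0 < (2 / T) ^ n)]
  have hgr := h.growth hn hT
  -- One factor `(2/T)^n` is the decay of the multipole. The growth of `f` supplies the second one,
  -- hence the exponent `2 * n`.
  have e2 : f 2 ≤ 2 * ((2 / T) ^ n * f T) := by
    have : (2 / T) ^ n * ((T / 2) ^ n * (f 2 / 2)) ≤ (2 / T) ^ n * f T := by gcongr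
    rw [← mul_assoc, ← mul_pow, show 2 / T * (T / 2) = 1 by field_simp, one_pow, one_mul] at this
    linarith
  calc |(2 * n + e) * β * (2 ^ n)⁻¹| * (2 / T) ^ n
      ≤ n * (n + e) * (2 ^ (e + 2) * B) * f 2 * (2 / T) ^ n := by gcongr
    _ ≤ n * (n + e) * (2 ^ (e + 2) * B) * (2 * ((2 / T) ^ n * f T)) * (2 / T) ^ n := by gcongr
    _ = _ := by ring

end Mode

end

section

variable {d : ℕ}

/-! ### Harmonic functions of separated form -/

/-- The Laplacian is computed as the divergence of an explicitly known gradient, which avoids second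
derivatives of composite expressions. -/
theorem harmonicOnNhd_of_gradient {U : Set (Sp d)} (hU : IsOpen U) {f : Sp d → ℝ}
    (hf : ∀ x ∈ U, ContDiffAt ℝ 2 f x) (g : Fin d → Sp d → ℝ)
    (hg : ∀ x ∈ U, ∀ i, fderiv ℝ f x (EuclideanSpace.single i 1) = g i x)
    (hdiv : ∀ x ∈ U, ∑ i, fderiv ℝ (g i) x (EuclideanSpace.single i 1) = 0) :
    InnerProductSpace.HarmonicOnNhd f U := by
  intro x hx
  refine ⟨hf x hx, ?_⟩
  filter_upwards [hU.mem_nhds hx] with y hy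
  rw [InnerProductSpace.laplacian_eq_iteratedFDeriv_orthonormalBasis f
    (EuclideanSpace.basisFun (Fin d) ℝ), Pi.zero_apply, ← hdiv y hy]
  refine Finset.sum_congr rfl fun i _ => ?_
  have hdiff : DifferentiableAt ℝ (fderiv ℝ f) y :=
    ((hf y hy).fderiv_right (m := 1) (by norm_num)).differentiableAt (by norm_num)
  have h1 : g i =ᶠ[nhds y] fun z => fderiv ℝ f z (EuclideanSpace.single i 1) := by
    filter_upwards [hU.mem_nhds hy] with z hz using (hg z hz i).symm
  rw [h1.fderiv_eq, iteratedFDeriv_two_apply, fderiv_clm_apply hdiff (differentiableAt_const _)]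
  simp

theorem harmonicOnNhd_ev {n : ℕ} {P : MvPolynomial (Fin d) ℝ} (hP : P ∈ Harm d n) :
    InnerProductSpace.HarmonicOnNhd (ev P) univ := by
  refine harmonicOnNhd_of_gradient isOpen_univ (fun x _ => (contDiff_ev P).contDiffAt)
    (fun i => ev (MvPolynomial.pderiv i P)) (fun x _ i => fderiv_ev P x i) fun x _ => ?_
  simp_rw [fderiv_ev]
  rw [← ev_sum, ← lap_apply, (mem_Harm.1 hP).2, ev_zero]

theorem hasFDerivAt_radial_mul_ev (m : ℕ) (Q : MvPolynomial (Fin d) ℝ) {x : Sp d} (hx : x ≠ 0) :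
    HasFDerivAt (fun y : Sp d => (‖y‖ ^ m)⁻¹ * ev Q y)
      ((‖x‖ ^ m)⁻¹ • fderiv ℝ (ev Q) x
        + ev Q x • ((-m * (‖x‖ ^ m * ‖x‖)⁻¹ / ‖x‖) • innerSL ℝ x)) x :=
  (hasFDerivAt_comp_norm (hasDerivAt_inv_pow m (norm_ne_zero_iff.2 hx)) hx).fun_mul
    ((contDiff_ev Q (n := 1)).differentiable (by simp) x).hasFDerivAt

theorem fderiv_radial_mul_ev (m : ℕ) (Q : MvPolynomial (Fin d) ℝ) {x : Sp d} (hx : x ≠ 0)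
    (i : Fin d) :
    fderiv ℝ (fun y : Sp d => (‖y‖ ^ m)⁻¹ * ev Q y) x (EuclideanSpace.single i 1)
      = (‖x‖ ^ m)⁻¹ * ev (MvPolynomial.pderiv i Q) x
        - m * ((‖x‖ ^ (m + 2))⁻¹ * ev (MvPolynomial.X i * Q) x) := by
  have hx' : ‖x‖ ≠ 0 := norm_ne_zero_iff.2 hx
  rw [(hasFDerivAt_radial_mul_ev m Q hx).fderiv]
  simp only [_root_.add_apply, _root_.smul_apply, smul_eq_mul, fderiv_ev, innerSL_apply_apply,
    EuclideanSpace.inner_single_right, ev_mul, ev_X]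
  simp
  field_simp
  ring

/-- The Kelvin transform of a homogeneous harmonic polynomial is harmonic. -/
theorem harmonicOnNhd_kelvin {n : ℕ} {P : MvPolynomial (Fin d) ℝ} (hP : P ∈ Harm d n)
    {m : ℕ} (hm : m + 2 = 2 * n + d) :
    InnerProductSpace.HarmonicOnNhd (fun x : Sp d => (‖x‖ ^ m)⁻¹ * ev P x) {0}ᶜ := by
  obtain ⟨hhom, hlap⟩ := mem_Harm.1 hP
  refine harmonicOnNhd_of_gradient isOpen_compl_singleton (fun x hx => ?_)
    (fun i x => (‖x‖ ^ m)⁻¹ * ev (MvPolynomial.pderiv i P) x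
        - m * ((‖x‖ ^ (m + 2))⁻¹ * ev (MvPolynomial.X i * P) x))
    (fun x hx i => fderiv_radial_mul_ev m P hx i) fun x hx => ?_
  · have hx0 : x ≠ 0 := hx
    exact (((contDiffAt_norm ℝ hx0).pow m).inv (pow_ne_zero _ (norm_ne_zero_iff.2 hx0))).mul
      (contDiff_ev P).contDiffAt
  · have hx0 : x ≠ 0 := hx
    have hx' : ‖x‖ ≠ 0 := norm_ne_zero_iff.2 hx0
    have h1 : ∀ i, fderiv ℝ (fun x : Sp d => (‖x‖ ^ m)⁻¹ * ev (MvPolynomial.pderiv i P) x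
        - m * ((‖x‖ ^ (m + 2))⁻¹ * ev (MvPolynomial.X i * P) x)) x (EuclideanSpace.single i 1)
        = (‖x‖ ^ m)⁻¹ * ev (MvPolynomial.pderiv i (MvPolynomial.pderiv i P)) x
          - m * (‖x‖ ^ (m + 2))⁻¹ * (2 * (x i * ev (MvPolynomial.pderiv i P) x) + ev P x)
          + m * (m + 2) * (‖x‖ ^ (m + 4))⁻¹ * ev P x * x i ^ 2 := by
      intro i
      have d1 := (hasFDerivAt_radial_mul_ev m (MvPolynomial.pderiv i P) hx0).differentiableAt
      have d2 := (hasFDerivAt_radial_mul_ev (m + 2) (MvPolynomial.X i * P) hx0).differentiableAt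
      rw [fderiv_fun_sub d1 (d2.const_mul _), fderiv_const_mul d2]
      simp only [sub_apply, _root_.smul_apply, smul_eq_mul]
      rw [fderiv_radial_mul_ev m _ hx0, fderiv_radial_mul_ev (m + 2) _ hx0]
      simp only [Derivation.leibniz, MvPolynomial.pderiv_X_self, smul_eq_mul, ev_add, ev_mul, ev_X,
        mul_one]
      push_cast
      ring
    simp_rw [h1, Finset.sum_add_distrib, Finset.sum_sub_distrib, ← Finset.mul_sum,
      Finset.sum_add_distrib, ← Finset.mul_sum, euler hhom x, ← ev_sum, ← lap_apply, hlap,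
      ← EuclideanSpace.real_norm_sq_eq]
    have hm' : (d : ℝ) = m + 2 - 2 * n := by
      have : (m : ℝ) + 2 = 2 * n + d := by exact_mod_cast hm
      linarith
    have hc : ev (d : MvPolynomial (Fin d) ℝ) x = m + 2 - 2 * n := by
      rw [← hm']
      simp [ev]
    simp [hc]
    field_simp
    ring

/-! ### Consequences of the vanishing of the polarization tensors -/

/-- In each homogeneous layer a separated solution is a combination of `P` and its Kelvin transform,
both harmonic away from the origin. -/
theorem locF_mul {n e : ℕ} (a b : ℝ) {x : Sp d} (hx : x ≠ 0) (P : MvPolynomial (Fin d) ℝ) :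
    locF n e a b ‖x‖ * ((‖x‖ ^ n)⁻¹ * ev P x)
      = a * ev P x + b * ((‖x‖ ^ (2 * n + e))⁻¹ * ev P x) := by
  have : ‖x‖ ≠ 0 := norm_ne_zero_iff.2 hx
  rw [locF]
  field_simp
  ring

theorem harmonicOnNhd_of_eq_locF {n e : ℕ} {P : MvPolynomial (Fin (e + 2)) ℝ}
    (hP : P ∈ Harm (e + 2) n) {f : ℝ → ℝ} {U : Set (Sp (e + 2))} (hU : IsOpen U)
    (h0 : ∀ x ∈ U, x ≠ 0) (c : ℝ) {a b : ℝ} (hf : ∀ x ∈ U, f ‖x‖ = locF n e a b ‖x‖) :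
    InnerProductSpace.HarmonicOnNhd (fun x => c * (f ‖x‖ * ((‖x‖ ^ n)⁻¹ * ev P x))) U := by
  intro x hx
  have h1 := ((harmonicOnNhd_ev hP x (mem_univ x)).const_smul (c := a)).add
    ((harmonicOnNhd_kelvin hP (m := 2 * n + e) (by ring) x (h0 x hx)).const_smul (c := b))
  refine (InnerProductSpace.harmonicAt_congr_nhds ?_).2 (h1.const_smul (c := c))
  filter_upwards [hU.mem_nhds hx] with y hy
  rw [hf y hy, locF_mul a b (h0 y hy)]
  simp

/-- At an interface the formula for `f` is valid on one side only, the set `I`. The one-sided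
derivative is expressed through the flux `locG`, which is common to both sides. -/
theorem hasDerivWithinAt_of_eq_locF {n e : ℕ} {P : MvPolynomial (Fin d) ℝ}
    (hP : P.IsHomogeneous n) {f : ℝ → ℝ} (c : ℝ) {a b s r : ℝ} {I S : Set ℝ} (hr : 0 < r)
    (hrI : r ∈ I) (hs : 0 < s) (hS : S ∈ nhdsWithin r I) (hf : ∀ t ∈ S, f t = locF n e a b t)
    {θ : Sp d} (hθ : ‖θ‖ = 1) :
    HasDerivWithinAt (fun t : ℝ => c * (f ‖t • θ‖ * ((‖t • θ‖ ^ n)⁻¹ * ev P (t • θ))))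
      (c * (1 / (r ^ (e + 1) * s) * locG n e s a b r * ev P θ)) I r := by
  have h1 := (((hasDerivAt_locF (n := n) (e := e) (α := a) (β := b) hs hr).mul_const
    (ev P θ)).const_mul c).hasDerivWithinAt (s := I)
  have key : ∀ t ∈ S, 0 < t → c * (f ‖t • θ‖ * ((‖t • θ‖ ^ n)⁻¹ * ev P (t • θ)))
      = c * (locF n e a b t * ev P θ) := by
    intro t ht ht0
    rw [norm_smul, hθ, mul_one, Real.norm_eq_abs, abs_of_pos ht0, hf t ht, ev_smul_point hP]
    field_simp
  refine h1.congr_of_eventuallyEq ?_ (key r (mem_of_mem_nhdsWithin hrI hS) hr)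
  filter_upwards [hS, mem_nhdsWithin_of_mem_nhds (Ioi_mem_nhds hr)] with t ht ht0
  exact key t ht ht0

theorem exists_ev_bound {n : ℕ} {P : MvPolynomial (Fin d) ℝ} (hP : P.IsHomogeneous n) :
    ∃ C, 0 ≤ C ∧ ∀ x : Sp d, x ≠ 0 → |ev P x| ≤ C * ‖x‖ ^ n := by
  obtain ⟨C, hC⟩ := (isCompact_sphere (0 : Sp d) 1).exists_bound_of_continuousOn
    (continuous_ev P).continuousOn
  refine ⟨|C|, abs_nonneg C, fun x hx => ?_⟩
  have hx' : ‖x‖ ≠ 0 := norm_ne_zero_iff.2 hx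
  have h1 : x = ‖x‖ • (‖x‖⁻¹ • x) := by rw [smul_smul, mul_inv_cancel₀ hx', one_smul]
  have h2 : ‖‖x‖⁻¹ • x‖ = 1 := by rw [norm_smul, norm_inv, norm_norm, inv_mul_cancel₀ hx']
  conv_lhs => rw [h1]
  rw [ev_smul_point hP, abs_mul, abs_of_nonneg (by positivity), mul_comm]
  refine mul_le_mul_of_nonneg_right ?_ (by positivity)
  exact (hC _ (by simpa using h2)).trans (le_abs_self C)

theorem Mode.far_eq {σ : Coating} {n e : ℕ} {f g : ℝ → ℝ} {α β : ℝ} (h : Mode σ n e f g α β)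
    (hn : 0 < n) (P : MvPolynomial (Fin d) ℝ) {x : Sp d} (hx : 2 ≤ ‖x‖) :
    α⁻¹ * (f ‖x‖ * ((‖x‖ ^ n)⁻¹ * ev P x)) - ev P x
      = α⁻¹ * β * ((‖x‖ ^ (2 * n + e))⁻¹ * ev P x) := by
  have hx0 : x ≠ 0 := norm_pos_iff.1 (two_pos.trans_le hx)
  have hα := h.alpha_pos hn
  rw [(h.outer _ hx).1, locF_mul α β hx0]
  field_simp
  ring

/-- Divided by `α`, the mode has background field exactly `P`, so the hypothesis on the polarization
tensors applies to it. -/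
theorem Mode.solves {σ : Coating} {n e : ℕ} {f g : ℝ → ℝ} {α β : ℝ} (h : Mode σ n e f g α β)
    (hn : 0 < n) {P : MvPolynomial (Fin (e + 2)) ℝ} (hP : P ∈ Harm (e + 2) n) :
    σ.Solves (e + 2) (ev P) (fun x => α⁻¹ * (f ‖x‖ * ((‖x‖ ^ n)⁻¹ * ev P x))) := by
  obtain ⟨hhom, hlap⟩ := mem_Harm.1 hP
  have hα := h.alpha_pos hn
  refine ⟨?_, ?_, fun i => ?_, fun i θ hθ => ?_, fun θ hθ => ?_, ?_⟩
  · have h1 : ContinuousOn (fun x : Sp (e + 2) => f ‖x‖) {x | 1 ≤ ‖x‖} :=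
      h.continuousOn.1.comp continuous_norm.continuousOn fun x hx => hx
    have h2 : ContinuousOn (fun x : Sp (e + 2) => (‖x‖ ^ n)⁻¹) {x | 1 ≤ ‖x‖} :=
      ContinuousOn.inv₀ (by fun_prop) fun x hx =>
        pow_ne_zero _ (one_pos.trans_le (show 1 ≤ ‖x‖ from hx)).ne'
    exact continuousOn_const.mul (h1.mul (h2.mul (continuous_ev P).continuousOn))
  · refine harmonicOnNhd_of_eq_locF hP (isOpen_lt continuous_const continuous_norm) (fun x hx => ?_)
      _ (fun x hx => (h.outer _ (le_of_lt hx)).1)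
    exact norm_pos_iff.1 (two_pos.trans (show 2 < ‖x‖ from hx))
  · obtain ⟨a, b, hab⟩ := h.layer i
    refine harmonicOnNhd_of_eq_locF hP ((isOpen_lt continuous_const continuous_norm).inter
      (isOpen_lt continuous_norm continuous_const)) (fun x hx => ?_) _
      (fun x hx => (hab _ ⟨le_of_lt hx.1, le_of_lt hx.2⟩).1)
    exact norm_pos_iff.1 (one_pos.trans_le ((σ.one_le_r _).trans (le_of_lt hx.1)))
  · have hr0 : 0 < σ.r i.castSucc := one_pos.trans_le (σ.one_le_r _)
    have hlt : σ.r i.succ < σ.r i.castSucc := σ.strictAnti (by rw [Fin.lt_def]; simp)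
    obtain ⟨a, b, hab⟩ := h.layer i
    have hq2 := hasDerivWithinAt_of_eq_locF (e := e) hhom α⁻¹ hr0 (self_mem_Iic) (σ.cond_pos i)
      (Icc_mem_nhdsLE hlt) (fun t ht => (hab t ht).1) hθ
    rw [← (hab _ (right_mem_Icc.2 hlt.le)).2] at hq2
    -- The medium just outside layer `i` is the background if `i = 0` and layer `i - 1` otherwise;
    -- this matches the definition of `condAbove`.
    obtain ⟨a', b', S, hS, hab', hpos, hg'⟩ : ∃ a' b' : ℝ, ∃ S ∈ nhdsWithin (σ.r i.castSucc)
        (Ici (σ.r i.castSucc)), (∀ t ∈ S, f t = locF n e a' b' t) ∧ 0 < σ.condAbove i ∧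
        g (σ.r i.castSucc) = locG n e (σ.condAbove i) a' b' (σ.r i.castSucc) := by
      obtain ⟨k, hk⟩ := i
      rcases k with _ | k
      · have h0 : σ.r (Fin.castSucc ⟨0, hk⟩) = 2 := σ.outer
        have hc : σ.condAbove ⟨0, hk⟩ = 1 := rfl
        rw [h0, hc]
        exact ⟨α, β, Ici 2, self_mem_nhdsWithin, fun t ht => (h.outer t ht).1, one_pos,
          (h.outer 2 le_rfl).2⟩
      · obtain ⟨a', b', hab'⟩ := h.layer ⟨k, by omega⟩
        have hc : σ.condAbove ⟨k + 1, hk⟩ = σ.cond ⟨k, by omega⟩ := rfl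
        rw [hc]
        have hlt' : σ.r (Fin.succ ⟨k, by omega⟩) < σ.r (Fin.castSucc (⟨k, by omega⟩ : Fin σ.L)) :=
          σ.strictAnti (by rw [Fin.lt_def]; simp)
        exact ⟨a', b', _, Icc_mem_nhdsGE hlt', fun t ht => (hab' t ht).1, σ.cond_pos _,
          (hab' _ (left_mem_Icc.2 hlt'.le)).2⟩
    have hq1 := hasDerivWithinAt_of_eq_locF (e := e) hhom α⁻¹ hr0 self_mem_Ici hpos hS hab' hθ
    rw [← hg'] at hq1
    refine ⟨_, _, hq1, hq2, ?_⟩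
    have := σ.cond_pos i
    field_simp
  · have hL := σ.L_pos
    have hlast : σ.r (Fin.succ ⟨σ.L - 1, by omega⟩) = 1 := by
      rw [← σ.inner]
      congr 1
      exact Fin.ext (by simp; omega)
    have hlt : σ.r (Fin.succ ⟨σ.L - 1, by omega⟩) < σ.r (Fin.castSucc ⟨σ.L - 1, by omega⟩) :=
      σ.strictAnti (by rw [Fin.lt_def]; simp)
    obtain ⟨a, b, hab⟩ := h.layer ⟨σ.L - 1, by omega⟩
    rw [hlast] at hab hlt
    have hq := hasDerivWithinAt_of_eq_locF (e := e) hhom α⁻¹ one_pos self_mem_Ici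
      (σ.cond_pos ⟨σ.L - 1, by omega⟩) (Icc_mem_nhdsGE hlt) (fun t ht => (hab t ht).1) hθ
    rw [← (hab 1 (left_mem_Icc.2 hlt.le)).2, h.flux_one] at hq
    simpa using hq
  · obtain ⟨C, hC0, hC⟩ := exists_ev_bound hhom
    refine Asymptotics.IsBigO.of_bound (|α⁻¹ * β| * C) ?_
    filter_upwards [tendsto_norm_cobounded_atTop.eventually_ge_atTop (2 : ℝ)] with x hx
    have hx0 : x ≠ 0 := norm_pos_iff.1 (two_pos.trans_le hx)
    have hx1 : 1 ≤ ‖x‖ := one_le_two.trans hx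
    have hxp : 0 < ‖x‖ := one_pos.trans_le hx1
    rw [h.far_eq hn P hx, norm_mul (α⁻¹ * β), norm_mul _ (ev P x), Real.norm_eq_abs (α⁻¹ * β),
      Real.norm_eq_abs (ev P x), norm_inv, norm_inv, norm_pow, norm_norm, mul_assoc]
    refine mul_le_mul_of_nonneg_left ?_ (abs_nonneg _)
    calc (‖x‖ ^ (2 * n + e))⁻¹ * |ev P x| ≤ (‖x‖ ^ (2 * n + e))⁻¹ * (C * ‖x‖ ^ n) :=
          mul_le_mul_of_nonneg_left (hC x hx0) (by positivity)
      -- The multipole has order `|x|^-(n+e)`, and `n > 0` makes this at most `|x|⁻¹`.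
      _ = C * (‖x‖ ^ (n + e))⁻¹ := by field_simp; ring
      _ ≤ C * ‖x‖⁻¹ := by
          refine mul_le_mul_of_nonneg_left (inv_anti₀ hxp ?_) hC0
          exact le_self_pow₀ hx1 (by omega)

/-- If the polarization tensors up to order `N` vanish, then modes of degree at most `N` have no
far field. -/
theorem Mode.beta_eq_zero {σ : Coating} {n e N : ℕ} {f g : ℝ → ℝ} {α β : ℝ}
    (h : Mode σ n e f g α β) (hn : 0 < n) (hnN : n ≤ N) (hσ : σ.GPTVanishing (e + 2) N)
    {P : MvPolynomial (Fin (e + 2)) ℝ} (hP : P ∈ Harm (e + 2) n) (hP0 : P ≠ 0) : β = 0 := by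
  obtain ⟨hhom, hlap⟩ := mem_Harm.1 hP
  have hα := h.alpha_pos hn
  obtain ⟨x, hx⟩ : ∃ x : Sp (e + 2), ev P x ≠ 0 := by
    by_contra! hall
    refine hP0 (MvPolynomial.funext fun v => ?_)
    simpa [ev] using hall (WithLp.toLp 2 v)
  have hx0 : x ≠ 0 := by
    rintro rfl
    have := ev_smul_point hhom 0 (0 : Sp (e + 2))
    rw [smul_zero, zero_pow hn.ne', zero_mul] at this
    exact hx this
  have hxn : 0 < ‖x‖ := norm_pos_iff.2 hx0
  obtain ⟨c, hc⟩ := (hσ P (hhom.totalDegree_le.trans hnN) (harmonicOnNhd_ev hP) _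
    (h.solves hn hP)).bound
  have htend : Filter.Tendsto (fun t : ℝ => t • x) Filter.atTop (Bornology.cobounded _) := by
    rw [← tendsto_norm_atTop_iff_cobounded]
    have : ∀ᶠ t : ℝ in Filter.atTop, t * ‖x‖ = ‖t • x‖ := by
      filter_upwards [Filter.eventually_ge_atTop 0] with t ht
      rw [norm_smul, Real.norm_eq_abs, abs_of_nonneg ht]
    exact (Filter.tendsto_id.atTop_mul_const hxn).congr' this
  have hev := htend.eventually (hc.and (tendsto_norm_cobounded_atTop.eventually_ge_atTop (2 : ℝ)))
  by_contra hβ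
  set K := |α⁻¹ * β| * |ev P x| * ‖x‖ ^ (N + (e + 1)) with hK
  have hK0 : 0 < K := by
    have : α⁻¹ * β ≠ 0 := mul_ne_zero (inv_ne_zero hα.ne') hβ
    positivity
  -- Along the ray through `x` the far field is exactly of order `t^-(n+e)`, whereas the hypothesis
  -- demands `t^-(N+e+1)`. As `n ≤ N`, a nonzero `β` would bound `t` from above.
  have hbd : ∀ᶠ t : ℝ in Filter.atTop, t * K ≤ c * ‖x‖ ^ (2 * n + e) := by
    filter_upwards [hev, Filter.eventually_ge_atTop 1] with t ht ht1
    obtain ⟨h1, h2⟩ := ht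
    have ht0 : 0 < t := one_pos.trans_le ht1
    have h3 := h.far_eq hn P h2
    change ‖α⁻¹ * (f ‖t • x‖ * ((‖t • x‖ ^ n)⁻¹ * ev P (t • x))) - ev P (t • x)‖ ≤ _ at h1
    rw [h3, norm_mul (α⁻¹ * β), norm_mul _ (ev P _), norm_inv, norm_inv, norm_pow, norm_pow,
      norm_norm, norm_smul, ev_smul_point hhom, norm_mul (t ^ n), norm_pow] at h1
    simp only [Real.norm_eq_abs, abs_of_pos ht0] at h1
    rw [show e + 2 - 1 = e + 1 by omega] at h1
    have hp : t ^ (2 * n + e) * (t * K) ≤ t ^ (2 * n + e) * (c * ‖x‖ ^ (2 * n + e)) := by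
      calc t ^ (2 * n + e) * (t * K) = t ^ (2 * n + e + 1) * K := by ring
        _ ≤ t ^ (n + (N + (e + 1))) * K :=
            mul_le_mul_of_nonneg_right (pow_le_pow_right₀ ht1 (by omega)) hK0.le
        _ = |α⁻¹ * β| * (((t * ‖x‖) ^ (2 * n + e))⁻¹ * (t ^ n * |ev P x|))
              * ((t * ‖x‖) ^ (2 * n + e) * (t * ‖x‖) ^ (N + (e + 1))) := by
            rw [hK]; field_simp; ring
        _ ≤ c * ((t * ‖x‖) ^ (N + (e + 1)))⁻¹
              * ((t * ‖x‖) ^ (2 * n + e) * (t * ‖x‖) ^ (N + (e + 1))) :=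
            mul_le_mul_of_nonneg_right h1 (by positivity)
        _ = _ := by field_simp; ring
    exact le_of_mul_le_mul_left hp (by positivity)
  obtain ⟨t, ht, ht'⟩ := (hbd.and ((Filter.tendsto_id.atTop_mul_const hK0).eventually_gt_atTop
    (c * ‖x‖ ^ (2 * n + e)))).exists
  exact absurd ht (not_le.2 ht')

end

section

/-! ### The blow-up map -/

section

variable {τ : ℝ}

/-- The inequality amounts to `τ ≤ 1/2`. An exponent of at least `1` makes `gInv τ s / s`
increasing. -/
theorem one_le_inv_blowExp (h0 : 0 < τ) (h1 : τ ≤ 3 / 8) : 1 ≤ 1 / blowExp τ := by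
  have hl : 0 < Real.log (3 / 2) := Real.log_pos (by norm_num)
  rw [blowExp, one_div_div, le_div_iff₀ hl, one_mul, ← Real.log_div (by norm_num) h0.ne']
  refine Real.log_le_log (by norm_num) ?_
  rw [le_div_iff₀ h0]
  linarith

/-- The exponent is chosen so that the power law meets the identity at `s = 3/4`. -/
theorem three_halves_rpow (h0 : 0 < τ) : τ * (3 / 2 : ℝ) ^ (1 / blowExp τ) = 3 / 4 := by
  have hl : Real.log (3 / 2) ≠ 0 := (Real.log_pos (by norm_num)).ne'
  rw [Real.rpow_def_of_pos (by norm_num), blowExp, one_div_div, mul_div_cancel₀ _ hl, Real.exp_sub,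
    Real.exp_log (by norm_num), Real.exp_log h0]
  field_simp

theorem gInv_of_mem {s : ℝ} (h1 : 1 / 2 ≤ s) (h2 : s ≤ 3 / 4) :
    gInv τ s = τ * (2 * s) ^ (1 / blowExp τ) := by
  unfold gInv
  split_ifs with h
  · have : s = 1 / 2 := le_antisymm h h1
    subst this
    norm_num
  · rfl

theorem gInv_of_le (h0 : 0 < τ) {s : ℝ} (h1 : 3 / 4 ≤ s) : gInv τ s = s := by
  rcases h1.eq_or_lt with h | h
  · rw [← h, gInv_of_mem (by norm_num) le_rfl]
    norm_num
    convert three_halves_rpow h0 using 3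
    norm_num
  · unfold gInv
    rw [if_neg (by linarith), if_neg (by linarith)]

theorem gInv_half : gInv τ (1 / 2) = τ := by
  simp [gInv]

theorem lam_of_lt {s : ℝ} (h1 : 1 / 2 ≤ s) (h2 : s < 3 / 4) : lam τ s = 1 / blowExp τ := by
  rw [lam, if_neg (not_lt.2 h1), if_pos h2]

theorem lam_of_le {s : ℝ} (h1 : 3 / 4 ≤ s) : lam τ s = 1 := by
  rw [lam, if_neg (by linarith), if_neg (by linarith)]

theorem gInv_strictMonoOn (h0 : 0 < τ) (h1 : τ ≤ 3 / 8) :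
    StrictMonoOn (gInv τ) (Icc (1 / 2) 1) := by
  have hμ := one_le_inv_blowExp h0 h1
  have a1 : StrictMonoOn (gInv τ) (Icc (1 / 2) (3 / 4)) := by
    intro x hx y hy hxy
    rw [gInv_of_mem hx.1 hx.2, gInv_of_mem hy.1 hy.2]
    refine mul_lt_mul_of_pos_left ?_ h0
    exact Real.rpow_lt_rpow (by linarith [hx.1]) (by linarith) (by linarith)
  have a2 : StrictMonoOn (gInv τ) (Icc (3 / 4) 1) := by
    intro x hx y hy hxy
    rwa [gInv_of_le h0 hx.1, gInv_of_le h0 hy.1]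
  have := a1.union a2 (isGreatest_Icc (by norm_num)) (isLeast_Icc (by norm_num))
  rwa [Icc_union_Icc_eq_Icc (by norm_num) (by norm_num)] at this

theorem gInv_div_monotoneOn (h0 : 0 < τ) (h1 : τ ≤ 3 / 8) :
    MonotoneOn (fun s => gInv τ s / s) (Icc (1 / 2) 1) := by
  have hμ := one_le_inv_blowExp h0 h1
  have a1 : MonotoneOn (fun s => gInv τ s / s) (Icc (1 / 2) (3 / 4)) := by
    have e1 : ∀ x ∈ Icc (1 / 2 : ℝ) (3 / 4),
        gInv τ x / x = 2 * τ * (2 * x) ^ (1 / blowExp τ - 1) := by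
      intro x hx
      have hx0 : 0 < x := lt_of_lt_of_le (by norm_num) hx.1
      rw [gInv_of_mem hx.1 hx.2, Real.rpow_sub_one (by positivity)]
      field_simp
    intro x hx y hy hxy
    beta_reduce
    rw [e1 x hx, e1 y hy]
    refine mul_le_mul_of_nonneg_left ?_ (by positivity)
    exact Real.rpow_le_rpow (by linarith [hx.1]) (by linarith) (by linarith)
  have a2 : MonotoneOn (fun s => gInv τ s / s) (Icc (3 / 4) 1) := by
    intro x hx y hy hxy
    have hx0 : x ≠ 0 := by linarith [hx.1]
    have hy0 : y ≠ 0 := by linarith [hy.1]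
    beta_reduce
    rw [gInv_of_le h0 hx.1, gInv_of_le h0 hy.1, div_self hx0, div_self hy0]
  have := a1.union_right a2 (isGreatest_Icc (by norm_num)) (isLeast_Icc (by norm_num))
  rwa [Icc_union_Icc_eq_Icc (by norm_num) (by norm_num)] at this

theorem gInv_div_bounds (h0 : 0 < τ) (h1 : τ ≤ 3 / 8) {s : ℝ} (hs : s ∈ Icc (1 / 2 : ℝ) 1) :
    2 * τ ≤ gInv τ s / s ∧ gInv τ s / s ≤ 1 := by
  have hm := gInv_div_monotoneOn h0 h1
  constructor
  · have := hm (left_mem_Icc.2 (by norm_num)) hs hs.1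
    beta_reduce at this
    rw [gInv_half] at this
    linarith
  · have := hm hs (right_mem_Icc.2 (by norm_num)) hs.2
    beta_reduce at this
    rwa [gInv_of_le h0 (s := 1) (by norm_num), div_self one_ne_zero] at this

theorem tau_le_gInv (h0 : 0 < τ) (h1 : τ ≤ 3 / 8) {s : ℝ} (hs : s ∈ Icc (1 / 2 : ℝ) 1) :
    τ ≤ gInv τ s := by
  have := (gInv_strictMonoOn h0 h1).monotoneOn (left_mem_Icc.2 (by norm_num)) hs hs.1
  rwa [gInv_half] at this

theorem one_le_gInv_div (h0 : 0 < τ) (h1 : τ ≤ 3 / 8) {s : ℝ} (hs : s ∈ Icc (1 / 2 : ℝ) 1) :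
    1 ≤ gInv τ s / τ := by
  rw [le_div_iff₀ h0, one_mul]
  exact tau_le_gInv h0 h1 hs

theorem hasDerivAt_gInv (h0 : 0 < τ) {s : ℝ} (h1 : 1 / 2 < s) (h2 : s ≠ 3 / 4) :
    HasDerivAt (gInv τ) (lam τ s * gInv τ s / s) s := by
  have hs0 : 0 < s := lt_trans (by norm_num) h1
  rcases lt_or_gt_of_ne h2 with h | h
  · have e1 : gInv τ =ᶠ[nhds s] fun s => τ * (2 * s) ^ (1 / blowExp τ) := by
      filter_upwards [Icc_mem_nhds h1 h] with x hx
      exact gInv_of_mem hx.1 hx.2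
    rw [lam_of_lt h1.le h, e1.eq_of_nhds]
    refine HasDerivAt.congr_of_eventuallyEq ?_ e1
    have h3 := ((((hasDerivAt_id s).const_mul 2).rpow_const (p := 1 / blowExp τ)
      (Or.inl (by simp only [id]; positivity))).const_mul τ)
    convert! h3 using 1
    simp only [id]
    rw [Real.rpow_sub_one (by positivity)]
    field_simp
  · have e1 : gInv τ =ᶠ[nhds s] fun s => s := by
      filter_upwards [Ici_mem_nhds h] with x hx
      exact gInv_of_le h0 hx
    rw [lam_of_le h.le, e1.eq_of_nhds, one_mul, div_self hs0.ne']
    exact (hasDerivAt_id s).congr_of_eventuallyEq e1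

theorem continuousOn_gInv (h0 : 0 < τ) : ContinuousOn (gInv τ) (Icc (1 / 2) 1) := by
  have a1 : ContinuousOn (gInv τ) (Icc (1 / 2) (3 / 4)) := by
    refine ContinuousOn.congr (f := fun s => τ * (2 * s) ^ (1 / blowExp τ)) ?_
      fun s hs => gInv_of_mem hs.1 hs.2
    refine continuousOn_const.mul (ContinuousOn.rpow_const (by fun_prop) fun s hs => Or.inl ?_)
    linarith [hs.1]
  have a2 : ContinuousOn (gInv τ) (Icc (3 / 4) 1) :=
    continuousOn_id.congr fun s hs => gInv_of_le h0 hs.1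
  have := a1.union_of_isClosed a2 isClosed_Icc isClosed_Icc
  rwa [Icc_union_Icc_eq_Icc (by norm_num) (by norm_num)] at this

theorem measurable_gInv : Measurable (gInv τ) := by
  refine Measurable.ite measurableSet_Iic (by fun_prop) (Measurable.ite measurableSet_Iic ?_ ?_)
  · fun_prop
  · exact measurable_id

theorem measurable_lam : Measurable (lam τ) :=
  Measurable.ite measurableSet_Iio measurable_const
    (Measurable.ite measurableSet_Iio measurable_const measurable_const)

theorem lam_antitoneOn (h0 : 0 < τ) (h1 : τ ≤ 3 / 8) : AntitoneOn (lam τ) (Icc (1 / 2) 1) := by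
  have hμ := one_le_inv_blowExp h0 h1
  intro x hx y hy hxy
  by_cases hy' : y < 3 / 4
  · rw [lam_of_lt hx.1 (hxy.trans_lt hy'), lam_of_lt hy.1 hy']
  · rw [lam_of_le (not_lt.1 hy')]
    by_cases hx' : x < 3 / 4
    · rwa [lam_of_lt hx.1 hx']
    · rw [lam_of_le (not_lt.1 hx')]

end

/-! ### Functions of bounded variation -/

/-- `ψ` takes values in `[0, B]` on `[1/2, 1]`, and its total variation is at most `W`. -/
structure BddVar (ψ : ℝ → ℝ) (B W : ℝ) : Prop where
  nonneg : ∀ s ∈ Icc (1 / 2 : ℝ) 1, 0 ≤ ψ s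
  le : ∀ s ∈ Icc (1 / 2 : ℝ) 1, ψ s ≤ B
  var : ∃ v : ℝ → ℝ, (∀ x ∈ Icc (1 / 2 : ℝ) 1, ∀ y ∈ Icc (1 / 2 : ℝ) 1, x ≤ y →
    |ψ y - ψ x| ≤ v y - v x) ∧ v 1 - v (1 / 2) ≤ W

namespace BddVar

variable {ψ χ : ℝ → ℝ} {B W B' W' : ℝ}

theorem bound_nonneg (h : BddVar ψ B W) : 0 ≤ B :=
  (h.nonneg 1 (by norm_num)).trans (h.le 1 (by norm_num))

theorem mul (h : BddVar ψ B W) (h' : BddVar χ B' W') :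
    BddVar (fun s => ψ s * χ s) (B * B') (B' * W + B * W') := by
  obtain ⟨v, hv, hvW⟩ := h.var
  obtain ⟨v', hv', hvW'⟩ := h'.var
  have hB := h.bound_nonneg
  have hB' := h'.bound_nonneg
  refine ⟨fun s hs => mul_nonneg (h.nonneg s hs) (h'.nonneg s hs),
    fun s hs => mul_le_mul (h.le s hs) (h'.le s hs) (h'.nonneg s hs) hB,
    fun s => B' * v s + B * v' s, fun x hx y hy hxy => ?_, ?_⟩
  · have e : ψ y * χ y - ψ x * χ x = ψ y * (χ y - χ x) + (ψ y - ψ x) * χ x := by ring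
    beta_reduce
    rw [e]
    refine (abs_add_le _ _).trans ?_
    rw [abs_mul, abs_mul, abs_of_nonneg (h.nonneg y hy), abs_of_nonneg (h'.nonneg x hx)]
    have h1 := mul_le_mul (h.le y hy) (hv' x hx y hy hxy) (abs_nonneg _) hB
    have h2 := mul_le_mul (hv x hx y hy hxy) (h'.le x hx) (h'.nonneg x hx)
      ((abs_nonneg _).trans (hv x hx y hy hxy))
    linarith
  · beta_reduce
    nlinarith [mul_le_mul_of_nonneg_left hvW hB', mul_le_mul_of_nonneg_left hvW' hB]

theorem of_monotoneOn (h : MonotoneOn ψ (Icc (1 / 2) 1)) (h0 : 0 ≤ ψ (1 / 2)) (h1 : ψ 1 ≤ B) :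
    BddVar ψ B B := by
  have hl : (1 / 2 : ℝ) ∈ Icc (1 / 2 : ℝ) 1 := by norm_num
  have hr : (1 : ℝ) ∈ Icc (1 / 2 : ℝ) 1 := by norm_num
  refine ⟨fun s hs => h0.trans (h hl hs hs.1), fun s hs => (h hs hr hs.2).trans h1, ψ,
    fun x hx y hy hxy => ?_, by linarith⟩
  rw [abs_of_nonneg (sub_nonneg.2 (h hx hy hxy))]

theorem of_antitoneOn (h : AntitoneOn ψ (Icc (1 / 2) 1)) (h0 : 0 ≤ ψ 1) (h1 : ψ (1 / 2) ≤ B) :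
    BddVar ψ B B := by
  have hl : (1 / 2 : ℝ) ∈ Icc (1 / 2 : ℝ) 1 := by norm_num
  have hr : (1 : ℝ) ∈ Icc (1 / 2 : ℝ) 1 := by norm_num
  refine ⟨fun s hs => h0.trans (h hs hr hs.2), fun s hs => (h hl hs hs.1).trans h1, fun s => -ψ s,
    fun x hx y hy hxy => ?_, by linarith⟩
  rw [abs_of_nonpos (sub_nonpos.2 (h hx hy hxy))]
  linarith

end BddVar

theorem Coating.profile_congr (σ : Coating) {t t' : ℝ} (h : ∀ i, σ.r i ≤ t ↔ σ.r i ≤ t') :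
    σ.profile t = σ.profile t' := by
  have h0 := h 0
  rw [σ.outer] at h0
  simp only [profile, h0, ← not_le, h]

/-- The number of radii `σ.r i` below `h s` is increasing and at most `L + 1`. The profile can
change only when this number does, and each change of `k ∘ profile` is at most `B`. The function `k`
is the identity or the inverse. -/
theorem Coating.bddVar_profile (σ : Coating) {k : ℝ → ℝ} {h : ℝ → ℝ} {B : ℝ}
    (hm : MonotoneOn h (Icc (1 / 2) 1)) (h0 : ∀ s ∈ Icc (1 / 2 : ℝ) 1, 0 ≤ k (σ.profile (h s)))
    (hB : ∀ s ∈ Icc (1 / 2 : ℝ) 1, k (σ.profile (h s)) ≤ B) :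
    BddVar (fun s => k (σ.profile (h s))) B ((σ.L + 1) * B) := by
  have hB0 : 0 ≤ B := (h0 1 (by norm_num)).trans (hB 1 (by norm_num))
  classical
  refine ⟨h0, hB, fun s => B * (Finset.univ.filter fun i => σ.r i ≤ h s).card,
    fun x hx y hy hxy => ?_, ?_⟩
  · have hsub : (Finset.univ.filter fun i => σ.r i ≤ h x) ⊆
        Finset.univ.filter fun i => σ.r i ≤ h y := fun i hi => by
      simp only [Finset.mem_filter, Finset.mem_univ, true_and] at hi ⊢
      exact hi.trans (hm hx hy hxy)
    by_cases heq : (Finset.univ.filter fun i => σ.r i ≤ h x)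
        = Finset.univ.filter fun i => σ.r i ≤ h y
    · have : σ.profile (h x) = σ.profile (h y) := σ.profile_congr fun i => by
        have := Finset.ext_iff.1 heq i
        simpa using this
      beta_reduce
      rw [this, heq, sub_self, sub_self, abs_zero]
    · have hlt := Finset.card_lt_card (lt_of_le_of_ne hsub heq)
      have hlt' : ((Finset.univ.filter fun i => σ.r i ≤ h x).card : ℝ) + 1
          ≤ (Finset.univ.filter fun i => σ.r i ≤ h y).card := by exact_mod_cast hlt
      have h1 : |k (σ.profile (h y)) - k (σ.profile (h x))| ≤ B := by
        rw [abs_le]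
        constructor <;> linarith [h0 x hx, hB x hx, h0 y hy, hB y hy]
      refine h1.trans ?_
      nlinarith
  · have h1 : (Finset.univ.filter fun i => σ.r i ≤ h 1).card ≤ σ.L + 1 := by
      simpa using Finset.card_filter_le (Finset.univ : Finset (Fin (σ.L + 1))) fun i => σ.r i ≤ h 1
    have h2 : ((Finset.univ.filter fun i => σ.r i ≤ h 1).card : ℝ) ≤ σ.L + 1 := by exact_mod_cast h1
    have h3 : (0 : ℝ) ≤ B * (Finset.univ.filter fun i => σ.r i ≤ h (1 / 2)).card := by positivity
    beta_reduce
    nlinarith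

/-! ### Variation of the eigenvalues of the push-forward -/

section

variable {τ : ℝ} (σ : Coating)

theorem gInv_div_tau_monotoneOn (h0 : 0 < τ) (h1 : τ ≤ 3 / 8) :
    MonotoneOn (fun s => gInv τ s / τ) (Icc (1 / 2) 1) := fun x hx y hy hxy => by
  have := (gInv_strictMonoOn h0 h1).monotoneOn hx hy hxy
  beta_reduce
  gcongr

/-- A product of a piecewise constant, an increasing and a decreasing factor; their relative
variations `L + 1`, `1` and `1` add up to `L + 3`. -/
theorem bddVar_sigmaTan (e : ℕ) (h0 : 0 < τ) (h1 : τ ≤ 3 / 8) {B : ℝ}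
    (hB : ∀ t, 1 ≤ t → 0 < σ.profile t ∧ σ.profile t ≤ B ∧ (σ.profile t)⁻¹ ≤ B) :
    BddVar (sigmaTan (e + 2) σ τ) (B * (1 / blowExp τ)) ((σ.L + 3) * (B * (1 / blowExp τ))) := by
  have hμ := one_le_inv_blowExp h0 h1
  have b1 : BddVar (fun s => σ.profile (gInv τ s / τ)) B ((σ.L + 1) * B) :=
    σ.bddVar_profile (k := id) (gInv_div_tau_monotoneOn h0 h1)
      (fun s hs => (hB _ (one_le_gInv_div h0 h1 hs)).1.le)
      (fun s hs => (hB _ (one_le_gInv_div h0 h1 hs)).2.1)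
  have b2 : BddVar (fun s => (gInv τ s / s) ^ e) 1 1 := by
    have hl : (1 / 2 : ℝ) ∈ Icc (1 / 2 : ℝ) 1 := by norm_num
    have hr : (1 : ℝ) ∈ Icc (1 / 2 : ℝ) 1 := by norm_num
    have hnn : ∀ s ∈ Icc (1 / 2 : ℝ) 1, 0 ≤ gInv τ s / s := fun s hs =>
      (by positivity : 0 ≤ 2 * τ).trans (gInv_div_bounds h0 h1 hs).1
    refine BddVar.of_monotoneOn (fun x hx y hy hxy => ?_) (pow_nonneg (hnn _ hl) _)
      (pow_le_one₀ (hnn _ hr) (gInv_div_bounds h0 h1 hr).2)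
    exact pow_le_pow_left₀ (hnn x hx) (gInv_div_monotoneOn h0 h1 hx hy hxy) _
  have b3 : BddVar (lam τ) (1 / blowExp τ) (1 / blowExp τ) :=
    BddVar.of_antitoneOn (lam_antitoneOn h0 h1) (by rw [lam_of_le (by norm_num)]; norm_num)
      (by rw [lam_of_lt le_rfl (by norm_num)])
  have := b1.mul (b2.mul b3)
  convert! this using 1 <;> ring

/-- As for `bddVar_sigmaTan`, with reciprocals. The lower bound `2τ ≤ gInv τ s / s` costs the factor
`(2τ)^-e`, which is why the scale in space must be finer by a power of `ρ`. -/
theorem bddVar_inv_sigmaRad (e : ℕ) (h0 : 0 < τ) (h1 : τ ≤ 3 / 8) {B : ℝ}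
    (hB : ∀ t, 1 ≤ t → 0 < σ.profile t ∧ σ.profile t ≤ B ∧ (σ.profile t)⁻¹ ≤ B) :
    BddVar (fun s => 1 / sigmaRad (e + 2) σ τ s) (B * (((2 * τ) ^ e)⁻¹ * (1 / blowExp τ)))
      ((σ.L + 3) * (B * (((2 * τ) ^ e)⁻¹ * (1 / blowExp τ)))) := by
  have hμ := one_le_inv_blowExp h0 h1
  have b1 : BddVar (fun s => (σ.profile (gInv τ s / τ))⁻¹) B ((σ.L + 1) * B) :=
    σ.bddVar_profile (k := fun x => x⁻¹) (gInv_div_tau_monotoneOn h0 h1)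
      (fun s hs => inv_nonneg.2 (hB _ (one_le_gInv_div h0 h1 hs)).1.le)
      (fun s hs => (hB _ (one_le_gInv_div h0 h1 hs)).2.2)
  have b2 : BddVar (fun s => ((gInv τ s / s) ^ e)⁻¹) ((2 * τ) ^ e)⁻¹ ((2 * τ) ^ e)⁻¹ := by
    have hl : (1 / 2 : ℝ) ∈ Icc (1 / 2 : ℝ) 1 := by norm_num
    have hr : (1 : ℝ) ∈ Icc (1 / 2 : ℝ) 1 := by norm_num
    have hnn : ∀ s ∈ Icc (1 / 2 : ℝ) 1, 0 < gInv τ s / s := fun s hs =>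
      (by positivity : 0 < 2 * τ).trans_le (gInv_div_bounds h0 h1 hs).1
    refine BddVar.of_antitoneOn (fun x hx y hy hxy => ?_)
      (inv_nonneg.2 (pow_nonneg (hnn _ hr).le _))
      (inv_anti₀ (by positivity) (pow_le_pow_left₀ (by positivity) (gInv_div_bounds h0 h1 hl).1 _))
    exact inv_anti₀ (pow_pos (hnn x hx) _)
      (pow_le_pow_left₀ (hnn x hx).le (gInv_div_monotoneOn h0 h1 hx hy hxy) _)
  have b3 : BddVar (lam τ) (1 / blowExp τ) (1 / blowExp τ) :=
    BddVar.of_antitoneOn (lam_antitoneOn h0 h1) (by rw [lam_of_le (by norm_num)]; norm_num)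
      (by rw [lam_of_lt le_rfl (by norm_num)])
  have := b1.mul (b2.mul b3)
  convert! this using 1
  · funext s
    rw [sigmaRad, Nat.add_sub_cancel, one_div, mul_inv, mul_inv, one_div, inv_inv]
  · ring

end

end

/-! ### The homogenized cloak as a push-forward of the coating -/

section

variable {σ : Coating} {n e : ℕ} {τ : ℝ}

theorem measurable_sigmaTan (d : ℕ) (σ : Coating) (τ : ℝ) : Measurable (sigmaTan d σ τ) :=
  (σ.measurable_profile.comp (measurable_gInv.div_const _)).mul
    (((measurable_gInv.div measurable_id).pow_const _).mul measurable_lam)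

theorem measurable_sigmaRad (d : ℕ) (σ : Coating) (τ : ℝ) : Measurable (sigmaRad d σ τ) :=
  (σ.measurable_profile.comp (measurable_gInv.div_const _)).mul
    (((measurable_gInv.div measurable_id).pow_const _).mul (measurable_const.div measurable_lam))

/-- The radial system of the homogenized cloak, by push-forward from the coating. -/
theorem Mode.radialSystem_blowup {f g : ℝ → ℝ} {α β : ℝ} (h : Mode σ n e f g α β)
    (h0 : 0 < τ) (h1 : τ ≤ 3 / 8) :
    RadialSystem (fun s => (s ^ (e + 1))⁻¹ * (1 / sigmaRad (e + 2) σ τ s))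
      (fun s => n * (n + e) * (s ^ (e + 1) / s ^ 2 * sigmaTan (e + 2) σ τ s))
      (fun s => f (gInv τ s / τ)) (fun s => τ ^ e * g (gInv τ s / τ)) (1 / 2) 1 := by
  obtain ⟨B, hB1, hB⟩ := σ.exists_profile_bounds
  have hle : (1 / 2 : ℝ) ≤ 1 := by norm_num
  have hpos : ∀ s ∈ Icc (1 / 2 : ℝ) 1, 0 < s := fun s hs => lt_of_lt_of_le (by norm_num) hs.1
  have vT := bddVar_sigmaTan σ e h0 h1 hB
  have vR := bddVar_inv_sigmaRad σ e h0 h1 hB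
  have hmaps : MapsTo (fun s => gInv τ s / τ) (Icc (1 / 2) 1) (Ici 1) := fun s hs =>
    one_le_gInv_div h0 h1 hs
  have hgc : ContinuousOn (fun s => gInv τ s / τ) (Icc (1 / 2) 1) :=
    (continuousOn_gInv h0).div_const _
  have cf : ContinuousOn (fun s => f (gInv τ s / τ)) (Icc (1 / 2) 1) :=
    h.continuousOn.1.comp hgc hmaps
  have cg : ContinuousOn (fun s => τ ^ e * g (gInv τ s / τ)) (Icc (1 / 2) 1) :=
    continuousOn_const.mul (h.continuousOn.2.comp hgc hmaps)
  have m1 : Measurable fun s => (s ^ (e + 1))⁻¹ * (1 / sigmaRad (e + 2) σ τ s) :=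
    (measurable_id.pow_const _).inv.mul (measurable_const.div (measurable_sigmaRad _ _ _))
  have m2 : Measurable fun s => n * (n + e) * (s ^ (e + 1) / s ^ 2 * sigmaTan (e + 2) σ τ s) :=
    measurable_const.mul (((measurable_id.pow_const _).div
      (measurable_id.pow_const _)).mul (measurable_sigmaTan _ _ _))
  have i1 : IntervalIntegrable (fun s => (s ^ (e + 1))⁻¹ * (1 / sigmaRad (e + 2) σ τ s)) volume
      (1 / 2) 1 := by
    refine intervalIntegrable_of_bound hle m1
      (C := ((1 / 2 : ℝ) ^ (e + 1))⁻¹ * (B * (((2 * τ) ^ e)⁻¹ * (1 / blowExp τ)))) fun s hs => ?_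
    have hs' := Ioo_subset_Icc_self hs
    have := hpos s hs'
    have hn := vR.nonneg s hs'
    beta_reduce at hn
    rw [abs_of_nonneg (mul_nonneg (by positivity) hn)]
    refine mul_le_mul (inv_anti₀ (by positivity) (pow_le_pow_left₀ (by norm_num) hs'.1 _))
      (vR.le s hs') hn (by positivity)
  have i2 : IntervalIntegrable (fun s => n * (n + e) * (s ^ (e + 1) / s ^ 2
      * sigmaTan (e + 2) σ τ s)) volume (1 / 2) 1 := by
    refine intervalIntegrable_of_bound hle m2
      (C := n * (n + e) * (4 * (B * (1 / blowExp τ)))) fun s hs => ?_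
    have hs' := Ioo_subset_Icc_self hs
    have hs0 := hpos s hs'
    have hn := vT.nonneg s hs'
    rw [abs_of_nonneg (mul_nonneg (by positivity) (mul_nonneg (by positivity) hn))]
    refine mul_le_mul_of_nonneg_left (mul_le_mul ?_ (vT.le s hs') hn (by norm_num)) (by positivity)
    rw [div_le_iff₀ (by positivity)]
    have h2 : s ^ (e + 1) ≤ 1 := pow_le_one₀ hs0.le hs'.2
    nlinarith [hs'.1]
  -- Points sent to interfaces of the coating, and the kink at `3/4`. Injectivity of `gInv` makes
  -- the set countable.
  set S : Set ℝ := (Icc (1 / 2 : ℝ) 1 ∩ (fun s => gInv τ s / τ) ⁻¹' range σ.r) ∪ {3 / 4} with hS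
  have hSc : S.Countable := by
    refine Countable.union ?_ (countable_singleton _)
    refine MapsTo.countable_of_injOn (f := fun s => gInv τ s / τ) (t := range σ.r)
      (fun s hs => hs.2) (fun x hx y hy hxy => ?_) (finite_range σ.r).countable
    exact (gInv_strictMonoOn h0 h1).injOn hx.1 hy.1 ((div_left_inj' h0.ne').1 hxy)
  have hder : ∀ s ∈ Ioo (1 / 2 : ℝ) 1 \ S,
      HasDerivAt (fun s => f (gInv τ s / τ))
        ((s ^ (e + 1))⁻¹ * (1 / sigmaRad (e + 2) σ τ s) * (τ ^ e * g (gInv τ s / τ))) s ∧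
      HasDerivAt (fun s => τ ^ e * g (gInv τ s / τ))
        (n * (n + e) * (s ^ (e + 1) / s ^ 2 * sigmaTan (e + 2) σ τ s) * f (gInv τ s / τ)) s := by
    intro s hs
    have hs' := Ioo_subset_Icc_self hs.1
    have hs0 := hpos s hs'
    have hne : s ≠ 3 / 4 := fun hc => hs.2 (Or.inr hc)
    have hr : gInv τ s / τ ∉ range σ.r := fun hc => hs.2 (Or.inl ⟨hs', hc⟩)
    have ht : 1 < gInv τ s / τ := by
      rw [lt_div_iff₀ h0, one_mul]
      have := gInv_strictMonoOn h0 h1 (left_mem_Icc.2 hle) hs' hs.1.1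
      rwa [gInv_half] at this
    have hG : 0 < gInv τ s := h0.trans_le (tau_le_gInv h0 h1 hs')
    have hP := (hB _ ht.le).1
    have hl : 0 < lam τ s := by
      have h3 := lam_antitoneOn h0 h1 hs' (right_mem_Icc.2 hle) hs'.2
      rw [lam_of_le (s := 1) (by norm_num)] at h3
      linarith
    obtain ⟨d1, d2⟩ := h.hasDerivAt ht hr
    have dg := (hasDerivAt_gInv h0 hs.1.1 hne).div_const τ
    constructor
    -- Chain rule with `t = gInv τ s / τ`. The factor `(gInv τ s / s)^e` in the eigenvalues equals
    -- `τ^e t^e / s^e`, which is where the `τ^e` in the flux comes from.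
    · convert! d1.comp s dg using 1
      rw [sigmaRad, Nat.add_sub_cancel]
      set t := gInv τ s / τ with ht_def
      have hGt : gInv τ s = t * τ := by rw [ht_def]; field_simp
      have ht0 : 0 < t := one_pos.trans ht
      rw [hGt, div_pow, mul_pow]
      field_simp
      ring
    · convert! (d2.comp s dg).const_mul (τ ^ e) using 1
      rw [sigmaTan, Nat.add_sub_cancel]
      set t := gInv τ s / τ with ht_def
      have hGt : gInv τ s = t * τ := by rw [ht_def]; field_simp
      have ht0 : 0 < t := one_pos.trans ht
      rw [hGt, div_pow, mul_pow]
      field_simp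
      ring
  constructor
  · refine IsPrim.of_hasDerivAt hSc hle cf (fun s hs => (hder s hs).1) (i1.mul_continuousOn ?_)
    rwa [uIcc_of_le hle]
  · refine IsPrim.of_hasDerivAt hSc hle cg (fun s hs => (hder s hs).2) (i2.mul_continuousOn ?_)
    rwa [uIcc_of_le hle]

end

section

/-! ### Averages over the cells of a laminate -/

theorem node_succ (ε : ℝ) (k : ℕ) : node ε (k + 1) = node ε k + ε := by
  simp only [node]; push_cast; ring

theorem node_zero (ε : ℝ) : node ε 0 = 1 / 2 := by simp [node]

theorem half_le_node {ε : ℝ} (hε : 0 < ε) (k : ℕ) : 1 / 2 ≤ node ε k := by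
  simp only [node]
  have : 0 ≤ k * ε := by positivity
  linarith

theorem node_mono {ε : ℝ} (hε : 0 < ε) {j k : ℕ} (h : j ≤ k) : node ε j ≤ node ε k := by
  simp only [node]
  have : (j : ℝ) ≤ k := by exact_mod_cast h
  nlinarith

theorem floor_eq_of_mem {ε : ℝ} (hε : 0 < ε) {k : ℕ} {r : ℝ}
    (hr : r ∈ Ico (node ε k) (node ε (k + 1))) : ⌊(r - 1 / 2) / ε⌋₊ = k := by
  have h1 := hr.1
  have h2 := hr.2
  rw [node_succ] at h2
  simp only [node] at h1 h2
  have h3 : 0 ≤ (k : ℝ) * ε := by positivity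
  rw [Nat.floor_eq_iff (div_nonneg (by linarith) hε.le), le_div_iff₀ hε, div_lt_iff₀ hε]
  constructor <;> nlinarith

theorem mem_of_floor {ε : ℝ} (hε : 0 < ε) {r : ℝ} (hr : 1 / 2 ≤ r) :
    r ∈ Ico (node ε ⌊(r - 1 / 2) / ε⌋₊) (node ε (⌊(r - 1 / 2) / ε⌋₊ + 1)) := by
  have h0 : 0 ≤ (r - 1 / 2) / ε := div_nonneg (by linarith) hε.le
  have h1 := Nat.floor_le h0
  have h2 := Nat.lt_floor_add_one ((r - 1 / 2) / ε)
  rw [le_div_iff₀ hε] at h1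
  rw [div_lt_iff₀ hε] at h2
  rw [node_succ]
  simp only [node]
  constructor <;> nlinarith

/-- The difference between an oscillating function and its cell means has small primitives. -/
theorem abs_integral_sub_le_of_cell_means {φ ψ w : ℝ → ℝ} {ε B W Lw Ww : ℝ} {m : ℕ} (hε : 0 < ε)
    (hm : node ε m ≤ 1) (hψ : BddVar ψ B W) (hψm : Measurable ψ)
    (hφ0 : ∀ r ∈ Icc (1 / 2 : ℝ) 1, 0 ≤ φ r) (hφi : IntervalIntegrable φ volume (1 / 2) 1)
    (hmean : ∀ k < m, ∫ r in node ε k..node ε (k + 1), φ r = ε * ψ (node ε k))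
    (hend : ∀ r ∈ Icc (1 / 2 : ℝ) 1, node ε m ≤ r → φ r = ψ r)
    (hwc : ContinuousOn w (Icc (1 / 2) 1)) (hWw : ∀ r ∈ Icc (1 / 2 : ℝ) 1, |w r| ≤ Ww)
    (hLw : ∀ r ∈ Icc (1 / 2 : ℝ) 1, ∀ s ∈ Icc (1 / 2 : ℝ) 1, |w r - w s| ≤ Lw * |r - s|)
    (hLw0 : 0 ≤ Lw) (hWw0 : 0 ≤ Ww) :
    ∀ r ∈ Icc (1 / 2 : ℝ) 1, |∫ t in (1 / 2)..r, (w t * φ t - w t * ψ t)|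
      ≤ ε * (2 * Lw * B + Ww * W + 2 * Ww * B) := by
  have hB := hψ.bound_nonneg
  obtain ⟨v, hv, hvW⟩ := hψ.var
  have hle : (1 / 2 : ℝ) ≤ 1 := by norm_num
  have hψi : IntervalIntegrable ψ volume (1 / 2) 1 :=
    intervalIntegrable_of_bound hle hψm (C := B) fun t ht => by
      rw [abs_of_nonneg (hψ.nonneg t (Ioo_subset_Icc_self ht))]
      exact hψ.le t (Ioo_subset_Icc_self ht)
  have hwc' : ContinuousOn w (uIcc (1 / 2) 1) := by rwa [uIcc_of_le hle]
  have hfi : IntervalIntegrable (fun t => w t * φ t - w t * ψ t) volume (1 / 2) 1 :=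
    (hφi.continuousOn_mul hwc').sub (hψi.continuousOn_mul hwc')
  have sub : ∀ {F : ℝ → ℝ} {x y : ℝ}, IntervalIntegrable F volume (1 / 2) 1 →
      x ∈ Icc (1 / 2 : ℝ) 1 → y ∈ Icc (1 / 2 : ℝ) 1 → IntervalIntegrable F volume x y := by
    intro F x y hF hx hy
    refine hF.mono_set ?_
    rw [uIcc_of_le hle]
    exact uIcc_subset_Icc hx hy
  have hnode : ∀ k ≤ m, node ε k ∈ Icc (1 / 2 : ℝ) 1 := fun k hk =>
    ⟨half_le_node hε k, (node_mono hε hk).trans hm⟩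
  -- On a cell, freeze `w` and `ψ` at the left node. The difference `φ - ψ(s_k)` has mean zero
  -- there, so what remains is the oscillation of `w`, at most `Lw ε`, and the variation of `ψ` over
  -- the cell. The function `φ` enters only through its integral.
  have hcell : ∀ k < m, |∫ t in node ε k..node ε (k + 1), (w t * φ t - w t * ψ t)|
      ≤ ε * ε * (2 * Lw * B) + ε * Ww * (v (node ε (k + 1)) - v (node ε k)) := by
    intro k hk
    set s := node ε k with hs
    set s' := node ε (k + 1) with hs'
    have hss : s' = s + ε := node_succ ε k
    have hsI : s ∈ Icc (1 / 2 : ℝ) 1 := hnode k hk.le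
    have hsI' : s' ∈ Icc (1 / 2 : ℝ) 1 := hnode (k + 1) hk
    have hsub : ∀ t ∈ Ioc s s', t ∈ Icc (1 / 2 : ℝ) 1 := fun t ht =>
      ⟨hsI.1.trans ht.1.le, ht.2.trans hsI'.2⟩
    have iφ := sub hφi hsI hsI'
    have i0 : IntervalIntegrable (fun t => w s * (φ t - ψ s)) volume s s' :=
      (iφ.sub intervalIntegrable_const).const_mul _
    have iR : IntervalIntegrable (fun t => (w t * φ t - w t * ψ t) - w s * (φ t - ψ s)) volume s s' :=
      (sub hfi hsI hsI').sub i0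
    have e0 : ∫ t in s..s', w s * (φ t - ψ s) = 0 := by
      rw [intervalIntegral.integral_const_mul, intervalIntegral.integral_sub iφ
        intervalIntegrable_const, hmean k hk, intervalIntegral.integral_const, hss]
      simp only [add_sub_cancel_left, smul_eq_mul, mul_eq_zero]
      exact Or.inr (sub_self _)
    have e1 : ∫ t in s..s', (w t * φ t - w t * ψ t)
        = ∫ t in s..s', ((w t * φ t - w t * ψ t) - w s * (φ t - ψ s)) := by
      rw [intervalIntegral.integral_sub (sub hfi hsI hsI') i0, e0, sub_zero]
    rw [e1, ← Real.norm_eq_abs]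
    have hvk : |ψ s' - ψ s| ≤ v s' - v s := hv s hsI s' hsI' (by linarith)
    have hbd : ∀ t ∈ Ioc s s', ‖(w t * φ t - w t * ψ t) - w s * (φ t - ψ s)‖
        ≤ Lw * ε * φ t + (Ww * (v s' - v s) + Lw * ε * B) := by
      intro t ht
      have htI := hsub t ht
      have a1 : |w t - w s| ≤ Lw * ε := (hLw t htI s hsI).trans (by
        rw [abs_of_pos (by linarith [ht.1])]
        exact mul_le_mul_of_nonneg_left (by linarith [ht.2]) hLw0)
      have a2 : |ψ t - ψ s| ≤ v s' - v s := by
        have h1 := hv s hsI t htI ht.1.le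
        have h2 := (abs_nonneg _).trans (hv t htI s' hsI' ht.2)
        linarith
      have e2 : (w t * φ t - w t * ψ t) - w s * (φ t - ψ s)
          = (w t - w s) * φ t - (w t * (ψ t - ψ s) + (w t - w s) * ψ s) := by ring
      rw [e2, Real.norm_eq_abs]
      have b1 : |(w t - w s) * φ t| ≤ Lw * ε * φ t := by
        rw [abs_mul, abs_of_nonneg (hφ0 t htI)]
        exact mul_le_mul_of_nonneg_right a1 (hφ0 t htI)
      have b2 : |w t * (ψ t - ψ s)| ≤ Ww * (v s' - v s) := by
        rw [abs_mul]
        exact mul_le_mul (hWw t htI) a2 (abs_nonneg _) hWw0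
      have b3 : |(w t - w s) * ψ s| ≤ Lw * ε * B := by
        rw [abs_mul, abs_of_nonneg (hψ.nonneg s hsI)]
        exact mul_le_mul a1 (hψ.le s hsI) (hψ.nonneg s hsI) (by positivity)
      calc |(w t - w s) * φ t - (w t * (ψ t - ψ s) + (w t - w s) * ψ s)|
          ≤ |(w t - w s) * φ t| + |w t * (ψ t - ψ s) + (w t - w s) * ψ s| := abs_sub _ _
        _ ≤ |(w t - w s) * φ t| + (|w t * (ψ t - ψ s)| + |(w t - w s) * ψ s|) := by
            gcongr; exact abs_add_le _ _
        _ ≤ _ := by linarith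
    have ig : IntervalIntegrable (fun t => Lw * ε * φ t + (Ww * (v s' - v s) + Lw * ε * B))
        volume s s' := (iφ.const_mul _).add intervalIntegrable_const
    refine (intervalIntegral.norm_integral_le_of_norm_le (by linarith)
      (Filter.Eventually.of_forall hbd) ig).trans ?_
    rw [intervalIntegral.integral_add (iφ.const_mul _) intervalIntegrable_const,
      intervalIntegral.integral_const_mul, hmean k hk, intervalIntegral.integral_const, hss,
      smul_eq_mul, add_sub_cancel_left, ← hss]
    have := mul_le_mul_of_nonneg_left (hψ.le s hsI) (by positivity : 0 ≤ Lw * ε * ε)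
    nlinarith
  -- The errors `ε²` add up over at most `1/ε` cells, and the variations telescope.
  have hsum : ∀ k ≤ m, |∫ t in (1 / 2)..node ε k, (w t * φ t - w t * ψ t)|
      ≤ k * ε * ε * (2 * Lw * B) + ε * Ww * (v (node ε k) - v (1 / 2)) := by
    intro k
    induction k with
    | zero => intro _; simp [node_zero]
    | succ k ih =>
      intro hk
      have h1 := ih (by omega)
      have h2 := hcell k hk
      rw [← intervalIntegral.integral_add_adjacent_intervals
        (sub hfi (left_mem_Icc.2 hle) (hnode k (by omega)))
        (sub hfi (hnode k (by omega)) (hnode (k + 1) hk))]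
      refine (abs_add_le _ _).trans ?_
      push_cast
      linarith
  have hsum' : ∀ k ≤ m, |∫ t in (1 / 2)..node ε k, (w t * φ t - w t * ψ t)|
      ≤ ε * (2 * Lw * B + Ww * W) := by
    intro k hk
    refine (hsum k hk).trans ?_
    have hk1 : (k : ℝ) * ε ≤ 1 := by
      have := (hnode k hk).2
      simp only [node] at this
      linarith
    have h1 : v (node ε k) - v (1 / 2) ≤ W := by
      have := (abs_nonneg _).trans (hv _ (hnode k hk) 1 (right_mem_Icc.2 hle) (hnode k hk).2)
      linarith
    have h2 : (k : ℝ) * ε * ε * (2 * Lw * B) ≤ 1 * ε * (2 * Lw * B) := by gcongr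
    have h3 : ε * Ww * (v (node ε k) - v (1 / 2)) ≤ ε * Ww * W := by gcongr
    linarith
  intro r hr
  by_cases hrm : node ε m ≤ r
  · have e1 : ∫ t in node ε m..r, (w t * φ t - w t * ψ t) = 0 := by
      rw [intervalIntegral.integral_congr (g := fun _ => 0)]
      · simp
      · intro t ht
        rw [uIcc_of_le hrm] at ht
        beta_reduce
        rw [hend t ⟨(hnode m le_rfl).1.trans ht.1, ht.2.trans hr.2⟩ ht.1, sub_self]
    rw [← intervalIntegral.integral_add_adjacent_intervals
        (sub hfi (left_mem_Icc.2 hle) (hnode m le_rfl)) (sub hfi (hnode m le_rfl) hr), e1, add_zero]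
    refine (hsum' m le_rfl).trans ?_
    have : 0 ≤ ε * (2 * Ww * B) := by positivity
    linarith
  · obtain ⟨hk1, hk2⟩ := mem_of_floor hε hr.1
    set k := ⌊(r - 1 / 2) / ε⌋₊
    have hkm : k < m := by
      by_contra hge
      exact hrm ((node_mono hε (not_lt.1 hge)).trans hk1)
    have hkI := hnode k hkm.le
    have hkI' := hnode (k + 1) hkm
    rw [← intervalIntegral.integral_add_adjacent_intervals
        (sub hfi (left_mem_Icc.2 hle) hkI) (sub hfi hkI hr)]
    refine (abs_add_le _ _).trans ?_
    have h1 := hsum' k hkm.le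
    have iφ : IntervalIntegrable (fun t => Ww * φ t + Ww * B) volume (1 / 2) 1 :=
      (hφi.const_mul _).add intervalIntegrable_const
    have hnn : ∀ t ∈ Icc (1 / 2 : ℝ) 1, 0 ≤ Ww * φ t + Ww * B := fun t ht =>
      add_nonneg (mul_nonneg hWw0 (hφ0 t ht)) (mul_nonneg hWw0 hB)
    -- No cancellation is available on an incomplete cell. Since the integrand majorizing it is
    -- nonnegative, the integral is enlarged to the full cell, where the mean of `φ` is known.
    have h2 : |∫ t in node ε k..r, (w t * φ t - w t * ψ t)| ≤ 2 * ε * Ww * B := by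
      rw [← Real.norm_eq_abs]
      have hbd : ∀ t ∈ Ioc (node ε k) r, ‖w t * φ t - w t * ψ t‖ ≤ Ww * φ t + Ww * B := by
        intro t ht
        have htI : t ∈ Icc (1 / 2 : ℝ) 1 := ⟨hkI.1.trans ht.1.le, ht.2.trans hr.2⟩
        rw [Real.norm_eq_abs]
        refine (abs_sub _ _).trans ?_
        rw [abs_mul, abs_mul, abs_of_nonneg (hφ0 t htI), abs_of_nonneg (hψ.nonneg t htI)]
        exact add_le_add (mul_le_mul_of_nonneg_right (hWw t htI) (hφ0 t htI))
          (mul_le_mul (hWw t htI) (hψ.le t htI) (hψ.nonneg t htI) hWw0)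
      refine (intervalIntegral.norm_integral_le_of_norm_le hk1
        (Filter.Eventually.of_forall hbd) (sub iφ hkI hr)).trans ?_
      have h3 : ∫ t in node ε k..r, (Ww * φ t + Ww * B)
          ≤ ∫ t in node ε k..node ε (k + 1), (Ww * φ t + Ww * B) := by
        refine intervalIntegral.integral_mono_interval le_rfl hk1 hk2.le ?_ (sub iφ hkI hkI')
        filter_upwards [ae_restrict_mem measurableSet_Ioc] with t ht
        exact hnn t ⟨hkI.1.trans ht.1.le, ht.2.trans hkI'.2⟩
      refine h3.trans ?_
      rw [intervalIntegral.integral_add ((sub hφi hkI hkI').const_mul _) intervalIntegrable_const,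
        intervalIntegral.integral_const_mul, hmean k hkm, intervalIntegral.integral_const,
        node_succ, smul_eq_mul, add_sub_cancel_left]
      have := mul_le_mul_of_nonneg_left (hψ.le _ hkI) (by positivity : 0 ≤ Ww * ε)
      linarith
    linarith

/-- The mean of a step function with three values over a period. -/
theorem integral_step {l₀ l₁ x y z : ℝ} (h0 : 0 ≤ l₀) (h1 : 0 ≤ l₁) (h2 : l₀ + l₁ ≤ 1) :
    ∫ t in (0 : ℝ)..1, (if Int.fract t < l₀ then x else if Int.fract t < l₀ + l₁ then y else z)
      = x * l₀ + y * l₁ + z * (1 - l₀ - l₁) := by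
  set F : ℝ → ℝ := fun t => if Int.fract t < l₀ then x else if Int.fract t < l₀ + l₁ then y else z
    with hF
  have hc : ∀ {a b c : ℝ}, a ≤ b → (∀ t ∈ Ioo a b, F t = c) →
      IntervalIntegrable F volume a b ∧ ∫ t in a..b, F t = c * (b - a) := by
    intro a b c hab h
    have hae : ∀ᵐ t, t ∈ uIoc a b → c = F t := by
      have : ∀ᵐ t : ℝ, t ≠ b := by simp [ae_iff]
      rw [uIoc_of_le hab]
      filter_upwards [this] with t ht ht'
      exact (h t ⟨ht'.1, lt_of_le_of_ne ht'.2 ht⟩).symm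
    constructor
    · refine (intervalIntegrable_const (c := c)).congr_ae ?_
      exact (ae_restrict_iff' measurableSet_uIoc).2 hae
    · rw [← intervalIntegral.integral_congr_ae hae, intervalIntegral.integral_const, smul_eq_mul,
        mul_comm]
  have hfr : ∀ t : ℝ, 0 < t → t < 1 → Int.fract t = t := fun t ht ht' =>
    Int.fract_eq_self.2 ⟨ht.le, ht'⟩
  obtain ⟨i1, e1⟩ := hc (a := 0) (b := l₀) (c := x) h0 fun t ht => by
    rw [hF]; beta_reduce
    rw [hfr t ht.1 (by linarith [ht.2]), if_pos ht.2]
  obtain ⟨i2, e2⟩ := hc (a := l₀) (b := l₀ + l₁) (c := y) (by linarith) fun t ht => by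
    rw [hF]; beta_reduce
    rw [hfr t (by linarith [ht.1]) (by linarith [ht.2]), if_neg (not_lt.2 ht.1.le), if_pos ht.2]
  obtain ⟨i3, e3⟩ := hc (a := l₀ + l₁) (b := 1) (c := z) h2 fun t ht => by
    rw [hF]; beta_reduce
    rw [hfr t (by linarith [ht.1]) ht.2, if_neg (not_lt.2 (by linarith [ht.1])),
      if_neg (not_lt.2 ht.1.le)]
  rw [← intervalIntegral.integral_add_adjacent_intervals (i1.trans i2) i3,
    ← intervalIntegral.integral_add_adjacent_intervals i1 i2, e1, e2, e3]
  ring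

/-- A node need not be a multiple of `ε`, so a cell may start in the middle of a period. It still
contains exactly one period, and the mean does not depend on the phase. -/
theorem integral_cell {F : ℝ → ℝ} {ε l₀ l₁ x y z : ℝ} (hε : 0 < ε) (h0 : 0 ≤ l₀) (h1 : 0 ≤ l₁)
    (h2 : l₀ + l₁ ≤ 1) (k : ℕ) (hF : ∀ r ∈ Ico (node ε k) (node ε (k + 1)), F r =
      if Int.fract (r / ε) < l₀ then x else if Int.fract (r / ε) < l₀ + l₁ then y else z) :
    ∫ r in node ε k..node ε (k + 1), F r = ε * (x * l₀ + y * l₁ + z * (1 - l₀ - l₁)) := by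
  set G : ℝ → ℝ := fun t => if Int.fract t < l₀ then x else if Int.fract t < l₀ + l₁ then y else z
    with hG
  have hle : node ε k ≤ node ε (k + 1) := node_mono hε (Nat.le_succ k)
  have e1 : ∫ r in node ε k..node ε (k + 1), F r
      = ∫ r in node ε k..node ε (k + 1), G (r / ε) := by
    refine intervalIntegral.integral_congr_ae ?_
    have : ∀ᵐ t : ℝ, t ≠ node ε (k + 1) := by simp [ae_iff]
    rw [uIoc_of_le hle]
    filter_upwards [this] with t ht ht'
    exact hF t ⟨ht'.1.le, lt_of_le_of_ne ht'.2 ht⟩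
  have hper : Function.Periodic G 1 := fun t => by simp only [hG, Int.fract_add_one]
  have e2 : node ε (k + 1) / ε = node ε k / ε + 1 := by
    rw [node_succ]; field_simp
  rw [e1, intervalIntegral.integral_comp_div G hε.ne', e2,
    hper.intervalIntegral_add_eq (node ε k / ε) 0, zero_add, smul_eq_mul, integral_step h0 h1 h2]

end

section

/-! ### The laminate as a radial conductivity -/

/-- A smooth weight is bounded and Lipschitz on `[1/2, 1]`. -/
theorem exists_weight_bound {w : ℝ → ℝ} (hw : ContDiffOn ℝ 1 w (Ioi 0)) :
    ∃ D : ℝ, 0 ≤ D ∧ (∀ r ∈ Icc (1 / 2 : ℝ) 1, |w r| ≤ D) ∧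
      ∀ r ∈ Icc (1 / 2 : ℝ) 1, ∀ s ∈ Icc (1 / 2 : ℝ) 1, |w r - w s| ≤ D * |r - s| := by
  have hsub : Icc (1 / 2 : ℝ) 1 ⊆ Ioi 0 := fun r hr => lt_of_lt_of_le (by norm_num) hr.1
  obtain ⟨D1, h1⟩ := isCompact_Icc.exists_bound_of_continuousOn (hw.continuousOn.mono hsub)
  obtain ⟨D2, h2⟩ := isCompact_Icc.exists_bound_of_continuousOn
    ((hw.continuousOn_deriv_of_isOpen isOpen_Ioi le_rfl).mono hsub)
  refine ⟨max (max D1 D2) 0, le_max_right _ _, fun r hr => ?_, fun r hr s hs => ?_⟩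
  · exact (h1 r hr).trans ((le_max_left _ _).trans (le_max_left _ _))
  · refine ((convex_Icc (1 / 2 : ℝ) 1).norm_image_sub_le_of_norm_deriv_le (f := w) (C := D2)
      (fun x hx => (hw.differentiableOn one_ne_zero).differentiableAt
        (isOpen_Ioi.mem_nhds (hsub hx))) h2 hs hr).trans ?_
    exact mul_le_mul_of_nonneg_right ((le_max_right _ _).trans (le_max_left _ _)) (norm_nonneg _)

/-- Beyond `3/4` the blow-up map is the identity, and `2τ ≤ 3/4` places such points in the
background of the coating. -/
theorem sigmaTan_of_le (d : ℕ) (σ : Coating) {τ s : ℝ} (h0 : 0 < τ) (h1 : τ ≤ 3 / 8)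
    (hs : 3 / 4 ≤ s) : sigmaTan d σ τ s = 1 := by
  have : 2 ≤ s / τ := by rw [le_div_iff₀ h0]; linarith
  rw [sigmaTan, gInv_of_le h0 hs, lam_of_le hs, σ.profile_of_two_le this, div_self (by linarith)]
  simp

theorem sigmaRad_of_le (d : ℕ) (σ : Coating) {τ s : ℝ} (h0 : 0 < τ) (h1 : τ ≤ 3 / 8)
    (hs : 3 / 4 ≤ s) : sigmaRad d σ τ s = 1 := by
  have : 2 ≤ s / τ := by rw [le_div_iff₀ h0]; linarith
  rw [sigmaRad, gInv_of_le h0 hs, lam_of_le hs, σ.profile_of_two_le this, div_self (by linarith)]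
  simp

namespace Laminate

variable (M : Laminate)

/-- The conductivity of the laminate at distance `r` from the origin. -/
def radCond (ε r : ℝ) : ℝ :=
  if node ε ⌊(r - 1 / 2) / ε⌋₊ < 3 / 4 then M.cell ⌊(r - 1 / 2) / ε⌋₊ (r / ε) else 1

theorem measurable_radCond (ε : ℝ) : Measurable (M.radCond ε) := by
  have h1 : Measurable fun q : ℝ × ℕ => if node ε q.2 < 3 / 4 then M.cell q.2 (q.1 / ε) else 1 := by
    refine measurable_from_prod_countable_left fun k => ?_
    have hf : Measurable fun r : ℝ => Int.fract (r / ε) :=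
      measurable_fract.comp (measurable_id.div_const ε)
    by_cases hk : node ε k < 3 / 4
    · simp only [hk, if_true, cell]
      exact Measurable.ite (measurableSet_lt hf measurable_const) measurable_const
        (Measurable.ite (measurableSet_lt hf measurable_const) measurable_const measurable_const)
    · simp only [hk, if_false]
      exact measurable_const
  have h2 : Measurable fun r : ℝ => (r, ⌊(r - 1 / 2) / ε⌋₊) :=
    measurable_id.prodMk (Nat.measurable_floor.comp
      ((measurable_id.sub measurable_const).div_const ε))
  exact h1.comp h2

variable {M}

/-- Only finitely many cells are laminated. These bounds depend on the laminate; they serve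
measurability and solvability and never reach the final constant. -/
theorem Realizes.exists_bounds {d : ℕ} {σ : Coating} {τ ε : ℝ} (h : M.Realizes d σ τ ε)
    (hε : 0 < ε) : ∃ m Q : ℝ, 0 < m ∧ ∀ r, m ≤ M.radCond ε r ∧ M.radCond ε r ≤ Q := by
  set K := ⌈1 / ε⌉₊ with hK
  set Q := 1 + ∑ k ∈ Finset.range K, |M.high k|
  set q := 1 + ∑ k ∈ Finset.range K, |1 / M.low k|
  have hQ : 1 ≤ Q := le_add_of_nonneg_right (Finset.sum_nonneg fun _ _ => abs_nonneg _)
  have hq : 1 ≤ q := le_add_of_nonneg_right (Finset.sum_nonneg fun _ _ => abs_nonneg _)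
  refine ⟨1 / q, Q, by positivity, fun r => ?_⟩
  have hq1 : 1 / q ≤ 1 := by rw [div_le_one (by linarith)]; exact hq
  rw [radCond]
  split_ifs with hk
  · set k := ⌊(r - 1 / 2) / ε⌋₊
    obtain ⟨hl, hlh, -⟩ := h k hk
    have hkK : k ∈ Finset.range K := by
      rw [Finset.mem_range, hK, Nat.lt_ceil, lt_div_iff₀ hε]
      simp only [node] at hk
      linarith
    have a1 : M.high k ≤ Q := by
      have := Finset.single_le_sum (f := fun k => |M.high k|) (fun _ _ => abs_nonneg _) hkK
      have := le_abs_self (M.high k)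
      simp only [Q]
      linarith
    have a2 : 1 / q ≤ M.low k := by
      have := Finset.single_le_sum (f := fun k => |1 / M.low k|) (fun _ _ => abs_nonneg _) hkK
      have h3 := le_abs_self (1 / M.low k)
      rw [one_div_le (by linarith) hl]
      simp only [q]
      linarith
    rw [cell]
    split_ifs
    · exact ⟨a2, hlh.le.trans a1⟩
    · exact ⟨hq1, hQ⟩
    · exact ⟨a2.trans hlh.le, a1⟩
  · exact ⟨hq1, hQ⟩

theorem radCond_of_mem {ε : ℝ} (hε : 0 < ε) {k : ℕ} (hk : node ε k < 3 / 4) {r : ℝ}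
    (hr : r ∈ Ico (node ε k) (node ε (k + 1))) : M.radCond ε r = M.cell k (r / ε) := by
  rw [radCond, floor_eq_of_mem hε hr, if_pos hk]

theorem radCond_of_node_le {ε : ℝ} (hε : 0 < ε) {m : ℕ} (hm : 3 / 4 ≤ node ε m) {r : ℝ}
    (hr : node ε m ≤ r) : M.radCond ε r = 1 := by
  rw [radCond, if_neg (not_lt.2 ?_)]
  have h2 := (mem_of_floor hε ((half_le_node hε m).trans hr)).2
  set k := ⌊(r - 1 / 2) / ε⌋₊
  refine hm.trans (node_mono hε ?_)
  by_contra hlt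
  exact absurd (hr.trans_lt h2) (not_lt.2 (node_mono hε (by omega)))

/-- The last laminated cell starts before `3/4` and has length at most `1/8`, so it ends before
`7/8`. -/
theorem radCond_of_le {ε : ℝ} (hε : 0 < ε) (hε8 : ε ≤ 1 / 8) {r : ℝ} (hr : 7 / 8 ≤ r) :
    M.radCond ε r = 1 := by
  rw [radCond, if_neg (not_lt.2 ?_)]
  have h2 := (mem_of_floor hε (by linarith : 1 / 2 ≤ r)).2
  rw [node_succ] at h2
  linarith

/-- The number of laminated cells. -/
theorem exists_count {ε : ℝ} (hε : 0 < ε) (hε8 : ε ≤ 1 / 8) :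
    ∃ m : ℕ, 3 / 4 ≤ node ε m ∧ node ε m ≤ 7 / 8 ∧ ∀ k < m, node ε k < 3 / 4 := by
  have hex : ∃ m : ℕ, 3 / 4 ≤ node ε m := by
    refine ⟨⌈1 / ε⌉₊, ?_⟩
    have := (div_le_iff₀ hε).1 (Nat.le_ceil (1 / ε))
    simp only [node]
    linarith
  classical
  refine ⟨Nat.find hex, Nat.find_spec hex, ?_, fun k hk => not_le.1 (Nat.find_min hex hk)⟩
  rcases Nat.eq_zero_or_pos (Nat.find hex) with h | h
  · rw [h, node_zero]; norm_num
  · obtain ⟨j, hj⟩ := Nat.exists_eq_succ_of_ne_zero h.ne'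
    have := not_le.1 (Nat.find_min hex (m := j) (by omega))
    rw [hj, Nat.succ_eq_add_one, node_succ]
    linarith

/-- The constant depends on the coating and the weights but not on the materials of the laminate.
The factor `L + 7` collects `2 + (L + 3) + 2` from `abs_integral_sub_le_of_cell_means`. -/
theorem exists_averaging_bound (σ : Coating) (e : ℕ) {wa wb : ℝ → ℝ}
    (hwa : ContDiffOn ℝ 1 wa (Ioi 0)) (hwb : ContDiffOn ℝ 1 wb (Ioi 0)) :
    ∃ C : ℝ, 0 ≤ C ∧ ∀ τ ε : ℝ, 0 < τ → τ ≤ 3 / 8 → 0 < ε → ε ≤ 1 / 8 →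
      ∀ M : Laminate, M.Realizes (e + 2) σ τ ε → ∀ r ∈ Icc (1 / 2 : ℝ) 1,
        |∫ t in (1 / 2)..r, (wa t * M.radCond ε t - wa t * sigmaTan (e + 2) σ τ t)|
          ≤ C * (ε * (1 / blowExp τ)) ∧
        |∫ t in (1 / 2)..r, (wb t * (1 / M.radCond ε t) - wb t * (1 / sigmaRad (e + 2) σ τ t))|
          ≤ C * (ε * ((τ ^ e)⁻¹ * (1 / blowExp τ))) := by
  obtain ⟨B, hB1, hB⟩ := σ.exists_profile_bounds
  obtain ⟨D, hD0, hDa, hDa'⟩ := exists_weight_bound hwa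
  obtain ⟨E, hE0, hEb, hEb'⟩ := exists_weight_bound hwb
  have hsub : Icc (1 / 2 : ℝ) 1 ⊆ Ioi 0 := fun r hr => lt_of_lt_of_le (by norm_num) hr.1
  refine ⟨(D + E) * (σ.L + 7) * B, by positivity, fun τ ε h0 h1 hε hε8 M hM r hr => ?_⟩
  have hμ := one_le_inv_blowExp h0 h1
  obtain ⟨m, hm1, hm2, hm3⟩ := exists_count hε hε8
  obtain ⟨l, Q, hl, hlQ⟩ := hM.exists_bounds hε
  have hle : (1 / 2 : ℝ) ≤ 1 := by norm_num
  have hpos : ∀ r, 0 < M.radCond ε r := fun r => hl.trans_le (hlQ r).1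
  have key1 := abs_integral_sub_le_of_cell_means (φ := M.radCond ε) (w := wa) hε
    (hm2.trans (by norm_num)) (bddVar_sigmaTan σ e h0 h1 hB) (measurable_sigmaTan _ σ τ)
    (fun r _ => (hpos r).le)
    (intervalIntegrable_of_bound hle (M.measurable_radCond ε) (C := Q) fun t _ => by
      rw [abs_of_pos (hpos t)]; exact (hlQ t).2)
    (fun k hk => by
      obtain ⟨-, -, a1, a2, a3, a4, -⟩ := hM k (hm3 k hk)
      rw [integral_cell (x := M.low k) (y := 1) (z := M.high k) hε a1 a2 a3 k, ← a4, one_mul]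
      intro r hr
      rw [radCond_of_mem hε (hm3 k hk) hr, cell])
    (fun r _ hr => by
      rw [radCond_of_node_le hε hm1 hr, sigmaTan_of_le _ σ h0 h1 (hm1.trans hr)])
    (hwa.continuousOn.mono hsub) hDa hDa' hD0 hD0 r hr
  have key2 := abs_integral_sub_le_of_cell_means (φ := fun t => 1 / M.radCond ε t) (w := wb) hε
    (hm2.trans (by norm_num)) (bddVar_inv_sigmaRad σ e h0 h1 hB)
    (measurable_const.div (measurable_sigmaRad _ σ τ))
    (fun r _ => (one_div_pos.2 (hpos r)).le)
    (intervalIntegrable_of_bound hle (measurable_const.div (M.measurable_radCond ε)) (C := 1 / l)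
      fun t _ => by
        rw [abs_of_pos (one_div_pos.2 (hpos t))]
        exact one_div_le_one_div_of_le hl (hlQ t).1)
    (fun k hk => by
      obtain ⟨-, -, a1, a2, a3, -, a4⟩ := hM k (hm3 k hk)
      rw [integral_cell (x := 1 / M.low k) (y := 1) (z := 1 / M.high k) hε a1 a2 a3 k, ← a4,
        one_mul]
      intro r hr
      rw [radCond_of_mem hε (hm3 k hk) hr, cell]
      split_ifs
      · rfl
      · norm_num
      · rfl)
    (fun r _ hr => by
      rw [radCond_of_node_le hε hm1 hr, sigmaRad_of_le _ σ h0 h1 (hm1.trans hr)])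
    (hwb.continuousOn.mono hsub) hEb hEb' hE0 hE0 r hr
  have hτ : ((2 * τ) ^ e)⁻¹ ≤ (τ ^ e)⁻¹ :=
    inv_anti₀ (by positivity) (pow_le_pow_left₀ h0.le (by linarith) e)
  have hfin : ∀ {X F : ℝ}, 0 ≤ X → 0 ≤ F → F ≤ D + E →
      ε * (2 * F * (B * X) + F * ((σ.L + 3) * (B * X)) + 2 * F * (B * X))
        ≤ (D + E) * (σ.L + 7) * B * (ε * X) := by
    intro X F hX hF hFD
    have : ε * (2 * F * (B * X) + F * ((σ.L + 3) * (B * X)) + 2 * F * (B * X))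
        = F * ((σ.L + 7) * B * (ε * X)) := by ring
    rw [this, show (D + E) * (σ.L + 7) * B * (ε * X) = (D + E) * ((σ.L + 7) * B * (ε * X)) by ring]
    exact mul_le_mul_of_nonneg_right hFD (by positivity)
  refine ⟨key1.trans (hfin (by linarith) hD0 (by linarith)), key2.trans ?_⟩
  refine (hfin (by positivity) hE0 (by linarith)).trans ?_
  gcongr

end Laminate

end

section

/-! ### Comparison of the laminate with the homogenized cloak -/

theorem radialSystem_pow (n e : ℕ) {x y : ℝ} (hx : 0 < x) (hxy : x ≤ y) :
    RadialSystem (fun r => (r ^ (e + 1))⁻¹) (fun r => n * (n + e) * (r ^ (e + 1) / r ^ 2))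
      (fun r => r ^ n) (fun r => n * r ^ (n + e)) x y := by
  have h0 : ∀ r ∈ Icc x y, r ≠ 0 := fun r hr => (hx.trans_le hr.1).ne'
  constructor
  · refine IsPrim.of_hasDerivAt countable_empty hxy (by fun_prop) (fun r hr => ?_) ?_
    · have hr0 := h0 r (Ioo_subset_Icc_self hr.1)
      convert! hasDerivAt_pow n r using 1
      rcases n with _ | n
      · simp
      · rw [Nat.add_sub_cancel]
        field_simp
        ring
    · refine ContinuousOn.intervalIntegrable_of_Icc hxy (ContinuousOn.mul ?_ (by fun_prop))
      exact ContinuousOn.inv₀ (by fun_prop) fun r hr => pow_ne_zero _ (h0 r hr)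
  · refine IsPrim.of_hasDerivAt countable_empty hxy (by fun_prop) (fun r hr => ?_) ?_
    · have hr0 := h0 r (Ioo_subset_Icc_self hr.1)
      convert! (hasDerivAt_pow (n + e) r).const_mul (n : ℝ) using 1
      rcases n with _ | n
      · simp
      · rw [show n + 1 + e - 1 = n + e by omega]
        push_cast
        field_simp
        ring
    · refine ContinuousOn.intervalIntegrable_of_Icc hxy
        (ContinuousOn.mul (continuousOn_const.mul (ContinuousOn.div (by fun_prop) (by fun_prop) ?_))
          (by fun_prop))
      exact fun r hr => pow_ne_zero _ (h0 r hr)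

/-- In a homogeneous medium the defect of the Dirichlet-to-Neumann coefficient is transported
by the regular solution. -/
theorem RadialSystem.defect_eq {n e : ℕ} {A V p : ℝ → ℝ} {R : ℝ}
    (h : RadialSystem (fun r => (r ^ (e + 1))⁻¹ * (1 / A r))
      (fun r => n * (n + e) * (r ^ (e + 1) / r ^ 2 * A r)) V p R 1)
    (hR : 0 < R) (hR1 : R ≤ 1) (hA : ∀ r, R ≤ r → A r = 1) :
    p 1 - n * V 1 = R ^ n * (p R - n * R ^ e * V R) := by
  have h1 := h.wronskian (radialSystem_pow n e hR hR1) hR1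
  rw [intervalIntegral.integral_congr (g := fun _ => 0)] at h1
  · simp only [one_pow, mul_one, intervalIntegral.integral_zero, add_zero] at h1
    rw [h1, pow_add]
    ring
  · intro t ht
    rw [uIcc_of_le hR1] at ht
    beta_reduce
    rw [hA t ht.1]
    ring

/-- `RadialSystem.compare` on `[1/2, R]` with the blown-up mode as second solution. The integral of
its coefficient `c'` is bounded through `G`, and that of the laminate through `G + S`, by closeness
of the primitives. -/
theorem RadialSystem.compare_blowup {σ : Coating} {n e : ℕ} {f g A V p : ℝ → ℝ} {τ α β l Q S T G : ℝ}
    (hf : Mode σ n e f g α β) (h0 : 0 < τ) (h1 : τ ≤ 3 / 8)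
    (h : RadialSystem (fun r => (r ^ (e + 1))⁻¹ * (1 / A r))
      (fun r => n * (n + e) * (r ^ (e + 1) / r ^ 2 * A r)) V p (1 / 2) 1)
    (hp : p (1 / 2) = 0) (hA : Measurable A) (hl : 0 < l) (hlQ : ∀ r, l ≤ A r ∧ A r ≤ Q)
    (hS : ∀ r ∈ Icc (1 / 2 : ℝ) 1, |∫ t in (1 / 2)..r, (t ^ (e + 1) / t ^ 2 * A t
      - t ^ (e + 1) / t ^ 2 * sigmaTan (e + 2) σ τ t)| ≤ S)
    (hT : ∀ r ∈ Icc (1 / 2 : ℝ) 1, |∫ t in (1 / 2)..r, ((t ^ (e + 1))⁻¹ * (1 / A t)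
      - (t ^ (e + 1))⁻¹ * (1 / sigmaRad (e + 2) σ τ t))| ≤ T)
    {R : ℝ} (hR : 3 / 4 ≤ R) (hR1 : R ≤ 1)
    (hG : ∫ t in (1 / 2)..R, t ^ (e + 1) / t ^ 2 * sigmaTan (e + 2) σ τ t ≤ G) (hV : 0 ≤ V R) :
    |p R * f (R / τ) - τ ^ e * g (R / τ) * V R| ≤
      (2 * (n * (n + e) * S) + 2 * T * (n * (n + e) * (G + S) * (n * (n + e) * G)))
        * (f (R / τ) * V R) := by
  obtain ⟨B, hB1, hB⟩ := σ.exists_profile_bounds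
  have hle : (1 / 2 : ℝ) ≤ R := by linarith
  have hRm : R ∈ Icc (1 / 2 : ℝ) 1 := ⟨hle, hR1⟩
  have hsub : Icc (1 / 2 : ℝ) R ⊆ Icc (1 / 2 : ℝ) 1 := Icc_subset_Icc_right hR1
  have hsub' : Ioo (1 / 2 : ℝ) R ⊆ Icc (1 / 2 : ℝ) 1 := Ioo_subset_Icc_self.trans hsub
  have hpos : ∀ s ∈ Icc (1 / 2 : ℝ) 1, 0 < s := fun s hs => lt_of_lt_of_le (by norm_num) hs.1
  have vT := bddVar_sigmaTan σ e h0 h1 hB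
  have vR := bddVar_inv_sigmaRad σ e h0 h1 hB
  have hApos : ∀ r, 0 < A r := fun r => hl.trans_le (hlQ r).1
  have cwa : ContinuousOn (fun t : ℝ => t ^ (e + 1) / t ^ 2) (uIcc (1 / 2) R) := by
    rw [uIcc_of_le hle]
    exact ContinuousOn.div (by fun_prop) (by fun_prop) fun r hr => pow_ne_zero _ (hpos r (hsub hr)).ne'
  have cwb : ContinuousOn (fun t : ℝ => (t ^ (e + 1))⁻¹) (uIcc (1 / 2) R) := by
    rw [uIcc_of_le hle]
    exact ContinuousOn.inv₀ (by fun_prop) fun r hr => pow_ne_zero _ (hpos r (hsub hr)).ne'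
  have ia : IntervalIntegrable (fun t => t ^ (e + 1) / t ^ 2 * A t) volume (1 / 2) R :=
    (intervalIntegrable_of_bound hle hA (C := Q) fun t _ => by
      rw [abs_of_pos (hApos t)]; exact (hlQ t).2).continuousOn_mul cwa
  have ib : IntervalIntegrable (fun t => (t ^ (e + 1))⁻¹ * (1 / A t)) volume (1 / 2) R :=
    (intervalIntegrable_of_bound (k := fun t => 1 / A t) hle (measurable_const.div hA) (C := 1 / l) fun t _ => by
      rw [abs_of_pos (one_div_pos.2 (hApos t))]
      exact one_div_le_one_div_of_le hl (hlQ t).1).continuousOn_mul cwb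
  have ia' : IntervalIntegrable (fun t => t ^ (e + 1) / t ^ 2 * sigmaTan (e + 2) σ τ t)
      volume (1 / 2) R :=
    (intervalIntegrable_of_bound hle (measurable_sigmaTan _ σ τ) fun t ht => by
      rw [abs_of_nonneg (vT.nonneg t (hsub' ht))]; exact vT.le t (hsub' ht)).continuousOn_mul cwa
  have ib' : IntervalIntegrable (fun t => (t ^ (e + 1))⁻¹ * (1 / sigmaRad (e + 2) σ τ t))
      volume (1 / 2) R :=
    (intervalIntegrable_of_bound (k := fun t => 1 / sigmaRad (e + 2) σ τ t) hle
      (measurable_const.div (measurable_sigmaRad _ σ τ)) fun t ht => by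
        rw [abs_of_nonneg (vR.nonneg t (hsub' ht))]; exact vR.le t (hsub' ht)).continuousOn_mul cwb
  have hnn : (0 : ℝ) ≤ n * (n + e) := by positivity
  have hRτ : gInv τ R / τ = R / τ := by rw [gInv_of_le h0 hR]
  have hfR := (hf.bounds (T := R / τ) (by rw [le_div_iff₀ h0]; linarith)).1
  have hS0 : 0 ≤ S := (abs_nonneg _).trans (hS R hRm)
  have hT0 : 0 ≤ T := (abs_nonneg _).trans (hT R hRm)
  have key := (h.mono le_rfl hle hR1).compare ((hf.radialSystem_blowup h0 h1).mono le_rfl hle hR1)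
    hle hp (by rw [gInv_half, div_self h0.ne', hf.flux_one, mul_zero])
    (fun t ht => mul_nonneg (by have := hpos t (hsub' ht); positivity) (one_div_pos.2 (hApos t)).le)
    (fun t ht => mul_nonneg hnn (mul_nonneg (by have := hpos t (hsub' ht); positivity) (hApos t).le))
    (fun t ht => mul_nonneg (by have := hpos t (hsub' ht); positivity) (vR.nonneg t (hsub' ht)))
    (fun t ht => mul_nonneg hnn (mul_nonneg (by have := hpos t (hsub' ht); positivity)
      (vT.nonneg t (hsub' ht))))
    ib (ia.const_mul _) ib' (ia'.const_mul _) hV (by rw [hRτ]; linarith)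
    (S := n * (n + e) * S) (T := T)
    (fun r hr => by
      rw [intervalIntegral.integral_congr (g := fun t => n * (n + e) * (t ^ (e + 1) / t ^ 2 * A t
        - t ^ (e + 1) / t ^ 2 * sigmaTan (e + 2) σ τ t)) fun t _ => by ring,
        intervalIntegral.integral_const_mul, abs_mul, abs_of_nonneg hnn]
      exact mul_le_mul_of_nonneg_left (hS r (hsub hr)) hnn)
    (fun r hr => by
      rw [intervalIntegral.integral_congr (g := fun t => -((t ^ (e + 1))⁻¹ * (1 / A t)
        - (t ^ (e + 1))⁻¹ * (1 / sigmaRad (e + 2) σ τ t))) fun t _ => by ring,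
        intervalIntegral.integral_neg, abs_neg]
      exact hT r (hsub hr))
  beta_reduce at key
  rw [hRτ, intervalIntegral.integral_const_mul, intervalIntegral.integral_const_mul] at key
  refine key.trans (mul_le_mul_of_nonneg_right ?_ (mul_nonneg (by linarith) hV))
  have hG0 : 0 ≤ ∫ t in (1 / 2)..R, t ^ (e + 1) / t ^ 2 * sigmaTan (e + 2) σ τ t :=
    intervalIntegral.integral_nonneg hle fun t ht =>
      mul_nonneg (by have := hpos t (hsub ht); positivity) (vT.nonneg t (hsub ht))
  have hGS : ∫ t in (1 / 2)..R, t ^ (e + 1) / t ^ 2 * A t ≤ G + S := by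
    have h2 := (le_abs_self _).trans (hS R hRm)
    rw [intervalIntegral.integral_sub ia ia'] at h2
    linarith
  have hA0 : 0 ≤ ∫ t in (1 / 2)..R, t ^ (e + 1) / t ^ 2 * A t :=
    intervalIntegral.integral_nonneg hle fun t ht =>
      mul_nonneg (by have := hpos t (hsub ht); positivity) (hApos t).le
  gcongr
  exact mul_nonneg hnn (hA0.trans hGS)

end

section

/-! ### Estimates uniform in the mode -/

/-- Geometric decay in the degree beats polynomial growth. It serves the fluctuations with `q = 7/8`
and the tail with `q = 9/14`. -/
theorem exists_bound_sq_mul_pow (e : ℕ) {q : ℝ} (hq0 : 0 ≤ q) (hq : q < 1) :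
    ∃ D : ℝ, 0 ≤ D ∧ ∀ n : ℕ, ((n : ℝ) * (n + e)) ^ 2 * q ^ n ≤ D := by
  obtain ⟨D, hD⟩ := (tendsto_pow_const_mul_const_pow_of_abs_lt_one 4
    (by rwa [abs_of_nonneg hq0] : |q| < 1)).bddAbove_range
  have hD' : ∀ n : ℕ, (n : ℝ) ^ 4 * q ^ n ≤ D := fun n => hD ⟨n, rfl⟩
  have hD0 : 0 ≤ D := le_trans (by positivity) (hD' 0)
  refine ⟨(1 + e) ^ 2 * D, by positivity, fun n => ?_⟩
  have h1 : (n : ℝ) * (n + e) ≤ n ^ 2 * (1 + e) := by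
    have : (n : ℝ) ≤ n ^ 2 := by exact_mod_cast Nat.le_self_pow two_ne_zero n
    nlinarith [Nat.cast_nonneg (α := ℝ) e]
  calc ((n : ℝ) * (n + e)) ^ 2 * q ^ n ≤ (n ^ 2 * (1 + e)) ^ 2 * q ^ n := by gcongr
    _ = (1 + e) ^ 2 * (n ^ 4 * q ^ n) := by ring
    _ ≤ _ := by gcongr; exact hD' n

theorem le_sq_of_mode {n : ℕ} (e : ℕ) : (n : ℝ) * (n + e) ≤ ((n : ℝ) * (n + e)) ^ 2 := by
  exact_mod_cast Nat.le_self_pow two_ne_zero (n * (n + e))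

/-- The modes above the order `N` are damped by the smallness of the inclusion. -/
theorem exists_tail_bound (e N : ℕ) : ∃ C : ℝ, 0 ≤ C ∧ ∀ n : ℕ, N < n → ∀ τ : ℝ, 0 < τ →
    τ ≤ 3 / 8 → (7 / 8) ^ n * (τ ^ e * (n * (n + e) * (2 / (7 / 8 / τ)) ^ (2 * n)))
      ≤ C * τ ^ (e + 2 + 2 * N) := by
  -- At `T = 7/(8τ)` the damping per degree is `(7/8)(16τ/7)² = 32τ²/7`, which is at most `9/14` for
  -- `τ ≤ 3/8`. The first `N + 1` of these factors supply `τ^(2N+2)`.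
  obtain ⟨D, hD0, hD⟩ := exists_bound_sq_mul_pow e (q := 9 / 14) (by norm_num) (by norm_num)
  refine ⟨(32 / 7) ^ (N + 1) * (D * ((9 / 14) ^ (N + 1))⁻¹), by positivity, fun n hn τ h0 h1 => ?_⟩
  obtain ⟨j, rfl⟩ := Nat.exists_eq_add_of_lt hn
  have e1 : (2 / (7 / 8 / τ) : ℝ) = 16 / 7 * τ := by field_simp; norm_num
  have e2 : (7 / 8 : ℝ) ^ (N + j + 1) * (16 / 7 * τ) ^ (2 * (N + j + 1))
      = (32 / 7) ^ (N + 1) * τ ^ (2 * (N + 1)) * (32 / 7 * τ ^ 2) ^ j := by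
    rw [pow_mul, ← mul_pow, show (7 / 8 : ℝ) * (16 / 7 * τ) ^ 2 = 32 / 7 * τ ^ 2 by ring,
      show N + j + 1 = N + 1 + j by ring, pow_add, mul_pow, ← pow_mul]
  have h2 : (32 / 7 * τ ^ 2) ^ j ≤ (9 / 14 : ℝ) ^ j :=
    pow_le_pow_left₀ (by positivity) (by nlinarith) j
  have h3 : ((N + j + 1 : ℕ) : ℝ) * ((N + j + 1 : ℕ) + e) * (9 / 14) ^ j
      ≤ D * ((9 / 14) ^ (N + 1))⁻¹ := by
    rw [le_mul_inv_iff₀ (by positivity), mul_assoc, ← pow_add, show j + (N + 1) = N + j + 1 by ring]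
    refine le_trans ?_ (hD (N + j + 1))
    exact mul_le_mul_of_nonneg_right (le_sq_of_mode e) (by positivity)
  set x : ℝ := ((N + j + 1 : ℕ) : ℝ) * ((N + j + 1 : ℕ) + e) with hx
  have hx0 : 0 ≤ x := by positivity
  rw [e1]
  calc (7 / 8 : ℝ) ^ (N + j + 1) * (τ ^ e * (x * (16 / 7 * τ) ^ (2 * (N + j + 1))))
      = τ ^ e * x * ((7 / 8 : ℝ) ^ (N + j + 1) * (16 / 7 * τ) ^ (2 * (N + j + 1))) := by ring
    _ = (32 / 7) ^ (N + 1) * (x * (32 / 7 * τ ^ 2) ^ j) * τ ^ (e + 2 + 2 * N) := by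
        rw [e2]; ring
    _ ≤ (32 / 7) ^ (N + 1) * (x * (9 / 14) ^ j) * τ ^ (e + 2 + 2 * N) := by gcongr
    _ ≤ _ := by gcongr

/-- `-ln τ` is the fraction `d/(d+2N)` of `-ln ρ`, and `ln (3/4)` is negative. -/
theorem inv_blowExp_rhoEC_le (d N : ℕ) {ρ : ℝ} (h0 : 0 < ρ) (h1 : ρ < 1) :
    1 / blowExp (rhoEC d N ρ) ≤ |Real.log ρ| / Real.log (3 / 2) := by
  have hl : 0 < Real.log (3 / 2) := Real.log_pos (by norm_num)
  have hneg := Real.log_neg h0 h1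
  rw [blowExp, one_div_div, rhoEC, Real.log_rpow h0, abs_of_neg hneg]
  refine div_le_div_of_nonneg_right ?_ hl.le
  have h2 : Real.log (3 / 4) ≤ 0 := Real.log_nonpos (by norm_num) (by norm_num)
  have h3 : (d : ℝ) / (d + 2 * N) ≤ 1 := div_le_one_of_le₀ (by linarith [Nat.cast_nonneg (α := ℝ) N])
    (by positivity)
  nlinarith

/-- The radius of the small inclusion is chosen for this identity: a far field of order `τ^(d+2N)`
becomes `ρ^d`. -/
theorem rhoEC_pow (d N : ℕ) (hd : 0 < d) {ρ : ℝ} (h0 : 0 < ρ) :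
    rhoEC d N ρ ^ (d + 2 * N) = ρ ^ d := by
  have hd' : (0 : ℝ) < d := by exact_mod_cast hd
  rw [rhoEC, ← Real.rpow_natCast, ← Real.rpow_mul h0.le, ← Real.rpow_natCast]
  congr 1
  push_cast
  field_simp

theorem rhoEC_pos (d N : ℕ) {ρ : ℝ} (h0 : 0 < ρ) : 0 < rhoEC d N ρ := Real.rpow_pos_of_pos h0 _

/-- A pointwise bound suffices: the weight is `1/t ≤ 2` on an interval of length at most `1/2`. -/
theorem integral_sigmaTan_le_of_plane (σ : Coating) {τ B R : ℝ} (h0 : 0 < τ) (h1 : τ ≤ 3 / 8)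
    (hB : ∀ t, 1 ≤ t → 0 < σ.profile t ∧ σ.profile t ≤ B ∧ (σ.profile t)⁻¹ ≤ B)
    (hR : 1 / 2 ≤ R) (hR1 : R ≤ 1) :
    ∫ t in (1 / 2)..R, t ^ (0 + 1) / t ^ 2 * sigmaTan (0 + 2) σ τ t ≤ B * (1 / blowExp τ) := by
  have v := bddVar_sigmaTan σ 0 h0 h1 hB
  refine (le_abs_self _).trans ?_
  rw [← Real.norm_eq_abs]
  refine (intervalIntegral.norm_integral_le_of_norm_le_const (C := 2 * (B * (1 / blowExp τ)))
    fun t ht => ?_).trans ?_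
  · rw [uIoc_of_le hR] at ht
    have ht' : t ∈ Icc (1 / 2 : ℝ) 1 := ⟨ht.1.le, ht.2.trans hR1⟩
    have ht0 : 0 < t := by linarith [ht'.1]
    rw [Real.norm_eq_abs, abs_of_nonneg (mul_nonneg (by positivity) (v.nonneg t ht'))]
    refine mul_le_mul ?_ (v.le t ht') (v.nonneg t ht') (by norm_num)
    rw [div_le_iff₀ (by positivity), zero_add, pow_one]
    nlinarith [ht'.1]
  · rw [abs_of_nonneg (by linarith)]
    nlinarith [v.bound_nonneg]

/-- For `d = 3`, `σ₂*` is the profile times the derivative of `gInv`. Its integral is at most `B`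
times the total increase of `gInv`, so no logarithm appears. -/
theorem integral_sigmaTan_le_of_space (σ : Coating) {τ B R : ℝ} (h0 : 0 < τ) (h1 : τ ≤ 3 / 8)
    (hB1 : 1 ≤ B) (hB : ∀ t, 1 ≤ t → 0 < σ.profile t ∧ σ.profile t ≤ B ∧ (σ.profile t)⁻¹ ≤ B)
    (hR : 1 / 2 ≤ R) (hR1 : R ≤ 1) :
    ∫ t in (1 / 2)..R, t ^ (1 + 1) / t ^ 2 * sigmaTan (1 + 2) σ τ t ≤ B := by
  have v := bddVar_sigmaTan σ 1 h0 h1 hB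
  have hsub : Icc (1 / 2 : ℝ) R ⊆ Icc (1 / 2 : ℝ) 1 := Icc_subset_Icc_right hR1
  have hpos : ∀ s ∈ Icc (1 / 2 : ℝ) R, 0 < s := fun s hs => lt_of_lt_of_le (by norm_num) hs.1
  have e1 : ∫ t in (1 / 2)..R, t ^ (1 + 1) / t ^ 2 * sigmaTan (1 + 2) σ τ t
      = ∫ t in (1 / 2)..R, sigmaTan (1 + 2) σ τ t := by
    refine intervalIntegral.integral_congr fun t ht => ?_
    rw [uIcc_of_le hR] at ht
    have := hpos t ht
    rw [show (1 + 1) = 2 from rfl, div_self (by positivity), one_mul]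
  have i1 : IntervalIntegrable (sigmaTan (1 + 2) σ τ) volume (1 / 2) R :=
    intervalIntegrable_of_bound hR (measurable_sigmaTan _ σ τ) fun t ht => by
      rw [abs_of_nonneg (v.nonneg t (hsub (Ioo_subset_Icc_self ht)))]
      exact v.le t (hsub (Ioo_subset_Icc_self ht))
  have hg : ∀ t ∈ Icc (1 / 2 : ℝ) R, 0 ≤ lam τ t * gInv τ t / t := fun t ht => by
    have h3 := lam_antitoneOn h0 h1 (hsub ht) (right_mem_Icc.2 (by norm_num)) (hsub ht).2
    rw [lam_of_le (s := 1) (by norm_num)] at h3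
    have h4 := h0.trans_le (tau_le_gInv h0 h1 (hsub ht))
    have h5 := hpos t ht
    have h6 : 0 < lam τ t := by linarith
    positivity
  have hone : gInv τ 1 = 1 := gInv_of_le h0 (by norm_num)
  have hg1 : ∀ t ∈ Icc (1 / 2 : ℝ) R, gInv τ t ≤ 1 := fun t ht => by
    have := (gInv_strictMonoOn h0 h1).monotoneOn (hsub ht) (right_mem_Icc.2 (by norm_num))
      (hsub ht).2
    rwa [hone] at this
  have i2 : IntervalIntegrable (fun t => lam τ t * gInv τ t / t) volume (1 / 2) R := by
    refine intervalIntegrable_of_bound hR ((measurable_lam.mul measurable_gInv).div measurable_id)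
      (C := 1 / blowExp τ * 1 / (1 / 2)) fun t ht => ?_
    have ht := Ioo_subset_Icc_self ht
    have hl := lam_antitoneOn h0 h1 (left_mem_Icc.2 (by norm_num)) (hsub ht) ht.1
    rw [lam_of_lt le_rfl (by norm_num)] at hl
    have hμ := one_le_inv_blowExp h0 h1
    have h4 := (h0.trans_le (tau_le_gInv h0 h1 (hsub ht))).le
    rw [abs_of_nonneg (hg t ht)]
    exact div_le_div₀ (by positivity) (mul_le_mul hl (hg1 t ht) h4 (by linarith)) (by norm_num) ht.1
  have e2 : ∫ t in (1 / 2)..R, lam τ t * gInv τ t / t = gInv τ R - gInv τ (1 / 2) := by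
    have := (IsPrim.of_hasDerivAt (countable_singleton (3 / 4 : ℝ)) hR
      ((continuousOn_gInv h0).mono hsub) (fun t ht => hasDerivAt_gInv h0 ht.1.1 ht.2) i2).2 R
      (right_mem_Icc.2 hR)
    linarith
  rw [e1]
  refine (intervalIntegral.integral_mono_on hR i1 (i2.const_mul B) fun t ht => ?_).trans ?_
  · rw [sigmaTan, show 1 + 2 - 2 = 1 from rfl, pow_one,
      show gInv τ t / t * lam τ t = lam τ t * gInv τ t / t by ring]
    exact mul_le_mul_of_nonneg_right (hB _ (one_le_gInv_div h0 h1 (hsub ht))).2.1 (hg t ht)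
  · rw [intervalIntegral.integral_const_mul, e2, gInv_half]
    have := hg1 R (right_mem_Icc.2 hR)
    nlinarith

/-- Assembles the three mechanisms: transport from `R` to `1`, comparison with the homogenized cloak
on `[1/2, R]`, and the far field of the mode, measured by `Z`. -/
theorem RadialSystem.abs_defect_le {σ : Coating} {n e : ℕ} {f g A V p : ℝ → ℝ}
    {τ α β l Q S T G Z : ℝ}
    (hf : Mode σ n e f g α β) (h0 : 0 < τ) (h1 : τ ≤ 3 / 8)
    (h : RadialSystem (fun r => (r ^ (e + 1))⁻¹ * (1 / A r))
      (fun r => n * (n + e) * (r ^ (e + 1) / r ^ 2 * A r)) V p (1 / 2) 1)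
    (hp : p (1 / 2) = 0) (hA : Measurable A) (hl : 0 < l) (hlQ : ∀ r, l ≤ A r ∧ A r ≤ Q)
    {R : ℝ} (hR : 3 / 4 ≤ R) (hR1 : R ≤ 1) (hA1 : ∀ r, R ≤ r → A r = 1)
    (hS : ∀ r ∈ Icc (1 / 2 : ℝ) 1, |∫ t in (1 / 2)..r, (t ^ (e + 1) / t ^ 2 * A t
      - t ^ (e + 1) / t ^ 2 * sigmaTan (e + 2) σ τ t)| ≤ S)
    (hT : ∀ r ∈ Icc (1 / 2 : ℝ) 1, |∫ t in (1 / 2)..r, ((t ^ (e + 1))⁻¹ * (1 / A t)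
      - (t ^ (e + 1))⁻¹ * (1 / sigmaRad (e + 2) σ τ t))| ≤ T)
    (hG : ∫ t in (1 / 2)..R, t ^ (e + 1) / t ^ 2 * sigmaTan (e + 2) σ τ t ≤ G)
    (hZ : |n * (R / τ) ^ e * f (R / τ) - g (R / τ)| ≤ Z * f (R / τ)) :
    |p 1 - n * V 1| ≤ R ^ n * (2 * (n * (n + e)) ^ 2 * (S + T * ((G + S) * G)) + τ ^ e * Z)
      * |V 1| := by
  -- The system is linear, so the sign of `V` can be normalized.
  wlog hV : 0 ≤ V 1 generalizing V p
  · have := this (h.const_mul (-1)) (by rw [hp, mul_zero]) (by linarith)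
    rw [show -1 * p 1 - n * (-1 * V 1) = -(p 1 - n * V 1) by ring, abs_neg, neg_one_mul,
      abs_neg] at this
    exact this
  have hle : (1 / 2 : ℝ) ≤ R := by linarith
  have hRm : R ∈ Icc (1 / 2 : ℝ) 1 := ⟨hle, hR1⟩
  have hR0 : 0 < R := by linarith
  have hApos : ∀ r, 0 < A r := fun r => hl.trans_le (hlQ r).1
  have hb : ∀ t ∈ Ioo (1 / 2 : ℝ) 1, 0 ≤ (t ^ (e + 1))⁻¹ * (1 / A t) := fun t ht => by
    have := hApos t
    have : 0 < t := by linarith [ht.1]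
    positivity
  have hc : ∀ t ∈ Ioo (1 / 2 : ℝ) 1, 0 ≤ n * (n + e) * (t ^ (e + 1) / t ^ 2 * A t) := fun t ht => by
    have := hApos t
    have : 0 < t := by linarith [ht.1]
    positivity
  obtain ⟨hV0, hp0⟩ := h.nonneg (by norm_num) hp hb hc hV
  have hVR := hV0 R hRm
  have hVm : V R ≤ V 1 := h.val_monotoneOn hb hp0 hRm (right_mem_Icc.2 (by norm_num)) hR1
  have key := h.compare_blowup hf h0 h1 hp hA hl hlQ hS hT hR hR1 hG hVR
  have hF := (hf.bounds (T := R / τ) (by rw [le_div_iff₀ h0]; linarith)).1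
  have hS0 : 0 ≤ S := (abs_nonneg _).trans (hS R hRm)
  have hT0 : 0 ≤ T := (abs_nonneg _).trans (hT R hRm)
  have hG0 : 0 ≤ G := by
    obtain ⟨B, -, hB⟩ := σ.exists_profile_bounds
    refine le_trans (intervalIntegral.integral_nonneg hle fun t ht => ?_) hG
    have ht' : t ∈ Icc (1 / 2 : ℝ) 1 := ⟨ht.1, ht.2.trans hR1⟩
    have : 0 < t := by linarith [ht.1]
    exact mul_nonneg (by positivity) ((bddVar_sigmaTan σ e h0 h1 hB).nonneg t ht')
  rw [(h.mono hle hR1 le_rfl).defect_eq hR0 hR1 hA1, abs_mul, abs_of_pos (pow_pos hR0 n),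
    abs_of_nonneg hV, mul_assoc (R ^ n)]
  refine mul_le_mul_of_nonneg_left ?_ (pow_pos hR0 n).le
  set F := f (R / τ)
  set H := g (R / τ)
  have hF0 : 0 < F := one_pos.trans_le hF
  have hZ0 : 0 ≤ Z := nonneg_of_mul_nonneg_left ((abs_nonneg _).trans hZ) hF0
  set X := S + T * ((G + S) * G) with hX
  set y : ℝ := n * (n + e) with hy
  have hyy : y ≤ y ^ 2 := le_sq_of_mode e
  have hW : 2 * (y * S) + 2 * T * (y * (G + S) * (y * G)) ≤ 2 * y ^ 2 * X := by
    have : y * S ≤ y ^ 2 * S := mul_le_mul_of_nonneg_right hyy hS0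
    rw [hX]
    linarith
  have hX0 : 0 ≤ X := by positivity
  -- The defect at `R`, multiplied by the mode `F`, is the Wronskian of laminate and cloak minus the
  -- defect of the cloak itself.
  have e1 : (p R - n * R ^ e * V R) * F
      = (p R * F - τ ^ e * H * V R) - τ ^ e * (n * (R / τ) ^ e * F - H) * V R := by
    rw [div_pow]
    field_simp
    ring
  have h2 : |p R - n * R ^ e * V R| * F ≤ (2 * y ^ 2 * X + τ ^ e * Z) * V R * F := by
    rw [← abs_of_pos hF0, ← abs_mul, abs_of_pos hF0, e1]
    refine (abs_sub _ _).trans ?_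
    have h3 : |τ ^ e * (n * (R / τ) ^ e * F - H) * V R| ≤ τ ^ e * (Z * F) * V R := by
      rw [abs_mul, abs_mul, abs_of_pos (pow_pos h0 e), abs_of_nonneg hVR]
      gcongr
    have h4 := key.trans (mul_le_mul_of_nonneg_right hW (mul_nonneg hF0.le hVR))
    linarith
  refine (le_of_mul_le_mul_right h2 hF0).trans ?_
  gcongr

end

section

/-! ### The size of the fluctuations -/

/-- In the plane `S`, `T` are of order `ε μ` and `G` of order `μ`, where `μ = 1/blowExp τ`. The
leading term `T G²` is `ε μ³`, which the assumed `|ln ρ|⁻³` compensates. -/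
theorem exists_fluctuation_bound_plane (σ : Coating) (N : ℕ) {K : ℝ} (hK : 0 < K) {C₀ : ℝ}
    (hC₀ : 0 ≤ C₀) : ∃ C : ℝ, 0 ≤ C ∧ ∀ ρ : ℝ, 0 < ρ → ρ < 1 / 2 → rhoEC (0 + 2) N ρ ≤ 3 / 8 →
    ∀ ε : ℝ, 0 < ε → ε ≤ 1 / 8 → ε ≤ K * scaleOrder (0 + 2) N σ.kappa ρ →
    ∃ G : ℝ, ∫ t in (1 / 2)..(7 / 8),
        t ^ (0 + 1) / t ^ 2 * sigmaTan (0 + 2) σ (rhoEC (0 + 2) N ρ) t ≤ G ∧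
      C₀ * (ε * (1 / blowExp (rhoEC (0 + 2) N ρ)))
        + C₀ * (ε * ((rhoEC (0 + 2) N ρ ^ 0)⁻¹ * (1 / blowExp (rhoEC (0 + 2) N ρ))))
          * ((G + C₀ * (ε * (1 / blowExp (rhoEC (0 + 2) N ρ)))) * G) ≤ C * ρ ^ (0 + 2) := by
  obtain ⟨B, hB1, hB⟩ := σ.exists_profile_bounds
  have hl : 0 < Real.log (3 / 2) := Real.log_pos (by norm_num)
  -- The contrast is fixed by the coating and disappears into the constant. The absolute value
  -- spares a discussion of its sign.
  set k := K * |(σ.kappa ^ 3)⁻¹| with hk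
  refine ⟨(C₀ + C₀ * ((B + C₀) * B)) * (k * ((Real.log (3 / 2)) ^ 3)⁻¹), by positivity, ?_⟩
  intro ρ h0 h1 h38 ε hε hε8 hεK
  have hτ := rhoEC_pos (0 + 2) N h0
  refine ⟨_, integral_sigmaTan_le_of_plane σ hτ h38 hB (by norm_num) (by norm_num), ?_⟩
  have hμ := one_le_inv_blowExp hτ h38
  have hμ' := inv_blowExp_rhoEC_le (0 + 2) N h0 (by linarith)
  set μ := 1 / blowExp (rhoEC (0 + 2) N ρ)
  set ℓ := |Real.log ρ| with hℓ
  have hℓ0 : 0 < ℓ := abs_pos.2 (Real.log_neg h0 (by linarith)).ne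
  have hε' : ε ≤ k * ρ ^ 2 * (ℓ ^ 3)⁻¹ := by
    refine hεK.trans ?_
    rw [scaleOrder, if_pos rfl, hk, mul_assoc K, mul_assoc K]
    gcongr
    exact le_abs_self _
  have h3 : ε * μ ^ 3 ≤ k * ((Real.log (3 / 2)) ^ 3)⁻¹ * ρ ^ 2 := by
    calc ε * μ ^ 3 ≤ k * ρ ^ 2 * (ℓ ^ 3)⁻¹ * (ℓ / Real.log (3 / 2)) ^ 3 := by gcongr
      _ = _ := by field_simp
  have hμ3 : μ ≤ μ ^ 3 := le_self_pow₀ hμ (by norm_num)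
  have h4 : ε * μ ≤ ε * μ ^ 3 := mul_le_mul_of_nonneg_left hμ3 hε.le
  have h5 : B * μ + C₀ * (ε * μ) ≤ (B + C₀) * μ := by
    have : ε * μ ≤ μ := mul_le_of_le_one_left (by linarith) (by linarith)
    nlinarith
  rw [pow_zero, inv_one, one_mul]
  calc C₀ * (ε * μ) + C₀ * (ε * μ) * ((B * μ + C₀ * (ε * μ)) * (B * μ))
      ≤ C₀ * (ε * μ ^ 3) + C₀ * (ε * μ) * ((B + C₀) * μ * (B * μ)) := by gcongr
    _ = (C₀ + C₀ * ((B + C₀) * B)) * (ε * μ ^ 3) := by ring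
    _ ≤ (C₀ + C₀ * ((B + C₀) * B)) * (k * ((Real.log (3 / 2)) ^ 3)⁻¹ * ρ ^ 2) := by gcongr
    _ = _ := by ring

/-- In space `G` is bounded and `T` is of order `ε μ / τ`; this is the leading term. -/
theorem exists_fluctuation_bound_space (σ : Coating) (N : ℕ) {K : ℝ} (hK : 0 < K) {C₀ : ℝ}
    (hC₀ : 0 ≤ C₀) : ∃ C : ℝ, 0 ≤ C ∧ ∀ ρ : ℝ, 0 < ρ → ρ < 1 / 2 → rhoEC (1 + 2) N ρ ≤ 3 / 8 →
    ∀ ε : ℝ, 0 < ε → ε ≤ 1 / 8 → ε ≤ K * scaleOrder (1 + 2) N σ.kappa ρ →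
    ∃ G : ℝ, ∫ t in (1 / 2)..(7 / 8),
        t ^ (1 + 1) / t ^ 2 * sigmaTan (1 + 2) σ (rhoEC (1 + 2) N ρ) t ≤ G ∧
      C₀ * (ε * (1 / blowExp (rhoEC (1 + 2) N ρ)))
        + C₀ * (ε * ((rhoEC (1 + 2) N ρ ^ 1)⁻¹ * (1 / blowExp (rhoEC (1 + 2) N ρ))))
          * ((G + C₀ * (ε * (1 / blowExp (rhoEC (1 + 2) N ρ)))) * G) ≤ C * ρ ^ (1 + 2) := by
  obtain ⟨B, hB1, hB⟩ := σ.exists_profile_bounds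
  have hl : 0 < Real.log (3 / 2) := Real.log_pos (by norm_num)
  set k := K * |(σ.kappa ^ 3)⁻¹| with hk
  set D := k * (Real.log (3 / 2))⁻¹ with hD
  have hD0 : 0 ≤ D := by positivity
  refine ⟨(C₀ + C₀ * ((B + C₀ * D) * B)) * D, by positivity, ?_⟩
  intro ρ h0 h1 h38 ε hε hε8 hεK
  have hτ := rhoEC_pos (1 + 2) N h0
  refine ⟨_, integral_sigmaTan_le_of_space σ hτ h38 hB1 hB (by norm_num) (by norm_num), ?_⟩
  have hμ := one_le_inv_blowExp hτ h38
  have hμ' := inv_blowExp_rhoEC_le (1 + 2) N h0 (by linarith)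
  -- The extra exponent `3/(2N+3)` is exactly one power of `τ`, which pays for the `τ⁻¹` in `T`.
  have hρ : ρ ^ (3 + 3 / (2 * (N : ℝ) + 3)) = ρ ^ 3 * rhoEC (1 + 2) N ρ := by
    rw [Real.rpow_add h0, rhoEC]
    norm_num
    rw [add_comm (2 * (N : ℝ))]
    exact Or.inl rfl
  set μ := 1 / blowExp (rhoEC (1 + 2) N ρ)
  set τ := rhoEC (1 + 2) N ρ
  set ℓ := |Real.log ρ| with hℓ
  have hℓ0 : 0 < ℓ := abs_pos.2 (Real.log_neg h0 (by linarith)).ne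
  have hε' : ε ≤ k * (ρ ^ 3 * τ) * ℓ⁻¹ := by
    refine hεK.trans ?_
    rw [scaleOrder, if_neg (by norm_num), hk, hρ, mul_assoc K, mul_assoc K]
    gcongr
    exact le_abs_self _
  have h3 : ε * (τ⁻¹ * μ) ≤ D * ρ ^ 3 := by
    calc ε * (τ⁻¹ * μ) ≤ k * (ρ ^ 3 * τ) * ℓ⁻¹ * (τ⁻¹ * (ℓ / Real.log (3 / 2))) := by gcongr
      _ = _ := by rw [hD]; field_simp
  have h4 : ε * μ ≤ ε * (τ⁻¹ * μ) := by
    have : 1 ≤ τ⁻¹ := (one_le_inv₀ hτ).2 (by linarith)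
    exact mul_le_mul_of_nonneg_left (le_mul_of_one_le_left (by linarith) this) hε.le
  have h5 : D * ρ ^ 3 ≤ D := mul_le_of_le_one_right hD0 (pow_le_one₀ h0.le (by linarith))
  have h6 : ε * μ ≤ D := h4.trans (h3.trans h5)
  have h7 : ε * μ ≤ D * ρ ^ 3 := h4.trans h3
  rw [pow_one]
  calc C₀ * (ε * μ) + C₀ * (ε * (τ⁻¹ * μ)) * ((B + C₀ * (ε * μ)) * B)
      ≤ C₀ * (D * ρ ^ 3) + C₀ * (D * ρ ^ 3) * ((B + C₀ * D) * B) := by gcongr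
    _ = _ := by ring

/-- The argument common to both dimensions. Only the size of the homogenization error, `hfluct`,
depends on whether `d` is `2` or `3`. -/
theorem exists_norm_sub_le (σ : Coating) (e N : ℕ) (hσ : σ.GPTVanishing (e + 2) N) {K : ℝ}
    (hfluct : ∀ C₀ : ℝ, 0 ≤ C₀ → ∃ C : ℝ, 0 ≤ C ∧ ∀ ρ : ℝ, 0 < ρ → ρ < 1 / 2 →
      rhoEC (e + 2) N ρ ≤ 3 / 8 → ∀ ε : ℝ, 0 < ε → ε ≤ 1 / 8 →
      ε ≤ K * scaleOrder (e + 2) N σ.kappa ρ →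
      ∃ G : ℝ, ∫ t in (1 / 2)..(7 / 8),
          t ^ (e + 1) / t ^ 2 * sigmaTan (e + 2) σ (rhoEC (e + 2) N ρ) t ≤ G ∧
        C₀ * (ε * (1 / blowExp (rhoEC (e + 2) N ρ)))
          + C₀ * (ε * ((rhoEC (e + 2) N ρ ^ e)⁻¹ * (1 / blowExp (rhoEC (e + 2) N ρ))))
            * ((G + C₀ * (ε * (1 / blowExp (rhoEC (e + 2) N ρ)))) * G) ≤ C * ρ ^ (e + 2)) :
    ∃ C : ℝ, 0 < C ∧
      ∀ ρ : ℝ, 0 < ρ → ρ < 1 / 2 → 2 * rhoEC (e + 2) N ρ ≤ 3 / 4 →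
      ∀ ε : ℝ, 0 < ε → ε ≤ 1 / 8 → ε ≤ K * scaleOrder (e + 2) N σ.kappa ρ →
      ∀ M : Laminate, M.Realizes (e + 2) σ (rhoEC (e + 2) N ρ) ε →
      ∃ Λε Λ₁ : HHalf (e + 2) →L[ℝ] HMinusHalf (e + 2),
        IsDtN (shell (e + 2)) (M.conductivity ε) Λε ∧
        IsDtN (unitBall (e + 2)) (fun _ => 1) Λ₁ ∧ ‖Λε - Λ₁‖ ≤ C * ρ ^ (e + 2) := by
  obtain ⟨B, hB1, hB⟩ := σ.exists_profile_bounds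
  have hpow : ∀ m : ℕ, ContDiffOn ℝ 1 (fun t : ℝ => t ^ m) (Ioi 0) := fun m => by fun_prop
  have hne : ∀ m : ℕ, ∀ t ∈ Ioi (0 : ℝ), t ^ m ≠ 0 := fun m t ht => pow_ne_zero m (ne_of_gt ht)
  obtain ⟨C₀, hC₀, hav⟩ := Laminate.exists_averaging_bound σ e
    (wa := fun t => t ^ (e + 1) / t ^ 2) (wb := fun t => (t ^ (e + 1))⁻¹)
    ((hpow _).div (hpow _) (hne _)) ((hpow _).inv (hne _))
  obtain ⟨C₁, hC₁, hfl⟩ := hfluct C₀ hC₀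
  obtain ⟨D, hD0, hD⟩ := exists_bound_sq_mul_pow e (q := 7 / 8) (by norm_num) (by norm_num)
  obtain ⟨C₂, hC₂, htail⟩ := exists_tail_bound e N
  -- The terms bound the fluctuations and the tail of high modes; the `1` ensures that the constant
  -- is positive.
  refine ⟨2 * D * C₁ + C₂ * (2 ^ (e + 3) * B) + 1, by positivity, ?_⟩
  intro ρ h0 h1 h34 ε hε hε8 hεK M hM
  have h38 : rhoEC (e + 2) N ρ ≤ 3 / 8 := by linarith
  have hτ := rhoEC_pos (e + 2) N h0
  have hτρ := rhoEC_pow (e + 2) N (by omega) h0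
  obtain ⟨G, hG, hX⟩ := hfl ρ h0 h1 h38 ε hε hε8 hεK
  have hav' := hav _ ε hτ h38 hε hε8 M hM
  set τ := rhoEC (e + 2) N ρ
  obtain ⟨l, Q, hl, hlQ⟩ := hM.exists_bounds hε
  have hAm := M.measurable_radCond ε
  obtain ⟨Λε, hΛε⟩ := exists_isDtN (d := e + 2) (by omega) admissible_shell
    (A := fun x => M.radCond ε ‖x‖) (hAm.comp measurable_norm) hl (fun x _ => (hlQ ‖x‖).1)
    (fun x _ => (hlQ ‖x‖).2)
  obtain ⟨Λ₁, hΛ₁⟩ := exists_isDtN (d := e + 2) (by omega) admissible_unitBall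
    (A := fun _ => 1) measurable_const one_pos (fun _ _ => le_rfl) (fun _ _ => le_rfl)
  refine ⟨Λε, Λ₁, hΛε, hΛ₁, norm_le_of_forall_harm (by omega) (by positivity) ?_⟩
  intro φ n P hP
  rw [_root_.sub_apply, _root_.sub_apply, hΛ₁.apply_polyHalf_of_laplacian (by omega) φ hP]
  obtain ⟨V, p, hVp, hp0, hV1, hp1⟩ := hΛε.exists_radialSystem (by omega) hAm hl
    (fun r _ => (hlQ r).1) (fun r _ => (hlQ r).2) φ hP
  rw [← hV1, ← hp1]
  have hbc : RadialSystem (fun r => (r ^ (e + 1))⁻¹ * (1 / M.radCond ε r))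
      (fun r => n * (n + e) * (r ^ (e + 1) / r ^ 2 * M.radCond ε r)) V p (1 / 2) 1 := by
    convert hVp using 2 with r r
    · rw [show e + 2 - 1 = e + 1 by omega, one_div, one_div, mul_inv]
    · rw [show e + 2 - 1 = e + 1 by omega]
      push_cast
      ring
  have hC : 0 ≤ (2 * D * C₁ + C₂ * (2 ^ (e + 3) * B) + 1) * ρ ^ (e + 2) := by positivity
  -- For `n = 0` the coefficient `c` vanishes, so the flux stays zero: constants are matched
  -- exactly.
  rcases Nat.eq_zero_or_pos n with rfl | hn
  · have : p 1 = 0 := by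
      rw [hbc.flux.2 1 (right_mem_Icc.2 (by norm_num)), hp0]
      simp
    rw [this]
    simp only [CharP.cast_eq_zero, zero_mul, sub_zero, abs_zero]
    positivity
  -- The vanishing of `β` is deduced from a point where `P` does not vanish, so `P = 0` is treated
  -- apart.
  by_cases hP0 : P = 0
  · have hV0 : V 1 = 0 := by 
      rw [hV1, hP0, ← toL2_polyHalf (by omega), map_zero, map_zero, inner_zero_right]
    have hp1' : p 1 = 0 := by rw [hp1, hP0, map_zero, map_zero]
    rw [hV0, hp1']
    simp
  obtain ⟨f, g, α, β, hf⟩ := exists_mode σ hn e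
  have hT2 : 2 ≤ 7 / 8 / τ := by rw [le_div_iff₀ hτ]; linarith
  have hF := (hf.bounds (T := 7 / 8 / τ) (by linarith)).1
  -- Up to degree `N` the homogenized cloak is perfect and `Z = 0`. Above `N` the far-field bound is
  -- combined with `τ^(d+2N) = ρ^d`.
  obtain ⟨Z, hZ, hZτ⟩ : ∃ Z : ℝ, |n * (7 / 8 / τ) ^ e * f (7 / 8 / τ) - g (7 / 8 / τ)|
      ≤ Z * f (7 / 8 / τ) ∧ (7 / 8) ^ n * (τ ^ e * Z) ≤ C₂ * (2 ^ (e + 3) * B) * ρ ^ (e + 2) := by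
    rcases le_or_gt n N with hnN | hnN
    · refine ⟨0, ?_, by rw [mul_zero, mul_zero]; positivity⟩
      rw [hf.outer_coeff hT2, hf.beta_eq_zero hn hnN hσ hP hP0]
      simp
    · refine ⟨_, hf.far_bound hn hB1 (fun t ht => (hB t ht).2.1) hT2, ?_⟩
      have := mul_le_mul_of_nonneg_right (htail n hnN τ hτ h38)
        (by positivity : 0 ≤ 2 ^ (e + 3) * B)
      rw [hτρ] at this
      linarith
  have key := hbc.abs_defect_le hf hτ h38 hp0 hAm hl hlQ (R := 7 / 8) (by norm_num) (by norm_num)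
    (fun r hr => Laminate.radCond_of_le hε hε8 hr) (fun r hr => (hav' r hr).1)
    (fun r hr => (hav' r hr).2) hG hZ
  refine key.trans ?_
  refine (mul_le_mul_of_nonneg_right ?_ (abs_nonneg (V 1))).trans_eq (mul_assoc _ _ _)
  set X := C₀ * (ε * (1 / blowExp τ)) + C₀ * (ε * ((τ ^ e)⁻¹ * (1 / blowExp τ)))
    * ((G + C₀ * (ε * (1 / blowExp τ))) * G)
  have h5 : (7 / 8 : ℝ) ^ n * (2 * (n * (n + e)) ^ 2 * X) ≤ 2 * D * C₁ * ρ ^ (e + 2) := by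
    have h6 := hD n
    calc (7 / 8 : ℝ) ^ n * (2 * (n * (n + e)) ^ 2 * X)
        = 2 * ((((n : ℝ) * (n + e)) ^ 2 * (7 / 8) ^ n) * X) := by ring
      _ ≤ 2 * ((((n : ℝ) * (n + e)) ^ 2 * (7 / 8) ^ n) * (C₁ * ρ ^ (e + 2))) := by gcongr
      _ ≤ 2 * (D * (C₁ * ρ ^ (e + 2))) := by gcongr
      _ = _ := by ring
  have h7 : (7 / 8 : ℝ) ^ n * (2 * (n * (n + e)) ^ 2 * X + τ ^ e * Z)
      ≤ (2 * D * C₁ + C₂ * (2 ^ (e + 3) * B) + 1) * ρ ^ (e + 2) := by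
    have : 0 ≤ ρ ^ (e + 2) := by positivity
    linarith
  -- The admissible weight `1 + n` is not exploited: `(7/8)^n` already made the bound uniform in
  -- `n`.
  exact h7.trans (le_mul_of_one_le_right hC (by linarith [Nat.cast_nonneg (α := ℝ) n]))

end

end Cloak

end

theorem theorem1p1 (d N : ℕ) (hd : d = 2 ∨ d = 3) (σ : Cloak.Coating)
    (hσ : σ.GPTVanishing d N) (K : ℝ) (hK : 0 < K) :
    ∃ C : ℝ, 0 < C ∧
      ∀ ρ : ℝ, 0 < ρ → ρ < 1 / 2 → 2 * Cloak.rhoEC d N ρ ≤ 3 / 4 →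
      ∀ ε : ℝ, 0 < ε → ε ≤ 1 / 8 → ε ≤ K * Cloak.scaleOrder d N σ.kappa ρ →
      ∀ M : Cloak.Laminate, M.Realizes d σ (Cloak.rhoEC d N ρ) ε →
      ∃ Λε Λ₁ : Cloak.HHalf d →L[ℝ] Cloak.HMinusHalf d,
        Cloak.IsDtN (Cloak.shell d) (M.conductivity ε) Λε ∧
        Cloak.IsDtN (Cloak.unitBall d) (fun _ => 1) Λ₁ ∧
        ‖Λε - Λ₁‖ ≤ C * ρ ^ d := by
  -- Writing `d = e + 2` removes truncated subtraction from the exponents `d - 1` and `d - 2`.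
  obtain ⟨e, he, rfl⟩ : ∃ e : ℕ, (e = 0 ∨ e = 1) ∧ d = e + 2 := ⟨d - 2, by omega, by omega⟩
  refine Cloak.exists_norm_sub_le σ e N hσ fun C₀ hC₀ => ?_
  rcases he with rfl | rfl
  · exact Cloak.exists_fluctuation_bound_plane σ N hK hC₀
  · exact Cloak.exists_fluctuation_bound_space σ N hK hC₀
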